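/- **Setting.** Let $\eta(x;\alpha,\beta)=\frac{\alpha+1}{x-1}+\frac{\beta+1}{x+1}$. For a real polynomial $\tau$ with $\tau(\pm1)\neq0$ let $$T_{\rm ng}(\tau;\alpha,\beta)=(x^2-1)\Big(D^2-2\tfrac{\tau'}{\tau}D+\tfrac{\tau''}{\tau}+\eta(x;\alpha,\beta)\big(D-\tfrac{\tau'}{\tau}\big)\Big)+2x\tfrac{\tau'}{\tau},\qquad T_{\rm rg}(\tau;\alpha,\beta)=\tau^{-1}\circ T_{\rm ng}(\tau;\alpha,\beta)\circ\tau .$$ $T_{\rm rg}(\tau;\alpha,\beta)$ is called *exceptional* if $T_{\rm ng}(\tau;\alpha,\beta)$ has eigenpolynomials of all but finitely many degrees. It is of *class G* if $\alpha,\beta,\alpha\pm\beta\notin\mathbb Z$ and of *class B* if $\alpha,\beta,\alpha+\beta\notin\mathbb Z$, $\alpha-\beta\in\mathbb Z$. A *quasi-polynomial eigenfunction* of $T$ is a rational eigenfunction without zeros or poles at $\pm1$; its degree is the degree of the numerator minus that of the denominator, and it is monic if numerator and denominator have the same leading coefficient. A *qr-eigenfunction* is a solution of $T\phi=\lambda\phi$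 ($\lambda\in\mathbb R$) with $w=\phi'/\phi$ rational; it has type 1, 2, 3, 4 if, respectively, $w$ is regular at $\pm1$, has poles at both $\pm1$, has a pole at $1$ but not at $-1$, has a pole at $-1$ but not at $1$. Its degree is the coefficient of $1/x$ in the expansion of $w$ at $\infty$. $\sigma_{\rm q}(T)$ is the set of all qr-eigenvalues. With $\deg\mu_1=0$, $\deg\mu_2=-\alpha-\beta$, $\deg\mu_3=-\alpha$, $\deg\mu_4=-\beta$, the *index set* $I_\imath(T)$ is the set of numbers $\deg\phi-\deg\mu_\imath$, $\phi$ ranging over the qr-eigenfunctions of type $\imath$. For $T=pD^2+qD+r$, the *label* of $\lambda\in\sigma_{\rm q}(T)$ records the types of the rational $w$ with $p(w'+w^2)+qw+r=\lambda$: the labels $\boxed1,\boxed2,\boxed3,\boxed4$ mean that there is exactly one such $w$, of that type, and $\boxed{34}$ means that there are exactly two, one of type 3 and one of type 4 (further labels exist but do not occur below). The *spectral diagram* of $T$ is the map sending each $\lambda\in\sigma_{\rm q}(T)$ to its label. Set $\lambda_1(k)=k(k+\alpha+\beta+1)$, $\lambda_2(k)=(k-\alpha-\beta)(k+1)$, $\lambda_3(k)=(k-\alpha)(k+\beta+1)$,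 $\lambda_4(k)=(k-\beta)(k+\alpha+1)$, and $\sigma_{\rm q}(\alpha,\beta)=\lambda_1(\mathbb Z)\cup\lambda_1(\mathbb Z-\alpha)$. **Parameters.** Let $a,b\in\mathbb R$ and let $K_1,K_3,K_4\subset\mathbb N_0$ be finite, of cardinalities $p_1,p_3,p_4$. Put $\bar K=-K-1$, $\tilde K=K_1\cup(K_3-a)\cup(K_4-b)$, $\tilde K_{34}=(K_3-a)\cup(K_4-b)$, and $$\alpha=a+p_1-p_3+p_4,\qquad \beta=b+p_1+p_3-p_4 .$$ Assume either * (G) $a,b,a\pm b\notin\mathbb Z$; or * (B) $a,b,a+b\notin\mathbb Z$, $a-b\in\mathbb Z$, $K_3\subset \check I_{3+}:=\{n\in\mathbb N_0:n-a+b\ge0\}$, $K_4\subset\check I_{4+}:=\{n\in\mathbb N_0:n+a-b\ge0\}$, and $K_3-a$, $K_4-b$ are disjoint. Let $P_n(x;a,b)=2^{-n}\sum_{k=0}^n\binom{n+a}{n-k}\binom{n+b}{k}(x-1)^k(x+1)^{n-k}$, $\check\pi_n=\frac{2^n n!}{(n+a+b+1)_n}P_n(x;a,b)$, where $(t)_n=t(t+1)\cdots(t+n-1)$,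 and, on $(-1,1)$, $\phi_{1n}=P_n(x;a,b)$, $\phi_{3n}=(1-x)^{-a}P_n(x;-a,b)$, $\phi_{4n}=(1+x)^{-b}P_n(x;a,-b)$. Let $\phi(K_1,K_3,K_4)$ be the list of $\phi_{1k}$ $(k\in K_1)$, $\phi_{3k}$ $(k\in K_3)$, $\phi_{4k}$ $(k\in K_4)$, each in increasing order of $k$, and let $$\tau(x)=(1-x)^{p_3(a+p_1+p_4)}(1+x)^{p_4(b+p_1+p_3)}\operatorname{Wr}[\phi(K_1,K_3,K_4)].$$ Let $I_1=(\mathbb N_0\setminus K_1)-p_1$, $I_2=(\mathbb N_0\cup\bar K_1)+p_1$, and, in case (G), $$I_3=((\mathbb N_0\setminus K_3)\cup\bar K_4)-p_3+p_4,\qquad I_4=((\mathbb N_0\setminus K_4)\cup\bar K_3)+p_3-p_4;$$ in case (B), with $\check I_{3-}=\{n\in\mathbb N_0:2n-a+b<0\}$ and $\check I_{4-}=\{n\in\mathbb N_0:2n+a-b<0\}$, $$\begin{aligned}I_{3-}&=(\check I_{3-}\cup\bar K_4)-p_3+p_4,& I_{3+}&=(\check I_{3+}\setminus(\tilde K_{34}+a))-p_3+p_4,&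 I_3&=I_{3-}\sqcup I_{3+},\\ I_{4-}&=(\check I_{4-}\cup\bar K_3)+p_3-p_4,& I_{4+}&=(\check I_{4+}\setminus(\tilde K_{34}+b))+p_3-p_4,& I_4&=I_{4-}\sqcup I_{4+}.\end{aligned}$$ Write $\sigma_\imath=\lambda_\imath(I_\imath)$ and $\sigma_{\imath\pm}=\lambda_\imath(I_{\imath\pm})$. **Claim.** 1. $\tau$ is a polynomial with $\tau(\pm1)\ne0$ and $$\deg\tau=\sum_{k\in K_1}k+\sum_{k\in K_3}k+\sum_{k\in K_4}k-\binom{p_1}2-\binom{p_3}2-\binom{p_4}2+p_3p_4 .$$ 2. $T=T_{\rm rg}(\tau;\alpha,\beta)$ is an exceptional operator, of class G in case (G) and of class B in case (B), and $\sigma_{\rm q}(T)=\sigma_{\rm q}(\alpha,\beta)$. Its index sets are $I_1,I_2,I_3,I_4$, and $I_1$ is also the set of degrees of its quasi-polynomial eigenfunctions. In case (G), $\sigma_{\rm q}(\alpha,\beta)=\sigma_1\sqcup\sigma_2\sqcup\sigma_3\sqcup\sigma_4$, and the spectral diagram of $T$ maps $(\sigma_1,\sigma_2,\sigma_3,\sigma_4)$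 to $(\boxed1,\boxed2,\boxed3,\boxed4)$. In case (B), $\sigma_{3+}=\sigma_{4+}=:\sigma_{34}$, $\sigma_{\rm q}(\alpha,\beta)=\sigma_1\sqcup\sigma_2\sqcup\sigma_{3-}\sqcup\sigma_{4-}\sqcup\sigma_{34}$, and the spectral diagram of $T$ maps $(\sigma_1,\sigma_2,\sigma_{34},\sigma_{3-},\sigma_{4-})$ to $(\boxed1,\boxed2,\boxed{34},\boxed3,\boxed4)$. 3. For $i\in I_1$, $$\pi_i(x)=\frac{(x-1)^{p_3}(1+x)^{p_4}}{\prod_{k\in\tilde K}(i+p_1-k)}\,\frac{\operatorname{Wr}[\phi(K_1,K_3,K_4),\check\pi_{i+p_1}]}{\operatorname{Wr}[\phi(K_1,K_3,K_4)]}$$ is a monic quasi-polynomial eigenfunction of $T$ of degree $i$ with eigenvalue $\lambda_1(i)$, and every quasi-polynomial eigenfunction of $T$ is a constant multiple of some $\pi_i$. 4. The norms of the $\pi_i$ are, for $i\in I_1$, $$\nu_i=\kappa(i+p_1)\,\nu(i+p_1;a,b),\qquad \kappa(z)=\prod_{k\in\tilde K}\frac{z-k^*}{z-k},\quad k^*=-k-a-b-1,$$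 $$\nu(z;a,b)=2^{1+a+b+2z}\frac{\Gamma(z+1)\Gamma(a+b+z+1)\Gamma(a+z+1)\Gamma(b+z+1)}{\Gamma(a+b+2z+1)\Gamma(a+b+2z+2)} .$$ Here the norms are the unique constants $\nu_i$ such that, for all $i,j\in I_1$, the function $$\Big(\pi_i\pi_j-\frac{\nu_i\delta_{ij}}{\nu(\alpha,\beta)}\Big)(1-x)^\alpha(1+x)^\beta,\qquad \nu(\alpha,\beta)=2^{1+\alpha+\beta}\frac{\Gamma(\alpha+1)\Gamma(\beta+1)}{\Gamma(\alpha+\beta+2)},$$ has an antiderivative of the form $q(x)(1-x)^{\alpha+1}(1+x)^{\beta+1}$ with $q$ rational and regular at $\pm1$. -/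

import Mathlib

open Polynomial Set

noncomputable section

namespace ExJacobi

/-! ### Rational functions and second order differential operators -/

/-- The derivative of a rational function, by the quotient rule. -/
def ratDeriv (f : RatFunc ℝ) : RatFunc ℝ :=
  algebraMap ℝ[X] (RatFunc ℝ) (derivative f.num * f.denom - f.num * derivative f.denom) /
    algebraMap ℝ[X] (RatFunc ℝ) (f.denom ^ 2)

/-- The value of a rational function at a real point (meaningful where `RegularAt f x`). -/
def rval (f : RatFunc ℝ) (x : ℝ) : ℝ := f.eval (RingHom.id ℝ) x

/-- `f` has no pole at `x` (numerator and denominator are coprime). -/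
def RegularAt (f : RatFunc ℝ) (x : ℝ) : Prop := f.denom.eval x ≠ 0

/-- The operator `p D² + q D + r` with rational coefficients. -/
structure DiffOp where
  p : RatFunc ℝ
  q : RatFunc ℝ
  r : RatFunc ℝ

/-- The action of an operator on rational functions. -/
def DiffOp.app (T : DiffOp) (y : RatFunc ℝ) : RatFunc ℝ :=
  T.p * ratDeriv (ratDeriv y) + T.q * ratDeriv y + T.r * y

/-- The gauge transform `f⁻¹ ∘ T ∘ f`, where `f` stands for multiplication by `f`:
`f⁻¹ (p (f y)'' + q (f y)' + r f y)
  = p y'' + (q + 2 p f'/f) y' + (r + q f'/f + p f''/f) y`. -/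
def DiffOp.gauge (T : DiffOp) (f : RatFunc ℝ) : DiffOp where
  p := T.p
  q := T.q + 2 * T.p * (ratDeriv f / f)
  r := T.r + T.q * (ratDeriv f / f) + T.p * (ratDeriv (ratDeriv f) / f)

/-- The degrees of the eigenpolynomials of `T`. -/
def degreeSet (T : DiffOp) : Set ℕ :=
  {n | ∃ (P : ℝ[X]) (lam : ℝ), P ≠ 0 ∧ P.natDegree = n ∧
    T.app (algebraMap ℝ[X] (RatFunc ℝ) P) = RatFunc.C lam * algebraMap ℝ[X] (RatFunc ℝ) P}

/-- `x² - 1`. -/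
def x21 : RatFunc ℝ := RatFunc.X ^ 2 - 1

/-- An exceptional Jacobi operator: leading coefficient `x² - 1`, and eigenpolynomials of all but
finitely many degrees. -/
def IsExceptionalJacobi (T : DiffOp) : Prop :=
  T.p = x21 ∧ (degreeSet T)ᶜ.Finite

/-- `η(x; α, β) = (α+1)/(x-1) + (β+1)/(x+1)`. -/
def eta (α β : ℝ) : RatFunc ℝ :=
  RatFunc.C (α + 1) / (RatFunc.X - 1) + RatFunc.C (β + 1) / (RatFunc.X + 1)

/-- The operator in the natural gauge,
`(x²-1) (D² - 2 (τ'/τ) D + τ''/τ + η (D - τ'/τ)) + 2 x τ'/τ`. -/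
def Tng (τ : ℝ[X]) (α β : ℝ) : DiffOp where
  p := x21
  q := x21 * (eta α β - 2 * (algebraMap ℝ[X] (RatFunc ℝ) (derivative τ) /
        algebraMap ℝ[X] (RatFunc ℝ) τ))
  r := x21 * (algebraMap ℝ[X] (RatFunc ℝ) (derivative (derivative τ)) /
          algebraMap ℝ[X] (RatFunc ℝ) τ
        - eta α β * (algebraMap ℝ[X] (RatFunc ℝ) (derivative τ) /
          algebraMap ℝ[X] (RatFunc ℝ) τ))
      + 2 * RatFunc.X * (algebraMap ℝ[X] (RatFunc ℝ) (derivative τ) /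
          algebraMap ℝ[X] (RatFunc ℝ) τ)

/-- The operator in the rational gauge, `τ⁻¹ ∘ Tng ∘ τ`. -/
def Trg (τ : ℝ[X]) (α β : ℝ) : DiffOp :=
  (Tng τ α β).gauge (algebraMap ℝ[X] (RatFunc ℝ) τ)

/-- `Trg τ α β` is an exceptional Jacobi operator in the rational gauge: `τ` does not vanish at
`±1`, and the natural gauge operator is an exceptional Jacobi operator. -/
def IsExceptionalRG (τ : ℝ[X]) (α β : ℝ) : Prop :=
  τ.eval 1 ≠ 0 ∧ τ.eval (-1) ≠ 0 ∧ IsExceptionalJacobi (Tng τ α β)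

/-! ### Quasi-polynomial and quasi-rational eigenfunctions -/

/-- `π` is a rational eigenfunction of `T` with eigenvalue `lam`, without zeros or poles
at `±1`. -/
def IsQuasiPolyEigenfunction (T : DiffOp) (lam : ℝ) (π : RatFunc ℝ) : Prop :=
  T.app π = RatFunc.C lam * π ∧
    π.num.eval 1 ≠ 0 ∧ π.num.eval (-1) ≠ 0 ∧ RegularAt π 1 ∧ RegularAt π (-1)

/-- The degrees (numerator minus denominator) of the quasi-polynomial eigenfunctions. -/
def quasiPolyIndexSet (T : DiffOp) : Set ℤ :=
  {k | ∃ (π : RatFunc ℝ) (lam : ℝ), IsQuasiPolyEigenfunction T lam π ∧ π.intDegree = k}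

/-- `φ` is (a branch, on some open interval, of) a quasi-rational eigenfunction of `T` with
eigenvalue `lam` and rational log-derivative `w = φ'/φ`. -/
def IsQREigenfunction (T : DiffOp) (lam : ℝ) (w : RatFunc ℝ) (φ : ℝ → ℝ) : Prop :=
  ∃ c d : ℝ, c < d ∧ ∀ x ∈ Ioo c d,
    RegularAt w x ∧ RegularAt T.p x ∧ RegularAt T.q x ∧ RegularAt T.r x ∧
    φ x ≠ 0 ∧ HasDerivAt φ (rval w x * φ x) x ∧
    rval T.p x * deriv (deriv φ) x + rval T.q x * deriv φ x + rval T.r x * φ x = lam * φ x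

/-- The quasi-rational spectrum of `T`. -/
def qrSpectrum (T : DiffOp) : Set ℝ := {lam | ∃ w φ, IsQREigenfunction T lam w φ}

/-- The four asymptotic types. -/
inductive QRType
  | one | two | three | four

/-- The asymptotic type of a rational log-derivative. -/
def HasType : QRType → RatFunc ℝ → Prop
  | .one, w => RegularAt w (-1) ∧ RegularAt w 1
  | .two, w => ¬ RegularAt w (-1) ∧ ¬ RegularAt w 1
  | .three, w => RegularAt w (-1) ∧ ¬ RegularAt w 1
  | .four, w => ¬ RegularAt w (-1) ∧ RegularAt w 1

/-- The coefficient of `1/x` in the expansion of `w` at infinity; this is the degree of a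
quasi-rational function with log-derivative `w`. -/
def resInfinity (w : RatFunc ℝ) : ℝ := (w.num % w.denom).coeff (w.denom.natDegree - 1)

/-- The degree of `μ_ι`, where `μ₁ = 1`, `μ₂ = (1-x)^(-α) (1+x)^(-β)`, `μ₃ = (1-x)^(-α)`,
`μ₄ = (1+x)^(-β)`. -/
def degMu : QRType → ℝ → ℝ → ℝ
  | .one, _, _ => 0
  | .two, α, β => -α - β
  | .three, α, _ => -α
  | .four, _, β => -β

/-- The index set `I_ι` of `Trg τ α β`: the numbers `deg φ - deg μ_ι`, for `φ` a quasi-rational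
eigenfunction of asymptotic type `ι`. -/
def indexSet (ι : QRType) (τ : ℝ[X]) (α β : ℝ) : Set ℝ :=
  {k | ∃ lam w φ, IsQREigenfunction (Trg τ α β) lam w φ ∧ HasType ι w ∧
    k = resInfinity w - degMu ι α β}

/-! ### Spectral diagrams -/

/-- The rational `w` with `p (w' + w²) + q w + r = lam`, i.e. the log-derivatives of the
quasi-rational solutions of `T φ = lam φ`. -/
def ricSet (T : DiffOp) (lam : ℝ) : Set (RatFunc ℝ) :=
  {w | T.p * (ratDeriv w + w ^ 2) + T.q * w + T.r = RatFunc.C lam}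

/-- The eight `λ`-labels. -/
inductive Label
  | circ | times | plus | minus | asterisk | divide | circtimes | bullet

/-- The label of `lam` is determined by the types of the members of `ricSet T lam`. -/
def HasLabel (T : DiffOp) (lam : ℝ) : Label → Prop
  | .circ => ∃ w, ricSet T lam = {w} ∧ HasType .one w
  | .times => ∃ w, ricSet T lam = {w} ∧ HasType .two w
  | .plus => ∃ w, ricSet T lam = {w} ∧ HasType .three w
  | .minus => ∃ w, ricSet T lam = {w} ∧ HasType .four w
  | .asterisk => ∃ w v, ricSet T lam = {w, v} ∧ HasType .two w ∧ HasType .three v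
  | .divide => ∃ w v, ricSet T lam = {w, v} ∧ HasType .three w ∧ HasType .four v
  | .circtimes => ∃ w v, ricSet T lam = {w, v} ∧ HasType .one w ∧ HasType .two v
  | .bullet => (ricSet T lam).Infinite ∧ (∃ w ∈ ricSet T lam, HasType .two w) ∧
      (∃ w ∈ ricSet T lam, HasType .three w) ∧ (∃ w ∈ ricSet T lam, HasType .four w)

/-- The spectral diagram of `T`, as the graph of the map assigning to each quasi-rational
eigenvalue its label. -/
def spectralDiagram (T : DiffOp) : Set (ℝ × Label) :=
  {z | z.1 ∈ qrSpectrum T ∧ HasLabel T z.1 z.2}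

/-- The functions `λ_ι(k; α, β)`. -/
def lamFn : QRType → ℝ → ℝ → ℝ → ℝ
  | .one, k, α, β => k * (k + α + β + 1)
  | .two, k, α, β => (k - α - β) * (k + 1)
  | .three, k, α, β => (k - α) * (k + β + 1)
  | .four, k, α, β => (k - β) * (k + α + 1)

/-- `λ_ι(I; α, β)` for a set `I` of integers. -/
def lamImage (ι : QRType) (I : Set ℤ) (α β : ℝ) : Set ℝ :=
  (fun k : ℤ => lamFn ι (k : ℝ) α β) '' I

/-- `λ₁(ℤ; α, β) ∪ λ₁(ℤ - α; α, β)`. -/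
def sigmaQ (α β : ℝ) : Set ℝ :=
  range (fun k : ℤ => lamFn .one (k : ℝ) α β) ∪ range (fun k : ℤ => lamFn .one ((k : ℝ) - α) α β)

/-! ### Classes G and B -/

/-- `t` is an integer. -/
def IsInt (t : ℝ) : Prop := ∃ m : ℤ, (m : ℝ) = t

def ClassG (a b : ℝ) : Prop := ¬ IsInt a ∧ ¬ IsInt b ∧ ¬ IsInt (a + b) ∧ ¬ IsInt (a - b)

def ClassB (a b : ℝ) : Prop := ¬ IsInt a ∧ ¬ IsInt b ∧ ¬ IsInt (a + b) ∧ IsInt (a - b)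

/-- The set of nonnegative integers. -/
def natZ : Set ℤ := {n | 0 ≤ n}

/-- `K` as a set of integers. -/
def castZ (K : Finset ℕ) : Set ℤ := (fun k : ℕ => (k : ℤ)) '' (K : Set ℕ)

/-- `-K - 1`. -/
def bar (K : Finset ℕ) : Set ℤ := (fun k : ℕ => -(k : ℤ) - 1) '' (K : Set ℕ)

/-- The translate `I + s`. -/
def shift (I : Set ℤ) (s : ℤ) : Set ℤ := (fun n => n + s) '' I

/-- The index sets of class G. -/
def indexG (K1 K3 K4 : Finset ℕ) : QRType → Set ℤ
  | .one => shift (natZ \ castZ K1) (-(K1.card : ℤ))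
  | .two => shift (natZ ∪ bar K1) K1.card
  | .three => shift ((natZ \ castZ K3) ∪ bar K4) (-(K3.card : ℤ) + K4.card)
  | .four => shift ((natZ \ castZ K4) ∪ bar K3) ((K3.card : ℤ) - K4.card)

/-- The diagram sending `σ₁, σ₂, σ₃, σ₄` to the first four labels. -/
def diagramG (K1 K3 K4 : Finset ℕ) (α β : ℝ) : Set (ℝ × Label) :=
  lamImage .one (indexG K1 K3 K4 .one) α β ×ˢ {Label.circ} ∪
  lamImage .two (indexG K1 K3 K4 .two) α β ×ˢ {Label.times} ∪
  lamImage .three (indexG K1 K3 K4 .three) α β ×ˢ {Label.plus} ∪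
  lamImage .four (indexG K1 K3 K4 .four) α β ×ˢ {Label.minus}

/-- `{n ∈ ℕ₀ : 2 n - a + b < 0}`; swapping `a, b` gives its type 4 analogue. -/
def classicalMinus (a b : ℝ) : Set ℤ := {n | 0 ≤ n ∧ 2 * (n : ℝ) - a + b < 0}

/-- `{n ∈ ℕ₀ : n - a + b ≥ 0}`; swapping `a, b` gives its type 4 analogue. -/
def classicalPlus (a b : ℝ) : Set ℤ := {n | 0 ≤ n ∧ 0 ≤ (n : ℝ) - a + b}

/-- `K - t`, as a set of reals. -/
def subR (K : Finset ℕ) (t : ℝ) : Set ℝ := (fun k : ℕ => (k : ℝ) - t) '' (K : Set ℕ)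

/-- `(K₃ - a) ∪ (K₄ - b)`. -/
def K34 (K3 K4 : Finset ℕ) (a b : ℝ) : Set ℝ := subR K3 a ∪ subR K4 b

/-- Class B parameters. -/
def ParamsB (K3 K4 : Finset ℕ) (a b : ℝ) : Prop :=
  ClassB a b ∧ castZ K3 ⊆ classicalPlus a b ∧ castZ K4 ⊆ classicalPlus b a ∧
    Disjoint (subR K3 a) (subR K4 b)

def indexB3minus (K3 K4 : Finset ℕ) (a b : ℝ) : Set ℤ :=
  shift (classicalMinus a b ∪ bar K4) (-(K3.card : ℤ) + K4.card)

def indexB3plus (K3 K4 : Finset ℕ) (a b : ℝ) : Set ℤ :=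
  shift (classicalPlus a b \ {n | (n : ℝ) - a ∈ K34 K3 K4 a b}) (-(K3.card : ℤ) + K4.card)

def indexB4minus (K3 K4 : Finset ℕ) (a b : ℝ) : Set ℤ :=
  shift (classicalMinus b a ∪ bar K3) ((K3.card : ℤ) - K4.card)

def indexB4plus (K3 K4 : Finset ℕ) (a b : ℝ) : Set ℤ :=
  shift (classicalPlus b a \ {n | (n : ℝ) - b ∈ K34 K3 K4 a b}) ((K3.card : ℤ) - K4.card)

/-- The index sets of class B. -/
def indexB (K1 K3 K4 : Finset ℕ) (a b : ℝ) : QRType → Set ℤ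
  | .one => shift (natZ \ castZ K1) (-(K1.card : ℤ))
  | .two => shift (natZ ∪ bar K1) K1.card
  | .three => indexB3minus K3 K4 a b ∪ indexB3plus K3 K4 a b
  | .four => indexB4minus K3 K4 a b ∪ indexB4plus K3 K4 a b

/-- The diagram sending `σ₁, σ₂, σ₃₄, σ₃₋, σ₄₋` to their labels (with `σ₃₄ = σ₃₊ = σ₄₊`). -/
def diagramB (K1 K3 K4 : Finset ℕ) (a b α β : ℝ) : Set (ℝ × Label) :=
  lamImage .one (indexB K1 K3 K4 a b .one) α β ×ˢ {Label.circ} ∪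
  lamImage .two (indexB K1 K3 K4 a b .two) α β ×ˢ {Label.times} ∪
  lamImage .three (indexB3plus K3 K4 a b) α β ×ˢ {Label.divide} ∪
  lamImage .three (indexB3minus K3 K4 a b) α β ×ˢ {Label.plus} ∪
  lamImage .four (indexB4minus K3 K4 a b) α β ×ˢ {Label.minus}

/-! ### Classical Jacobi polynomials, Wronskians -/

/-- The Jacobi polynomial
`P_n(x; a, b) = 2⁻ⁿ ∑ₖ binom(n+a, n-k) binom(n+b, k) (x-1)ᵏ (x+1)ⁿ⁻ᵏ`. -/
def jacobiP (n : ℕ) (a b : ℝ) : ℝ[X] :=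
  C ((1 / 2 : ℝ) ^ n) * ∑ k ∈ Finset.range (n + 1),
    C (Ring.choose ((n : ℝ) + a) (n - k) * Ring.choose ((n : ℝ) + b) k) *
      (X - 1) ^ k * (X + 1) ^ (n - k)

/-- The monic Jacobi polynomial `π_n(x; a, b) = 2ⁿ n! / (n+a+b+1)ₙ · P_n(x; a, b)`. -/
def jacobiMonic (n : ℕ) (a b : ℝ) : ℝ[X] :=
  C (2 ^ n * (n.factorial : ℝ) / (ascPochhammer ℝ n).eval ((n : ℝ) + a + b + 1)) * jacobiP n a b

/-- The Wronskian determinant of a list of functions. -/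
def wronskian (L : List (ℝ → ℝ)) (x : ℝ) : ℝ :=
  Matrix.det (Matrix.of fun i j : Fin L.length => iteratedDeriv i (L.get j) x)

def phi1 (a b : ℝ) (n : ℕ) (x : ℝ) : ℝ := (jacobiP n a b).eval x

def phi3 (a b : ℝ) (n : ℕ) (x : ℝ) : ℝ := (1 - x) ^ (-a) * (jacobiP n (-a) b).eval x

def phi4 (a b : ℝ) (n : ℕ) (x : ℝ) : ℝ := (1 + x) ^ (-b) * (jacobiP n a (-b)).eval x

/-- The concatenated list `φ₁(K₁), φ₃(K₃), φ₄(K₄)`, each in increasing order of the index. -/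
def phiList (K1 K3 K4 : Finset ℕ) (a b : ℝ) : List (ℝ → ℝ) :=
  (K1.sort (· ≤ ·)).map (phi1 a b) ++ (K3.sort (· ≤ ·)).map (phi3 a b) ++
    (K4.sort (· ≤ ·)).map (phi4 a b)

open Classical in
/-- `K₁ ∪ (K₃ - a) ∪ (K₄ - b)`. -/
def Ktilde (K1 K3 K4 : Finset ℕ) (a b : ℝ) : Finset ℝ :=
  K1.image (fun k : ℕ => (k : ℝ)) ∪ K3.image (fun k : ℕ => (k : ℝ) - a) ∪
    K4.image (fun k : ℕ => (k : ℝ) - b)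

/-- `(1-x)^(p₃(a+p₁+p₄)) (1+x)^(p₄(b+p₁+p₃)) Wr[φ(K₁,K₃,K₄)]`, for `-1 < x < 1`. -/
def tauFun (K1 K3 K4 : Finset ℕ) (a b x : ℝ) : ℝ :=
  (1 - x) ^ ((K3.card : ℝ) * (a + K1.card + K4.card)) *
    (1 + x) ^ ((K4.card : ℝ) * (b + K1.card + K3.card)) * wronskian (phiList K1 K3 K4 a b) x

/-- The Wronskian ratio for the quasi-polynomial of degree `i`, where `i + p₁ ≥ 0`. -/
def piFun (K1 K3 K4 : Finset ℕ) (a b : ℝ) (i : ℤ) (x : ℝ) : ℝ :=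
  (x - 1) ^ K3.card * (1 + x) ^ K4.card /
      (∏ k ∈ Ktilde K1 K3 K4 a b, ((i : ℝ) + K1.card - k)) *
    (wronskian (phiList K1 K3 K4 a b ++
        [fun y => (jacobiMonic (i + K1.card).toNat a b).eval y]) x /
      wronskian (phiList K1 K3 K4 a b) x)

/-! ### Norms -/

/-- The classical norms `ν(z; a, b)`. -/
def nu (z a b : ℝ) : ℝ :=
  (2 : ℝ) ^ (1 + a + b + 2 * z) *
    (Real.Gamma (z + 1) * Real.Gamma (a + b + z + 1) * Real.Gamma (a + z + 1) *
      Real.Gamma (b + z + 1)) /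
    (Real.Gamma (a + b + 2 * z + 1) * Real.Gamma (a + b + 2 * z + 2))

/-- `κ(z) = ∏ (z - k*)/(z - k)` over `k ∈ K̃`, with `k* = -k - a - b - 1`. -/
def kappa (K1 K3 K4 : Finset ℕ) (a b z : ℝ) : ℝ :=
  ∏ k ∈ Ktilde K1 K3 K4 a b, (z - (-k - a - b - 1)) / (z - k)

/-- `ν(α, β) = 2^(1+α+β) Γ(α+1) Γ(β+1) / Γ(α+β+2)`. -/
def nuBase (α β : ℝ) : ℝ :=
  (2 : ℝ) ^ (1 + α + β) * (Real.Gamma (α + 1) * Real.Gamma (β + 1)) / Real.Gamma (α + β + 2)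

open Classical in
/-- The numbers `ν i` are the (formal) norms of the family `π i`, `i ∈ I`: for all `i, j ∈ I` the
expression `(π i π j - ν i δ_ij / ν(α, β)) (1-x)^α (1+x)^β` has an antiderivative of the form
`q(x) (1-x)^(α+1) (1+x)^(β+1)` with `q` rational and regular at `±1`. -/
def AreFormalNorms (α β : ℝ) (I : Set ℤ) (π : ℤ → RatFunc ℝ) (ν : ℤ → ℝ) : Prop :=
  ∀ i ∈ I, ∀ j ∈ I, ∃ q : RatFunc ℝ, RegularAt q 1 ∧ RegularAt q (-1) ∧
    ∀ x ∈ Ioo (-1 : ℝ) 1, RegularAt q x → RegularAt (π i) x → RegularAt (π j) x →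
      HasDerivAt (fun y => rval q y * ((1 - y) ^ (α + 1) * (1 + y) ^ (β + 1)))
        ((rval (π i) x * rval (π j) x - (if i = j then ν i else 0) / nuBase α β) *
          ((1 - x) ^ α * (1 + x) ^ β)) x

end ExJacobi

end

open ExJacobi

noncomputable section

namespace ExJacobi

/-! ### The derivation on rational functions -/

/-! The statement is proved by algebra in the differential field ℝ(x). A quasi-rational
eigenfunction is encoded by its log-derivative `w`, and solving `T φ = λ φ` becomes finding the
rational solutions `ricSet T λ` of a Riccati equation (`exists_qr_iff` is the bridge to actual
functions). Up to a gauge by `(x-1)^p₃ (x+1)^p₄` and an additive constant, `Trg τ α β` is the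
iterated Darboux transform of the classical Jacobi operator with the seeds indexed by `K₁, K₃, K₄`
(`mem_ricSet_Trg_iff`). So all claims are proved for the classical operator and transported along
the chain.

For the classical operator, the exponents of a solution at `±1` are roots of the indicial equations.
Once they are removed, the remaining poles are simple with residue `1`, so what is left is `P'/P`
with `P` a Jacobi polynomial (`classOp_classify`). Because `a` and `b` are not integers, eigenvalue
and type determine the solution.

One Darboux step with seed `w₁` at `λ₁` sends `w` to `w + (w-w₁)'/(w-w₁)`. With `w₁* = -q/p - w₁`,
the identity `p (w-w₁)(ŵ-w₁*) = λ-λ₁` (`dual_relation`) makes this a bijection of solution sets for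
`λ ≠ λ₁`. At `λ₁` only `w₁*` survives, unless the square of the seed has a quasi-rational
antiderivative against the weight (`ricSet_darboux_self`). That exception is excluded for Jacobi
seeds by `IsEig.not_exact_sq`, and the exclusion persists through later steps (`NotExact.darboux`).
Hence a seed of index `k` is replaced by a function of the dual type with index `-k-1`, which
explains the sets `K̄` in the index sets. The effect on exponents at `±1` and on degrees is
`JacOp.asym_step`; the finite points and infinity are handled together through `IsPlace`.

Wronskians enter through Crum's reduction (`twr_cons`, `twr_append`): the Wronskian of the seeds is
the product of the successively transformed seeds, and the ratio defining `π_i` is an iterated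
Darboux transform. The log-derivative of `τ` is therefore a sum of known log-derivatives. Its
residues at `±1` vanish, so `τ` is a polynomial that is nonzero there, and its residue at infinity
is the degree (`exists_tau`).

All four eigenvalue functions are one quadratic polynomial evaluated at the degree of the
eigenfunction. Coincidences of eigenvalues thus reduce to linear conditions, and these give the
partitions and labels in classes G and B.

For the norms, integration by parts in each step multiplies the formal norm by a difference of
eigenvalues (`trans_spec`). The product of these differences, divided by the square of the
normalizing constant, is `κ` up to sign. The classical norms follow by induction, since
differentiation lowers the degree and raises both parameters by one (`IsEig.hasNorm`). -/

/-- A polynomial as a rational function. -/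
abbrev toRat (P : ℝ[X]) : RatFunc ℝ := algebraMap ℝ[X] (RatFunc ℝ) P

theorem toRat_ne_zero {P : ℝ[X]} (h : P ≠ 0) : toRat P ≠ 0 := RatFunc.algebraMap_ne_zero h

theorem toRat_mul (P Q : ℝ[X]) : toRat (P * Q) = toRat P * toRat Q := map_mul _ _ _

theorem toRat_pow (P : ℝ[X]) (n : ℕ) : toRat (P ^ n) = toRat P ^ n := map_pow _ _ _

theorem toRat_X : toRat X = RatFunc.X := RatFunc.algebraMap_X

theorem toRat_C (c : ℝ) : toRat (C c) = RatFunc.C c := RatFunc.algebraMap_C c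

theorem toRat_inj {P Q : ℝ[X]} (h : toRat P = toRat Q) : P = Q :=
  RatFunc.algebraMap_injective ℝ h

theorem exists_toRat_div (f : RatFunc ℝ) : ∃ N M : ℝ[X], M ≠ 0 ∧ f = toRat N / toRat M :=
  ⟨f.num, f.denom, f.denom_ne_zero, (RatFunc.num_div_denom f).symm⟩

theorem toRat_div_eq_iff {N M N' M' : ℝ[X]} (hM : M ≠ 0) (hM' : M' ≠ 0) :
    toRat N / toRat M = toRat N' / toRat M' ↔ N * M' = N' * M := by
  rw [div_eq_div_iff (toRat_ne_zero hM) (toRat_ne_zero hM'), ← map_mul, ← map_mul]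
  exact (RatFunc.algebraMap_injective ℝ).eq_iff

/-- `ratDeriv` is defined through the reduced fraction; differentiating the cross relation `N d = n
M` shows that every representation gives the same result. The sum and product rules are then
computed with unreduced fractions. -/
theorem ratDeriv_div_toRat (N M : ℝ[X]) (hM : M ≠ 0) :
    ratDeriv (toRat N / toRat M) =
      toRat (derivative N * M - N * derivative M) / toRat (M ^ 2) := by
  have hd := (toRat N / toRat M).denom_ne_zero
  set n := (toRat N / toRat M).num with hn
  set d := (toRat N / toRat M).denom with hdd
  have key : N * d = n * M := by
    rw [← toRat_div_eq_iff hM hd]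
    exact (RatFunc.num_div_denom _).symm
  have key' := congrArg derivative key
  simp only [derivative_mul] at key'
  unfold ratDeriv
  rw [← hn, ← hdd]
  refine (toRat_div_eq_iff (pow_ne_zero 2 hd) (pow_ne_zero 2 hM)).2 ?_
  -- The extra factor `d` allows the cross relations to be substituted without dividing; it is
  -- cancelled at the end.
  have h2 : (derivative n * d - n * derivative d) * M ^ 2 * d
      = (derivative N * M - N * derivative M) * d ^ 2 * d := by
    have e1 : derivative n * M = derivative N * d + N * derivative d - n * derivative M := by
      rw [key']; ring
    calc _ = (derivative n * M) * d * d * M - (n * M) * M * derivative d * d := by ring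
      _ = (derivative N * d + N * derivative d - n * derivative M) * d * d * M
          - (N * d) * M * derivative d * d := by rw [e1, key]
      _ = derivative N * d ^ 3 * M - (n * M) * d ^ 2 * derivative M := by ring
      _ = derivative N * d ^ 3 * M - (N * d) * d ^ 2 * derivative M := by rw [key]
      _ = _ := by ring
  exact mul_right_cancel₀ hd h2

theorem ratDeriv_toRat (P : ℝ[X]) : ratDeriv (toRat P) = toRat (derivative P) := by
  have := ratDeriv_div_toRat P 1 one_ne_zero
  simpa using this

theorem ratDeriv_add (f g : RatFunc ℝ) : ratDeriv (f + g) = ratDeriv f + ratDeriv g := by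
  obtain ⟨N, M, hM, rfl⟩ := exists_toRat_div f
  obtain ⟨N', M', hM', rfl⟩ := exists_toRat_div g
  have h1 := toRat_ne_zero hM
  have h2 := toRat_ne_zero hM'
  rw [div_add_div _ _ h1 h2, ← map_mul, ← map_mul, ← map_mul, ← map_add,
    ratDeriv_div_toRat _ _ (mul_ne_zero hM hM'), ratDeriv_div_toRat _ _ hM,
    ratDeriv_div_toRat _ _ hM']
  simp only [derivative_mul, map_add, map_mul, map_sub, map_pow]
  field_simp
  ring

theorem ratDeriv_mul (f g : RatFunc ℝ) :
    ratDeriv (f * g) = ratDeriv f * g + f * ratDeriv g := by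
  obtain ⟨N, M, hM, rfl⟩ := exists_toRat_div f
  obtain ⟨N', M', hM', rfl⟩ := exists_toRat_div g
  have h1 := toRat_ne_zero hM
  have h2 := toRat_ne_zero hM'
  rw [div_mul_div_comm, ← map_mul, ← map_mul,
    ratDeriv_div_toRat _ _ (mul_ne_zero hM hM'), ratDeriv_div_toRat _ _ hM,
    ratDeriv_div_toRat _ _ hM']
  simp only [derivative_mul, map_add, map_mul, map_sub, map_pow]
  field_simp
  ring

@[simp] theorem ratDeriv_C (c : ℝ) : ratDeriv (RatFunc.C c) = 0 := by
  rw [← RatFunc.algebraMap_C, ratDeriv_toRat]; simp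

@[simp] theorem ratDeriv_X : ratDeriv RatFunc.X = 1 := by
  rw [← RatFunc.algebraMap_X, ratDeriv_toRat]; simp

@[simp] theorem ratDeriv_one : ratDeriv 1 = 0 := by
  have := ratDeriv_C 1; rwa [map_one] at this

@[simp] theorem ratDeriv_zero : ratDeriv 0 = 0 := by
  have := ratDeriv_C 0; rwa [map_zero] at this

/-- Differentiation of rational functions as a derivation. -/
def ratD : Derivation ℝ (RatFunc ℝ) (RatFunc ℝ) :=
  Derivation.mk'
    { toFun := ratDeriv
      map_add' := ratDeriv_add
      map_smul' := fun c f => by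
        rw [RatFunc.smul_eq_C_mul, ratDeriv_mul, ratDeriv_C, RingHom.id_apply,
          RatFunc.smul_eq_C_mul]; ring }
    (fun f g => by
      change ratDeriv (f * g) = _
      rw [ratDeriv_mul]; simp only [smul_eq_mul, LinearMap.coe_mk, AddHom.coe_mk]; ring)

theorem ratD_apply (f : RatFunc ℝ) : ratD f = ratDeriv f := rfl

theorem ratDeriv_neg (f : RatFunc ℝ) : ratDeriv (-f) = -ratDeriv f := map_neg ratD f

theorem ratDeriv_sub (f g : RatFunc ℝ) : ratDeriv (f - g) = ratDeriv f - ratDeriv g :=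
  map_sub ratD f g

theorem ratDeriv_pow (f : RatFunc ℝ) (n : ℕ) :
    ratDeriv (f ^ n) = n * f ^ (n - 1) * ratDeriv f := by
  have := ratD.leibniz_pow f n
  simp only [ratD_apply, smul_eq_mul, nsmul_eq_mul] at this
  rw [this]; ring

theorem ratDeriv_inv (f : RatFunc ℝ) : ratDeriv f⁻¹ = -ratDeriv f / f ^ 2 := by
  have := ratD.leibniz_inv f
  simp only [ratD_apply, smul_eq_mul] at this
  rw [this]; field_simp

theorem ratDeriv_div (f g : RatFunc ℝ) (hg : g ≠ 0) :
    ratDeriv (f / g) = (ratDeriv f * g - f * ratDeriv g) / g ^ 2 := by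
  rw [div_eq_mul_inv, ratDeriv_mul, ratDeriv_inv]; field_simp; ring

theorem ratDeriv_zpow (f : RatFunc ℝ) (hf : f ≠ 0) (n : ℤ) :
    ratDeriv (f ^ n) = n * f ^ n * (ratDeriv f / f) := by
  have h : ∀ m : ℕ, ratDeriv (f ^ m) = m * f ^ m * (ratDeriv f / f) := by
    intro m
    rw [ratDeriv_pow]
    rcases m with _ | m
    · simp
    · rw [Nat.add_sub_cancel, pow_succ]; field_simp
  rcases n with m | m
  · simpa using h m
  · rw [zpow_negSucc, ratDeriv_inv, h]
    push_cast
    field_simp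

theorem ratDeriv_C_mul (c : ℝ) (f : RatFunc ℝ) :
    ratDeriv (RatFunc.C c * f) = RatFunc.C c * ratDeriv f := by
  rw [ratDeriv_mul, ratDeriv_C]; ring

@[simp] theorem ratDeriv_natCast (n : ℕ) : ratDeriv (n : RatFunc ℝ) = 0 := by
  have := ratDeriv_C (n : ℝ); rwa [map_natCast] at this

/-! ### Values at finite points -/

theorem C_ne_zero {c : ℝ} (h : c ≠ 0) : RatFunc.C c ≠ 0 := by
  rw [← map_zero RatFunc.C]; exact fun h' => h (RatFunc.C_injective h')

theorem X_sub_C_ne_zero (c : ℝ) : (RatFunc.X - RatFunc.C c : RatFunc ℝ) ≠ 0 := by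
  rw [← RatFunc.algebraMap_X, ← RatFunc.algebraMap_C, ← map_sub]
  exact toRat_ne_zero (Polynomial.X_sub_C_ne_zero c)

/-- `f` is regular at `c`, with value `v`. -/
def ValAt (c v : ℝ) (f : RatFunc ℝ) : Prop := RegularAt f c ∧ rval f c = v

theorem rval_eq (f : RatFunc ℝ) (x : ℝ) : rval f x = f.num.eval x / f.denom.eval x := by
  simp [rval, RatFunc.eval, eval₂_eq_eval_map]

/-- Evaluation may be read off any fraction whose denominator survives at `c`, since the reduced
denominator divides it. -/
theorem valAt_iff {c v : ℝ} {f : RatFunc ℝ} :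
    ValAt c v f ↔ ∃ N M : ℝ[X], M.eval c ≠ 0 ∧ f = toRat N / toRat M ∧
      v = N.eval c / M.eval c := by
  constructor
  · rintro ⟨h1, rfl⟩
    exact ⟨f.num, f.denom, h1, (RatFunc.num_div_denom f).symm, rval_eq f c⟩
  · rintro ⟨N, M, hM, hf, rfl⟩
    have hM0 : M ≠ 0 := by rintro rfl; simp at hM
    have key : f.num * M = N * f.denom := by
      rw [← toRat_div_eq_iff f.denom_ne_zero hM0, ← hf]; exact RatFunc.num_div_denom f
    have hd : RegularAt f c := by
      intro h0
      have : f.denom ∣ M := (RatFunc.denom_dvd hM0).2 ⟨N, hf⟩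
      obtain ⟨k, hk⟩ := this
      rw [hk, eval_mul, h0, zero_mul] at hM
      exact hM rfl
    refine ⟨hd, ?_⟩
    have := congrArg (eval c) key
    simp only [eval_mul] at this
    rw [rval_eq, div_eq_div_iff hd hM, this]

theorem valAt_div {c : ℝ} {N M : ℝ[X]} (h : M.eval c ≠ 0) :
    ValAt c (N.eval c / M.eval c) (toRat N / toRat M) := valAt_iff.2 ⟨N, M, h, rfl, rfl⟩

theorem valAt_toRat (c : ℝ) (P : ℝ[X]) : ValAt c (P.eval c) (toRat P) :=
  valAt_iff.2 ⟨P, 1, by simp, by simp, by simp⟩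

theorem valAt_C (c a : ℝ) : ValAt c a (RatFunc.C a) := by
  simpa [toRat] using valAt_toRat c (Polynomial.C a)

theorem valAt_X (c : ℝ) : ValAt c c RatFunc.X := by
  simpa [toRat] using valAt_toRat c Polynomial.X

theorem ValAt.add {c u v : ℝ} {f g : RatFunc ℝ} (hf : ValAt c u f) (hg : ValAt c v g) :
    ValAt c (u + v) (f + g) := by
  obtain ⟨N, M, hM, rfl, rfl⟩ := valAt_iff.1 hf
  obtain ⟨N', M', hM', rfl, rfl⟩ := valAt_iff.1 hg
  have h1 : toRat M ≠ 0 := toRat_ne_zero (by rintro rfl; simp at hM)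
  have h2 : toRat M' ≠ 0 := toRat_ne_zero (by rintro rfl; simp at hM')
  refine valAt_iff.2 ⟨N * M' + M * N', M * M', by simp [hM, hM'], ?_, ?_⟩
  · rw [div_add_div _ _ h1 h2]; simp
  · rw [div_add_div _ _ hM hM']; simp

theorem ValAt.mul {c u v : ℝ} {f g : RatFunc ℝ} (hf : ValAt c u f) (hg : ValAt c v g) :
    ValAt c (u * v) (f * g) := by
  obtain ⟨N, M, hM, rfl, rfl⟩ := valAt_iff.1 hf
  obtain ⟨N', M', hM', rfl, rfl⟩ := valAt_iff.1 hg
  refine valAt_iff.2 ⟨N * N', M * M', by simp [hM, hM'], ?_, ?_⟩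
  · rw [div_mul_div_comm]; simp
  · rw [div_mul_div_comm]; simp

theorem ValAt.inv {c v : ℝ} {f : RatFunc ℝ} (hf : ValAt c v f) (hv : v ≠ 0) :
    ValAt c v⁻¹ f⁻¹ := by
  obtain ⟨N, M, hM, rfl, rfl⟩ := valAt_iff.1 hf
  refine valAt_iff.2 ⟨M, N, fun h => hv (by rw [h, zero_div]), by rw [inv_div], by rw [inv_div]⟩

theorem ValAt.unique {c u v : ℝ} {f : RatFunc ℝ} (hf : ValAt c u f) (hg : ValAt c v f) :
    u = v := hf.2.symm.trans hg.2

/-- The link between the formal derivation and real analysis: near `c` the function `rval f` is an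
honest quotient of polynomials. -/
theorem valAt_ratDeriv {c v : ℝ} {f : RatFunc ℝ} (hf : ValAt c v f) :
    ∃ v', ValAt c v' (ratDeriv f) ∧ HasDerivAt (rval f) v' c := by
  obtain ⟨N, M, hM, rfl, rfl⟩ := valAt_iff.1 hf
  have hM0 : M ≠ 0 := by rintro rfl; simp at hM
  refine ⟨_, valAt_iff.2 ⟨_, M ^ 2, by simpa using hM, ratDeriv_div_toRat N M hM0, rfl⟩, ?_⟩
  have h1 : HasDerivAt (fun x => N.eval x / M.eval x)
      ((derivative N * M - N * derivative M).eval c / (M ^ 2).eval c) c := by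
    have := (N.hasDerivAt c).fun_div (M.hasDerivAt c) hM
    simp only [eval_sub, eval_mul, eval_pow]
    exact this
  refine h1.congr_of_eventuallyEq ?_
  filter_upwards [M.continuous.continuousAt.eventually_ne hM] with x hx
  exact (valAt_div hx).2

theorem RegularAt.valAt {c : ℝ} {f : RatFunc ℝ} (hf : RegularAt f c) : ValAt c (rval f c) f :=
  ⟨hf, rfl⟩

theorem RegularAt.ratDeriv {c : ℝ} {f : RatFunc ℝ} (hf : RegularAt f c) :
    RegularAt (ratDeriv f) c := by
  obtain ⟨v, h, -⟩ := valAt_ratDeriv hf.valAt; exact h.1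

theorem RegularAt.hasDerivAt {c : ℝ} {f : RatFunc ℝ} (hf : RegularAt f c) :
    HasDerivAt (rval f) (rval (ExJacobi.ratDeriv f) c) c := by
  obtain ⟨v, h, h'⟩ := valAt_ratDeriv hf.valAt; rwa [h.2]

/-! ### The value at infinity -/

/-- `f` is regular at infinity, with value `v`. -/
def ValInf (v : ℝ) (f : RatFunc ℝ) : Prop :=
  ∃ N M : ℝ[X], M ≠ 0 ∧ N.natDegree ≤ M.natDegree ∧ f = toRat N / toRat M ∧
    v = N.coeff M.natDegree / M.leadingCoeff

theorem ValInf.add {u v : ℝ} {f g : RatFunc ℝ} (hf : ValInf u f) (hg : ValInf v g) :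
    ValInf (u + v) (f + g) := by
  obtain ⟨N, M, hM, hN, rfl, rfl⟩ := hf
  obtain ⟨N', M', hM', hN', rfl, rfl⟩ := hg
  have l1 : M.leadingCoeff ≠ 0 := leadingCoeff_ne_zero.2 hM
  have l2 : M'.leadingCoeff ≠ 0 := leadingCoeff_ne_zero.2 hM'
  refine ⟨N * M' + M * N', M * M', mul_ne_zero hM hM', ?_, ?_, ?_⟩
  · rw [natDegree_mul hM hM']
    refine natDegree_add_le_of_degree_le ?_ ?_
    · exact natDegree_mul_le.trans (by omega)
    · exact natDegree_mul_le.trans (by omega)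
  · rw [div_add_div _ _ (toRat_ne_zero hM) (toRat_ne_zero hM')]; simp
  · rw [natDegree_mul hM hM', coeff_add, coeff_mul_add_eq_of_natDegree_le hN le_rfl,
      coeff_mul_add_eq_of_natDegree_le le_rfl hN', leadingCoeff_mul, div_add_div _ _ l1 l2]
    simp

theorem ValInf.mul {u v : ℝ} {f g : RatFunc ℝ} (hf : ValInf u f) (hg : ValInf v g) :
    ValInf (u * v) (f * g) := by
  obtain ⟨N, M, hM, hN, rfl, rfl⟩ := hf
  obtain ⟨N', M', hM', hN', rfl, rfl⟩ := hg
  refine ⟨N * N', M * M', mul_ne_zero hM hM', ?_, ?_, ?_⟩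
  · rw [natDegree_mul hM hM']
    exact natDegree_mul_le.trans (by omega)
  · rw [div_mul_div_comm]; simp
  · rw [natDegree_mul hM hM', coeff_mul_add_eq_of_natDegree_le hN hN', leadingCoeff_mul,
      div_mul_div_comm]

theorem valInf_C (a : ℝ) : ValInf a (RatFunc.C a) :=
  ⟨Polynomial.C a, 1, one_ne_zero, by simp, by simp [toRat], by simp⟩

theorem ValInf.natDegree_eq {v : ℝ} (hv : v ≠ 0) {N M : ℝ[X]} (hN : N.natDegree ≤ M.natDegree)
    (h : v = N.coeff M.natDegree / M.leadingCoeff) : N.natDegree = M.natDegree := by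
  refine le_antisymm hN (le_natDegree_of_ne_zero fun h0 => hv ?_)
  rw [h, h0, zero_div]

theorem ValInf.inv {v : ℝ} {f : RatFunc ℝ} (hf : ValInf v f) (hv : v ≠ 0) :
    ValInf v⁻¹ f⁻¹ := by
  obtain ⟨N, M, hM, hN, rfl, h⟩ := hf
  have hd := ValInf.natDegree_eq hv hN h
  refine ⟨M, N, ?_, hd.ge, by rw [inv_div], ?_⟩
  · rintro rfl; simp at h; exact hv h
  · rw [h, inv_div, leadingCoeff, leadingCoeff, hd]

theorem ValInf.unique {u v : ℝ} {f : RatFunc ℝ} (hf : ValInf u f) (hg : ValInf v f) :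
    u = v := by
  obtain ⟨N, M, hM, hN, rfl, rfl⟩ := hf
  obtain ⟨N', M', hM', hN', h, rfl⟩ := hg
  rw [toRat_div_eq_iff hM hM'] at h
  have l1 : M.leadingCoeff ≠ 0 := leadingCoeff_ne_zero.2 hM
  have l2 : M'.leadingCoeff ≠ 0 := leadingCoeff_ne_zero.2 hM'
  have h' : (N * M').coeff (M.natDegree + M'.natDegree) =
      (N' * M).coeff (M.natDegree + M'.natDegree) := by rw [h]
  rw [coeff_mul_add_eq_of_natDegree_le hN le_rfl, add_comm, coeff_mul_add_eq_of_natDegree_le hN' le_rfl] at h'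
  rw [div_eq_div_iff l1 l2]
  exact h'

/-- `x d/dx` multiplies the coefficient of `x^k` by `k`, so in `xN'M - NxM'` the coefficients of
`x^(2 deg M)` cancel: the Euler operator kills a finite value at infinity. -/
theorem ValInf.theta {v : ℝ} {f : RatFunc ℝ} (hf : ValInf v f) :
    ValInf 0 (RatFunc.X * ratDeriv f) := by
  obtain ⟨N, M, hM, hN, rfl, rfl⟩ := hf
  have hX : ∀ P : ℝ[X], (X * derivative P).natDegree ≤ P.natDegree := by
    intro P
    by_cases h : P.natDegree = 0
    · rw [natDegree_eq_zero] at h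
      obtain ⟨c, rfl⟩ := h
      simp
    · refine natDegree_mul_le.trans ?_
      have := natDegree_derivative_le P
      rw [natDegree_X]; omega
  have hc : ∀ (P : ℝ[X]) (n : ℕ), (X * derivative P).coeff n = P.coeff n * n := by
    intro P n
    rcases n with _ | n
    · simp
    · rw [coeff_X_mul, coeff_derivative]; push_cast; ring
  refine ⟨X * derivative N * M - N * (X * derivative M), M ^ 2, pow_ne_zero 2 hM, ?_, ?_, ?_⟩
  · rw [natDegree_pow]
    refine (natDegree_sub_le _ _).trans (max_le ?_ ?_)
    · exact natDegree_mul_le.trans (by have := hX N; omega)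
    · exact natDegree_mul_le.trans (by have := hX M; omega)
  · rw [ratDeriv_div_toRat N M hM, ← RatFunc.algebraMap_X, ← mul_div_assoc, ← map_mul]
    congr 2; ring
  · rw [natDegree_pow, two_mul, coeff_sub, coeff_mul_add_eq_of_natDegree_le ((hX N).trans hN) le_rfl,
      coeff_mul_add_eq_of_natDegree_le hN (hX M), hc, hc]
    ring

/-! ### Places -/

/-- Residue-field valued evaluation `V` at a place with uniformizer (or its inverse) `t`. -/
structure IsPlace (V : ℝ → RatFunc ℝ → Prop) (t : RatFunc ℝ) : Prop where
  add : ∀ {u v f g}, V u f → V v g → V (u + v) (f + g)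
  mul : ∀ {u v f g}, V u f → V v g → V (u * v) (f * g)
  const : ∀ a, V a (RatFunc.C a)
  unique : ∀ {u v f}, V u f → V v f → u = v
  inv : ∀ {v f}, V v f → v ≠ 0 → V v⁻¹ f⁻¹
  theta : ∀ {v f}, V v f → V 0 (t * ratDeriv f)
  dt : ratDeriv t = 1
  t0 : t ≠ 0
  ord : ∀ f, f ≠ 0 → ∃ (m : ℤ) (v : ℝ), v ≠ 0 ∧ V v (f * t ^ (-m))

theorem isPlace_valAt (c : ℝ) : IsPlace (ValAt c) (RatFunc.X - RatFunc.C c) where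
  add := ValAt.add
  mul := ValAt.mul
  const := valAt_C c
  unique := ValAt.unique
  inv := ValAt.inv
  theta := fun {v f} hf => by
    obtain ⟨v', h, -⟩ := valAt_ratDeriv hf
    have h0 : ValAt c (c + -c) (RatFunc.X + RatFunc.C (-c)) := (valAt_X c).add (valAt_C c (-c))
    have := h0.mul h
    rwa [add_neg_cancel, zero_mul, map_neg, ← sub_eq_add_neg] at this
  dt := by rw [ratDeriv_sub]; simp
  t0 := X_sub_C_ne_zero c
  ord := fun f hf => by
    obtain ⟨N, M, hM, rfl⟩ := exists_toRat_div f
    have hN : N ≠ 0 := by rintro rfl; simp at hf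
    have ht : toRat (X - Polynomial.C c) = RatFunc.X - RatFunc.C c := by simp [toRat]
    obtain ⟨N', hN', h1⟩ := exists_eq_pow_rootMultiplicity_mul_and_not_dvd N hN c
    obtain ⟨M', hM', h2⟩ := exists_eq_pow_rootMultiplicity_mul_and_not_dvd M hM c
    have e1 : N'.eval c ≠ 0 := fun h => h1 (dvd_iff_isRoot.2 h)
    have e2 : M'.eval c ≠ 0 := fun h => h2 (dvd_iff_isRoot.2 h)
    refine ⟨(N.rootMultiplicity c : ℤ) - M.rootMultiplicity c, N'.eval c / M'.eval c,
      div_ne_zero e1 e2, ?_⟩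
    convert! valAt_div (N := N') e2 using 1
    have t0 := X_sub_C_ne_zero c
    rw [neg_sub, zpow_sub₀ t0, zpow_natCast, zpow_natCast, ← ht]
    have eN : toRat N = toRat (X - Polynomial.C c) ^ N.rootMultiplicity c * toRat N' := by
      rw [← toRat_pow, ← toRat_mul, ← hN']
    have eM : toRat M = toRat (X - Polynomial.C c) ^ M.rootMultiplicity c * toRat M' := by
      rw [← toRat_pow, ← toRat_mul, ← hM']
    have t0' : toRat (X - Polynomial.C c) ≠ 0 := by rwa [ht]
    have := toRat_ne_zero (P := M') (by rintro rfl; simp at e2)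
    rw [eN, eM]
    field_simp

/-- Here `t = x` is the inverse of a uniformizer, so the exponent in `ord` is a degree of growth
rather than an order of vanishing. -/
theorem isPlace_valInf : IsPlace ValInf RatFunc.X where
  add := ValInf.add
  mul := ValInf.mul
  const := valInf_C
  unique := ValInf.unique
  inv := ValInf.inv
  theta := ValInf.theta
  dt := ratDeriv_X
  t0 := RatFunc.X_ne_zero
  ord := fun f hf => by
    obtain ⟨N, M, hM, rfl⟩ := exists_toRat_div f
    have hN : N ≠ 0 := by rintro rfl; simp at hf
    have l1 : M.leadingCoeff ≠ 0 := leadingCoeff_ne_zero.2 hM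
    have l2 : N.leadingCoeff ≠ 0 := leadingCoeff_ne_zero.2 hN
    -- Padding by powers of `X` brings numerator and denominator to the same degree, so that the
    -- value is the ratio of leading coefficients.
    refine ⟨(N.natDegree : ℤ) - M.natDegree, N.leadingCoeff / M.leadingCoeff,
      div_ne_zero l2 l1, N * X ^ M.natDegree, M * X ^ N.natDegree,
      mul_ne_zero hM (pow_ne_zero _ X_ne_zero), ?_, ?_, ?_⟩
    · rw [natDegree_mul_X_pow _ hN, natDegree_mul_X_pow _ hM]; omega
    · rw [neg_sub, zpow_sub₀ RatFunc.X_ne_zero, zpow_natCast, zpow_natCast,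
        toRat_mul, toRat_mul, toRat_pow, toRat_pow, toRat_X, div_mul_div_comm]
    · rw [natDegree_mul_X_pow _ hM, add_comm, coeff_mul_X_pow, leadingCoeff_mul_X_pow]; rfl

namespace IsPlace

variable {V : ℝ → RatFunc ℝ → Prop} {t : RatFunc ℝ}

theorem neg (h : IsPlace V t) {u f} (hf : V u f) : V (-u) (-f) := by
  have := h.mul (h.const (-1)) hf
  rwa [neg_one_mul, map_neg, map_one, neg_one_mul] at this

theorem sub (h : IsPlace V t) {u v f g} (hf : V u f) (hg : V v g) : V (u - v) (f - g) := by
  rw [sub_eq_add_neg, sub_eq_add_neg]; exact h.add hf (h.neg hg)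

theorem div (h : IsPlace V t) {u v f g} (hf : V u f) (hg : V v g) (hv : v ≠ 0) :
    V (u / v) (f / g) := by
  rw [div_eq_mul_inv, div_eq_mul_inv]; exact h.mul hf (h.inv hg hv)

theorem pow (h : IsPlace V t) {u f} (hf : V u f) (n : ℕ) : V (u ^ n) (f ^ n) := by
  induction n with
  | zero => simpa using h.const 1
  | succ n ih => rw [pow_succ, pow_succ]; exact h.mul ih hf

theorem ne_zero (h : IsPlace V t) {u f} (hf : V u f) (hu : u ≠ 0) : f ≠ 0 := by
  rintro rfl
  have := h.const 0
  rw [map_zero] at this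
  exact hu (h.unique hf this)

theorem zero (h : IsPlace V t) : V 0 0 := by simpa using h.const 0

theorem one (h : IsPlace V t) : V 1 1 := by simpa using h.const 1

theorem sum (h : IsPlace V t) {κ : Type*} (s : Finset κ) {u : κ → ℝ} {f : κ → RatFunc ℝ}
    (hf : ∀ i ∈ s, V (u i) (f i)) : V (∑ i ∈ s, u i) (∑ i ∈ s, f i) := by
  classical
  induction s using Finset.induction_on with
  | empty => simpa using h.zero
  | insert a s ha ih =>
    rw [Finset.sum_insert ha, Finset.sum_insert ha]
    exact h.add (hf a (Finset.mem_insert_self _ _))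
      (ih fun i hi => hf i (Finset.mem_insert_of_mem hi))

theorem prod (h : IsPlace V t) {κ : Type*} (s : Finset κ) {u : κ → ℝ} {f : κ → RatFunc ℝ}
    (hf : ∀ i ∈ s, V (u i) (f i)) : V (∏ i ∈ s, u i) (∏ i ∈ s, f i) := by
  classical
  induction s using Finset.induction_on with
  | empty => simpa using h.one
  | insert a s ha ih =>
    rw [Finset.prod_insert ha, Finset.prod_insert ha]
    exact h.mul (hf a (Finset.mem_insert_self _ _))
      (ih fun i hi => hf i (Finset.mem_insert_of_mem hi))

theorem det (h : IsPlace V t) {n : ℕ} {u : Matrix (Fin n) (Fin n) ℝ}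
    {f : Matrix (Fin n) (Fin n) (RatFunc ℝ)} (hf : ∀ i j, V (u i j) (f i j)) :
    V u.det f.det := by
  rw [Matrix.det_apply', Matrix.det_apply']
  refine h.sum _ fun σ _ => h.mul ?_ (h.prod _ fun i _ => hf _ _)
  have := h.const (((Equiv.Perm.sign σ : ℤ) : ℝ))
  rwa [map_intCast] at this

/-- The log-derivative of a function with leading exponent `m`. -/
theorem logDeriv (h : IsPlace V t) {f : RatFunc ℝ} {m : ℤ} {v : ℝ} (hv : v ≠ 0)
    (hf : V v (f * t ^ (-m))) : V m (t * (ratDeriv f / f)) := by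
  have hg := h.ne_zero hf hv
  have f0 : f ≠ 0 := left_ne_zero_of_mul hg
  have h1 := h.div (h.theta hf) hf hv
  have h2 := h.add h1 (h.const (m : ℝ))
  rw [zero_div, zero_add] at h2
  convert! h2 using 1
  have t0 := h.t0
  have tz : t ^ (-m) ≠ 0 := zpow_ne_zero _ t0
  rw [ratDeriv_mul, ratDeriv_zpow _ t0, h.dt]
  push_cast
  rw [map_intCast]
  field_simp
  ring

theorem exists_logDeriv (h : IsPlace V t) {f : RatFunc ℝ} (hf : f ≠ 0) :
    ∃ (m : ℤ) (v : ℝ), v ≠ 0 ∧ V v (f * t ^ (-m)) ∧ V m (t * (ratDeriv f / f)) := by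
  obtain ⟨m, v, hv, h1⟩ := h.ord f hf
  exact ⟨m, v, hv, h1, h.logDeriv hv h1⟩

end IsPlace

/-- The exponent is an invariant of `f`, being the value of `x f'/f` at infinity. Comparison with
the reduced fraction, whose denominator is monic, identifies both exponent and value. -/
theorem intDegree_of_valInf {f : RatFunc ℝ} {m : ℤ} {v : ℝ} (hv : v ≠ 0)
    (h : ValInf v (f * RatFunc.X ^ (-m))) : f.intDegree = m ∧ f.num.leadingCoeff = v := by
  have hf : f ≠ 0 := left_ne_zero_of_mul (isPlace_valInf.ne_zero h hv)
  have hN := RatFunc.num_ne_zero hf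
  have hM := f.denom_ne_zero
  have key : ValInf f.num.leadingCoeff (f * RatFunc.X ^ (-f.intDegree)) := by
    refine ⟨f.num * X ^ f.denom.natDegree, f.denom * X ^ f.num.natDegree,
      mul_ne_zero hM (pow_ne_zero _ X_ne_zero), ?_, ?_, ?_⟩
    · rw [natDegree_mul_X_pow _ hN, natDegree_mul_X_pow _ hM]; omega
    · rw [RatFunc.intDegree, neg_sub, zpow_sub₀ RatFunc.X_ne_zero, zpow_natCast, zpow_natCast,
        toRat_mul, toRat_mul, toRat_pow, toRat_pow, toRat_X, ← div_mul_div_comm,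
        RatFunc.num_div_denom f]
    · rw [natDegree_mul_X_pow _ hM, add_comm, coeff_mul_X_pow, leadingCoeff_mul_X_pow,
        (RatFunc.monic_denom f).leadingCoeff, div_one]; rfl
  have hl : f.num.leadingCoeff ≠ 0 := leadingCoeff_ne_zero.2 hN
  have e := isPlace_valInf.unique (isPlace_valInf.logDeriv hv h)
    (isPlace_valInf.logDeriv hl key)
  have e' : m = f.intDegree := by exact_mod_cast e
  subst e'
  exact ⟨rfl, isPlace_valInf.unique key h⟩

/-! ### Darboux transformations -/

/-- The Darboux transform of `T` with respect to an eigenfunction with log-derivative `w`. -/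
def DiffOp.darboux (T : DiffOp) (w : RatFunc ℝ) : DiffOp where
  p := T.p
  q := T.q + ratDeriv T.p
  r := T.r + ratDeriv T.q + 2 * T.p * ratDeriv w + ratDeriv T.p * w

/-- The log-derivative of the eigenfunction of `T.darboux w` dual to the seed. -/
def DiffOp.dual (T : DiffOp) (w : RatFunc ℝ) : RatFunc ℝ := -(T.q / T.p) - w

/-- The effect of a Darboux transformation with seed `w₁` on log-derivatives. -/
def darbouxLog (w₁ w : RatFunc ℝ) : RatFunc ℝ := w + ratDeriv (w - w₁) / (w - w₁)

/-- The square of the eigenfunction with log-derivative `w` has no quasi-rational antiderivative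
relative to the weight of `T`. -/
def NotExact (T : DiffOp) (w : RatFunc ℝ) : Prop :=
  ¬ ∃ h : RatFunc ℝ, ratDeriv h + (T.q / T.p + 2 * w) * h = 1 / T.p

/-! ### One Darboux step on the solution sets of the Riccati equations -/

section Step

variable {T : DiffOp} {w w₁ : RatFunc ℝ} {lam lam₁ : ℝ}

theorem ricSet_sub (h₁ : w₁ ∈ ricSet T lam₁) (h : w ∈ ricSet T lam) :
    T.p * (ratDeriv (w - w₁) + (w - w₁) * (w + w₁)) + T.q * (w - w₁) =
      RatFunc.C (lam - lam₁) := by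
  have h₁' : T.p * (ratDeriv w₁ + w₁ ^ 2) + T.q * w₁ + T.r = RatFunc.C lam₁ := h₁
  have h' : T.p * (ratDeriv w + w ^ 2) + T.q * w + T.r = RatFunc.C lam := h
  rw [map_sub, ← h₁', ← h', ratDeriv_sub]; ring

theorem sub_ne_zero_of_ricSet (hne : lam ≠ lam₁) (h₁ : w₁ ∈ ricSet T lam₁)
    (h : w ∈ ricSet T lam) : w - w₁ ≠ 0 := by
  intro h0
  have := ricSet_sub h₁ h
  rw [h0, ratDeriv_zero] at this
  exact C_ne_zero (sub_ne_zero.2 hne) (by rw [← this]; ring)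

/-- The basic identity: the distance of `w` from the seed and the distance of its transform from the
dual multiply to a constant over `p`. It makes the step invertible. -/
theorem dual_relation (hp : T.p ≠ 0) (hne : lam ≠ lam₁) (h₁ : w₁ ∈ ricSet T lam₁)
    (h : w ∈ ricSet T lam) :
    T.p * (w - w₁) * (darbouxLog w₁ w - T.dual w₁) = RatFunc.C (lam - lam₁) := by
  rw [← ricSet_sub h₁ h, darbouxLog, DiffOp.dual]
  have := sub_ne_zero_of_ricSet hne h₁ h
  field_simp
  ring

theorem darbouxLog_eq (hp : T.p ≠ 0) (hne : lam ≠ lam₁) (h₁ : w₁ ∈ ricSet T lam₁)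
    (h : w ∈ ricSet T lam) :
    darbouxLog w₁ w = T.dual w₁ + RatFunc.C (lam - lam₁) / (T.p * (w - w₁)) := by
  have h0 := sub_ne_zero_of_ricSet hne h₁ h
  rw [← dual_relation hp hne h₁ h]
  field_simp
  ring

theorem ratDeriv_dual (hp : T.p ≠ 0) : ratDeriv (T.dual w₁) =
    -((ratDeriv T.q * T.p - T.q * ratDeriv T.p) / T.p ^ 2) - ratDeriv w₁ := by
  rw [DiffOp.dual, ratDeriv_sub, ratDeriv_neg, ratDeriv_div _ _ hp]

theorem dual_mem (hp : T.p ≠ 0) (h₁ : w₁ ∈ ricSet T lam₁) :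
    T.dual w₁ ∈ ricSet (T.darboux w₁) lam₁ := by
  have h₁' : T.p * (ratDeriv w₁ + w₁ ^ 2) + T.q * w₁ + T.r = RatFunc.C lam₁ := h₁
  change T.p * (ratDeriv (T.dual w₁) + T.dual w₁ ^ 2) + (T.q + ratDeriv T.p) * T.dual w₁ +
    (T.r + ratDeriv T.q + 2 * T.p * ratDeriv w₁ + ratDeriv T.p * w₁) = _
  rw [← h₁', ratDeriv_dual hp, DiffOp.dual]
  field_simp
  ring

/-- The substitution `δ ↦ Λ/(pδ)` preserves the form of the equation. The condition `hu` is
symmetric in the pairs `(q, v)` and `(q₂, u)`, which is why the lemma serves both the transform and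
its inverse. -/
theorem riccati_transform {p p' q q₂ δ δ' u v Λ : RatFunc ℝ} (hp : p ≠ 0) (hδ : δ ≠ 0)
    (h : p * (δ' + δ ^ 2 + 2 * v * δ) + q * δ = Λ) (hu : q₂ = p' - (2 * p * v + q) - 2 * p * u) :
    p * (-(Λ * (p' * δ + p * δ')) / (p * δ) ^ 2 + (Λ / (p * δ)) ^ 2
      + 2 * u * (Λ / (p * δ))) + q₂ * (Λ / (p * δ)) = Λ := by
  subst hu
  rw [← h]
  field_simp
  ring

theorem ricSet_add_iff {δ : RatFunc ℝ} (h₁ : w₁ ∈ ricSet T lam₁) :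
    w₁ + δ ∈ ricSet T lam ↔
      T.p * (ratDeriv δ + δ ^ 2 + 2 * w₁ * δ) + T.q * δ = RatFunc.C (lam - lam₁) := by
  have h₁' : T.p * (ratDeriv w₁ + w₁ ^ 2) + T.q * w₁ + T.r = RatFunc.C lam₁ := h₁
  change T.p * (ratDeriv (w₁ + δ) + (w₁ + δ) ^ 2) + T.q * (w₁ + δ) + T.r = _ ↔ _
  rw [map_sub, ← h₁', ratDeriv_add, eq_sub_iff_add_eq]
  constructor <;> intro h <;> rw [← h] <;> ring

theorem ratDeriv_const_div (c : ℝ) (p δ : RatFunc ℝ) (h : p * δ ≠ 0) :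
    ratDeriv (RatFunc.C c / (p * δ)) =
      -(RatFunc.C c * (ratDeriv p * δ + p * ratDeriv δ)) / (p * δ) ^ 2 := by
  rw [ratDeriv_div _ _ h, ratDeriv_C, ratDeriv_mul]; ring

theorem darbouxLog_mem (hp : T.p ≠ 0) (hne : lam ≠ lam₁) (h₁ : w₁ ∈ ricSet T lam₁)
    (h : w ∈ ricSet T lam) : darbouxLog w₁ w ∈ ricSet (T.darboux w₁) lam := by
  have h0 := sub_ne_zero_of_ricSet hne h₁ h
  rw [darbouxLog_eq hp hne h₁ h, ricSet_add_iff (dual_mem hp h₁),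
    ratDeriv_const_div _ _ _ (mul_ne_zero hp h0)]
  have h' := (ricSet_add_iff (δ := w - w₁) (lam := lam) h₁).1 (by rwa [add_sub_cancel])
  refine riccati_transform (p' := ratDeriv T.p) hp h0 h' ?_
  change T.q + ratDeriv T.p =
    ratDeriv T.p - (2 * T.p * w₁ + T.q) - 2 * T.p * (-(T.q / T.p) - w₁)
  field_simp
  ring

/-- The inverse of the step is the same construction with the roles of the seed and its dual
exchanged. -/
theorem exists_darbouxLog_eq {w' : RatFunc ℝ} (hp : T.p ≠ 0) (hne : lam ≠ lam₁)
    (h₁ : w₁ ∈ ricSet T lam₁) (h : w' ∈ ricSet (T.darboux w₁) lam) :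
    ∃ w ∈ ricSet T lam, darbouxLog w₁ w = w' := by
  have hd := dual_mem hp h₁
  have h0 := sub_ne_zero_of_ricSet hne hd h
  have hp' : (T.darboux w₁).p = T.p := rfl
  have hq' : (T.darboux w₁).q = T.q + ratDeriv T.p := rfl
  have h' := (ricSet_add_iff (δ := w' - T.dual w₁) (lam := lam) hd).1 (by rwa [add_sub_cancel])
  rw [hp', hq'] at h'
  have hc := C_ne_zero (sub_ne_zero.2 hne)
  have hm : w₁ + RatFunc.C (lam - lam₁) / (T.p * (w' - T.dual w₁)) ∈ ricSet T lam := by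
    rw [ricSet_add_iff h₁, ratDeriv_const_div _ _ _ (mul_ne_zero hp h0)]
    refine riccati_transform (p' := ratDeriv T.p) hp h0 h' ?_
    rw [DiffOp.dual]
    field_simp
    ring
  refine ⟨_, hm, ?_⟩
  rw [darbouxLog_eq hp hne h₁ hm, add_sub_cancel_left]
  field_simp
  ring

theorem darbouxLog_injOn (hp : T.p ≠ 0) (hne : lam ≠ lam₁) (h₁ : w₁ ∈ ricSet T lam₁) :
    InjOn (darbouxLog w₁) (ricSet T lam) := by
  intro u hu v hv h
  have e1 := dual_relation hp hne h₁ hu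
  have e2 := dual_relation hp hne h₁ hv
  have hc := C_ne_zero (sub_ne_zero.2 hne)
  rw [h] at e1
  have hx : T.p * (darbouxLog w₁ v - T.dual w₁) ≠ 0 := by
    intro h0
    apply hc
    rw [← e2, mul_right_comm, h0, zero_mul]
  have : (u - w₁) * (T.p * (darbouxLog w₁ v - T.dual w₁)) =
      (v - w₁) * (T.p * (darbouxLog w₁ v - T.dual w₁)) := by
    linear_combination e1 - e2
  exact sub_left_injective (mul_right_cancel₀ hx this)

theorem darbouxLog_bijOn (hp : T.p ≠ 0) (hne : lam ≠ lam₁) (h₁ : w₁ ∈ ricSet T lam₁) :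
    BijOn (darbouxLog w₁) (ricSet T lam) (ricSet (T.darboux w₁) lam) :=
  ⟨fun _ h => darbouxLog_mem hp hne h₁ h, darbouxLog_injOn hp hne h₁,
    fun _ h => exists_darbouxLog_eq hp hne h₁ h⟩

/-- At the seed eigenvalue the equation for the difference `δ` from the dual is homogeneous of
Bernoulli type. So `1/(pδ)` solves a linear equation, the one whose solvability `NotExact` forbids.
-/
theorem ricSet_darboux_self (hp : T.p ≠ 0) (h₁ : w₁ ∈ ricSet T lam₁) (hN : NotExact T w₁) :
    ricSet (T.darboux w₁) lam₁ = {T.dual w₁} := by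
  have hd := dual_mem hp h₁
  refine eq_singleton_iff_unique_mem.2 ⟨hd, fun u hu => ?_⟩
  by_contra hne
  have h0 : u - T.dual w₁ ≠ 0 := sub_ne_zero.2 hne
  have h' := (ricSet_add_iff (δ := u - T.dual w₁) (lam := lam₁) hd).1 (by rwa [add_sub_cancel])
  have hp' : (T.darboux w₁).p = T.p := rfl
  have hq' : (T.darboux w₁).q = T.q + ratDeriv T.p := rfl
  rw [hp', hq', sub_self, map_zero] at h'
  refine hN ⟨RatFunc.C 1 / (T.p * (u - T.dual w₁)), ?_⟩
  rw [ratDeriv_const_div _ _ _ (mul_ne_zero hp h0), map_one]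
  have e : ratDeriv (u - T.dual w₁) = -((u - T.dual w₁) ^ 2 +
      2 * T.dual w₁ * (u - T.dual w₁) + (T.q + ratDeriv T.p) / T.p * (u - T.dual w₁)) := by
    field_simp
    linear_combination h'
  rw [e]
  have e2 : w₁ = -(T.q / T.p) - T.dual w₁ := by rw [DiffOp.dual]; ring
  rw [show T.q / T.p + 2 * w₁ = -(T.q / T.p) - 2 * T.dual w₁ by
    conv_lhs => rw [e2]
    ring]
  generalize T.dual w₁ = d at *
  field_simp
  ring

/-- With `c = λ - λ₁`, `δ = w - w₁` and the weight `W`, integration by parts gives `(pWδφ²)' = cWφ²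
+ pWδ²φ²`. The last term is the transformed square against the transformed weight, so an
antiderivative of it yields one of `Wφ²`. -/
theorem NotExact.darboux (hp : T.p ≠ 0) (hne : lam ≠ lam₁) (h₁ : w₁ ∈ ricSet T lam₁)
    (h : w ∈ ricSet T lam) (hN : NotExact T w) :
    NotExact (T.darboux w₁) (darbouxLog w₁ w) := by
  rintro ⟨k, hk⟩
  have h0 := sub_ne_zero_of_ricSet hne h₁ h
  have hc := C_ne_zero (sub_ne_zero.2 hne)
  have hs := ricSet_sub h₁ h
  have hp' : (T.darboux w₁).p = T.p := rfl
  have hq' : (T.darboux w₁).q = T.q + ratDeriv T.p := rfl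
  rw [hp', hq', darbouxLog] at hk
  -- The antiderivative of `Wφ²` so obtained is `pWφ²(δ - kpδ²)/c`; dividing by `pWφ²` gives the
  -- witness.
  refine hN ⟨RatFunc.C (lam - lam₁)⁻¹ * ((w - w₁) - k * T.p * (w - w₁) ^ 2), ?_⟩
  rw [ratDeriv_C_mul, ratDeriv_sub (w - w₁), ratDeriv_mul, ratDeriv_mul k, ratDeriv_pow, map_inv₀]
  have e : ratDeriv k = 1 / T.p - ((T.q + ratDeriv T.p) / T.p +
      2 * (w + ratDeriv (w - w₁) / (w - w₁))) * k := by rw [← hk]; ring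
  rw [e]
  rw [show w + w₁ = 2 * w - (w - w₁) by ring] at hs
  generalize w - w₁ = δ at *
  generalize RatFunc.C (lam - lam₁) = c at *
  have e3 : ratDeriv δ = (c - T.q * δ) / T.p - δ * (2 * w - δ) := by
    rw [← hs]; field_simp; ring
  rw [e3]
  field_simp
  push_cast
  ring

end Step

/-! ### Local behaviour of Darboux transformations -/

namespace IsPlace

variable {V : ℝ → RatFunc ℝ → Prop} {t : RatFunc ℝ}

/-- Distinct residues make `w - w₁` behave exactly like a nonzero multiple of `1/t`, so its
log-derivative contributes `-1`. -/
theorem darbouxLog_of_ne (h : IsPlace V t) {w w₁ : RatFunc ℝ} {e e₁ : ℝ} (hw : V e (t * w))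
    (hw₁ : V e₁ (t * w₁)) (hne : e ≠ e₁) : V (e - 1) (t * darbouxLog w₁ w) := by
  have hd := h.sub hw hw₁
  rw [← mul_sub] at hd
  have h0 := h.ne_zero hd (sub_ne_zero.2 hne)
  have t0 := h.t0
  have d0 : w - w₁ ≠ 0 := right_ne_zero_of_mul h0
  have h1 := h.div (h.theta hd) hd (sub_ne_zero.2 hne)
  have h2 := h.sub (h.add hw h1) h.one
  rw [zero_div, add_zero] at h2
  convert! h2 using 1
  rw [darbouxLog, ratDeriv_mul, h.dt]
  field_simp
  ring

end IsPlace

/-- Here `w - w₁` is regular and nonzero at `c`, so its log-derivative has no residue. A pole is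
excluded by the equality of residues; a zero would make the left side of `ricSet_sub` vanish at `c`,
although it equals `λ - λ₁`. -/
theorem darbouxLog_valAt_of_eq {T : DiffOp} {w w₁ : RatFunc ℝ} {lam lam₁ c e a : ℝ}
    (hp : ∃ b, ValAt c b (T.p / (RatFunc.X - RatFunc.C c))) (hq : ValAt c a T.q)
    (hne : lam ≠ lam₁) (h₁ : w₁ ∈ ricSet T lam₁) (h : w ∈ ricSet T lam)
    (hw : ValAt c e ((RatFunc.X - RatFunc.C c) * w))
    (hw₁ : ValAt c e ((RatFunc.X - RatFunc.C c) * w₁)) :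
    ValAt c e ((RatFunc.X - RatFunc.C c) * darbouxLog w₁ w) := by
  have P := isPlace_valAt c
  obtain ⟨b, hb⟩ := hp
  set t := RatFunc.X - RatFunc.C c with ht
  have t0 : t ≠ 0 := P.t0
  have tv : ValAt c 0 t := by
    have := P.sub (valAt_X c) (valAt_C c c); rwa [sub_self] at this
  have d0 := sub_ne_zero_of_ricSet hne h₁ h
  obtain ⟨m, v, hv, hm, hl⟩ := P.exists_logDeriv d0
  have key : m = 0 := by
    rcases lt_trichotomy m 0 with hlt | h0 | hgt
    · -- a pole of order at least one contradicts the equality of residues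
      exfalso
      have hd := P.sub hw hw₁
      rw [← mul_sub, sub_self] at hd
      obtain ⟨k, hk⟩ : ∃ k : ℕ, m = -(k + 1 : ℕ) := ⟨(-m - 1).toNat, by omega⟩
      have h3 := P.mul hd (P.pow tv k)
      have e3 : t * (w - w₁) * t ^ k = (w - w₁) * t ^ (-m) := by
        rw [hk, neg_neg, zpow_natCast, pow_succ]; ring
      rw [e3, zero_mul] at h3
      exact hv (P.unique hm h3)
    · exact h0
    · exfalso
      obtain ⟨k, hk⟩ : ∃ k : ℕ, m = (k + 1 : ℕ) := ⟨(m - 1).toNat, by omega⟩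
      have hd : ∃ u, ValAt c u ((w - w₁) / t) := by
        have h3 := P.mul hm (P.pow tv k)
        refine ⟨v * 0 ^ k, ?_⟩
        convert! h3 using 1
        rw [hk, zpow_neg, zpow_natCast, pow_succ]; field_simp
      obtain ⟨u, hu⟩ := hd
      have hδ := P.mul hu tv
      rw [mul_zero, div_mul_cancel₀ _ t0] at hδ
      have h4 := ricSet_sub h₁ h
      have h5 := P.add (P.mul hb (P.add (P.theta hδ)
        (P.mul hδ (P.add hw hw₁)))) (P.mul hq hδ)
      have e5 : T.p / t * (t * ratDeriv (w - w₁) + (w - w₁) * (t * w + t * w₁)) + T.q * (w - w₁)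
          = RatFunc.C (lam - lam₁) := by
        rw [← h4]; field_simp
      rw [e5] at h5
      have h6 := P.unique h5 (P.const _)
      simp only [zero_mul, mul_zero, add_zero] at h6
      exact hne (sub_eq_zero.1 h6.symm)
  rw [key, Int.cast_zero] at hl
  have := P.add hw hl
  rw [add_zero, ← mul_add] at this
  exact this

/-- Equal degrees would give `w - w₁ = o(1/x)`, and then the left side of `ricSet_sub` would tend to
`0` at infinity instead of being `λ - λ₁`. -/
theorem valInf_ne_of_ricSet {T : DiffOp} {w w₁ : RatFunc ℝ} {lam lam₁ d d₁ a b : ℝ}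
    (hp : ValInf b (T.p / RatFunc.X ^ 2)) (hq : ValInf a (T.q / RatFunc.X))
    (hne : lam ≠ lam₁) (h₁ : w₁ ∈ ricSet T lam₁) (h : w ∈ ricSet T lam)
    (hw : ValInf d (RatFunc.X * w)) (hw₁ : ValInf d₁ (RatFunc.X * w₁)) : d ≠ d₁ := by
  rintro rfl
  have P := isPlace_valInf
  have t0 := P.t0
  have hd := P.sub hw hw₁
  rw [← mul_sub, sub_self] at hd
  have h2 := P.theta hd
  rw [ratDeriv_mul, ratDeriv_X] at h2
  have h5 := P.add (P.mul hp (P.add (P.sub h2 hd) (P.mul hd (P.add hw hw₁)))) (P.mul hq hd)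
  have h4 := ricSet_sub h₁ h
  have e5 : T.p / RatFunc.X ^ 2 * (RatFunc.X * (1 * (w - w₁) + RatFunc.X * ratDeriv (w - w₁)) -
      RatFunc.X * (w - w₁) +
      RatFunc.X * (w - w₁) * (RatFunc.X * w + RatFunc.X * w₁)) + T.q / RatFunc.X *
        (RatFunc.X * (w - w₁))
      = RatFunc.C (lam - lam₁) := by
    rw [← h4]; field_simp; ring
  rw [e5] at h5
  have h6 := P.unique h5 (P.const _)
  simp only [zero_mul, mul_zero, add_zero, sub_zero] at h6
  exact hne (sub_eq_zero.1 h6.symm)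

/-! ### Quasi-rational functions and their Wronskians -/

/-- A quasi-rational function `μ f`, where `μ' = ω μ` and `ω`, `f` are rational. -/
structure QF where
  ω : RatFunc ℝ
  f : RatFunc ℝ

/-- The twisted derivative `f' + ω f`, i.e. `μ⁻¹ (μ f)'` where `μ' = ω μ`. -/
def twD (ω f : RatFunc ℝ) : RatFunc ℝ := ratDeriv f + ω * f

theorem twD_mul (α β f g : RatFunc ℝ) :
    twD (α + β) (f * g) = twD α f * g + f * twD β g := by
  simp only [twD, ratDeriv_mul]; ring

theorem twD_add (α f g : RatFunc ℝ) : twD α (f + g) = twD α f + twD α g := by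
  simp only [twD, ratDeriv_add]; ring

theorem twD_zero (α : RatFunc ℝ) : twD α 0 = 0 := by simp [twD]

theorem twD_sum (α : RatFunc ℝ) (s : Finset ℕ) (f : ℕ → RatFunc ℝ) :
    twD α (∑ i ∈ s, f i) = ∑ i ∈ s, twD α (f i) := by
  classical
  induction s using Finset.induction_on with
  | empty => simp [twD_zero]
  | insert a s ha ih => rw [Finset.sum_insert ha, Finset.sum_insert ha, twD_add, ih]

namespace QF

/-- The log-derivative of a quasi-rational function. -/
def lg (y : QF) : RatFunc ℝ := y.ω + ratDeriv y.f / y.f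

/-- The first-order operator `y ↦ y' - (φ'/φ) y`. -/
def step (φ y : QF) : QF := ⟨y.ω, ratDeriv y.f + y.ω * y.f - φ.lg * y.f⟩

/-- The product of quasi-rational functions. -/
def mul (g y : QF) : QF := ⟨g.ω + y.ω, g.f * y.f⟩

/-- The derivative of a quasi-rational function. -/
def der (y : QF) : QF := ⟨y.ω, twD y.ω y.f⟩

theorem step_f {φ y : QF} (hy : y.f ≠ 0) : (φ.step y).f = (y.lg - φ.lg) * y.f := by
  simp only [step]
  conv_rhs => rw [lg]
  field_simp
  ring

theorem step_f_ne_zero {φ y : QF} (hy : y.f ≠ 0) (h : y.lg - φ.lg ≠ 0) : (φ.step y).f ≠ 0 := by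
  rw [step_f hy]; exact mul_ne_zero h hy

/-- This ties the first-order operator that occurs in the reduction of Wronskians to the
transformation of Riccati solutions. -/
theorem lg_step {φ y : QF} (hy : y.f ≠ 0) (h : y.lg - φ.lg ≠ 0) :
    (φ.step y).lg = darbouxLog φ.lg y.lg := by
  have e : (φ.step y).ω = y.ω := rfl
  rw [lg, e, step_f hy, ratDeriv_mul, darbouxLog]
  have e2 : y.lg = y.ω + ratDeriv y.f / y.f := rfl
  generalize y.lg - φ.lg = δ at *
  rw [e2]
  field_simp
  ring

end QF

/-- The Wronskian of a list of quasi-rational functions, divided by the product of their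
transcendental factors. -/
def twr (L : List QF) : RatFunc ℝ :=
  Matrix.det (Matrix.of fun i j : Fin L.length => (twD (L.get j).ω)^[i] (L.get j).f)

theorem twr_map {κ : Type*} (g : κ → QF) (L : List κ) : twr (L.map g) =
    Matrix.det (Matrix.of fun i j : Fin L.length =>
      (twD (g (L.get j)).ω)^[i] (g (L.get j)).f) := by
  rw [twr, ← Matrix.det_submatrix_equiv_self (finCongr (List.length_map (as := L) g)).symm]
  congr 1
  ext i j
  simp

/-- The coefficients of the Leibniz expansion of the twisted derivatives of a product. -/
def leibCoeff (α f : RatFunc ℝ) : ℕ → ℕ → RatFunc ℝ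
  | 0, 0 => f
  | 0, _ + 1 => 0
  | n + 1, 0 => twD α (leibCoeff α f n 0)
  | n + 1, k + 1 => twD α (leibCoeff α f n (k + 1)) + leibCoeff α f n k

theorem leibCoeff_of_lt (α f : RatFunc ℝ) (n k : ℕ) (h : n < k) : leibCoeff α f n k = 0 := by
  induction n generalizing k with
  | zero => obtain ⟨k, rfl⟩ := Nat.exists_eq_succ_of_ne_zero h.ne'; rfl
  | succ n ih =>
    obtain ⟨k, rfl⟩ := Nat.exists_eq_succ_of_ne_zero (Nat.ne_zero_of_lt h)
    rw [Nat.succ_eq_add_one, leibCoeff, ih _ (by omega), ih _ (by omega), twD_zero, add_zero]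

theorem leibCoeff_self (α f : RatFunc ℝ) (n : ℕ) : leibCoeff α f n n = f := by
  induction n with
  | zero => rfl
  | succ n ih => rw [leibCoeff, leibCoeff_of_lt _ _ _ _ (Nat.lt_succ_self n), ih, twD_zero,
      zero_add]

theorem iterate_twD_mul (α β f g : RatFunc ℝ) (n N : ℕ) (h : n < N) :
    (twD (α + β))^[n] (f * g) = ∑ k ∈ Finset.range N, leibCoeff α f n k * (twD β)^[k] g := by
  induction n with
  | zero =>
    obtain ⟨N, rfl⟩ := Nat.exists_eq_succ_of_ne_zero h.ne'
    rw [Finset.sum_range_succ']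
    simp [leibCoeff]
  | succ n ih =>
    obtain ⟨N, rfl⟩ := Nat.exists_eq_succ_of_ne_zero (Nat.ne_zero_of_lt h)
    rw [Function.iterate_succ_apply', ih (by omega), twD_sum]
    simp only [twD_mul, ← Function.iterate_succ_apply' (twD β)]
    rw [Finset.sum_add_distrib, Finset.sum_range_succ', Nat.succ_eq_add_one,
      Finset.sum_range_succ (fun k => leibCoeff α f n k * (twD β)^[k.succ] g),
      leibCoeff_of_lt α f n N (by omega), zero_mul, add_zero, Finset.sum_range_succ' (n := N)]
    simp only [leibCoeff, add_mul, Finset.sum_add_distrib, Nat.succ_eq_add_one]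
    ring

/-- By the Leibniz rule the Wronskian matrix of the products is that of `L` multiplied from the left
by a lower triangular matrix with `g.f` along the diagonal. -/
theorem twr_map_mul (g : QF) (L : List QF) : twr (L.map g.mul) = g.f ^ L.length * twr L := by
  rw [twr_map, twr]
  have : (Matrix.of fun i j : Fin L.length =>
      (twD (g.mul (L.get j)).ω)^[(i : ℕ)] (g.mul (L.get j)).f) =
      (Matrix.of fun i k : Fin L.length => leibCoeff g.ω g.f i k) *
      (Matrix.of fun i j : Fin L.length => (twD (L.get j).ω)^[(i : ℕ)] (L.get j).f) := by
    ext i j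
    rw [Matrix.mul_apply]
    simp only [Matrix.of_apply, QF.mul]
    rw [iterate_twD_mul _ _ _ _ _ _ i.2, Finset.sum_range]
  rw [this, Matrix.det_mul, Matrix.det_of_isLowerTriangular]
  · simp [leibCoeff_self]
  · intro i j hij
    exact leibCoeff_of_lt _ _ _ _ (by simpa using hij)

theorem twr_one_cons (L : List QF) : twr (⟨0, 1⟩ :: L) = twr (L.map QF.der) := by
  rw [twr_map, twr]
  change Matrix.det (n := Fin (L.length + 1)) _ = _
  rw [Matrix.det_succ_column_zero, Finset.sum_eq_single 0]
  · simp only [Fin.val_zero, pow_zero, one_mul, Matrix.of_apply]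
    change (1 : RatFunc ℝ) * _ = _
    rw [one_mul]
    congr 1
  · intro i _ hi
    obtain ⟨k, rfl⟩ := Fin.exists_succ_eq.2 hi
    have : (twD 0)^[(k : ℕ) + 1] (1 : RatFunc ℝ) = 0 := by
      rw [Function.iterate_succ_apply]
      have h1 : twD 0 1 = 0 := by simp [twD]
      rw [h1]
      exact Function.iterate_fixed (twD_zero 0) _
    simp only [Matrix.of_apply]
    change _ * (twD 0)^[(k : ℕ) + 1] (1 : RatFunc ℝ) * _ = 0
    rw [this]; ring
  · simp

/-- Crum's reduction: divide all functions by `φ`, expand along the column `(1, 0, …, 0)`, multiply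
back by `φ`. The division involves one function more than the multiplication, which leaves one
factor `φ.f`. -/
theorem twr_cons {φ : QF} (hφ : φ.f ≠ 0) (L : List QF) :
    twr (φ :: L) = φ.f * twr (L.map φ.step) := by
  let d : QF → QF := fun y => ⟨y.ω - φ.ω, y.f / φ.f⟩
  have e1 : φ :: L = ((⟨0, 1⟩ : QF) :: L.map d).map φ.mul := by
    rw [List.map_cons, List.map_map]
    have h1 : φ.mul ⟨0, 1⟩ = φ := by simp [QF.mul]
    have h2 : φ.mul ∘ d = id := by
      funext y
      simp only [Function.comp, QF.mul, d, id]
      congr 1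
      · ring
      · field_simp
    rw [h1, h2, List.map_id]
  have e2 : L.map φ.step = ((L.map d).map QF.der).map φ.mul := by
    rw [List.map_map, List.map_map]
    refine List.map_congr_left fun y _ => ?_
    simp only [Function.comp, QF.mul, d, QF.step, QF.der, QF.lg, twD]
    congr 1
    · ring
    · rw [ratDeriv_div _ _ hφ]; field_simp; ring
  rw [e1, twr_map_mul, twr_one_cons, e2, twr_map_mul]
  simp only [List.length_cons, List.length_map, pow_succ]
  ring

theorem twr_nil : twr [] = 1 := by rw [twr]; exact Matrix.det_fin_zero

/-- The iterated Darboux transform of `y` with respect to the seeds `L`. -/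
def trans : List QF → QF → QF
  | [], y => y
  | φ :: L, y => trans (L.map φ.step) (φ.step y)
termination_by L => L.length
decreasing_by simp

/-- The seeds `L` remain nonzero during the successive Darboux transformations. -/
def Nondeg : List QF → Prop
  | [] => True
  | φ :: L => φ.f ≠ 0 ∧ Nondeg (L.map φ.step)
termination_by L => L.length
decreasing_by simp

/-- The recursions along a chain replace the tail by its image under `g φ`, so the induction has to
run on the length. -/
theorem length_induction {κ : Type*} (g : κ → κ → κ) {P : List κ → Prop} (nil : P [])
    (cons : ∀ φ L, P (L.map (g φ)) → P (φ :: L)) (L : List κ) : P L := by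
  obtain ⟨n, hn⟩ : ∃ n, L.length = n := ⟨_, rfl⟩
  induction n generalizing L with
  | zero => rw [List.length_eq_zero_iff] at hn; rwa [hn]
  | succ n ih =>
    obtain ⟨φ, L, rfl⟩ := List.exists_cons_of_length_eq_add_one hn
    exact cons _ _ (ih _ (by simpa using hn))

theorem trans_ω (L : List QF) : ∀ y, (trans L y).ω = y.ω := by
  induction L using length_induction QF.step with
  | nil => intro y; rw [trans]
  | cons φ L ih => intro y; rw [trans, ih]; rfl

/-- Peeling off the seeds one by one leaves the last function after all Darboux steps. The ratio of
Wronskians in the claim is thus an iterated Darboux transform. -/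
theorem twr_append (L : List QF) : ∀ y, Nondeg L → twr (L ++ [y]) = twr L * (trans L y).f := by
  induction L using length_induction QF.step with
  | nil =>
    intro y _
    rw [twr_nil, trans, one_mul, List.nil_append, twr]
    simp
  | cons φ L ih =>
    intro y h
    rw [Nondeg] at h
    rw [trans, List.cons_append, twr_cons h.1, twr_cons h.1, List.map_append, List.map_cons,
      List.map_nil, ih _ h.2]
    ring

theorem twr_ne_zero (L : List QF) : Nondeg L → twr L ≠ 0 := by
  induction L using length_induction QF.step with
  | nil => intro _; rw [twr_nil]; exact one_ne_zero
  | cons φ L ih =>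
    intro h
    rw [Nondeg] at h
    rw [twr_cons h.1]
    exact mul_ne_zero h.1 (ih h.2)

/-- The sum of the log-derivatives of the successive seeds. -/
def lgSum : List QF → RatFunc ℝ
  | [] => 0
  | φ :: L => φ.lg + lgSum (L.map φ.step)
termination_by L => L.length
decreasing_by simp

/-- By `twr_cons` the Wronskian is the product of the successive seeds stripped of their
transcendental factors; the sum of the `ω` accounts for these factors. -/
theorem lgSum_eq (L : List QF) : Nondeg L →
    lgSum L = (L.map QF.ω).sum + ratDeriv (twr L) / twr L := by
  induction L using length_induction QF.step with
  | nil => intro _; rw [lgSum, twr_nil]; simp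
  | cons φ L ih =>
    intro h
    rw [Nondeg] at h
    have h1 := h.1
    have h2 := twr_ne_zero _ h.2
    rw [lgSum, ih h.2, twr_cons h.1, ratDeriv_mul, List.map_map, List.map_cons, List.sum_cons]
    have : (QF.ω ∘ φ.step) = QF.ω := rfl
    rw [this, QF.lg]
    field_simp
    ring

/-! ### Comparison with Wronskians of real functions -/

/-- `φ = μ f` on `(-1, 1)`, where `μ' = ω μ`. -/
structure Realizes (φ μ : ℝ → ℝ) (y : QF) : Prop where
  eq : ∀ x ∈ Ioo (-1 : ℝ) 1, φ x = μ x * rval y.f x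
  deriv : ∀ x ∈ Ioo (-1 : ℝ) 1, HasDerivAt μ (rval y.ω x * μ x) x
  regω : ∀ x ∈ Ioo (-1 : ℝ) 1, RegularAt y.ω x
  regf : ∀ x ∈ Ioo (-1 : ℝ) 1, RegularAt y.f x

theorem Realizes.iteratedDeriv {φ μ : ℝ → ℝ} {y : QF} (h : Realizes φ μ y) (n : ℕ) :
    ∀ x ∈ Ioo (-1 : ℝ) 1, RegularAt ((twD y.ω)^[n] y.f) x ∧
      iteratedDeriv n φ x = μ x * rval ((twD y.ω)^[n] y.f) x := by
  induction n with
  | zero => exact fun x hx => ⟨h.regf x hx, by simpa using h.eq x hx⟩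
  | succ n ih =>
    intro x hx
    have hr := (ih x hx).1
    have hv := hr.ratDeriv.valAt.add ((h.regω x hx).valAt.mul hr.valAt)
    rw [Function.iterate_succ_apply']
    refine ⟨hv.1, ?_⟩
    rw [iteratedDeriv_succ]
    have e : _root_.iteratedDeriv n φ =ᶠ[nhds x] fun x => μ x * rval ((twD y.ω)^[n] y.f) x := by
      filter_upwards [isOpen_Ioo.mem_nhds hx] with z hz
      exact (ih z hz).2
    rw [e.deriv_eq, ((h.deriv x hx).fun_mul hr.hasDerivAt).deriv]
    have e2 : rval (twD y.ω ((twD y.ω)^[n] y.f)) x = _ := hv.2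
    rw [e2]
    ring

/-- Each column carries a single transcendental factor `μ z`; taking these out leaves the values of
the rational matrix whose determinant is `twr`. -/
theorem wronskian_eq {κ : Type*} {φ μ : κ → ℝ → ℝ} {Y : κ → QF} (Z : List κ)
    (h : ∀ z ∈ Z, Realizes (φ z) (μ z) (Y z)) {x : ℝ} (hx : x ∈ Ioo (-1 : ℝ) 1) :
    RegularAt (twr (Z.map Y)) x ∧
      wronskian (Z.map φ) x = (Z.map fun z => μ z x).prod * rval (twr (Z.map Y)) x := by
  have hv : ValAt x (Matrix.det (Matrix.of fun i j : Fin Z.length =>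
      rval ((twD (Y (Z.get j)).ω)^[i] (Y (Z.get j)).f) x)) (twr (Z.map Y)) := by
    rw [twr_map]
    refine (isPlace_valAt x).det fun i j => ?_
    exact (((h _ (List.get_mem _ _)).iteratedDeriv i x hx).1).valAt
  refine ⟨hv.1, ?_⟩
  rw [hv.2, wronskian,
    ← Matrix.det_submatrix_equiv_self (finCongr (List.length_map (as := Z) φ)).symm]
  have e : (Matrix.of fun i j : Fin (Z.map φ).length =>
      iteratedDeriv i ((Z.map φ).get j) x).submatrix
        (finCongr (List.length_map (as := Z) φ)).symm
        (finCongr (List.length_map (as := Z) φ)).symm =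
      Matrix.of fun i j : Fin Z.length => μ (Z.get j) x *
        (Matrix.of fun i j : Fin Z.length =>
          rval ((twD (Y (Z.get j)).ω)^[i] (Y (Z.get j)).f) x) i j := by
    ext i j
    simp only [Matrix.submatrix_apply, Matrix.of_apply]
    rw [← ((h _ (List.get_mem _ _)).iteratedDeriv i x hx).2]
    simp
  rw [e, Matrix.det_mul_row]
  congr 1
  rw [← List.prod_ofFn]
  congr 1
  refine List.ext_get (by simp) fun n h1 h2 => by simp

/-! ### Rational functions with poles at most at `±1` -/

theorem x21_eq : x21 = toRat (X ^ 2 - 1) := by simp [x21, toRat]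

theorem x21_ne_zero : x21 ≠ 0 := by
  rw [x21_eq]
  exact toRat_ne_zero (by
    have := (monic_X_pow_sub_C (1 : ℝ) two_ne_zero).ne_zero
    simpa using this)

/-- The rational functions with poles at most at `±1`. -/
def poleRing : Subring (RatFunc ℝ) where
  carrier := {f | ∃ (m : ℕ) (N : ℝ[X]), f * x21 ^ m = toRat N}
  mul_mem' := by
    rintro f g ⟨m, N, h⟩ ⟨m', N', h'⟩
    exact ⟨m + m', N * N', by rw [toRat_mul, ← h, ← h', pow_add]; ring⟩
  one_mem' := ⟨0, 1, by simp⟩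
  add_mem' := by
    rintro f g ⟨m, N, h⟩ ⟨m', N', h'⟩
    refine ⟨m + m', N * (X ^ 2 - 1) ^ m' + N' * (X ^ 2 - 1) ^ m, ?_⟩
    rw [toRat, map_add, ← toRat, ← toRat, toRat_mul, toRat_mul, toRat_pow, toRat_pow, ← x21_eq,
      ← h, ← h', pow_add]
    ring
  zero_mem' := ⟨0, 0, by simp⟩
  neg_mem' := by
    rintro f ⟨m, N, h⟩
    exact ⟨m, -N, by rw [toRat, map_neg, ← toRat, ← h]; ring⟩

theorem toRat_mem_poleRing (P : ℝ[X]) : toRat P ∈ poleRing := ⟨0, P, by simp⟩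

theorem C_mem_poleRing (c : ℝ) : RatFunc.C c ∈ poleRing := ⟨0, C c, by simp [toRat]⟩

theorem X_mem_poleRing : RatFunc.X ∈ poleRing := ⟨0, X, by simp [toRat]⟩

theorem inv_sub_mem_poleRing : (RatFunc.X - 1 : RatFunc ℝ)⁻¹ ∈ poleRing := by
  refine ⟨1, X + 1, ?_⟩
  have := X_sub_C_ne_zero 1
  rw [map_one] at this
  simp only [toRat, map_add, map_one, RatFunc.algebraMap_X, x21]
  field_simp
  ring

theorem inv_add_mem_poleRing : (RatFunc.X + 1 : RatFunc ℝ)⁻¹ ∈ poleRing := by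
  refine ⟨1, X - 1, ?_⟩
  have := X_sub_C_ne_zero (-1)
  rw [map_neg, map_one, sub_neg_eq_add] at this
  simp only [toRat, map_sub, map_one, RatFunc.algebraMap_X, x21]
  field_simp
  ring

theorem ratDeriv_mem_poleRing {f : RatFunc ℝ} (hf : f ∈ poleRing) : ratDeriv f ∈ poleRing := by
  obtain ⟨m, N, h⟩ := hf
  refine ⟨m + 1, derivative N * (X ^ 2 - 1) - (m : ℝ[X]) * (2 * X) * N, ?_⟩
  have hd : ratDeriv x21 = 2 * RatFunc.X := by
    rw [x21, ratDeriv_sub, ratDeriv_pow]; simp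
  have h' := congrArg ratDeriv h
  rw [ratDeriv_mul, ratDeriv_pow, ratDeriv_toRat, hd] at h'
  have e : toRat (derivative N * (X ^ 2 - 1) - (m : ℝ[X]) * (2 * X) * N) =
      toRat (derivative N) * x21 - (m : RatFunc ℝ) * (2 * RatFunc.X) * toRat N := by
    have h2 : (algebraMap ℝ[X] (RatFunc ℝ)) 2 = 2 := map_ofNat _ 2
    rw [x21_eq]; simp [toRat, h2]
  rw [e, ← h', ← h]
  rcases m with _ | m
  · simp
  · rw [Nat.add_sub_cancel]; ring

theorem twr_mem_poleRing {L : List QF} (h : ∀ y ∈ L, y.ω ∈ poleRing ∧ y.f ∈ poleRing) :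
    twr L ∈ poleRing := by
  rw [twr, Matrix.det_apply']
  refine Subring.sum_mem _ fun σ _ => Subring.mul_mem _ (intCast_mem _ _)
    (Subring.prod_mem _ fun i _ => ?_)
  have hi := h _ (List.get_mem L i)
  rw [Matrix.of_apply]
  have : ∀ n : ℕ, (twD (L.get i).ω)^[n] (L.get i).f ∈ poleRing := by
    intro n
    induction n with
    | zero => exact hi.2
    | succ n ih =>
      rw [Function.iterate_succ_apply']
      exact Subring.add_mem _ (ratDeriv_mem_poleRing ih) (Subring.mul_mem _ hi.1 ih)
  exact this _

/-- The reduced denominator divides a power of `x² - 1` and is coprime to it, hence is `1`. -/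
theorem exists_polynomial_of_mem_poleRing {f : RatFunc ℝ} (hf : f ∈ poleRing)
    (h1 : RegularAt f 1) (h2 : RegularAt f (-1)) : ∃ P : ℝ[X], f = toRat P := by
  obtain ⟨m, N, h⟩ := hf
  have h0 : (X ^ 2 - 1 : ℝ[X]) ≠ 0 := fun h0 => x21_ne_zero (by rw [x21_eq, h0]; simp)
  have hdvd : f.denom ∣ (X ^ 2 - 1) ^ m := by
    refine (RatFunc.denom_dvd (pow_ne_zero m h0)).2 ⟨N, ?_⟩
    rw [eq_div_iff (toRat_ne_zero (pow_ne_zero m h0)), toRat_pow, ← x21_eq, h]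
  have c : ∀ a : ℝ, f.denom.eval a ≠ 0 → IsCoprime f.denom (X - C a) := by
    intro a ha
    refine ((irreducible_X_sub_C a).coprime_iff_not_dvd.2 fun hd => ha ?_).symm
    exact dvd_iff_isRoot.1 hd
  have e : (X ^ 2 - 1 : ℝ[X]) = (X - C 1) * (X - C (-1)) := by
    simp only [map_one, map_neg]; ring
  have hc : IsCoprime f.denom ((X ^ 2 - 1) ^ m) := by
    rw [e]; exact ((c 1 h1).mul_right (c _ h2)).pow_right
  have hu : IsUnit f.denom := hc.isUnit_of_dvd' dvd_rfl hdvd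
  have h3 : f.denom = 1 := (RatFunc.monic_denom f).eq_one_of_isUnit hu
  refine ⟨f.num, ?_⟩
  conv_lhs => rw [← RatFunc.num_div_denom f, h3]
  simp [toRat]

/-! ### The classical Jacobi polynomials -/

theorem succ_mul_choose (r : ℝ) (j : ℕ) :
    ((j : ℝ) + 1) * Ring.choose r (j + 1) = (r - j) * Ring.choose r j := by
  have h1 := Ring.descPochhammer_eq_factorial_smul_choose r j
  have h2 := Ring.descPochhammer_eq_factorial_smul_choose r (j + 1)
  rw [descPochhammer_succ_right, Polynomial.smeval_mul, h1, Nat.factorial_succ] at h2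
  have e : (X - (j : ℤ[X])).smeval r = r - j := by
    rw [Polynomial.smeval_sub, Polynomial.smeval_X, Polynomial.smeval_natCast]; simp
  rw [e] at h2
  simp only [nsmul_eq_mul] at h2
  push_cast at h2
  have hf : ((j.factorial : ℕ) : ℝ) ≠ 0 := by exact_mod_cast j.factorial_ne_zero
  refine mul_left_cancel₀ hf ?_
  linear_combination -h2

theorem factorial_mul_choose (r : ℝ) (n : ℕ) :
    (n.factorial : ℝ) * Ring.choose r n = ∏ j ∈ Finset.range n, (r - j) := by
  induction n with
  | zero => simp
  | succ n ih =>
    rw [Finset.prod_range_succ, ← ih, Nat.factorial_succ]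
    push_cast
    linear_combination (n.factorial : ℝ) * succ_mul_choose r n

theorem ascPochhammer_eval_eq_prod (x : ℝ) (n : ℕ) :
    (ascPochhammer ℝ n).eval x = ∏ j ∈ Finset.range n, (x + j) := by
  induction n with
  | zero => simp
  | succ n ih => rw [ascPochhammer_succ_eval, ih, Finset.prod_range_succ]

theorem factorial_mul_choose_eq_ascPochhammer (s : ℝ) (n : ℕ) :
    (n.factorial : ℝ) * Ring.choose (2 * n + s) n =
      (ascPochhammer ℝ n).eval ((n : ℝ) + s + 1) := by
  rw [factorial_mul_choose, ascPochhammer_eval_eq_prod, ← Finset.prod_range_reflect]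
  refine Finset.prod_congr rfl fun j hj => ?_
  have h := Finset.mem_range.1 hj
  rw [Nat.cast_sub (by omega), Nat.cast_sub (by omega)]
  push_cast
  ring

theorem C_mul_C_mul (c d : ℝ) (P : ℝ[X]) : C c * (C d * P) = C (c * d) * P := by
  rw [← mul_assoc, ← C_mul]

/-- `P` is an eigenpolynomial of the classical Jacobi operator. -/
def IsEig (a b lam : ℝ) (P : ℝ[X]) : Prop :=
  (X ^ 2 - 1) * derivative (derivative P) +
    (C (a + 1) * (X + 1) + C (b + 1) * (X - 1)) * derivative P = C lam * P

theorem IsEig.add {a b lam : ℝ} {P Q : ℝ[X]} (hP : IsEig a b lam P) (hQ : IsEig a b lam Q) :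
    IsEig a b lam (P + Q) := by
  unfold IsEig at *
  simp only [map_add] at *
  linear_combination hP + hQ

theorem IsEig.C_mul {a b lam : ℝ} {P : ℝ[X]} (hP : IsEig a b lam P) (c : ℝ) :
    IsEig a b lam (C c * P) := by
  unfold IsEig at *
  simp only [derivative_C_mul]
  linear_combination C c * hP

theorem deriv_uv (k l : ℕ) : derivative ((X - 1 : ℝ[X]) ^ k * (X + 1) ^ l) =
    (k : ℝ[X]) * ((X - 1) ^ (k - 1) * (X + 1) ^ l) +
    (l : ℝ[X]) * ((X - 1) ^ k * (X + 1) ^ (l - 1)) := by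
  rw [derivative_mul, derivative_pow, derivative_pow]
  simp
  ring

/-- In the basis `(x-1)^k (x+1)^l` with `k + l` fixed, the Jacobi operator is tridiagonal. -/
theorem jacobi_op_uv (a b : ℝ) (k l : ℕ) :
    (X ^ 2 - 1) * derivative (derivative ((X - 1 : ℝ[X]) ^ k * (X + 1) ^ l)) +
      (C (a + 1) * (X + 1) + C (b + 1) * (X - 1)) *
        derivative ((X - 1 : ℝ[X]) ^ k * (X + 1) ^ l) =
    C (k * (k + a)) * ((X - 1) ^ (k - 1) * (X + 1) ^ (l + 1)) +
    C (2 * k * l + (a + 1) * l + (b + 1) * k) * ((X - 1) ^ k * (X + 1) ^ l) +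
    C (l * (l + b)) * ((X - 1) ^ (k + 1) * (X + 1) ^ (l - 1)) := by
  have d : ∀ (m : ℕ) (P : ℝ[X]), derivative ((m : ℝ[X]) * P) = m * derivative P := by
    intro m P; rw [derivative_mul, derivative_natCast]; ring
  rw [deriv_uv, derivative_add, d, d, deriv_uv, deriv_uv]
  have e : (X ^ 2 - 1 : ℝ[X]) = (X - 1) * (X + 1) := by ring
  rw [e]
  simp only [map_add, map_mul, map_one, map_natCast, map_ofNat]
  generalize (X - 1 : ℝ[X]) = u
  generalize (X + 1 : ℝ[X]) = v
  -- Truncated subtraction in the exponents makes the values `0` and `1` separate cases.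
  rcases k with _ | _ | k <;> rcases l with _ | _ | l <;>
    simp only [Nat.zero_sub, Nat.add_sub_cancel, pow_succ, pow_zero, Nat.cast_zero, Nat.cast_add,
      Nat.cast_one, Nat.reduceAdd, zero_add, Nat.reduceSub] <;> ring

/-- The coefficients of the Jacobi polynomials in powers of `x - 1` and `x + 1`. -/
def jacobiCoeff (n : ℕ) (a b : ℝ) (k : ℕ) : ℝ :=
  Ring.choose ((n : ℝ) + a) (n - k) * Ring.choose ((n : ℝ) + b) k

/-- This recursion turns each off-diagonal contribution of `jacobi_op_uv` into a multiple of the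
neighbouring coefficient, so that in `jacobiP_isEig` the sum collapses onto the diagonal. -/
theorem jacobiCoeff_succ {n k : ℕ} (a b : ℝ) (h : k < n) :
    ((k : ℝ) + 1) * (k + 1 + a) * jacobiCoeff n a b (k + 1) =
      ((n - k : ℕ) : ℝ) * ((n - k : ℕ) + b) * jacobiCoeff n a b k := by
  obtain ⟨l, rfl⟩ : ∃ l, n = k + l + 1 := ⟨n - k - 1, by omega⟩
  have e1 : k + l + 1 - k = l + 1 := by omega
  have e2 : k + l + 1 - (k + 1) = l := by omega
  have h1 := succ_mul_choose (((k + l + 1 : ℕ) : ℝ) + a) l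
  have h2 := succ_mul_choose (((k + l + 1 : ℕ) : ℝ) + b) k
  rw [jacobiCoeff, jacobiCoeff, e1, e2]
  push_cast at *
  linear_combination (k + 1 + a) * Ring.choose ((k : ℝ) + l + 1 + a) l * h2 -
    (l + 1 + b) * Ring.choose ((k : ℝ) + l + 1 + b) k * h1

theorem jacobiP_eq (n : ℕ) (a b : ℝ) : jacobiP n a b = C ((1 / 2 : ℝ) ^ n) *
    ∑ k ∈ Finset.range (n + 1), C (jacobiCoeff n a b k) * ((X - 1) ^ k * (X + 1) ^ (n - k)) := by
  simp only [jacobiP, jacobiCoeff, mul_assoc]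

theorem jacobiP_isEig (n : ℕ) (a b : ℝ) : IsEig a b (n * (n + a + b + 1)) (jacobiP n a b) := by
  rw [jacobiP_eq]
  refine IsEig.C_mul ?_ _
  have h1 : ∑ k ∈ Finset.range (n + 1), C (jacobiCoeff n a b k) *
      (C (k * (k + a)) * ((X - 1) ^ (k - 1) * (X + 1) ^ (n - k + 1))) =
      ∑ k ∈ Finset.range (n + 1), C (jacobiCoeff n a b k) *
      (C ((n - k : ℕ) * ((n - k : ℕ) + b)) * ((X - 1) ^ k * (X + 1) ^ (n - k))) := by
    rw [Finset.sum_range_succ', Finset.sum_range_succ _ n]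
    simp only [Nat.cast_zero, zero_mul, map_zero, mul_zero, add_zero, Nat.sub_self]
    refine Finset.sum_congr rfl fun k hk => ?_
    have hk := Finset.mem_range.1 hk
    have h := jacobiCoeff_succ a b hk
    rw [C_mul_C_mul, C_mul_C_mul]
    congr 2
    · push_cast; linear_combination h
    · congr 2
      omega
  have h2 : ∑ k ∈ Finset.range (n + 1), C (jacobiCoeff n a b k) *
      (C ((n - k : ℕ) * ((n - k : ℕ) + b)) * ((X - 1) ^ (k + 1) * (X + 1) ^ (n - k - 1))) =
      ∑ k ∈ Finset.range (n + 1), C (jacobiCoeff n a b k) *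
      (C (k * (k + a)) * ((X - 1) ^ k * (X + 1) ^ (n - k))) := by
    rw [Finset.sum_range_succ, Finset.sum_range_succ' _ n]
    simp only [Nat.cast_zero, zero_mul, map_zero, mul_zero, add_zero, Nat.sub_self]
    refine Finset.sum_congr rfl fun k hk => ?_
    have hk := Finset.mem_range.1 hk
    have h := jacobiCoeff_succ a b hk
    rw [C_mul_C_mul, C_mul_C_mul]
    congr 2
    push_cast; linear_combination -h
  unfold IsEig
  simp only [derivative_sum, derivative_C_mul]
  rw [Finset.mul_sum, Finset.mul_sum, ← Finset.sum_add_distrib, Finset.mul_sum]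
  have h3 : ∀ k ∈ Finset.range (n + 1),
      (X ^ 2 - 1) * (C (jacobiCoeff n a b k) *
        derivative (derivative ((X - 1) ^ k * (X + 1) ^ (n - k)))) +
      (C (a + 1) * (X + 1) + C (b + 1) * (X - 1)) * (C (jacobiCoeff n a b k) *
        derivative ((X - 1) ^ k * (X + 1) ^ (n - k))) =
      C (jacobiCoeff n a b k) *
        (C (k * (k + a)) * ((X - 1) ^ (k - 1) * (X + 1) ^ (n - k + 1))) +
      C (jacobiCoeff n a b k) *
        (C (2 * k * (n - k : ℕ) + (a + 1) * (n - k : ℕ) + (b + 1) * k) *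
          ((X - 1) ^ k * (X + 1) ^ (n - k))) +
      C (jacobiCoeff n a b k) *
        (C ((n - k : ℕ) * ((n - k : ℕ) + b)) * ((X - 1) ^ (k + 1) * (X + 1) ^ (n - k - 1))) := by
    intro k _
    linear_combination C (jacobiCoeff n a b k) * jacobi_op_uv a b k (n - k)
  rw [Finset.sum_congr rfl h3, Finset.sum_add_distrib, Finset.sum_add_distrib, h1, h2,
    ← Finset.sum_add_distrib, ← Finset.sum_add_distrib]
  refine Finset.sum_congr rfl fun k hk => ?_
  have hk : k ≤ n := Nat.lt_succ_iff.1 (Finset.mem_range.1 hk)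
  rw [← mul_add, ← mul_add, ← add_mul, ← add_mul, ← C_add, ← C_add, C_mul_C_mul, C_mul_C_mul]
  congr 2
  rw [Nat.cast_sub hk]
  ring

theorem natDegree_uv_le (k l : ℕ) : ((X - 1 : ℝ[X]) ^ k * (X + 1) ^ l).natDegree ≤ k + l := by
  refine natDegree_mul_le.trans (add_le_add ?_ ?_)
  · refine natDegree_pow_le.trans ?_
    have : (X - 1 : ℝ[X]).natDegree = 1 := by simpa using natDegree_X_sub_C (1 : ℝ)
    rw [this, mul_one]
  · refine natDegree_pow_le.trans ?_
    have : (X + 1 : ℝ[X]).natDegree = 1 := by simpa using natDegree_X_add_C (1 : ℝ)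
    rw [this, mul_one]

theorem coeff_uv (k l : ℕ) : ((X - 1 : ℝ[X]) ^ k * (X + 1) ^ l).coeff (k + l) = 1 := by
  have m1 : (X - 1 : ℝ[X]).Monic := by simpa using monic_X_sub_C (1 : ℝ)
  have m2 : (X + 1 : ℝ[X]).Monic := by simpa using monic_X_add_C (1 : ℝ)
  have n1 : (X - 1 : ℝ[X]).natDegree = 1 := by simpa using natDegree_X_sub_C (1 : ℝ)
  have n2 : (X + 1 : ℝ[X]).natDegree = 1 := by simpa using natDegree_X_add_C (1 : ℝ)
  have m := (m1.pow k).mul (m2.pow l)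
  have n : ((X - 1 : ℝ[X]) ^ k * (X + 1) ^ l).natDegree = k + l := by
    rw [(m1.pow k).natDegree_mul (m2.pow l), natDegree_pow, natDegree_pow, n1, n2]; ring
  have := m.coeff_natDegree
  rwa [n] at this

theorem jacobiP_natDegree_le (n : ℕ) (a b : ℝ) : (jacobiP n a b).natDegree ≤ n := by
  rw [jacobiP_eq]
  refine (natDegree_C_mul_le _ _).trans (natDegree_sum_le_of_forall_le _ _ fun k hk => ?_)
  have hk : k ≤ n := Nat.lt_succ_iff.1 (Finset.mem_range.1 hk)
  refine (natDegree_C_mul_le _ _).trans ((natDegree_uv_le _ _).trans (by omega))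

/-- Every product `(x-1)^k (x+1)^(n-k)` is monic, so the top coefficient is a sum of products of
binomials, evaluated by Chu–Vandermonde. -/
theorem jacobiP_coeff (n : ℕ) (a b : ℝ) : 2 ^ n * (n.factorial : ℝ) * (jacobiP n a b).coeff n =
    (ascPochhammer ℝ n).eval ((n : ℝ) + (a + b) + 1) := by
  rw [← factorial_mul_choose_eq_ascPochhammer, jacobiP_eq, coeff_C_mul, finsetSum_coeff]
  have h : ∀ k ∈ Finset.range (n + 1), (C (jacobiCoeff n a b k) *
      ((X - 1 : ℝ[X]) ^ k * (X + 1) ^ (n - k))).coeff n = jacobiCoeff n a b k := by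
    intro k hk
    have hk : k ≤ n := Nat.lt_succ_iff.1 (Finset.mem_range.1 hk)
    have := coeff_uv k (n - k)
    rw [Nat.add_sub_cancel' hk] at this
    rw [coeff_C_mul, this, mul_one]
  rw [Finset.sum_congr rfl h]
  have e : (2 * (n : ℝ) + (a + b)) = ((n : ℝ) + b) + (n + a) := by ring
  rw [e, Ring.add_choose_eq _ (Commute.all _ _),
    Finset.Nat.sum_antidiagonal_eq_sum_range_succ
      (fun i j => Ring.choose ((n : ℝ) + b) i * Ring.choose ((n : ℝ) + a) j)]
  have e2 : ∀ S : ℝ, (2 : ℝ) ^ n * n.factorial * ((1 / 2) ^ n * S) = n.factorial * S := by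
    intro S
    rw [one_div, inv_pow]; field_simp
  rw [e2]
  congr 1
  exact Finset.sum_congr rfl fun k _ => mul_comm _ _

theorem jacobiP_eval_one (n : ℕ) (a b : ℝ) :
    (jacobiP n a b).eval 1 = Ring.choose ((n : ℝ) + a) n := by
  rw [jacobiP_eq, eval_mul, eval_finsetSum, Finset.sum_eq_single 0]
  · simp only [jacobiCoeff]
    simp
    rw [mul_left_comm, one_add_one_eq_two, inv_mul_cancel₀ (pow_ne_zero n two_ne_zero), mul_one]
  · intro k _ hk
    simp [hk]
  · simp

/-- The value at `1` is a binomial coefficient, which could vanish only for an integer `a`. -/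
theorem jacobiP_ne_zero (n : ℕ) {a : ℝ} (b : ℝ) (ha : ¬ IsInt a) : jacobiP n a b ≠ 0 := by
  intro h
  have h1 := jacobiP_eval_one n a b
  rw [h, eval_zero] at h1
  have h2 := factorial_mul_choose ((n : ℝ) + a) n
  rw [← h1, mul_zero, eq_comm, Finset.prod_eq_zero_iff] at h2
  obtain ⟨j, -, hj⟩ := h2
  exact ha ⟨j - n, by push_cast; linarith⟩

/-! ### Local analysis of Riccati equations -/

theorem x21_eq_mul : x21 = (RatFunc.X - 1) * (RatFunc.X + 1) := by rw [x21]; ring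

theorem X_sub_one_ne_zero : (RatFunc.X - 1 : RatFunc ℝ) ≠ 0 := by
  have := X_sub_C_ne_zero 1; rwa [map_one] at this

theorem X_add_one_ne_zero : (RatFunc.X + 1 : RatFunc ℝ) ≠ 0 := by
  have := X_sub_C_ne_zero (-1); rwa [map_neg, map_one, sub_neg_eq_add] at this

/-- The log-derivative `e/(x-1) + e'/(x+1)` of `(1-x)^e (1+x)^e'`. -/
def gam (e e' : ℝ) : RatFunc ℝ :=
  RatFunc.C e / (RatFunc.X - 1) + RatFunc.C e' / (RatFunc.X + 1)

theorem eta_eq (a b : ℝ) : eta a b = gam (a + 1) (b + 1) := rfl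

theorem gam_add (e e' d d' : ℝ) : gam (e + d) (e' + d') = gam e e' + gam d d' := by
  simp only [gam, map_add]; ring

theorem gam_zero : gam 0 0 = 0 := by simp [gam]

theorem ratDeriv_gam (e e' : ℝ) : ratDeriv (gam e e') =
    -(RatFunc.C e / (RatFunc.X - 1) ^ 2) - RatFunc.C e' / (RatFunc.X + 1) ^ 2 := by
  rw [gam, ratDeriv_add, ratDeriv_div _ _ X_sub_one_ne_zero, ratDeriv_div _ _ X_add_one_ne_zero,
    ratDeriv_sub, ratDeriv_add, ratDeriv_C, ratDeriv_C, ratDeriv_X, ratDeriv_one]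
  ring

theorem valAt_X_sub (c z : ℝ) : ValAt c (c - z) (RatFunc.X - RatFunc.C z) :=
  (isPlace_valAt c).sub (valAt_X c) (valAt_C c z)

theorem valAt_X_sub_self (c : ℝ) : ValAt c 0 (RatFunc.X - RatFunc.C c) := by
  have := valAt_X_sub c c; rwa [sub_self] at this

theorem valInf_inv_X : ValInf 0 (RatFunc.X⁻¹) :=
  ⟨1, X, X_ne_zero, by simp, by rw [toRat_X]; simp [toRat], by simp [coeff_one]⟩

theorem C_neg_one : RatFunc.C (-1 : ℝ) = -1 := by simp

theorem gam_valAt_one (e e' : ℝ) : ValAt 1 e ((RatFunc.X - RatFunc.C 1) * gam e e') := by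
  have P := isPlace_valAt 1
  have h2 := valAt_X_sub 1 (-1)
  have h := P.add (P.const e) (P.mul (valAt_X_sub_self 1) (P.div (P.const e') h2 (by norm_num)))
  rw [zero_mul, add_zero] at h
  convert! h using 1
  have := X_sub_one_ne_zero
  have := X_add_one_ne_zero
  rw [gam, C_neg_one, map_one, sub_neg_eq_add]
  field_simp

theorem gam_valAt_neg_one (e e' : ℝ) :
    ValAt (-1) e' ((RatFunc.X - RatFunc.C (-1)) * gam e e') := by
  have P := isPlace_valAt (-1)
  have h2 := valAt_X_sub (-1) 1
  have h := P.add (P.const e') (P.mul (valAt_X_sub_self (-1))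
    (P.div (P.const e) h2 (by norm_num)))
  rw [zero_mul, add_zero] at h
  convert! h using 1
  have := X_sub_one_ne_zero
  have := X_add_one_ne_zero
  rw [gam, C_neg_one, map_one, sub_neg_eq_add]
  field_simp
  ring

theorem X_div_valInf (z : ℝ) : ValInf 1 (RatFunc.X / (RatFunc.X - RatFunc.C z)) := by
  have P := isPlace_valInf
  have h1 := P.sub P.one (P.mul (P.const z) valInf_inv_X)
  rw [mul_zero, sub_zero] at h1
  have h := P.inv h1 one_ne_zero
  rw [inv_one] at h
  convert! h using 1
  have := X_sub_C_ne_zero z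
  have := RatFunc.X_ne_zero (K := ℝ)
  field_simp

theorem gam_valInf (e e' : ℝ) : ValInf (e + e') (RatFunc.X * gam e e') := by
  have P := isPlace_valInf
  have h := P.add (P.mul (P.const e) (X_div_valInf 1)) (P.mul (P.const e') (X_div_valInf (-1)))
  rw [mul_one, mul_one] at h
  convert! h using 1
  rw [gam, C_neg_one, map_one, sub_neg_eq_add]
  ring

/-- A log-derivative with vanishing residue is regular. -/
theorem regularAt_of_residue_zero {c : ℝ} {v : RatFunc ℝ}
    (h : ValAt c 0 ((RatFunc.X - RatFunc.C c) * v)) : RegularAt v c := by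
  have P := isPlace_valAt c
  have t0 := P.t0
  by_cases hv : v = 0
  · rw [hv]; exact P.zero.1
  obtain ⟨m, u, hu, hm⟩ := P.ord v hv
  rcases lt_or_ge m 0 with hlt | hge
  · exfalso
    obtain ⟨k, rfl⟩ : ∃ k : ℕ, m = -(k + 1 : ℕ) := ⟨(-m - 1).toNat, by omega⟩
    have h3 := P.mul h (P.pow (valAt_X_sub_self c) k)
    rw [zero_mul, mul_right_comm, ← pow_succ', mul_comm] at h3
    rw [neg_neg, zpow_natCast] at hm
    exact hu (P.unique hm h3)
  · obtain ⟨k, rfl⟩ : ∃ k : ℕ, m = k := ⟨m.toNat, by omega⟩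
    have h3 := P.mul hm (P.pow (valAt_X_sub_self c) k)
    rw [zpow_neg, zpow_natCast, inv_mul_cancel_right₀ (pow_ne_zero k t0)] at h3
    exact h3.1

theorem valAt_zero_of_regularAt {c : ℝ} {v : RatFunc ℝ} (h : RegularAt v c) :
    ValAt c 0 ((RatFunc.X - RatFunc.C c) * v) := by
  have := (isPlace_valAt c).mul (valAt_X_sub_self c) h.valAt
  rwa [zero_mul] at this

theorem regularAt_iff_of_residue {c e : ℝ} {v : RatFunc ℝ}
    (h : ValAt c e ((RatFunc.X - RatFunc.C c) * v)) : RegularAt v c ↔ e = 0 :=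
  ⟨fun h' => (isPlace_valAt c).unique h (valAt_zero_of_regularAt h'),
    fun he => regularAt_of_residue_zero (he ▸ h)⟩

/-- A nonzero rational function whose log-derivative has no residue at `c` is regular and
nonzero at `c`. -/
theorem exists_valAt_of_logDeriv {c : ℝ} {f : RatFunc ℝ} (hf : f ≠ 0)
    (h : ValAt c 0 ((RatFunc.X - RatFunc.C c) * (ratDeriv f / f))) : ∃ v, v ≠ 0 ∧ ValAt c v f := by
  obtain ⟨m, v, hv, h1, h2⟩ := (isPlace_valAt c).exists_logDeriv hf
  have : (m : ℝ) = 0 := (isPlace_valAt c).unique h2 h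
  have hm : m = 0 := by exact_mod_cast this
  rw [hm, neg_zero, zpow_zero, mul_one] at h1
  exact ⟨v, hv, h1⟩

/-! ### Solutions of Riccati equations at a simple zero of `p` and at infinity -/

section Riccati

variable {T : DiffOp} {w : RatFunc ℝ} {lam c pv qv rv : ℝ}

/-- At a simple zero of `p`, a pole of order `k + 2` of `w` would leave the term `p w²`, of order
`2k + 3`, uncompensated. So `w` has at most a simple pole. -/
theorem exists_residue (hp : ValAt c pv (T.p / (RatFunc.X - RatFunc.C c))) (hpv : pv ≠ 0)
    (hq : ValAt c qv T.q) (hr : ValAt c rv T.r) (h : w ∈ ricSet T lam) :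
    ∃ e, ValAt c e ((RatFunc.X - RatFunc.C c) * w) := by
  have P := isPlace_valAt c
  by_cases hw : w = 0
  · exact ⟨0, by rw [hw, mul_zero]; exact P.zero⟩
  have t0 := P.t0
  have tv := valAt_X_sub_self c
  set t := RatFunc.X - RatFunc.C c with ht
  obtain ⟨m, v, hv, hm⟩ := P.ord w hw
  rcases lt_or_ge m (-1) with hlt | hge
  · exfalso
    obtain ⟨k, rfl⟩ : ∃ k : ℕ, m = -(k + 2 : ℕ) := ⟨(-m - 2).toNat, by omega⟩
    rw [neg_neg, zpow_natCast] at hm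
    have tk := P.pow tv (k + 1)
    have h0 : (0 : ℝ) ^ (k + 1) = 0 := by simp
    have h1 : T.p * (ratDeriv w + w ^ 2) + T.q * w + T.r = RatFunc.C lam := h
    have h2 := P.add (P.add (P.mul hp (P.add (P.mul tk (P.sub (P.theta hm)
      (P.mul (P.const ((k + 2 : ℕ) : ℝ)) hm))) (P.pow hm 2))) (P.mul hq (P.mul tk hm)))
      (P.mul (P.sub hr (P.const lam)) (P.pow tv (2 * k + 3)))
    have e : T.p / t * (t ^ (k + 1) * (t * ratDeriv (w * t ^ (k + 2)) -
        RatFunc.C ((k + 2 : ℕ) : ℝ) * (w * t ^ (k + 2))) + (w * t ^ (k + 2)) ^ 2) +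
        T.q * (t ^ (k + 1) * (w * t ^ (k + 2))) + (T.r - RatFunc.C lam) * t ^ (2 * k + 3)
        = 0 := by
      rw [← h1, ratDeriv_mul, ratDeriv_pow, P.dt, map_natCast,
        show k + 2 - 1 = k + 1 by omega]
      field_simp
      ring
    rw [e] at h2
    have h3 := P.unique h2 P.zero
    simp only [h0, zero_mul, mul_zero, add_zero, zero_add,
      zero_pow (show 2 * k + 3 ≠ 0 by omega)] at h3
    exact mul_ne_zero hpv (pow_ne_zero 2 hv) h3
  · obtain ⟨k, hk⟩ : ∃ k : ℕ, m = k - 1 := ⟨(m + 1).toNat, by omega⟩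
    refine ⟨v * 0 ^ k, ?_⟩
    convert! P.mul hm (P.pow tv k) using 1
    rw [hk, neg_sub, zpow_sub₀ t0, zpow_one, zpow_natCast]
    field_simp

/-- The leading terms of the Riccati equation at `c` form the indicial equation. -/
theorem residue_eq (hp : ValAt c pv (T.p / (RatFunc.X - RatFunc.C c)))
    (hq : ValAt c qv T.q) (hr : ValAt c rv T.r) (h : w ∈ ricSet T lam) {e : ℝ}
    (he : ValAt c e ((RatFunc.X - RatFunc.C c) * w)) : pv * (e ^ 2 - e) + qv * e = 0 := by
  have P := isPlace_valAt c
  have t0 := P.t0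
  have tv := valAt_X_sub_self c
  set t := RatFunc.X - RatFunc.C c with ht
  have h1 : T.p * (ratDeriv w + w ^ 2) + T.q * w + T.r = RatFunc.C lam := h
  have h2 := P.add (P.add (P.mul hp (P.add (P.sub (P.theta he) he) (P.pow he 2)))
    (P.mul hq he)) (P.mul (P.sub hr (P.const lam)) tv)
  have e1 : T.p / t * (t * ratDeriv (t * w) - t * w + (t * w) ^ 2) + T.q * (t * w) +
      (T.r - RatFunc.C lam) * t = 0 := by
    rw [← h1, ratDeriv_mul, P.dt]
    field_simp
    ring
  rw [e1] at h2
  have h3 := P.unique h2 P.zero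
  linear_combination h3

/-- The same count at infinity: growth like `x^k` with `k ≥ 0` would leave `p w²`, of order
`x^(2k+2)`, alone at the top. -/
theorem exists_residue_inf (hp : ValInf pv (T.p / RatFunc.X ^ 2)) (hpv : pv ≠ 0)
    (hq : ValInf qv (T.q / RatFunc.X)) (hr : ValInf rv T.r) (h : w ∈ ricSet T lam) :
    ∃ d, ValInf d (RatFunc.X * w) := by
  have P := isPlace_valInf
  by_cases hw : w = 0
  · exact ⟨0, by rw [hw, mul_zero]; exact P.zero⟩
  have t0 := P.t0
  have tv := valInf_inv_X
  have dX := P.dt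
  set t : RatFunc ℝ := RatFunc.X with ht
  obtain ⟨m, v, hv, hm⟩ := P.ord w hw
  rcases lt_or_ge m 0 with hlt | hge
  · obtain ⟨k, hk⟩ : ∃ k : ℕ, m = -k - 1 := ⟨(-m - 1).toNat, by omega⟩
    refine ⟨v * 0 ^ k, ?_⟩
    convert! P.mul hm (P.pow tv k) using 1
    rw [hk, neg_sub, sub_neg_eq_add, add_comm, zpow_add₀ t0, zpow_one, zpow_natCast, inv_pow]
    field_simp
  · exfalso
    obtain ⟨k, rfl⟩ : ∃ k : ℕ, m = k := ⟨m.toNat, by omega⟩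
    have hm' : ValInf v (w / t ^ k) := by
      rwa [zpow_neg, zpow_natCast, ← div_eq_mul_inv] at hm
    have tk := P.pow tv (k + 1)
    have h0 : (0 : ℝ) ^ (k + 1) = 0 := by simp
    have h1 : T.p * (ratDeriv w + w ^ 2) + T.q * w + T.r = RatFunc.C lam := h
    have h2 := P.add (P.add (P.mul hp (P.add (P.mul tk (P.add (P.theta hm')
      (P.mul (P.const (k : ℝ)) hm'))) (P.pow hm' 2))) (P.mul hq (P.mul tk hm')))
      (P.mul (P.sub hr (P.const lam)) (P.pow tv (2 * k + 2)))
    have e : T.p / t ^ 2 * (t⁻¹ ^ (k + 1) * (t * ratDeriv (w / t ^ k) +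
        RatFunc.C (k : ℝ) * (w / t ^ k)) + (w / t ^ k) ^ 2) +
        T.q / t * (t⁻¹ ^ (k + 1) * (w / t ^ k)) + (T.r - RatFunc.C lam) * t⁻¹ ^ (2 * k + 2)
        = 0 := by
      rw [← h1, ratDeriv_div _ _ (pow_ne_zero k t0), ratDeriv_pow, dX, map_natCast]
      rcases k with _ | k
      · simp only [pow_zero, Nat.cast_zero, inv_pow]
        field_simp
        ring
      · rw [Nat.add_sub_cancel]
        simp only [inv_pow]
        field_simp
        ring
    rw [e] at h2
    have h3 := P.unique h2 P.zero
    simp only [h0, zero_mul, mul_zero, add_zero, zero_add,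
      zero_pow (show 2 * k + 2 ≠ 0 by omega)] at h3
    exact mul_ne_zero hpv (pow_ne_zero 2 hv) h3

end Riccati

/-! ### The classical operator -/

/-- The classical Jacobi operator. -/
def classOp (a b : ℝ) : DiffOp := ⟨x21, x21 * eta a b, 0⟩

theorem x21_mul_gam (e e' : ℝ) : x21 * gam e e' =
    RatFunc.C e * (RatFunc.X + 1) + RatFunc.C e' * (RatFunc.X - 1) := by
  have := X_sub_one_ne_zero
  have := X_add_one_ne_zero
  rw [gam, x21_eq_mul]
  field_simp

theorem x21_valAt_one : ValAt 1 2 (x21 / (RatFunc.X - RatFunc.C 1)) := by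
  have h2 := valAt_X_sub 1 (-1)
  have := X_sub_one_ne_zero
  convert! h2 using 1
  · norm_num
  · rw [x21_eq_mul, map_one, C_neg_one]; field_simp; ring

theorem x21_valAt_neg_one : ValAt (-1) (-2) (x21 / (RatFunc.X - RatFunc.C (-1))) := by
  have h2 := valAt_X_sub (-1) 1
  have := X_add_one_ne_zero
  convert! h2 using 1
  · norm_num
  · rw [x21_eq_mul, map_one, C_neg_one, sub_neg_eq_add]; field_simp

theorem x21_gam_valAt_one (e e' : ℝ) : ValAt 1 (2 * e) (x21 * gam e e') := by
  have := (isPlace_valAt 1).mul x21_valAt_one (gam_valAt_one e e')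
  convert! this using 1
  have := X_sub_C_ne_zero 1
  field_simp

theorem x21_gam_valAt_neg_one (e e' : ℝ) : ValAt (-1) (-2 * e') (x21 * gam e e') := by
  have := (isPlace_valAt (-1)).mul x21_valAt_neg_one (gam_valAt_neg_one e e')
  convert! this using 1
  have := X_sub_C_ne_zero (-1)
  field_simp

theorem x21_valInf : ValInf 1 (x21 / RatFunc.X ^ 2) := by
  have P := isPlace_valInf
  have h := P.sub P.one (P.pow valInf_inv_X 2)
  have : (1 : ℝ) - 0 ^ 2 = 1 := by norm_num
  rw [this] at h
  convert! h using 1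
  have := RatFunc.X_ne_zero (K := ℝ)
  rw [x21]
  field_simp

theorem x21_gam_valInf (e e' : ℝ) : ValInf (e + e') (x21 * gam e e' / RatFunc.X) := by
  have := isPlace_valInf.mul x21_valInf (gam_valInf e e')
  rw [one_mul] at this
  convert! this using 1
  have := RatFunc.X_ne_zero (K := ℝ)
  field_simp

theorem x21_gam_gauge (A B e e' : ℝ) :
    x21 * (ratDeriv (gam e e') + gam e e' ^ 2) + x21 * gam A B * gam e e' =
      RatFunc.C (e ^ 2 - e + e * A) * ((RatFunc.X + 1) / (RatFunc.X - 1)) +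
      RatFunc.C (e' ^ 2 - e' + e' * B) * ((RatFunc.X - 1) / (RatFunc.X + 1)) +
      RatFunc.C (2 * e * e' + e * B + e' * A) := by
  have := X_sub_one_ne_zero
  have := X_add_one_ne_zero
  rw [ratDeriv_gam, gam, gam, x21_eq_mul]
  simp only [map_add, map_sub, map_mul, map_pow, map_ofNat]
  field_simp
  ring

/-- Splitting off indicial exponents kills the pole terms in `x21_gam_gauge`. What remains is a
constant shift of the eigenvalue, and a parameter changes sign exactly when its nonzero exponent is
split off. -/
theorem classOp_gauge {a b e e' lam : ℝ} (he : e = 0 ∨ e = -a) (he' : e' = 0 ∨ e' = -b)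
    (v : RatFunc ℝ) :
    v + gam e e' ∈ ricSet (classOp a b) (lam + (2 * e * e' + e * (b + 1) + e' * (a + 1))) ↔
      v ∈ ricSet (classOp (a + 2 * e) (b + 2 * e')) lam := by
  have h1 : e ^ 2 - e + e * (a + 1) = 0 := by rcases he with rfl | rfl <;> ring
  have h2 : e' ^ 2 - e' + e' * (b + 1) = 0 := by rcases he' with rfl | rfl <;> ring
  have h := x21_gam_gauge (a + 1) (b + 1) e e'
  rw [h1, h2, map_zero, zero_mul, zero_mul, zero_add, zero_add] at h
  have h3 : eta (a + 2 * e) (b + 2 * e') = gam (a + 1) (b + 1) + 2 * gam e e' := by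
    rw [eta_eq, two_mul (gam e e'), ← gam_add, ← gam_add]
    congr 1 <;> ring
  change x21 * (ratDeriv (v + gam e e') + (v + gam e e') ^ 2) +
      x21 * gam (a + 1) (b + 1) * (v + gam e e') + 0 = RatFunc.C _ ↔
    x21 * (ratDeriv v + v ^ 2) + x21 * eta (a + 2 * e) (b + 2 * e') * v + 0 = RatFunc.C _
  rw [map_add, ← h, h3, ratDeriv_add]
  constructor <;> intro h4
  · linear_combination h4
  · linear_combination h4

theorem toRat_x21_gam (a b : ℝ) : toRat (C (a + 1) * (X + 1) + C (b + 1) * (X - 1)) =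
    x21 * gam (a + 1) (b + 1) := by
  rw [x21_mul_gam]
  simp only [toRat, map_add, map_sub, map_mul, map_one, RatFunc.algebraMap_X, RatFunc.algebraMap_C]

theorem isEig_iff {a b lam : ℝ} {P : ℝ[X]} (hP : P ≠ 0) :
    IsEig a b lam P ↔ toRat (derivative P) / toRat P ∈ ricSet (classOp a b) lam := by
  have h0 := toRat_ne_zero hP
  change _ ↔ x21 * (ratDeriv (toRat (derivative P) / toRat P) +
    (toRat (derivative P) / toRat P) ^ 2) + x21 * gam (a + 1) (b + 1) *
      (toRat (derivative P) / toRat P) + 0 = RatFunc.C lam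
  rw [← toRat_x21_gam, ratDeriv_div _ _ h0, ratDeriv_toRat, ratDeriv_toRat]
  have e : (toRat (derivative (derivative P)) * toRat P - toRat (derivative P) *
      toRat (derivative P)) / toRat P ^ 2 + (toRat (derivative P) / toRat P) ^ 2 =
      toRat (derivative (derivative P)) / toRat P := by field_simp; ring
  rw [e, add_zero, x21_eq, ← mul_div_assoc, ← mul_div_assoc, ← add_div, div_eq_iff h0,
    ← toRat_C, ← toRat_mul, ← toRat_mul, ← toRat_mul, toRat, toRat, ← map_add]
  exact (RatFunc.algebraMap_injective ℝ).eq_iff.symm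

theorem toRat_logDeriv_valInf {P : ℝ[X]} (hP : P ≠ 0) :
    ValInf P.natDegree (RatFunc.X * (toRat (derivative P) / toRat P)) := by
  have h : ValInf P.leadingCoeff (toRat P * RatFunc.X ^ (-(P.natDegree : ℤ))) := by
    refine ⟨P, X ^ P.natDegree, pow_ne_zero _ X_ne_zero, by simp, ?_, by simp⟩
    rw [zpow_neg, zpow_natCast, toRat_pow, toRat_X, div_eq_mul_inv]
  have := isPlace_valInf.logDeriv (leadingCoeff_ne_zero.2 hP) h
  rwa [ratDeriv_toRat, Int.cast_natCast] at this

/-- The order of vanishing at an endpoint is an indicial exponent, `0` or `-a` (respectively `-b`),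
and of these only `0` is an integer. -/
theorem IsEig.eval_ne_zero {a b lam : ℝ} {P : ℝ[X]} (h : IsEig a b lam P) (hP : P ≠ 0)
    (ha : ¬ IsInt a) (hb : ¬ IsInt b) : P.eval 1 ≠ 0 ∧ P.eval (-1) ≠ 0 := by
  have hr := (isEig_iff hP).1 h
  have h0 := toRat_ne_zero hP
  have hz : ∀ c, ValAt c 0 (classOp a b).r := fun c => (isPlace_valAt c).zero
  rw [← ratDeriv_toRat] at hr
  constructor
  · obtain ⟨m, v, hv, h1, h2⟩ := (isPlace_valAt 1).exists_logDeriv h0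
    have h3 := residue_eq (T := classOp a b) x21_valAt_one (x21_gam_valAt_one _ _) (hz 1) hr h2
    have h4 : (m : ℝ) * (m + a) = 0 := by linear_combination h3 / 2
    rcases mul_eq_zero.1 h4 with h5 | h5
    · have hm : m = 0 := by exact_mod_cast h5
      rw [hm, neg_zero, zpow_zero, mul_one] at h1
      rwa [(isPlace_valAt 1).unique (valAt_toRat 1 P) h1]
    · exact absurd ⟨-m, by push_cast; linarith⟩ ha
  · obtain ⟨m, v, hv, h1, h2⟩ := (isPlace_valAt (-1)).exists_logDeriv h0
    have h3 := residue_eq (T := classOp a b) x21_valAt_neg_one (x21_gam_valAt_neg_one _ _)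
      (hz _) hr h2
    have h4 : (m : ℝ) * (m + b) = 0 := by linear_combination -h3 / 2
    rcases mul_eq_zero.1 h4 with h5 | h5
    · have hm : m = 0 := by exact_mod_cast h5
      rw [hm, neg_zero, zpow_zero, mul_one] at h1
      rwa [(isPlace_valAt (-1)).unique (valAt_toRat (-1) P) h1]
    · exact absurd ⟨-m, by push_cast; linarith⟩ hb

/-- Otherwise a combination of the two would be a nonzero eigenpolynomial vanishing at `1`. -/
theorem IsEig.eq_smul {a b lam : ℝ} {P Q : ℝ[X]} (hP : IsEig a b lam P) (hQ : IsEig a b lam Q)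
    (ha : ¬ IsInt a) (hb : ¬ IsInt b) (hP0 : P ≠ 0) : ∃ c, Q = C c * P := by
  have h1 := (hP.eval_ne_zero hP0 ha hb).1
  refine ⟨Q.eval 1 / P.eval 1, ?_⟩
  by_contra hne
  have h2 : Q + C (-(Q.eval 1 / P.eval 1)) * P ≠ 0 := by
    intro h; apply hne
    rw [map_neg] at h
    linear_combination h
  refine ((hQ.add (hP.C_mul _)).eval_ne_zero h2 ha hb).1 ?_
  simp only [eval_add, eval_mul, eval_C]
  field_simp
  ring

theorem IsEig.lam_eq {a b lam : ℝ} {P : ℝ[X]} (h : IsEig a b lam P) (hP : P ≠ 0) :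
    lam = P.natDegree * (P.natDegree + a + b + 1) := by
  have key : ∀ n, P.natDegree = n → lam = (n : ℝ) * (n + a + b + 1) := by
    intro n hn
    have hl : P.coeff n ≠ 0 := by rw [← hn]; exact leadingCoeff_ne_zero.2 hP
    have h1 : (C lam * P).coeff n = lam * P.coeff n := coeff_C_mul _
    rw [← h] at h1
    have e : (X ^ 2 - 1) * derivative (derivative P) +
        (C (a + 1) * (X + 1) + C (b + 1) * (X - 1)) * derivative P =
        X * (X * derivative (derivative P)) - derivative (derivative P) +
        C (a + b + 2) * (X * derivative P) + C (a - b) * derivative P := by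
      simp only [map_add, map_sub, map_one, map_ofNat]; ring
    have hc : ∀ Q : ℝ[X], ∀ k, (X * derivative Q).coeff k = Q.coeff k * k := by
      intro Q k
      rcases k with _ | k
      · simp
      · rw [coeff_X_mul, coeff_derivative]; push_cast; ring
    have hc2 : ∀ k, (X * (X * derivative (derivative P))).coeff k = P.coeff k * k * (k - 1) := by
      intro k
      rcases k with _ | k
      · simp
      · rw [coeff_X_mul, hc, coeff_derivative]; push_cast; ring
    have z1 : (derivative P).coeff n = 0 := by
      rw [coeff_derivative, coeff_eq_zero_of_natDegree_lt (by omega), zero_mul]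
    have z2 : (derivative (derivative P)).coeff n = 0 := by
      rw [coeff_derivative, coeff_derivative, coeff_eq_zero_of_natDegree_lt (by omega)]; ring
    rw [e, coeff_add, coeff_add, coeff_sub, hc2, coeff_C_mul, coeff_C_mul, hc, z1, z2] at h1
    have h2 : (lam - n * (n + a + b + 1)) * P.coeff n = 0 := by linear_combination -h1
    rcases mul_eq_zero.1 h2 with h3 | h3
    · linarith
    · exact absurd h3 hl
  exact key _ rfl

/-- Subtracting the exponents at `±1` leaves a fraction `N/M` that is regular there and vanishes at
infinity. At other points the Riccati equation allows only simple poles of residue `1`, which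
algebraically says `N = M'`; so `M` is an eigenpolynomial. -/
theorem classOp_classify {a b lam : ℝ} {w : RatFunc ℝ} (h : w ∈ ricSet (classOp a b) lam) :
    ∃ (e e' mu : ℝ) (P : ℝ[X]), (e = 0 ∨ e = -a) ∧ (e' = 0 ∨ e' = -b) ∧ P ≠ 0 ∧
      IsEig (a + 2 * e) (b + 2 * e') mu P ∧ w = toRat (derivative P) / toRat P + gam e e' ∧
      lam = mu + (2 * e * e' + e * (b + 1) + e' * (a + 1)) := by
  have hz : ∀ c, ValAt c 0 (classOp a b).r := fun c => (isPlace_valAt c).zero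
  have g1 := x21_gam_valAt_one (a + 1) (b + 1)
  have g2 := x21_gam_valAt_neg_one (a + 1) (b + 1)
  obtain ⟨e, he⟩ := exists_residue (T := classOp a b) x21_valAt_one two_ne_zero g1 (hz 1) h
  obtain ⟨e', he'⟩ := exists_residue (T := classOp a b) x21_valAt_neg_one (by norm_num) g2
    (hz _) h
  obtain ⟨d, hd⟩ := exists_residue_inf (T := classOp a b) x21_valInf one_ne_zero
    (x21_gam_valInf _ _) isPlace_valInf.zero h
  have r1 := residue_eq (T := classOp a b) x21_valAt_one g1 (hz 1) h he
  have r2 := residue_eq (T := classOp a b) x21_valAt_neg_one g2 (hz _) h he'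
  have he0 : e = 0 ∨ e = -a := by
    have : e * (e + a) = 0 := by linear_combination r1 / 2
    rcases mul_eq_zero.1 this with h1 | h1
    · exact Or.inl h1
    · exact Or.inr (by linarith)
  have he0' : e' = 0 ∨ e' = -b := by
    have : e' * (e' + b) = 0 := by linear_combination -r2 / 2
    rcases mul_eq_zero.1 this with h1 | h1
    · exact Or.inl h1
    · exact Or.inr (by linarith)
  set σ := 2 * e * e' + e * (b + 1) + e' * (a + 1) with hσ
  set v := w - gam e e' with hv
  have hvm : v ∈ ricSet (classOp (a + 2 * e) (b + 2 * e')) (lam - σ) := by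
    rw [← classOp_gauge he0 he0', hv, sub_add_cancel, sub_add_cancel]; exact h
  have v1 := (isPlace_valAt 1).sub he (gam_valAt_one e e')
  have v2 := (isPlace_valAt (-1)).sub he' (gam_valAt_neg_one e e')
  have v3 := isPlace_valInf.sub hd (gam_valInf e e')
  rw [sub_self, ← mul_sub] at v1 v2
  rw [← mul_sub] at v3
  have reg1 : v.denom.eval 1 ≠ 0 := regularAt_of_residue_zero v1
  have reg2 : v.denom.eval (-1) ≠ 0 := regularAt_of_residue_zero v2
  have hM := v.denom_ne_zero
  have hdeg : v.num.degree < v.denom.degree := by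
    by_cases hv0 : v = 0
    · rw [hv0]; simp
    have hN := RatFunc.num_ne_zero hv0
    obtain ⟨N, M, hM', hN', hX, -⟩ := v3
    have : toRat (X * v.num) / toRat v.denom = toRat N / toRat M := by
      rw [← hX, toRat_mul, toRat_X, mul_div_assoc, RatFunc.num_div_denom]
    rw [toRat_div_eq_iff hM hM'] at this
    have hN0 : N ≠ 0 := by
      rintro rfl
      rw [zero_mul] at this
      exact mul_ne_zero (mul_ne_zero X_ne_zero hN) hM' this
    have h2 := congrArg natDegree this
    rw [natDegree_mul (mul_ne_zero X_ne_zero hN) hM', natDegree_mul X_ne_zero hN,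
      natDegree_mul hN0 hM, natDegree_X] at h2
    exact (degree_lt_degree (by omega))
  have hmain : v.num = derivative v.denom := by
    have hr : x21 * (ratDeriv v + v ^ 2) + x21 * gam (a + 2 * e + 1) (b + 2 * e' + 1) * v + 0 =
      RatFunc.C (lam - σ) := hvm
    have h0 := toRat_ne_zero hM
    rw [← toRat_x21_gam, x21_eq, ← toRat_C] at hr
    have hvv : v = toRat v.num / toRat v.denom := (RatFunc.num_div_denom v).symm
    set N := v.num with hN
    set M := v.denom with hMM
    rw [hvv, ratDeriv_div_toRat _ _ hM] at hr
    set Q := C (a + 2 * e + 1) * (X + 1) + C (b + 2 * e' + 1) * (X - 1) with hQ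
    have hr2 : toRat ((X ^ 2 - 1) * ((derivative N * M - N * derivative M) + N ^ 2) +
        Q * N * M) = toRat (C (lam - σ) * M ^ 2) := by
      simp only [toRat, map_add, map_mul, map_pow] at hr ⊢
      field_simp at hr
      linear_combination hr
    have hr3 := toRat_inj hr2
    -- Modulo `M` the cleared Riccati equation reads `(x²-1) N (N - M') = 0`. Since `M` is coprime
    -- to `(x²-1) N` and `N - M'` has smaller degree, `N = M'` follows.
    have hdvd : M ∣ ((X ^ 2 - 1) * N) * (N - derivative M) :=
      ⟨C (lam - σ) * M - Q * N - (X ^ 2 - 1) * derivative N, by linear_combination hr3⟩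
    have c : ∀ z : ℝ, M.eval z ≠ 0 → IsCoprime M (X - C z) := by
      intro z hz
      exact ((irreducible_X_sub_C z).coprime_iff_not_dvd.2
        fun hd => hz (dvd_iff_isRoot.1 hd)).symm
    have e1 : (X ^ 2 - 1 : ℝ[X]) = (X - C 1) * (X - C (-1)) := by
      simp only [map_one, map_neg]; ring
    have hcop : IsCoprime M ((X ^ 2 - 1) * N) := by
      rw [e1]
      exact ((c 1 reg1).mul_right (c _ reg2)).mul_right (RatFunc.isCoprime_num_denom v).symm
    have hd2 := hcop.dvd_of_dvd_mul_left hdvd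
    refine sub_eq_zero.1 (eq_zero_of_dvd_of_degree_lt hd2 ?_)
    exact (degree_sub_le _ _).trans_lt (max_lt hdeg (degree_derivative_lt hM))
  refine ⟨e, e', lam - σ, v.denom, he0, he0', hM, ?_, ?_, by ring⟩
  · rw [isEig_iff hM, ← hmain, RatFunc.num_div_denom]; exact hvm
  · rw [← hmain, RatFunc.num_div_denom]; ring

/-! ### Formal integration against Jacobi weights -/

/-- `f (1-x)^a (1+x)^b` has an antiderivative of the form `q (1-x)^a (1+x)^b`, `q` rational. -/
def Exact (a b : ℝ) (f : RatFunc ℝ) : Prop := ∃ q, ratDeriv q + gam a b * q = f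

namespace Exact

variable {a b : ℝ} {f g : RatFunc ℝ}

theorem add (hf : Exact a b f) (hg : Exact a b g) : Exact a b (f + g) := by
  obtain ⟨q, rfl⟩ := hf
  obtain ⟨q', rfl⟩ := hg
  exact ⟨q + q', by rw [ratDeriv_add]; ring⟩

theorem C_mul (hf : Exact a b f) (c : ℝ) : Exact a b (RatFunc.C c * f) := by
  obtain ⟨q, rfl⟩ := hf
  exact ⟨RatFunc.C c * q, by rw [ratDeriv_C_mul]; ring⟩

theorem sub (hf : Exact a b f) (hg : Exact a b g) : Exact a b (f - g) := by
  have := hf.add (hg.C_mul (-1))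
  rwa [C_neg_one, neg_one_mul, ← sub_eq_add_neg] at this

end Exact

/-- A factor `t` with log-derivative `gam d d'` can be moved from the weight into the integrand; the
antiderivative is multiplied by the same factor. -/
theorem exact_mul_iff {a b d d' : ℝ} {t : RatFunc ℝ} (ht : t ≠ 0)
    (h : ratDeriv t / t = gam d d') (f : RatFunc ℝ) :
    Exact (a + d) (b + d') f ↔ Exact a b (t * f) := by
  have h' : ratDeriv t = gam d d' * t := by rw [← h, div_mul_cancel₀ _ ht]
  constructor
  · rintro ⟨q, rfl⟩
    exact ⟨t * q, by rw [ratDeriv_mul, h', gam_add]; ring⟩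
  · rintro ⟨q, hq⟩
    refine ⟨q / t, ?_⟩
    have : f = (ratDeriv q + gam a b * q) / t := by rw [hq]; field_simp
    rw [this, ratDeriv_div _ _ ht, h', gam_add]
    field_simp
    ring

theorem x21_logDeriv : ratDeriv x21 / x21 = gam 1 1 := by
  have := X_sub_one_ne_zero
  have := X_add_one_ne_zero
  rw [gam, x21_eq_mul, ratDeriv_mul, ratDeriv_sub, ratDeriv_add]
  simp only [ratDeriv_X, ratDeriv_one, map_one]
  field_simp
  ring

theorem exact_x21_mul_iff {a b : ℝ} (f : RatFunc ℝ) :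
    Exact (a + 1) (b + 1) f ↔ Exact a b (x21 * f) := exact_mul_iff x21_ne_zero x21_logDeriv f

/-- An antiderivative of a function that is regular at `c` vanishes at `c`. -/
theorem antideriv_div_valAt {c e v : ℝ} {q f g : RatFunc ℝ} (hg : ValAt c e
    ((RatFunc.X - RatFunc.C c) * g)) (he : ¬ IsInt e) (hf : ValAt c v f)
    (h : ratDeriv q + g * q = f) : ∃ u, ValAt c u (q / (RatFunc.X - RatFunc.C c)) := by
  have P := isPlace_valAt c
  have t0 := P.t0
  by_cases hq : q = 0
  · exact ⟨0, by rw [hq, zero_div]; exact P.zero⟩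
  obtain ⟨m, _, _, -, hl⟩ := P.exists_logDeriv hq
  set t := RatFunc.X - RatFunc.C c with ht
  have h1 := P.add hl hg
  -- `m + e` is the exponent at `c` of `q` times the weight, and it is the value of `t f / q` there.
  -- Being nonzero, it may be inverted, which bounds `q / t`.
  have hne : (m : ℝ) + e ≠ 0 := fun h0 => he ⟨-m, by push_cast; linarith⟩
  have e1 : t * (ratDeriv q / q) + t * g = t * f / q := by
    rw [← h]; field_simp
  rw [e1] at h1
  have f0 : f ≠ 0 := by
    rintro rfl
    exact P.ne_zero h1 hne (by simp)
  refine ⟨v / (m + e), ?_⟩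
  convert! P.div hf h1 hne using 1
  field_simp

/-- Away from `±1` a pole of `q` would give a pole of higher order on the left; for the reduced
denominator this becomes `M ∣ M'`, so `M` is constant. At `±1` the antiderivative vanishes by
`antideriv_div_valAt`. -/
theorem antideriv_polynomial {a b : ℝ} (ha : ¬ IsInt a) (hb : ¬ IsInt b) {P : ℝ[X]}
    {q : RatFunc ℝ} (h : ratDeriv q + gam a b * q = toRat P) :
    ∃ R : ℝ[X], q = toRat ((X ^ 2 - 1) * R) := by
  have P1 := isPlace_valAt 1
  have P2 := isPlace_valAt (-1)
  obtain ⟨u, hu⟩ := antideriv_div_valAt (gam_valAt_one a b) ha (valAt_toRat 1 P) h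
  obtain ⟨u', hu'⟩ := antideriv_div_valAt (gam_valAt_neg_one a b) hb (valAt_toRat (-1) P) h
  have hu2 := P1.mul hu (valAt_X_sub_self 1)
  have hu2' := P2.mul hu' (valAt_X_sub_self (-1))
  rw [div_mul_cancel₀ _ P1.t0, mul_zero] at hu2
  rw [div_mul_cancel₀ _ P2.t0, mul_zero] at hu2'
  have hM := q.denom_ne_zero
  have hM0 := toRat_ne_zero hM
  have hqq : q = toRat q.num / toRat q.denom := (RatFunc.num_div_denom q).symm
  have reg1 : q.denom.eval 1 ≠ 0 := hu2.1
  have reg2 : q.denom.eval (-1) ≠ 0 := hu2'.1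
  have key : q.denom = 1 := by
    have hcop := RatFunc.isCoprime_num_denom q
    have hmon := RatFunc.monic_denom q
    set N := q.num
    set M := q.denom
    have hx : toRat (C a * (X + 1) + C b * (X - 1)) = x21 * gam a b := by
      rw [x21_mul_gam]
      simp only [toRat, map_add, map_sub, map_mul, map_one, RatFunc.algebraMap_X,
        RatFunc.algebraMap_C]
    set G := C a * (X + 1) + C b * (X - 1) with hG
    have h2 : x21 * ratDeriv q + toRat G * q = x21 * toRat P := by rw [hx, ← h]; ring
    rw [hqq, ratDeriv_div_toRat _ _ hM, x21_eq] at h2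
    have h3 : toRat ((X ^ 2 - 1) * (derivative N * M - N * derivative M) + G * N * M) =
        toRat ((X ^ 2 - 1) * P * M ^ 2) := by
      simp only [toRat, map_add, map_mul, map_pow] at h2 ⊢
      field_simp at h2
      linear_combination h2
    have h4 := toRat_inj h3
    have hdvd : M ∣ ((X ^ 2 - 1) * N) * derivative M :=
      ⟨(X ^ 2 - 1) * derivative N + G * N - (X ^ 2 - 1) * P * M, by linear_combination -h4⟩
    have c : ∀ z : ℝ, M.eval z ≠ 0 → IsCoprime M (X - C z) := by
      intro z hz
      exact ((irreducible_X_sub_C z).coprime_iff_not_dvd.2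
        fun hd => hz (dvd_iff_isRoot.1 hd)).symm
    have e1 : (X ^ 2 - 1 : ℝ[X]) = (X - C 1) * (X - C (-1)) := by
      simp only [map_one, map_neg]; ring
    have hc : IsCoprime M ((X ^ 2 - 1) * N) := by
      rw [e1]
      exact ((c 1 reg1).mul_right (c _ reg2)).mul_right hcop.symm
    have h5 := eq_zero_of_dvd_of_degree_lt (hc.dvd_of_dvd_mul_left hdvd) (degree_derivative_lt hM)
    have h6 := derivative_eq_zero.1 h5
    exact hmon.natDegree_eq_zero.1 h6
  have hq2 : q = toRat q.num := by
    conv_lhs => rw [hqq, key]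
    simp [toRat]
  have z1 : q.num.eval 1 = 0 := by
    rw [hq2] at hu2; exact P1.unique (valAt_toRat 1 _) hu2
  have z2 : q.num.eval (-1) = 0 := by
    rw [hq2] at hu2'; exact P2.unique (valAt_toRat (-1) _) hu2'
  have d1 : X - C 1 ∣ q.num := dvd_iff_isRoot.2 z1
  have d2 : X - C (-1) ∣ q.num := dvd_iff_isRoot.2 z2
  have hcc : IsCoprime (X - C (1 : ℝ)) (X - C (-1)) := isCoprime_X_sub_C_of_isUnit_sub (by norm_num)
  obtain ⟨R, hR⟩ := hcc.mul_dvd d1 d2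
  refine ⟨R, ?_⟩
  rw [hq2, hR]
  congr 2
  simp only [map_one, map_neg]; ring

/-- An antiderivative would come from a polynomial of degree `r + 2`. The left side then has the
coefficient of degree `r + 1` proportional to `a + b + r + 2`, and this would have to vanish. -/
theorem not_exact_const {a b c : ℝ} (ha : ¬ IsInt a) (hb : ¬ IsInt b)
    (hab : ∀ k : ℕ, a + b + 2 + k ≠ 0) (hc : c ≠ 0) : ¬ Exact a b (RatFunc.C c) := by
  rintro ⟨q, hq⟩
  rw [← toRat_C] at hq
  obtain ⟨R, rfl⟩ := antideriv_polynomial ha hb hq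
  have hx : (X ^ 2 - 1 : ℝ[X]) ≠ 0 := by
    have := (monic_X_pow_sub_C (1 : ℝ) two_ne_zero).ne_zero
    simpa using this
  have hR : R ≠ 0 := by
    rintro rfl
    rw [mul_zero] at hq
    have h0 : toRat (0 : ℝ[X]) = 0 := map_zero _
    rw [h0, ratDeriv_zero, mul_zero, add_zero, toRat_C] at hq
    exact C_ne_zero hc hq.symm
  set Q := (X ^ 2 - 1) * R with hQ
  have hQ0 : Q ≠ 0 := mul_ne_zero hx hR
  have hdeg : Q.natDegree = R.natDegree + 2 := by
    rw [hQ, natDegree_mul hx hR, add_comm]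
    congr 1
    simpa using natDegree_X_pow_sub_C (n := 2) (r := (1 : ℝ))
  have h0 := toRat_ne_zero hQ0
  have h1 := isPlace_valInf.add (toRat_logDeriv_valInf hQ0) (gam_valInf a b)
  have h2 : ValInf 0 (RatFunc.X * (toRat (derivative Q) / toRat Q) + RatFunc.X * gam a b) := by
    refine ⟨C c * X, Q, hQ0, ?_, ?_, ?_⟩
    · refine (natDegree_C_mul_le _ _).trans ?_
      rw [natDegree_X, hdeg]; omega
    · rw [toRat_mul (C c), toRat_X, ← hq, ratDeriv_toRat]
      field_simp
    · rw [coeff_C_mul, hdeg, coeff_X_of_ne_one (by omega)]; simp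
  have h3 := isPlace_valInf.unique h1 h2
  rw [hdeg] at h3
  push_cast at h3
  exact hab R.natDegree (by linarith)

/-- Integration by parts: the antiderivative is `(x²-1) P P'`. -/
theorem IsEig.exact_sq {a b lam : ℝ} {P : ℝ[X]} (h : IsEig a b lam P) :
    Exact a b (RatFunc.C lam * toRat P ^ 2 + x21 * toRat (derivative P) ^ 2) := by
  refine ⟨x21 * toRat P * toRat (derivative P), ?_⟩
  have h' := congrArg toRat h
  have hd : ratDeriv x21 = gam 1 1 * x21 := by
    rw [← x21_logDeriv, div_mul_cancel₀ _ x21_ne_zero]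
  simp only [toRat_mul, toRat_C] at h'
  rw [toRat, map_add, ← toRat, ← toRat, toRat_mul, toRat_mul, toRat_x21_gam, ← x21_eq,
    gam_add] at h'
  rw [ratDeriv_mul, ratDeriv_mul, hd, ratDeriv_toRat, ratDeriv_toRat]
  linear_combination toRat P * h'

theorem IsEig.derivative {a b lam : ℝ} {P : ℝ[X]} (h : IsEig a b lam P) :
    IsEig (a + 1) (b + 1) (lam - (a + b + 2)) (derivative P) := by
  have h' := congrArg Polynomial.derivative h
  simp only [derivative_add, derivative_mul, derivative_sub, derivative_X_pow, derivative_C,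
    derivative_X, derivative_one] at h'
  unfold IsEig
  simp only [map_add, map_sub, map_one, map_ofNat, Nat.cast_ofNat] at h' ⊢
  linear_combination h'

theorem not_isInt_add_one {a : ℝ} (ha : ¬ IsInt a) : ¬ IsInt (a + 1) := by
  rintro ⟨m, hm⟩
  exact ha ⟨m - 1, by push_cast; linarith⟩

/-- If `P²` were exact, `exact_sq` would make `(x²-1) P'²` exact, that is `P'²` against the weight
with both parameters raised by one. Descending to a constant contradicts `not_exact_const`; the
hypothesis on `a + b + 2n + 2` is the one needed at the last stage. -/
theorem IsEig.not_exact_sq (n : ℕ) : ∀ {a b lam : ℝ} {P : ℝ[X]}, ¬ IsInt a → ¬ IsInt b →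
    (∀ k : ℕ, a + b + 2 * n + 2 + k ≠ 0) → IsEig a b lam P → P ≠ 0 → P.natDegree = n →
    ¬ Exact a b (toRat P ^ 2) := by
  induction n with
  | zero =>
    intro a b lam P ha hb hab _ hP hn
    rw [natDegree_eq_zero] at hn
    obtain ⟨c, rfl⟩ := hn
    have hc : c ≠ 0 := by rintro rfl; simp at hP
    rw [toRat_C, ← map_pow]
    exact not_exact_const ha hb (by simpa using hab) (pow_ne_zero 2 hc)
  | succ n ih =>
    intro a b lam P ha hb hab h hP hn he
    have h1 := h.exact_sq.sub (he.C_mul lam)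
    rw [add_sub_cancel_left, ← exact_x21_mul_iff] at h1
    refine ih (not_isInt_add_one ha) (not_isInt_add_one hb) (fun k => ?_) h.derivative ?_ ?_ h1
    · have := hab k
      push_cast at this
      intro h0; apply this; linarith
    · intro h0
      have := derivative_eq_zero.1 h0
      omega
    · have := natDegree_derivative P
      omega

/-! ### Formal norms -/

/-- The integral of `f (1-x)^a (1+x)^b` is `ν`, in the formal sense. -/
def HasNorm (a b : ℝ) (f : RatFunc ℝ) (ν : ℝ) : Prop := Exact a b (f - RatFunc.C (ν / nuBase a b))

theorem Gamma_ne_zero_of_not_isInt {s : ℝ} (h : ¬ IsInt s) : Real.Gamma s ≠ 0 :=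
  Real.Gamma_ne_zero fun m hm => h ⟨-m, by push_cast; exact hm.symm⟩

theorem not_isInt_add_natCast {a : ℝ} (ha : ¬ IsInt a) (k : ℕ) : ¬ IsInt (a + k) := by
  rintro ⟨m, hm⟩
  exact ha ⟨m - k, by push_cast; linarith⟩

theorem not_isInt_add_intCast {a : ℝ} (ha : ¬ IsInt a) (k : ℤ) : ¬ IsInt (a + k) := by
  rintro ⟨m, hm⟩
  exact ha ⟨m - k, by push_cast; linarith⟩

theorem ne_intCast_of_not_isInt {a : ℝ} (ha : ¬ IsInt a) (k : ℤ) : a ≠ k := fun h => ha ⟨k, h.symm⟩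

theorem nuBase_ne_zero {a b : ℝ} (ha : ¬ IsInt a) (hb : ¬ IsInt b) (hab : ¬ IsInt (a + b)) :
    nuBase a b ≠ 0 := by
  have h1 := Gamma_ne_zero_of_not_isInt (not_isInt_add_one ha)
  have h2 := Gamma_ne_zero_of_not_isInt (not_isInt_add_one hb)
  have h3 := Gamma_ne_zero_of_not_isInt (not_isInt_add_natCast hab 2)
  push_cast at h3
  have h4 : (2 : ℝ) ^ (1 + a + b) ≠ 0 := (Real.rpow_pos_of_pos two_pos _).ne'
  rw [nuBase]
  exact div_ne_zero (mul_ne_zero h4 (mul_ne_zero h1 h2)) h3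

theorem nuBase_comm (a b : ℝ) : nuBase a b = nuBase b a := by
  rw [nuBase, nuBase, mul_comm (Real.Gamma (a + 1)), add_right_comm 1 a b, add_comm a b]

theorem nuBase_succ_left {a b : ℝ} (ha : ¬ IsInt a) (hab : ¬ IsInt (a + b)) :
    nuBase (a + 1) b * (a + b + 2) = nuBase a b * (2 * (a + 1)) := by
  have h1 : a + 1 ≠ 0 := by
    have := ne_intCast_of_not_isInt (not_isInt_add_one ha) 0; simpa using this
  have h2 : a + b + 2 ≠ 0 := by
    have := ne_intCast_of_not_isInt (not_isInt_add_natCast hab 2) 0; simpa using this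
  have h3 := Gamma_ne_zero_of_not_isInt (not_isInt_add_natCast hab 2)
  push_cast at h3
  rw [nuBase, nuBase, Real.Gamma_add_one h1,
    show a + 1 + b + 2 = (a + b + 2) + 1 by ring, Real.Gamma_add_one h2,
    show 1 + (a + 1) + b = (1 + a + b) + 1 by ring, Real.rpow_add_one two_ne_zero]
  field_simp

theorem nuBase_succ_right {a b : ℝ} (hb : ¬ IsInt b) (hab : ¬ IsInt (a + b)) :
    nuBase a (b + 1) * (a + b + 2) = nuBase a b * (2 * (b + 1)) := by
  rw [nuBase_comm a, nuBase_comm a, add_comm a b]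
  exact nuBase_succ_left hb (by rwa [add_comm])

theorem exact_one_sub {a b : ℝ} : Exact a b
    (RatFunc.C (a + b + 2) * (1 - RatFunc.X) - RatFunc.C (2 * (a + 1))) := by
  refine ⟨-x21, ?_⟩
  have := X_sub_one_ne_zero
  have := X_add_one_ne_zero
  have h : ratDeriv x21 = gam 1 1 * x21 := by
    rw [← x21_logDeriv, div_mul_cancel₀ _ x21_ne_zero]
  rw [ratDeriv_neg, h, gam, gam, x21_eq_mul]
  simp only [map_add, map_mul, map_one, map_ofNat]
  field_simp
  ring

theorem exact_one_add {a b : ℝ} : Exact a b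
    (RatFunc.C (a + b + 2) * (1 + RatFunc.X) - RatFunc.C (2 * (b + 1))) := by
  refine ⟨x21, ?_⟩
  have := X_sub_one_ne_zero
  have := X_add_one_ne_zero
  have h : ratDeriv x21 = gam 1 1 * x21 := by
    rw [← x21_logDeriv, div_mul_cancel₀ _ x21_ne_zero]
  rw [h, gam, gam, x21_eq_mul]
  simp only [map_add, map_mul, map_one, map_ofNat]
  field_simp
  ring

theorem one_sub_X_ne_zero : (1 - RatFunc.X : RatFunc ℝ) ≠ 0 := by
  rw [← neg_sub]; exact neg_ne_zero.2 X_sub_one_ne_zero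

theorem one_add_X_ne_zero : (1 + RatFunc.X : RatFunc ℝ) ≠ 0 := by
  rw [add_comm]; exact X_add_one_ne_zero

theorem one_sub_logDeriv : ratDeriv (1 - RatFunc.X) / (1 - RatFunc.X) = gam 1 0 := by
  have := X_sub_one_ne_zero
  have := one_sub_X_ne_zero
  rw [ratDeriv_sub, gam]
  simp only [ratDeriv_X, ratDeriv_one, map_one, map_zero]
  field_simp
  ring

theorem one_add_logDeriv : ratDeriv (1 + RatFunc.X) / (1 + RatFunc.X) = gam 0 1 := by
  rw [ratDeriv_add, gam]
  simp only [ratDeriv_X, ratDeriv_one, map_one, map_zero]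
  rw [add_comm (1 : RatFunc ℝ) RatFunc.X]
  ring

/-- `k` is the formal mean of `t` under the weight with parameters `a`, `b`, and the total masses
`nuBase` differ by this same factor. So constants are converted consistently when `t` moves out of
the weight. -/
theorem hasNorm_change {a b d d' k : ℝ} {t : RatFunc ℝ} (ht : t ≠ 0)
    (hl : ratDeriv t / t = gam d d') (he : Exact a b (t - RatFunc.C k))
    (hk : nuBase (a + d) (b + d') = nuBase a b * k) (hn : nuBase (a + d) (b + d') ≠ 0)
    (f : RatFunc ℝ) (ν : ℝ) : HasNorm (a + d) (b + d') f ν ↔ HasNorm a b (t * f) ν := by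
  rw [HasNorm, HasNorm, exact_mul_iff ht hl]
  have h1 := he.C_mul (ν / nuBase (a + d) (b + d'))
  have h0 : nuBase a b ≠ 0 := by intro h; rw [hk, h, zero_mul] at hn; exact hn rfl
  have hk0 : k ≠ 0 := by rintro rfl; rw [mul_zero] at hk; exact hn hk
  have e : ν / nuBase a b = ν / nuBase (a + d) (b + d') * k := by rw [hk]; field_simp
  rw [e, map_mul]
  constructor <;> intro h
  · convert! h.add h1 using 1; ring
  · convert! h.sub h1 using 1; ring

/-! ### Moving integer powers of `1 - x` and `1 + x` between weight and integrand -/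

section

variable {a b : ℝ} (ha : ¬ IsInt a) (hb : ¬ IsInt b) (hab : ¬ IsInt (a + b))
include ha hb hab

theorem hasNorm_one_sub (f : RatFunc ℝ) (ν : ℝ) :
    HasNorm (a + 1) b f ν ↔ HasNorm a b ((1 - RatFunc.X) * f) ν := by
  have h2 : a + b + 2 ≠ 0 := by
    have := ne_intCast_of_not_isInt (not_isInt_add_natCast hab 2) 0; simpa using this
  have he := (exact_one_sub (a := a) (b := b)).C_mul (a + b + 2)⁻¹
  have h := hasNorm_change (d := 1) (d' := 0) (k := 2 * (a + 1) / (a + b + 2)) one_sub_X_ne_zero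
    one_sub_logDeriv (by
      convert! he using 1
      rw [map_inv₀, map_div₀]
      have := C_ne_zero h2
      field_simp) (by
      rw [add_zero]; field_simp; linear_combination nuBase_succ_left ha hab) (by
      rw [add_zero]
      refine nuBase_ne_zero (not_isInt_add_one ha) hb ?_
      rw [add_right_comm]; exact not_isInt_add_one hab) f ν
  rwa [add_zero] at h

theorem hasNorm_one_add (f : RatFunc ℝ) (ν : ℝ) :
    HasNorm a (b + 1) f ν ↔ HasNorm a b ((1 + RatFunc.X) * f) ν := by
  have h2 : a + b + 2 ≠ 0 := by
    have := ne_intCast_of_not_isInt (not_isInt_add_natCast hab 2) 0; simpa using this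
  have he := (exact_one_add (a := a) (b := b)).C_mul (a + b + 2)⁻¹
  have h := hasNorm_change (d := 0) (d' := 1) (k := 2 * (b + 1) / (a + b + 2)) one_add_X_ne_zero
    one_add_logDeriv (by
      convert! he using 1
      rw [map_inv₀, map_div₀]
      have := C_ne_zero h2
      field_simp) (by
      rw [add_zero]; field_simp; linear_combination nuBase_succ_right hb hab) (by
      rw [add_zero]
      refine nuBase_ne_zero ha (not_isInt_add_one hb) ?_
      rw [← add_assoc]; exact not_isInt_add_one hab) f ν
  rwa [add_zero] at h

theorem hasNorm_one_sub_zpow (f : RatFunc ℝ) (ν : ℝ) (m : ℤ) :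
    HasNorm (a + m) b f ν ↔ HasNorm a b ((1 - RatFunc.X) ^ m * f) ν := by
  have hi : ∀ k : ℤ, ¬ IsInt (a + k) ∧ ¬ IsInt (a + k + b) := fun k =>
    ⟨not_isInt_add_intCast ha k, by rw [add_right_comm]; exact not_isInt_add_intCast hab k⟩
  induction m using Int.induction_on generalizing f with
  | zero => simp
  | succ m ih =>
    have ih : ∀ f, HasNorm (a + ((m : ℤ) : ℝ)) b f ν ↔ HasNorm a b ((1 - RatFunc.X) ^ (m : ℤ) * f) ν := ih
    have h := hasNorm_one_sub (hi m).1 hb (hi m).2 f ν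
    rw [ih] at h
    rw [zpow_add_one₀ one_sub_X_ne_zero, mul_assoc, ← h]
    push_cast
    rw [add_assoc]
  | pred m ih =>
    have ih : ∀ f, HasNorm (a + ((-m : ℤ) : ℝ)) b f ν ↔ HasNorm a b ((1 - RatFunc.X) ^ (-m : ℤ) * f) ν := ih
    have h := hasNorm_one_sub (hi (-m - 1)).1 hb (hi (-m - 1)).2 ((1 - RatFunc.X)⁻¹ * f) ν
    rw [mul_inv_cancel_left₀ one_sub_X_ne_zero] at h
    rw [← h, zpow_sub_one₀ one_sub_X_ne_zero, mul_assoc, ← ih]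
    push_cast
    rw [add_assoc, sub_add_cancel]

theorem hasNorm_one_add_zpow (f : RatFunc ℝ) (ν : ℝ) (m : ℤ) :
    HasNorm a (b + m) f ν ↔ HasNorm a b ((1 + RatFunc.X) ^ m * f) ν := by
  have hi : ∀ k : ℤ, ¬ IsInt (b + k) ∧ ¬ IsInt (a + (b + k)) := fun k =>
    ⟨not_isInt_add_intCast hb k, by rw [← add_assoc]; exact not_isInt_add_intCast hab k⟩
  induction m using Int.induction_on generalizing f with
  | zero => simp
  | succ m ih =>
    have ih : ∀ f, HasNorm a (b + ((m : ℤ) : ℝ)) f ν ↔ HasNorm a b ((1 + RatFunc.X) ^ (m : ℤ) * f) ν := ih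
    have h := hasNorm_one_add ha (hi m).1 (hi m).2 f ν
    rw [ih] at h
    rw [zpow_add_one₀ one_add_X_ne_zero, mul_assoc, ← h]
    push_cast
    rw [add_assoc]
  | pred m ih =>
    have ih : ∀ f, HasNorm a (b + ((-m : ℤ) : ℝ)) f ν ↔ HasNorm a b ((1 + RatFunc.X) ^ (-m : ℤ) * f) ν := ih
    have h := hasNorm_one_add ha (hi (-m - 1)).1 (hi (-m - 1)).2 ((1 + RatFunc.X)⁻¹ * f) ν
    rw [mul_inv_cancel_left₀ one_add_X_ne_zero] at h
    rw [← h, zpow_sub_one₀ one_add_X_ne_zero, mul_assoc, ← ih]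
    push_cast
    rw [add_assoc, sub_add_cancel]

/-- Two different norms would make a nonzero constant exact. -/
theorem hasNorm_unique {f : RatFunc ℝ} {ν ν' : ℝ} (h : HasNorm a b f ν) (h' : HasNorm a b f ν') :
    ν = ν' := by
  by_contra hne
  have h1 := h'.sub h
  have hn := nuBase_ne_zero ha hb hab
  rw [sub_sub_sub_cancel_left, ← map_sub, ← sub_div] at h1
  refine not_exact_const ha hb (fun k => ?_) (div_ne_zero (sub_ne_zero.2 hne) hn) h1
  have := ne_intCast_of_not_isInt (not_isInt_add_natCast hab (2 + k)) 0
  push_cast at this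
  rwa [← add_assoc] at this

end

theorem HasNorm.C_mul {a b : ℝ} {f : RatFunc ℝ} {ν : ℝ} (h : HasNorm a b f ν) (c : ℝ) :
    HasNorm a b (RatFunc.C c * f) (c * ν) := by
  have := Exact.C_mul h c
  rwa [mul_sub, ← map_mul, ← mul_div_assoc] at this

theorem HasNorm.add_exact {a b : ℝ} {f g : RatFunc ℝ} {ν : ℝ} (h : HasNorm a b f ν)
    (hg : Exact a b g) : HasNorm a b (f + g) ν := by
  have := Exact.add h hg
  rwa [sub_add_eq_add_sub] at this

theorem nu_zero {a b : ℝ} (hab : ¬ IsInt (a + b)) : nu 0 a b = nuBase a b := by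
  have h3 := Gamma_ne_zero_of_not_isInt (not_isInt_add_one hab)
  rw [nu, nuBase]
  simp only [mul_zero, add_zero, zero_add, Real.Gamma_one]
  field_simp

/-- The recursion of the norms under differentiation of the polynomials; it is what the induction in
`IsEig.hasNorm` consumes. -/
theorem nu_succ {a b : ℝ} (hab : ¬ IsInt (a + b)) (n : ℕ) :
    nu ((n : ℝ) + 1) a b * ((n : ℝ) + 1 + a + b + 1) =
      ((n : ℝ) + 1) * nu n (a + 1) (b + 1) := by
  have h1 : (n : ℝ) + 1 ≠ 0 := by positivity
  have h2 : (n : ℝ) + 1 + a + b + 1 ≠ 0 := by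
    have := ne_intCast_of_not_isInt (not_isInt_add_natCast hab (n + 2)) 0
    push_cast at this
    intro h; apply this; linarith
  rw [nu, nu, Real.Gamma_add_one h1,
    show a + 1 + (b + 1) + (n : ℝ) + 1 = ((n : ℝ) + 1 + a + b + 1) + 1 by ring,
    Real.Gamma_add_one h2,
    show a + b + ((n : ℝ) + 1) + 1 = (n : ℝ) + 1 + a + b + 1 by ring,
    show 1 + (a + 1) + (b + 1) + 2 * (n : ℝ) = 1 + a + b + 2 * ((n : ℝ) + 1) by ring,
    show a + 1 + (b + 1) + 2 * (n : ℝ) + 1 = a + b + 2 * ((n : ℝ) + 1) + 1 by ring,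
    show a + 1 + (b + 1) + 2 * (n : ℝ) + 2 = a + b + 2 * ((n : ℝ) + 1) + 2 by ring,
    show a + 1 + (n : ℝ) + 1 = a + ((n : ℝ) + 1) + 1 by ring,
    show b + 1 + (n : ℝ) + 1 = b + ((n : ℝ) + 1) + 1 by ring]
  ring

/-- The derivative of `P`, made monic, is the eigenpolynomial of degree one less for both parameters
raised by one. By `exact_sq`, the eigenvalue times the norm of `P²` is the norm of `(1-x²) P'²`. -/
theorem IsEig.hasNorm (n : ℕ) : ∀ {a b : ℝ} {P : ℝ[X]}, ¬ IsInt a → ¬ IsInt b →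
    ¬ IsInt (a + b) → IsEig a b (n * (n + a + b + 1)) P → P.Monic → P.natDegree = n →
    HasNorm a b (toRat P ^ 2) (nu n a b) := by
  induction n with
  | zero =>
    intro a b P ha hb hab _ hP hn
    have := hP.natDegree_eq_zero.1 hn
    rw [this, Nat.cast_zero, nu_zero hab, HasNorm, div_self (nuBase_ne_zero ha hb hab)]
    exact ⟨0, by simp [toRat]⟩
  | succ n ih =>
    intro a b P ha hb hab h hP hn
    have hn1 : (n : ℝ) + 1 ≠ 0 := by positivity
    have h2 : (n : ℝ) + 1 + a + b + 1 ≠ 0 := by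
      have := ne_intCast_of_not_isInt (not_isInt_add_natCast hab (n + 2)) 0
      push_cast at this
      intro h; apply this; linarith
    have hab2 : ¬ IsInt (a + 1 + (b + 1)) := by
      have := not_isInt_add_natCast hab 2
      push_cast at this
      rwa [show a + 1 + (b + 1) = a + b + 2 by ring]
    have hab1 : ¬ IsInt (a + (b + 1)) := by rw [← add_assoc]; exact not_isInt_add_one hab
    set Q := C ((n : ℝ) + 1)⁻¹ * Polynomial.derivative P with hQ
    have hQd : Q.natDegree = n := by
      rw [hQ, natDegree_C_mul (inv_ne_zero hn1), natDegree_derivative P]; omega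
    have hQm : Q.Monic := by
      rw [Monic, leadingCoeff, hQd, hQ, coeff_C_mul, coeff_derivative, ← hn, hP.coeff_natDegree,
        one_mul, inv_mul_cancel₀ hn1]
    have hQe : IsEig (a + 1) (b + 1) (n * (n + (a + 1) + (b + 1) + 1)) Q := by
      have := h.derivative.C_mul ((n : ℝ) + 1)⁻¹
      convert! this using 1
      push_cast; ring
    have h3 := ih (not_isInt_add_one ha) (not_isInt_add_one hb) hab2 hQe hQm hQd
    rw [hasNorm_one_sub ha (not_isInt_add_one hb) hab1, hasNorm_one_add ha hb hab] at h3
    have h4 := (h3.C_mul (((n : ℝ) + 1) ^ 2)).add_exact h.exact_sq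
    have e : RatFunc.C (((n : ℝ) + 1) ^ 2) * ((1 + RatFunc.X) * ((1 - RatFunc.X) * toRat Q ^ 2)) +
        (RatFunc.C (((n + 1 : ℕ) : ℝ) * (((n + 1 : ℕ) : ℝ) + a + b + 1)) * toRat P ^ 2 +
          x21 * toRat (Polynomial.derivative P) ^ 2) =
        RatFunc.C (((n : ℝ) + 1) * ((n : ℝ) + 1 + a + b + 1)) * toRat P ^ 2 := by
      rw [hQ, toRat_mul, toRat_C, x21, map_inv₀]
      have := C_ne_zero hn1
      push_cast
      rw [map_pow]
      field_simp
      ring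
    rw [e] at h4
    have h5 := h4.C_mul (((n : ℝ) + 1) * ((n : ℝ) + 1 + a + b + 1))⁻¹
    rw [← mul_assoc, ← map_mul, inv_mul_cancel₀ (mul_ne_zero hn1 h2), map_one, one_mul] at h5
    convert! h5 using 1
    have h6 := nu_succ hab n
    push_cast
    field_simp
    linear_combination h6

/-! ### Types and exponents -/

/-- Whether functions of the given type are singular at `1`. -/
def QRType.sing1 : QRType → Bool
  | .one => false
  | .two => true
  | .three => true
  | .four => false

/-- Whether functions of the given type are singular at `-1`. -/
def QRType.singm : QRType → Bool
  | .one => false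
  | .two => true
  | .three => false
  | .four => true

/-- The type of the dual eigenfunction. -/
def QRType.dual : QRType → QRType
  | .one => .two
  | .two => .one
  | .three => .four
  | .four => .three

theorem QRType.sing1_dual (ι : QRType) : ι.dual.sing1 = !ι.sing1 := by cases ι <;> rfl

theorem QRType.singm_dual (ι : QRType) : ι.dual.singm = !ι.singm := by cases ι <;> rfl

theorem QRType.ext_sing {ι κ : QRType} (h1 : ι.sing1 = κ.sing1) (h2 : ι.singm = κ.singm) :
    ι = κ := by
  cases ι <;> cases κ <;> first | rfl | (exact absurd h1 (by decide)) |
    (exact absurd h2 (by decide))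

/-- The exponents at `±1` of the regular and singular eigenfunctions of an operator. -/
structure Expo where
  r1 : ℝ
  s1 : ℝ
  rm : ℝ
  sm : ℝ

namespace Expo

/-- The exponent at `1` of functions of type `ι`. -/
def e1 (E : Expo) (ι : QRType) : ℝ := if ι.sing1 then E.s1 else E.r1

/-- The exponent at `-1` of functions of type `ι`. -/
def em (E : Expo) (ι : QRType) : ℝ := if ι.singm then E.sm else E.rm

/-- The exponents after a Darboux transformation with a seed of type `κ`. -/
def step (E : Expo) (κ : QRType) : Expo where
  r1 := if κ.sing1 then E.r1 - 1 else E.r1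
  s1 := if κ.sing1 then E.s1 else E.s1 - 1
  rm := if κ.singm then E.rm - 1 else E.rm
  sm := if κ.singm then E.sm else E.sm - 1

end Expo

/-- The exponents of the log-derivative `w` at `±1` and its degree at infinity. -/
structure Asym (E : Expo) (ι : QRType) (d : ℝ) (w : RatFunc ℝ) : Prop where
  one : ValAt 1 (E.e1 ι) ((RatFunc.X - RatFunc.C 1) * w)
  neg : ValAt (-1) (E.em ι) ((RatFunc.X - RatFunc.C (-1)) * w)
  inf : ValInf d (RatFunc.X * w)

/-- An operator with the first two coefficients of a Jacobi operator with parameters `A`, `B`,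
and with exponents `E` at `±1`. -/
structure JacOp (T : DiffOp) (A B : ℝ) (E : Expo) : Prop where
  p : T.p = x21
  q : T.q = x21 * gam (A + 1) (B + 1)
  sum1 : E.r1 + E.s1 = -A
  summ : E.rm + E.sm = -B
  int1 : IsInt E.r1
  intm : IsInt E.rm
  hA : ¬ IsInt A
  hB : ¬ IsInt B

theorem ratDeriv_x21 : ratDeriv x21 = x21 * gam 1 1 := by
  rw [← x21_logDeriv]; field_simp [x21_ne_zero]

theorem IsInt.sub_one {x : ℝ} (h : IsInt x) : IsInt (x - 1) := by
  obtain ⟨m, rfl⟩ := h; exact ⟨m - 1, by push_cast; ring⟩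

namespace JacOp

variable {T : DiffOp} {A B : ℝ} {E : Expo}

theorem p_ne_zero (h : JacOp T A B E) : T.p ≠ 0 := by rw [h.p]; exact x21_ne_zero

theorem darboux (h : JacOp T A B E) (w : RatFunc ℝ) (κ : QRType) :
    JacOp (T.darboux w) (A + 1) (B + 1) (E.step κ) where
  p := h.p
  q := by
    change T.q + ratDeriv T.p = _
    rw [h.q, h.p, ratDeriv_x21, ← mul_add, ← gam_add]
  sum1 := by
    have := h.sum1
    cases hk : κ.sing1 <;> simp [Expo.step, hk] <;> linarith
  summ := by
    have := h.summ
    cases hk : κ.singm <;> simp [Expo.step, hk] <;> linarith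
  int1 := by
    have := h.int1
    cases hk : κ.sing1 <;> simp [Expo.step, hk, this, this.sub_one]
  intm := by
    have := h.intm
    cases hk : κ.singm <;> simp [Expo.step, hk, this, this.sub_one]
  hA := not_isInt_add_one h.hA
  hB := not_isInt_add_one h.hB

/-- The regular exponent is an integer, and equality would force `A = -2 r1`. -/
theorem r1_ne_s1 (h : JacOp T A B E) : E.r1 ≠ E.s1 := by
  obtain ⟨m, hm⟩ := h.int1
  intro he
  have := h.sum1
  exact h.hA ⟨-(2 * m), by push_cast; linarith⟩

theorem rm_ne_sm (h : JacOp T A B E) : E.rm ≠ E.sm := by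
  obtain ⟨m, hm⟩ := h.intm
  intro he
  have := h.summ
  exact h.hB ⟨-(2 * m), by push_cast; linarith⟩

theorem type_unique (h : JacOp T A B E) {ι κ : QRType} {d d' : ℝ} {w : RatFunc ℝ}
    (h1 : Asym E ι d w) (h2 : Asym E κ d' w) : ι = κ := by
  have e1 := (isPlace_valAt 1).unique h1.one h2.one
  have e2 := (isPlace_valAt (-1)).unique h1.neg h2.neg
  have n1 := h.r1_ne_s1
  have n2 := h.rm_ne_sm
  apply QRType.ext_sing
  · cases hi : ι.sing1 <;> cases hk : κ.sing1 <;> simp [Expo.e1, hi, hk] at e1 ⊢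
    · exact n1 e1
    · exact n1 e1.symm
  · cases hi : ι.singm <;> cases hk : κ.singm <;> simp [Expo.em, hi, hk] at e2 ⊢
    · exact n2 e2
    · exact n2 e2.symm

/-- At `±1` the exponent stays if it agrees with that of the seed and drops by one otherwise, as
recorded in `Expo.step`. At infinity the degrees always differ, so the degree drops by one. -/
theorem asym_step (h : JacOp T A B E) {ι κ : QRType} {d d₁ lam lam₁ : ℝ} {w w₁ : RatFunc ℝ}
    (hne : lam ≠ lam₁) (h₁ : w₁ ∈ ricSet T lam₁) (hw : w ∈ ricSet T lam)
    (a₁ : Asym E κ d₁ w₁) (a : Asym E ι d w) :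
    Asym (E.step κ) ι (d - 1) (darbouxLog w₁ w) where
  one := by
    have hp : ∃ b, ValAt 1 b (T.p / (RatFunc.X - RatFunc.C 1)) := ⟨2, h.p ▸ x21_valAt_one⟩
    have hq : ValAt 1 (2 * (A + 1)) T.q := h.q ▸ x21_gam_valAt_one _ _
    have n1 := h.r1_ne_s1
    have a1 := a.one
    have a2 := a₁.one
    cases hi : ι.sing1 <;> cases hk : κ.sing1 <;>
      simp only [Expo.e1, Expo.step, hi, hk, if_true, if_false, Bool.false_eq_true] at a1 a2 ⊢
    · exact darbouxLog_valAt_of_eq hp hq hne h₁ hw a1 a2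
    · exact (isPlace_valAt 1).darbouxLog_of_ne a1 a2 n1
    · exact (isPlace_valAt 1).darbouxLog_of_ne a1 a2 n1.symm
    · exact darbouxLog_valAt_of_eq hp hq hne h₁ hw a1 a2
  neg := by
    have hp : ∃ b, ValAt (-1) b (T.p / (RatFunc.X - RatFunc.C (-1))) :=
      ⟨-2, h.p ▸ x21_valAt_neg_one⟩
    have hq : ValAt (-1) (-2 * (B + 1)) T.q := h.q ▸ x21_gam_valAt_neg_one _ _
    have n1 := h.rm_ne_sm
    have a1 := a.neg
    have a2 := a₁.neg
    cases hi : ι.singm <;> cases hk : κ.singm <;>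
      simp only [Expo.em, Expo.step, hi, hk, if_true, if_false, Bool.false_eq_true] at a1 a2 ⊢
    · exact darbouxLog_valAt_of_eq hp hq hne h₁ hw a1 a2
    · exact (isPlace_valAt (-1)).darbouxLog_of_ne a1 a2 n1
    · exact (isPlace_valAt (-1)).darbouxLog_of_ne a1 a2 n1.symm
    · exact darbouxLog_valAt_of_eq hp hq hne h₁ hw a1 a2
  inf := by
    have hp : ValInf 1 (T.p / RatFunc.X ^ 2) := h.p ▸ x21_valInf
    have hq : ValInf (A + 1 + (B + 1)) (T.q / RatFunc.X) := h.q ▸ x21_gam_valInf _ _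
    exact isPlace_valInf.darbouxLog_of_ne a.inf a₁.inf
      (valInf_ne_of_ricSet hp hq hne h₁ hw a.inf a₁.inf)

theorem dual_eq (h : JacOp T A B E) (w : RatFunc ℝ) : T.dual w = -gam (A + 1) (B + 1) - w := by
  rw [DiffOp.dual, h.p, h.q, mul_div_cancel_left₀ _ x21_ne_zero]

/-- The two exponents at an endpoint add up to `-A` or `-B`, so `e ↦ -(A+1) - e` exchanges regular
and singular, up to the drop by one recorded in `Expo.step`. -/
theorem asym_dual (h : JacOp T A B E) {κ : QRType} {d : ℝ} {w : RatFunc ℝ}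
    (a : Asym E κ d w) : Asym (E.step κ) κ.dual (-(A + B + 2) - d) (T.dual w) where
  one := by
    have P := isPlace_valAt 1
    have h1 := P.sub (P.neg (gam_valAt_one (A + 1) (B + 1))) a.one
    rw [h.dual_eq]
    convert! h1 using 1
    · have := h.sum1
      rw [Expo.e1, Expo.e1, κ.sing1_dual]
      cases hk : κ.sing1 <;> simp [Expo.step, hk] <;> linarith
    · ring
  neg := by
    have P := isPlace_valAt (-1)
    have h1 := P.sub (P.neg (gam_valAt_neg_one (A + 1) (B + 1))) a.neg
    rw [h.dual_eq]
    convert! h1 using 1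
    · have := h.summ
      rw [Expo.em, Expo.em, κ.singm_dual]
      cases hk : κ.singm <;> simp [Expo.step, hk] <;> linarith
    · ring
  inf := by
    have P := isPlace_valInf
    have h1 := P.sub (P.neg (gam_valInf (A + 1) (B + 1))) a.inf
    rw [h.dual_eq]
    convert! h1 using 1 <;> ring

end JacOp

/-! ### Chains of Darboux transformations -/

/-- A quasi-rational eigenfunction with its eigenvalue, type and degree. -/
structure Seed where
  y : QF
  lam : ℝ
  ty : QRType
  deg : ℝ

/-- The effect on `s` of a Darboux transformation with seed `φ`. -/
def Seed.step (φ s : Seed) : Seed := ⟨φ.y.step s.y, s.lam, s.ty, s.deg - 1⟩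

/-- The data of `s` are correct with respect to `T`. -/
structure IsEigen (T : DiffOp) (E : Expo) (s : Seed) : Prop where
  f0 : s.y.f ≠ 0
  mem : s.y.lg ∈ ricSet T s.lam
  asym : Asym E s.ty s.deg s.y.lg

theorem IsEigen.step {T : DiffOp} {A B : ℝ} {E : Expo} {φ s : Seed} (hT : JacOp T A B E)
    (hφ : IsEigen T E φ) (hs : IsEigen T E s) (hne : s.lam ≠ φ.lam) :
    IsEigen (T.darboux φ.y.lg) (E.step φ.ty) (φ.step s) := by
  have h0 := sub_ne_zero_of_ricSet hne hφ.mem hs.mem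
  have hl : (φ.step s).y.lg = darbouxLog φ.y.lg s.y.lg := QF.lg_step hs.f0 h0
  exact ⟨QF.step_f_ne_zero hs.f0 h0, hl ▸ darbouxLog_mem hT.p_ne_zero hne hφ.mem hs.mem,
    hl ▸ hT.asym_step hne hφ.mem hs.mem hφ.asym hs.asym⟩

/-- The iterated Darboux transform of `T` with respect to a list of seeds. -/
def opAfter (T : DiffOp) : List Seed → DiffOp
  | [] => T
  | φ :: L => opAfter (T.darboux φ.y.lg) (L.map φ.step)
termination_by L => L.length
decreasing_by simp

/-- The exponents after a chain of Darboux transformations. -/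
def expoAfter (E : Expo) (L : List Seed) : Expo := L.foldl (fun E s => E.step s.ty) E

/-- The effect of a chain of Darboux transformations on log-derivatives. -/
def wtr : List Seed → RatFunc ℝ → RatFunc ℝ
  | [], w => w
  | φ :: L, w => wtr (L.map φ.step) (darbouxLog φ.y.lg w)
termination_by L => L.length
decreasing_by simp

theorem expoAfter_map (E : Expo) (φ : Seed) (L : List Seed) :
    expoAfter E (L.map φ.step) = expoAfter E L := by
  induction L generalizing E with
  | nil => rfl
  | cons s L ih => exact ih _

theorem expoAfter_cons (E : Expo) (φ : Seed) (L : List Seed) :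
    expoAfter E (φ :: L) = expoAfter (E.step φ.ty) L := rfl

/-- The seeds in `L` are eigenfunctions with distinct eigenvalues and nonzero norms. -/
structure IsChain (T : DiffOp) (E : Expo) (L : List Seed) : Prop where
  eigen : ∀ s ∈ L, IsEigen T E s
  notExact : ∀ s ∈ L, NotExact T s.y.lg
  distinct : L.Pairwise fun s s' => s.lam ≠ s'.lam

/-- `NotExact` has to be carried along for the remaining seeds, since it is needed when each of them
becomes the seed of a step. -/
theorem IsChain.tail {T : DiffOp} {A B : ℝ} {E : Expo} {φ : Seed} {L : List Seed}
    (hT : JacOp T A B E) (h : IsChain T E (φ :: L)) :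
    IsChain (T.darboux φ.y.lg) (E.step φ.ty) (L.map φ.step) := by
  have hd := List.pairwise_cons.1 h.distinct
  have hφ := h.eigen φ (by simp)
  refine ⟨?_, ?_, ?_⟩
  · intro s hs
    obtain ⟨s, hs', rfl⟩ := List.mem_map.1 hs
    exact hφ.step hT (h.eigen s (by simp [hs'])) (hd.1 s hs').symm
  · intro s hs
    obtain ⟨s, hs', rfl⟩ := List.mem_map.1 hs
    have he := h.eigen s (by simp [hs'])
    have hne := (hd.1 s hs').symm
    have hl : (φ.step s).y.lg = darbouxLog φ.y.lg s.y.lg :=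
      QF.lg_step he.f0 (sub_ne_zero_of_ricSet hne hφ.mem he.mem)
    rw [hl]
    exact (h.notExact s (by simp [hs'])).darboux hT.p_ne_zero hne hφ.mem he.mem
  · exact List.pairwise_map.2 hd.2

theorem seed_map_y (φ : Seed) (L : List Seed) :
    (L.map φ.step).map Seed.y = (L.map Seed.y).map φ.y.step := by
  rw [List.map_map, List.map_map]; rfl

theorem mem_lam_map {φ : Seed} {L : List Seed} {lam : ℝ} (h : ∀ s ∈ L, lam ≠ s.lam) :
    ∀ s ∈ L.map φ.step, lam ≠ s.lam := by
  intro s hs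
  obtain ⟨s, hs', rfl⟩ := List.mem_map.1 hs
  exact h s hs'

theorem IsChain.nondeg (L : List Seed) : ∀ {T : DiffOp} {A B : ℝ} {E : Expo}, JacOp T A B E →
    IsChain T E L → Nondeg (L.map Seed.y) := by
  induction L using length_induction Seed.step with
  | nil => intro T A B E _ _; rw [List.map_nil, Nondeg]; trivial
  | cons φ L ih =>
    intro T A B E hT h
    rw [List.map_cons, Nondeg, ← seed_map_y]
    exact ⟨(h.eigen φ (by simp)).f0, ih (hT.darboux _ φ.ty) (h.tail hT)⟩

theorem jacOp_opAfter (L : List Seed) : ∀ {T : DiffOp} {A B : ℝ} {E : Expo}, JacOp T A B E →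
    JacOp (opAfter T L) (A + L.length) (B + L.length) (expoAfter E L) := by
  induction L using length_induction Seed.step with
  | nil => intro T A B E h; rw [opAfter]; simpa [expoAfter] using h
  | cons φ L ih =>
    intro T A B E h
    have := ih (h.darboux φ.y.lg φ.ty)
    rw [expoAfter_map, List.length_map] at this
    rw [opAfter, expoAfter_cons, List.length_cons]
    convert! this using 1 <;> push_cast <;> ring

/-- The zero-order coefficient depends on the seeds only through their number and the sum of the
successive log-derivatives, hence by `lgSum_eq` through the Wronskian. -/
theorem opAfter_r (L : List Seed) : ∀ T : DiffOp, (opAfter T L).p = T.p ∧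
    (opAfter T L).r = T.r + L.length * ratDeriv T.q +
      L.length * (L.length - 1) / 2 * ratDeriv (ratDeriv T.p) +
      2 * T.p * ratDeriv (lgSum (L.map Seed.y)) + ratDeriv T.p * lgSum (L.map Seed.y) := by
  induction L using length_induction Seed.step with
  | nil => intro T; rw [opAfter, List.map_nil, lgSum]; simp
  | cons φ L ih =>
    intro T
    obtain ⟨h1, h2⟩ := ih (T.darboux φ.y.lg)
    rw [opAfter, List.map_cons, lgSum, ← seed_map_y]
    refine ⟨h1, ?_⟩
    rw [h2, ratDeriv_add φ.y.lg]
    simp only [DiffOp.darboux, List.length_map, List.length_cons, ratDeriv_add]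
    push_cast
    ring

theorem wtr_bijOn (L : List Seed) : ∀ {T : DiffOp} {A B : ℝ} {E : Expo}, JacOp T A B E →
    IsChain T E L → ∀ {lam : ℝ}, (∀ s ∈ L, lam ≠ s.lam) →
    BijOn (wtr L) (ricSet T lam) (ricSet (opAfter T L) lam) := by
  induction L using length_induction Seed.step with
  | nil =>
    intro T A B E _ _ lam _
    rw [opAfter]
    exact (bijOn_id _).congr fun w _ => by rw [wtr]; rfl
  | cons φ L ih =>
    intro T A B E hT h lam hl
    rw [opAfter]
    have h1 := darbouxLog_bijOn hT.p_ne_zero (hl φ (by simp)) (h.eigen φ (by simp)).mem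
    have h2 := ih (hT.darboux _ φ.ty) (h.tail hT)
      (mem_lam_map fun s hs => hl s (by simp [hs]))
    exact (h2.comp h1).congr fun w _ => by rw [wtr]; rfl

theorem wtr_asym (L : List Seed) : ∀ {T : DiffOp} {A B : ℝ} {E : Expo}, JacOp T A B E →
    IsChain T E L → ∀ {lam : ℝ}, (∀ s ∈ L, lam ≠ s.lam) → ∀ {w ι d}, w ∈ ricSet T lam →
    Asym E ι d w → Asym (expoAfter E L) ι (d - L.length) (wtr L w) := by
  induction L using length_induction Seed.step with
  | nil => intro T A B E _ _ lam _ w ι d _ h; rw [wtr]; simpa [expoAfter] using h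
  | cons φ L ih =>
    intro T A B E hT h lam hl w ι d hw ha
    have hφ := h.eigen φ (by simp)
    have hne := hl φ (by simp)
    have := ih (hT.darboux _ φ.ty) (h.tail hT) (mem_lam_map fun s hs => hl s (by simp [hs]))
      (darbouxLog_mem hT.p_ne_zero hne hφ.mem hw) (hT.asym_step hne hφ.mem hw hφ.asym ha)
    rw [expoAfter_map, List.length_map] at this
    rw [wtr, expoAfter_cons, List.length_cons]
    convert! this using 1
    push_cast; ring

/-- When a seed is used, its eigenvalue keeps only the dual solution, and the later steps carry that
solution along. This is the origin of the indices `-k - 1` in the index sets. -/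
theorem ricSet_opAfter_seed (L : List Seed) : ∀ {T : DiffOp} {A B : ℝ} {E : Expo},
    JacOp T A B E → IsChain T E L → ∀ s ∈ L, ∃ w, ricSet (opAfter T L) s.lam = {w} ∧
      Asym (expoAfter E L) s.ty.dual (-(A + B + 1) - s.deg - L.length) w := by
  induction L using length_induction Seed.step with
  | nil => intro T A B E _ _ s hs; simp at hs
  | cons φ L ih =>
    intro T A B E hT h s hs
    rw [opAfter, expoAfter_cons, List.length_cons]
    have hT' := hT.darboux φ.y.lg φ.ty
    have ht := h.tail hT
    have hd := List.pairwise_cons.1 h.distinct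
    rcases List.mem_cons.1 hs with rfl | hs'
    · have hφ := h.eigen s (by simp)
      have h1 := ricSet_darboux_self hT.p_ne_zero hφ.mem (h.notExact s (by simp))
      have hl := mem_lam_map (φ := s) hd.1
      have h2 := (wtr_bijOn _ hT' ht hl).image_eq
      rw [h1, image_singleton] at h2
      refine ⟨_, h2.symm, ?_⟩
      have h3 := wtr_asym _ hT' ht hl (by rw [h1]; rfl) (hT.asym_dual hφ.asym)
      rw [expoAfter_map, List.length_map] at h3
      convert! h3 using 1
      push_cast; ring
    · obtain ⟨w, h1, h2⟩ := ih hT' ht (φ.step s) (List.mem_map_of_mem hs')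
      rw [expoAfter_map, List.length_map] at h2
      refine ⟨w, h1, ?_⟩
      convert! h2 using 1
      simp only [Seed.step]
      push_cast; ring

/-- The properties of the transform of an eigenfunction that is not among the seeds. -/
theorem trans_spec (L : List Seed) : ∀ {T : DiffOp} {A B : ℝ} {E : Expo}, JacOp T A B E →
    IsChain T E L → ∀ {s : Seed}, (∀ s' ∈ L, s.lam ≠ s'.lam) → IsEigen T E s →
    (trans (L.map Seed.y) s.y).f ≠ 0 ∧
    (trans (L.map Seed.y) s.y).lg ∈ ricSet (opAfter T L) s.lam ∧
    Asym (expoAfter E L) s.ty (s.deg - L.length) (trans (L.map Seed.y) s.y).lg ∧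
    (∀ (c : ℝ) (m : ℤ), ValInf c (s.y.f * RatFunc.X ^ (-m)) →
      ValInf (c * (L.map fun s' => s.deg - s'.deg).prod)
        ((trans (L.map Seed.y) s.y).f * RatFunc.X ^ (-(m - L.length)))) ∧
    (s.y.ω = 0 → Exact A B ((trans (L.map Seed.y) s.y).f ^ 2 * x21 ^ L.length -
      RatFunc.C (L.map fun s' => s'.lam - s.lam).prod * s.y.f ^ 2)) := by
  induction L using length_induction Seed.step with
  | nil =>
    intro T A B E _ _ s _ hs
    rw [List.map_nil, trans, opAfter]
    refine ⟨hs.f0, hs.mem, by simpa [expoAfter] using hs.asym, by simp, fun _ => ⟨0, by simp⟩⟩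
  | cons φ L ih =>
    intro T A B E hT h s hl hs
    have hφ := h.eigen φ (by simp)
    have hne := hl φ (by simp)
    have hs' := hφ.step hT hs hne
    obtain ⟨h1, h2, h3, h4, h5⟩ := ih (hT.darboux _ φ.ty) (h.tail hT) (s := φ.step s)
      (mem_lam_map fun s hs => hl s (by simp [hs])) hs'
    rw [List.map_cons, trans, ← seed_map_y, opAfter, expoAfter_cons, List.length_cons]
    rw [expoAfter_map, List.length_map] at h3
    rw [List.length_map] at h4 h5
    refine ⟨h1, h2, ?_, ?_, ?_⟩
    · convert! h3 using 1
      simp only [Seed.step]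
      push_cast; ring
    · intro c m hc
      -- The difference of log-derivatives behaves like `(deg s - deg φ)/x` at infinity, so each
      -- step multiplies the leading coefficient by a difference of degrees. Later steps see the
      -- same differences, as all degrees drop together.
      have hv : ValInf (c * (s.deg - φ.deg)) ((φ.step s).y.f * RatFunc.X ^ (-(m - 1))) := by
        have h6 := isPlace_valInf.mul hc (isPlace_valInf.sub hs.asym.inf hφ.asym.inf)
        convert! h6 using 1
        have e : (φ.step s).y.f = (s.y.lg - φ.y.lg) * s.y.f := QF.step_f hs.f0
        have hz : (RatFunc.X : RatFunc ℝ) ^ (-(m - 1)) = RatFunc.X ^ (-m) * RatFunc.X := by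
          rw [show -(m - 1) = -m + 1 by ring, zpow_add₀ RatFunc.X_ne_zero, zpow_one]
        rw [e, hz]
        ring
      have h6 := h4 _ _ hv
      convert! h6 using 1
      · rw [List.map_map, List.map_cons, List.prod_cons, mul_assoc]
        congr 3
        refine List.map_congr_left fun s' _ => ?_
        simp only [Function.comp, Seed.step]; ring
      · congr 2
        push_cast; ring
    · intro hω
      have h6 := h5 hω
      rw [exact_x21_mul_iff] at h6
      have hδ := ricSet_sub hφ.mem hs.mem
      have e : (φ.step s).y.f = (s.y.lg - φ.y.lg) * s.y.f := QF.step_f hs.f0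
      have hlg : ratDeriv s.y.f = s.y.lg * s.y.f := by
        rw [QF.lg, hω, zero_add, div_mul_cancel₀ _ hs.f0]
      -- Integration by parts for one step: modulo exact terms, the transformed square with the
      -- extra factor `x² - 1` is `φ.lam - s.lam` times the old square.
      have h7 : Exact A B (x21 * (φ.step s).y.f ^ 2 -
          RatFunc.C (φ.lam - s.lam) * s.y.f ^ 2) := by
        refine ⟨x21 * (s.y.lg - φ.y.lg) * s.y.f ^ 2, ?_⟩
        rw [hT.p, hT.q, gam_add] at hδ
        rw [e, ratDeriv_mul, ratDeriv_mul, ratDeriv_pow, hlg, ratDeriv_x21,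
          ← neg_sub s.lam, map_neg, ← hδ]
        push_cast
        ring
      have h8 := h6.add (h7.C_mul (List.map (fun s' => s'.lam - s.lam) L).prod)
      convert! h8 using 1
      have e2 : (List.map (fun s' => s'.lam - (φ.step s).lam) (L.map φ.step)) =
          List.map (fun s' => s'.lam - s.lam) L := by
        rw [List.map_map]; rfl
      have e3 : (φ.step s).y = φ.y.step s.y := rfl
      rw [e2, e3, List.map_cons, List.prod_cons, map_mul, pow_succ]
      ring

/-! ### Eigenfunctions of the classical operator -/

/-- The exponent at `1` of the classical eigenfunctions of type `ι`. -/
def ex1 (ι : QRType) (a : ℝ) : ℝ := if ι.sing1 then -a else 0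

/-- The exponent at `-1` of the classical eigenfunctions of type `ι`. -/
def exm (ι : QRType) (b : ℝ) : ℝ := if ι.singm then -b else 0

/-- The first parameter of the Jacobi polynomials in eigenfunctions of type `ι`. -/
def par1 (ι : QRType) (a : ℝ) : ℝ := a + 2 * ex1 ι a

/-- The second parameter of the Jacobi polynomials in eigenfunctions of type `ι`. -/
def parm (ι : QRType) (b : ℝ) : ℝ := b + 2 * exm ι b

/-- The sum of the parameters of the Jacobi polynomials in eigenfunctions of type `ι`. -/
def parSum (ι : QRType) (a b : ℝ) : ℝ := par1 ι a + parm ι b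

/-- The exponents of the classical operator. -/
def classExpo (a b : ℝ) : Expo := ⟨0, -a, 0, -b⟩

theorem degMu_eq (ι : QRType) (a b : ℝ) : degMu ι a b = ex1 ι a + exm ι b := by
  cases ι <;> simp [degMu, ex1, exm, QRType.sing1, QRType.singm]; ring

theorem lamFn_eq (ι : QRType) (n a b : ℝ) : lamFn ι n a b = n * (n + parSum ι a b + 1) +
    (2 * ex1 ι a * exm ι b + ex1 ι a * (b + 1) + exm ι b * (a + 1)) := by
  cases ι <;> simp only [lamFn, parSum, par1, parm, ex1, exm, QRType.sing1, QRType.singm, if_true,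
    if_false, Bool.false_eq_true] <;> ring

/-- The argument on the right is the degree of the eigenfunction: the eigenvalues of all types are
one quadratic function of the degree. -/
theorem lamFn_eq_one (ι : QRType) (n a b : ℝ) :
    lamFn ι n a b = lamFn .one (n + degMu ι a b) a b := by
  cases ι <;> simp only [lamFn, degMu] <;> ring

/-- `λ₁` is quadratic and symmetric under `z ↦ -a - b - 1 - z`. Together with `lamFn_eq_one` this
decides the coincidences among eigenvalues. -/
theorem lamFn_one_inj {z z' a b : ℝ} :
    lamFn .one z a b = lamFn .one z' a b ↔ z = z' ∨ z + z' = -a - b - 1 := by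
  simp only [lamFn]
  rw [← sub_eq_zero, show z * (z + a + b + 1) - z' * (z' + a + b + 1) =
    (z - z') * (z + z' - (-a - b - 1)) by ring, mul_eq_zero, sub_eq_zero, sub_eq_zero]

theorem lamFn_dual (ι : QRType) (n a b : ℝ) : lamFn ι.dual (-n - 1) a b = lamFn ι n a b := by
  cases ι <;> simp only [lamFn, QRType.dual] <;> ring

theorem degMu_dual (ι : QRType) (a b : ℝ) : degMu ι.dual a b = -a - b - degMu ι a b := by
  cases ι <;> simp only [degMu, QRType.dual] <;> ring

theorem ex1_cases (ι : QRType) (a : ℝ) : ex1 ι a = 0 ∨ ex1 ι a = -a := by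
  cases h : ι.sing1 <;> simp [ex1, h]

theorem exm_cases (ι : QRType) (b : ℝ) : exm ι b = 0 ∨ exm ι b = -b := by
  cases h : ι.singm <;> simp [exm, h]

theorem isInt_neg {x : ℝ} (h : IsInt (-x)) : IsInt x := by
  obtain ⟨m, hm⟩ := h; exact ⟨-m, by push_cast; linarith⟩

theorem not_isInt_par1 (ι : QRType) {a : ℝ} (ha : ¬ IsInt a) : ¬ IsInt (par1 ι a) := by
  rcases ex1_cases ι a with h | h
  · rw [par1, h]; simpa using ha
  · rw [par1, h, show a + 2 * -a = -a by ring]; exact fun h => ha (isInt_neg h)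

theorem not_isInt_parm (ι : QRType) {b : ℝ} (hb : ¬ IsInt b) : ¬ IsInt (parm ι b) := by
  rcases exm_cases ι b with h | h
  · rw [parm, h]; simpa using hb
  · rw [parm, h, show b + 2 * -b = -b by ring]; exact fun h => hb (isInt_neg h)

theorem exists_type {a b e e' : ℝ} (he : e = 0 ∨ e = -a) (he' : e' = 0 ∨ e' = -b) :
    ∃ ι, e = ex1 ι a ∧ e' = exm ι b := by
  rcases he with rfl | rfl <;> rcases he' with rfl | rfl
  · exact ⟨.one, rfl, rfl⟩
  · exact ⟨.four, rfl, rfl⟩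
  · exact ⟨.three, rfl, rfl⟩
  · exact ⟨.two, rfl, rfl⟩

/-- The Jacobi polynomial of index `n`, whose parameters have sum `s`, has degree `n`. -/
def Good (n : ℕ) (s : ℝ) : Prop := (ascPochhammer ℝ n).eval ((n : ℝ) + s + 1) ≠ 0

theorem good_iff {n : ℕ} {s : ℝ} : Good n s ↔ ∀ j < n, (n : ℝ) + s + 1 + j ≠ 0 := by
  rw [Good, ascPochhammer_eval_eq_prod, Finset.prod_ne_zero_iff]; simp

theorem good_of_not_isInt (n : ℕ) {s : ℝ} (hs : ¬ IsInt s) : Good n s :=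
  good_iff.2 fun j _ h => hs ⟨-n - 1 - j, by push_cast; linarith⟩

/-- For an integer `s`, the factors `n + s + 1, …, 2n + s` avoid `0` exactly when all are negative
or all are positive. -/
theorem good_intCast_iff {n : ℕ} {s : ℤ} : Good n s ↔ 2 * (n : ℤ) + s < 0 ∨ 0 ≤ (n : ℤ) + s := by
  rw [good_iff]
  have h : ∀ j : ℕ, (n : ℝ) + s + 1 + j ≠ 0 ↔ (n : ℤ) + s + 1 + j ≠ 0 := fun j => by
    rw [Ne, Ne, not_iff_not]; exact_mod_cast Iff.rfl
  simp only [h]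
  constructor
  · intro h1
    by_contra! h2
    have := h1 (-(n : ℤ) - s - 1).toNat (by omega)
    omega
  · intro h1 j hj; omega

theorem jacobiP_natDegree_iff (n : ℕ) {a : ℝ} (b : ℝ) (ha : ¬ IsInt a) :
    (jacobiP n a b).natDegree = n ↔ Good n (a + b) := by
  have h := jacobiP_coeff n a b
  have h2 : (2 : ℝ) ^ n * n.factorial ≠ 0 := by positivity
  rw [Good, ← h, mul_ne_zero_iff_left h2]
  constructor
  · intro hd h0
    have h1 : (jacobiP n a b).leadingCoeff = 0 := by rw [leadingCoeff, hd, h0]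
    exact jacobiP_ne_zero n b ha (leadingCoeff_eq_zero.1 h1)
  · exact fun h0 => le_antisymm (jacobiP_natDegree_le n a b) (le_natDegree_of_ne_zero h0)

/-- The classical quasi-rational function of type `ι` with polynomial part `P`. -/
def classSeed (ι : QRType) (P : ℝ[X]) (n : ℕ) (a b : ℝ) : Seed :=
  ⟨⟨gam (ex1 ι a) (exm ι b), toRat P⟩, lamFn ι n a b, ι, n + degMu ι a b⟩

theorem classSeed_lg (ι : QRType) (P : ℝ[X]) (n : ℕ) (a b : ℝ) : (classSeed ι P n a b).y.lg =
    toRat (derivative P) / toRat P + gam (ex1 ι a) (exm ι b) := by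
  simp only [classSeed, QF.lg, ratDeriv_toRat, add_comm]

section

variable {a b : ℝ} (ha : ¬ IsInt a) (hb : ¬ IsInt b)
include ha hb

theorem jacOp_classOp : JacOp (classOp a b) a b (classExpo a b) where
  p := rfl
  q := rfl
  sum1 := by simp [classExpo]
  summ := by simp [classExpo]
  int1 := ⟨0, by simp [classExpo]⟩
  intm := ⟨0, by simp [classExpo]⟩
  hA := ha
  hB := hb

theorem classSeed_isEigen {ι : QRType} {P : ℝ[X]} {n : ℕ}
    (h : IsEig (par1 ι a) (parm ι b) (n * (n + par1 ι a + parm ι b + 1)) P) (hP : P ≠ 0)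
    (hn : P.natDegree = n) : IsEigen (classOp a b) (classExpo a b) (classSeed ι P n a b) where
  f0 := toRat_ne_zero hP
  mem := by
    rw [classSeed_lg]
    simp only [classSeed]
    rw [lamFn_eq, classOp_gauge (ex1_cases ι a) (exm_cases ι b), ← par1, ← parm, parSum,
      ← add_assoc]
    exact (isEig_iff hP).1 h
  asym := by
    obtain ⟨h1, h2⟩ := h.eval_ne_zero hP (not_isInt_par1 ι ha) (not_isInt_parm ι hb)
    have hl : ∀ c, P.eval c ≠ 0 → ValAt c 0 ((RatFunc.X - RatFunc.C c) *
        (toRat (derivative P) / toRat P)) := fun c hc =>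
      valAt_zero_of_regularAt (valAt_div hc).1
    rw [classSeed_lg]
    refine ⟨?_, ?_, ?_⟩
    · have := (isPlace_valAt 1).add (hl 1 h1) (gam_valAt_one (ex1 ι a) (exm ι b))
      rwa [zero_add, ← mul_add] at this
    · have := (isPlace_valAt (-1)).add (hl (-1) h2) (gam_valAt_neg_one (ex1 ι a) (exm ι b))
      rwa [zero_add, ← mul_add] at this
    · have := isPlace_valInf.add (toRat_logDeriv_valInf hP) (gam_valInf (ex1 ι a) (exm ι b))
      rwa [← mul_add, hn, ← degMu_eq] at this

theorem classSeed_jacobiP_isEigen {ι : QRType} {n : ℕ} (h : Good n (parSum ι a b)) :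
    IsEigen (classOp a b) (classExpo a b)
      (classSeed ι (jacobiP n (par1 ι a) (parm ι b)) n a b) :=
  classSeed_isEigen ha hb (jacobiP_isEig _ _ _) (jacobiP_ne_zero _ _ (not_isInt_par1 ι ha))
    ((jacobiP_natDegree_iff _ _ (not_isInt_par1 ι ha)).2 h)

/-- The eigenvalue is given by the degree, and eigenpolynomials are unique up to scalars. So the
polynomial found in `classOp_classify` may be replaced by the Jacobi polynomial of that index. -/
theorem ricSet_classOp_classify {lam : ℝ} {w : RatFunc ℝ} (h : w ∈ ricSet (classOp a b) lam) :
    ∃ (ι : QRType) (n : ℕ), Good n (parSum ι a b) ∧ lam = lamFn ι n a b ∧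
      w = (classSeed ι (jacobiP n (par1 ι a) (parm ι b)) n a b).y.lg := by
  obtain ⟨e, e', mu, P, he, he', hP, hE, rfl, rfl⟩ := classOp_classify h
  obtain ⟨ι, rfl, rfl⟩ := exists_type he he'
  rw [← par1, ← parm] at hE
  have ha' := not_isInt_par1 ι ha
  have hmu := hE.lam_eq hP
  obtain ⟨c, hc⟩ := hE.eq_smul (hmu ▸ jacobiP_isEig P.natDegree (par1 ι a) (parm ι b)) ha'
    (not_isInt_parm ι hb) hP
  have hc0 : c ≠ 0 := by
    rintro rfl
    rw [C_0, zero_mul] at hc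
    exact jacobiP_ne_zero _ _ ha' hc
  refine ⟨ι, P.natDegree, ?_, ?_, ?_⟩
  · rw [parSum, ← jacobiP_natDegree_iff _ _ ha', hc, natDegree_C_mul hc0]
  · rw [lamFn_eq, hmu, parSum, add_assoc (P.natDegree : ℝ)]
  · rw [classSeed_lg, hc, derivative_C_mul, toRat_mul, toRat_mul,
      mul_div_mul_left _ _ (toRat_ne_zero (Polynomial.C_ne_zero.2 hc0))]

/-- Equal eigenvalues make the two Jacobi polynomials proportional, and `Good` says that their
degrees are their indices. -/
theorem classical_index_unique {ι : QRType} {n m : ℕ} (hn : Good n (parSum ι a b))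
    (hm : Good m (parSum ι a b)) (h : lamFn ι n a b = lamFn ι m a b) : n = m := by
  have ha' := not_isInt_par1 ι ha
  have e : (n : ℝ) * (n + par1 ι a + parm ι b + 1) = m * (m + par1 ι a + parm ι b + 1) := by
    rw [lamFn_eq, lamFn_eq, parSum] at h; linarith
  obtain ⟨c, hc⟩ := (jacobiP_isEig n (par1 ι a) (parm ι b)).eq_smul
    (e ▸ jacobiP_isEig m (par1 ι a) (parm ι b)) ha' (not_isInt_parm ι hb) (jacobiP_ne_zero _ _ ha')
  have hc0 : c ≠ 0 := by
    rintro rfl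
    rw [C_0, zero_mul] at hc
    exact jacobiP_ne_zero _ _ ha' hc
  rw [← (jacobiP_natDegree_iff _ _ ha').2 hn, ← (jacobiP_natDegree_iff _ _ ha').2 hm, hc,
    natDegree_C_mul hc0]

/-- The transcendental factor of the seed, squared, changes the weight parameters to `par1` and
`parm`; the statement then becomes `IsEig.not_exact_sq` for the polynomial part. -/
theorem classSeed_notExact {ι : QRType} {n : ℕ} (h : Good n (parSum ι a b))
    (hk : ∀ k : ℕ, parSum ι a b + 2 * n + 2 + k ≠ 0) :
    NotExact (classOp a b) (classSeed ι (jacobiP n (par1 ι a) (parm ι b)) n a b).y.lg := by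
  have ha' := not_isInt_par1 ι ha
  have hP := jacobiP_ne_zero n (parm ι b) ha'
  rintro ⟨h', hh⟩
  refine (jacobiP_isEig n _ _).not_exact_sq n ha' (not_isInt_parm ι hb) hk hP
    ((jacobiP_natDegree_iff _ _ ha').2 h) ?_
  set P := jacobiP n (par1 ι a) (parm ι b)
  rw [classSeed_lg] at hh
  have hx := x21_ne_zero
  have h0 := toRat_ne_zero hP
  simp only [classOp, eta_eq] at hh
  rw [mul_div_cancel_left₀ _ hx] at hh
  refine ⟨h' * x21 * toRat P ^ 2, ?_⟩
  have e1 : gam (par1 ι a) (parm ι b) + gam 1 1 =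
      gam (a + 1) (b + 1) + gam (ex1 ι a) (exm ι b) + gam (ex1 ι a) (exm ι b) := by
    rw [← gam_add, ← gam_add, ← gam_add]; congr 1 <;> simp only [par1, parm] <;> ring
  have e2 : ratDeriv h' = 1 / x21 - (gam (a + 1) (b + 1) +
      2 * (toRat (derivative P) / toRat P + gam (ex1 ι a) (exm ι b))) * h' := by
    rw [← hh]; ring
  rw [ratDeriv_mul, ratDeriv_mul, ratDeriv_pow, ratDeriv_x21, ratDeriv_toRat, e2,
    eq_sub_of_add_eq e1]
  field_simp
  push_cast
  ring

end

/-! ### Coincidences among eigenvalues -/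

section Arithmetic

variable {a b : ℝ}

theorem isInt_of_eq {x : ℝ} (m : ℤ) (h : x = m) : IsInt x := ⟨m, h.symm⟩

theorem lamFn_one_one (hs : ¬ IsInt (a + b)) (n m : ℤ) :
    lamFn .one n a b = lamFn .one m a b ↔ n = m := by
  rw [lamFn_one_inj, Int.cast_inj, or_iff_left]
  exact fun h => hs (isInt_of_eq (-1 - n - m) (by push_cast; linarith))

theorem lamFn_one_two (hs : ¬ IsInt (a + b)) (n m : ℤ) :
    lamFn .one n a b = lamFn .two m a b ↔ n + m + 1 = 0 := by
  rw [lamFn_eq_one .two, lamFn_one_inj]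
  simp only [degMu]
  rw [or_iff_right fun h => hs (isInt_of_eq (m - n) (by push_cast; linarith))]
  constructor
  · intro h
    have : (n : ℝ) + m + 1 = 0 := by linarith
    exact_mod_cast this
  · intro h
    have : (n : ℝ) + m + 1 = 0 := by exact_mod_cast h
    linarith

theorem lamFn_one_three (ha : ¬ IsInt a) (hb : ¬ IsInt b) (n m : ℤ) :
    lamFn .one n a b ≠ lamFn .three m a b := by
  rw [lamFn_eq_one .three, Ne, lamFn_one_inj]
  simp only [degMu]
  rintro (h | h)
  · exact ha (isInt_of_eq (m - n) (by push_cast; linarith))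
  · exact hb (isInt_of_eq (-1 - n - m) (by push_cast; linarith))

theorem lamFn_one_four (ha : ¬ IsInt a) (hb : ¬ IsInt b) (n m : ℤ) :
    lamFn .one n a b ≠ lamFn .four m a b := by
  rw [lamFn_eq_one .four, Ne, lamFn_one_inj]
  simp only [degMu]
  rintro (h | h)
  · exact hb (isInt_of_eq (m - n) (by push_cast; linarith))
  · exact ha (isInt_of_eq (-1 - n - m) (by push_cast; linarith))

theorem lamFn_two_three (ha : ¬ IsInt a) (hb : ¬ IsInt b) (n m : ℤ) :
    lamFn .two n a b ≠ lamFn .three m a b := by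
  have h := lamFn_one_three ha hb (-n - 1) m
  have h2 := lamFn_dual .two n a b
  simp only [QRType.dual] at h2
  push_cast at h
  rwa [h2] at h

theorem lamFn_two_four (ha : ¬ IsInt a) (hb : ¬ IsInt b) (n m : ℤ) :
    lamFn .two n a b ≠ lamFn .four m a b := by
  have h := lamFn_one_four ha hb (-n - 1) m
  have h2 := lamFn_dual .two n a b
  simp only [QRType.dual] at h2
  push_cast at h
  rwa [h2] at h

theorem lamFn_three_three (n m : ℤ) : lamFn .three n a b = lamFn .three m a b ↔
    n = m ∨ (n : ℝ) + m + 1 = a - b := by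
  rw [lamFn_eq_one, lamFn_eq_one .three m, lamFn_one_inj]
  simp only [degMu]
  rw [add_left_inj, Int.cast_inj]
  exact or_congr_right ⟨fun h => by linarith, fun h => by linarith⟩

theorem lamFn_four_four (n m : ℤ) : lamFn .four n a b = lamFn .four m a b ↔
    n = m ∨ (n : ℝ) + m + 1 = b - a := by
  rw [lamFn_eq_one, lamFn_eq_one .four m, lamFn_one_inj]
  simp only [degMu]
  rw [add_left_inj, Int.cast_inj]
  exact or_congr_right ⟨fun h => by linarith, fun h => by linarith⟩

theorem lamFn_three_four (n m : ℤ) : lamFn .three n a b = lamFn .four m a b ↔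
    (n : ℝ) - a = m - b ∨ n + m + 1 = 0 := by
  rw [lamFn_eq_one, lamFn_eq_one .four m, lamFn_one_inj]
  simp only [degMu, ← sub_eq_add_neg]
  refine or_congr_right ⟨fun h => ?_, fun h => ?_⟩
  · have : (n : ℝ) + m + 1 = 0 := by linarith
    exact_mod_cast this
  · have : (n : ℝ) + m + 1 = 0 := by exact_mod_cast h
    linarith

end Arithmetic

/-! ### Residues of the logarithmic derivative of a Wronskian -/

/-- The sum of the exponents at `1` of the successive seeds of a chain with the given types. -/
def expSum1 : Expo → List QRType → ℝ
  | _, [] => 0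
  | E, ι :: l => E.e1 ι + expSum1 (E.step ι) l

/-- The sum of the exponents at `-1` of the successive seeds of a chain with the given types. -/
def expSumm : Expo → List QRType → ℝ
  | _, [] => 0
  | E, ι :: l => E.em ι + expSumm (E.step ι) l

theorem expoAfter_eq (E : Expo) (L : List Seed) :
    expoAfter E L = (L.map Seed.ty).foldl Expo.step E := by
  rw [expoAfter, List.foldl_map]

/-- The exponents and degrees of the successive seeds add up. The `j`-th seed, counted from `0`, has
lost `j` in degree, whence the term `n(n-1)/2`. -/
theorem lgSum_residues (L : List Seed) : ∀ {T : DiffOp} {A B : ℝ} {E : Expo}, JacOp T A B E →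
    IsChain T E L →
    ValAt 1 (expSum1 E (L.map Seed.ty)) ((RatFunc.X - RatFunc.C 1) * lgSum (L.map Seed.y)) ∧
    ValAt (-1) (expSumm E (L.map Seed.ty))
      ((RatFunc.X - RatFunc.C (-1)) * lgSum (L.map Seed.y)) ∧
    ValInf ((L.map Seed.deg).sum - L.length * (L.length - 1) / 2)
      (RatFunc.X * lgSum (L.map Seed.y)) := by
  induction L using length_induction Seed.step with
  | nil =>
    intro T A B E _ _
    rw [List.map_nil (f := Seed.y), lgSum]
    simp only [List.map_nil, expSum1, expSumm, mul_zero, List.sum_nil, List.length_nil,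
      Nat.cast_zero, zero_mul, zero_div, sub_zero]
    exact ⟨(isPlace_valAt 1).zero, (isPlace_valAt (-1)).zero, isPlace_valInf.zero⟩
  | cons φ L ih =>
    intro T A B E hT h
    obtain ⟨h1, h2, h3⟩ := ih (hT.darboux φ.y.lg φ.ty) (h.tail hT)
    have hφ := (h.eigen φ (by simp)).asym
    have e1 : (L.map φ.step).map Seed.ty = L.map Seed.ty := by rw [List.map_map]; rfl
    have e2 : (L.map φ.step).map Seed.deg = L.map fun s => s.deg - 1 := by rw [List.map_map]; rfl
    rw [e1] at h1 h2
    rw [e2, List.length_map] at h3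
    rw [List.map_cons (f := Seed.y), lgSum, ← seed_map_y]
    refine ⟨?_, ?_, ?_⟩
    · rw [mul_add]; exact (isPlace_valAt 1).add hφ.one h1
    · rw [mul_add]; exact (isPlace_valAt (-1)).add hφ.neg h2
    · rw [mul_add]
      convert! isPlace_valInf.add hφ.inf h3 using 1
      have e3 : ∀ l : List Seed, (l.map fun s => s.deg - 1).sum = (l.map Seed.deg).sum - l.length := by
        intro l
        induction l with
        | nil => simp
        | cons s l ih => simp only [List.map_cons, List.sum_cons, ih, List.length_cons]; push_cast; ring
      rw [e3, List.map_cons, List.sum_cons, List.length_cons]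
      push_cast; ring

theorem expSum1_append (l l' : List QRType) (E : Expo) :
    expSum1 E (l ++ l') = expSum1 E l + expSum1 (l.foldl Expo.step E) l' := by
  induction l generalizing E with
  | nil => simp [expSum1]
  | cons ι l ih => simp only [List.cons_append, expSum1, ih, List.foldl_cons, add_assoc]

theorem expSumm_append (l l' : List QRType) (E : Expo) :
    expSumm E (l ++ l') = expSumm E l + expSumm (l.foldl Expo.step E) l' := by
  induction l generalizing E with
  | nil => simp [expSumm]
  | cons ι l ih => simp only [List.cons_append, expSumm, ih, List.foldl_cons, add_assoc]

theorem foldl_replicate (k : ℕ) (ι : QRType) (E : Expo) :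
    (List.replicate k ι).foldl Expo.step E =
      ⟨if ι.sing1 then E.r1 - k else E.r1, if ι.sing1 then E.s1 else E.s1 - k,
        if ι.singm then E.rm - k else E.rm, if ι.singm then E.sm else E.sm - k⟩ := by
  induction k generalizing E with
  | zero => simp
  | succ k ih =>
    rw [List.replicate_succ, List.foldl_cons, ih]
    cases h1 : ι.sing1 <;> cases h2 : ι.singm <;>
      simp only [Expo.step, h1, h2, if_true, if_false, Bool.false_eq_true] <;>
      push_cast <;> congr 1 <;> ring

theorem expSum1_replicate (k : ℕ) (ι : QRType) (E : Expo) :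
    expSum1 E (List.replicate k ι) = k * E.e1 ι := by
  induction k generalizing E with
  | zero => simp [expSum1]
  | succ k ih =>
    rw [List.replicate_succ, expSum1, ih]
    cases h1 : ι.sing1 <;>
      simp only [Expo.e1, Expo.step, h1, if_true, if_false, Bool.false_eq_true] <;>
      push_cast <;> ring

theorem expSumm_replicate (k : ℕ) (ι : QRType) (E : Expo) :
    expSumm E (List.replicate k ι) = k * E.em ι := by
  induction k generalizing E with
  | zero => simp [expSumm]
  | succ k ih =>
    rw [List.replicate_succ, expSumm, ih]
    cases h1 : ι.singm <;>
      simp only [Expo.em, Expo.step, h1, if_true, if_false, Bool.false_eq_true] <;>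
      push_cast <;> ring

/-! ### The seeds -/

/-- The types and indices of the seeds. -/
def seedIdx (K1 K3 K4 : Finset ℕ) : List (QRType × ℕ) :=
  (K1.sort (· ≤ ·)).map (fun k => (QRType.one, k)) ++
    (K3.sort (· ≤ ·)).map (fun k => (QRType.three, k)) ++
    (K4.sort (· ≤ ·)).map (fun k => (QRType.four, k))

/-- The seed of given type and index. -/
def seedOf (a b : ℝ) (z : QRType × ℕ) : Seed :=
  classSeed z.1 (jacobiP z.2 (par1 z.1 a) (parm z.1 b)) z.2 a b

/-- The list of seeds. -/
def seedList (K1 K3 K4 : Finset ℕ) (a b : ℝ) : List Seed := (seedIdx K1 K3 K4).map (seedOf a b)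

section Seeds

variable {K1 K3 K4 : Finset ℕ}

/-- The indices of the seeds of given type. -/
def seedSet (K1 K3 K4 : Finset ℕ) : QRType → Finset ℕ
  | .one => K1
  | .two => ∅
  | .three => K3
  | .four => K4

theorem mem_seedIdx {z : QRType × ℕ} : z ∈ seedIdx K1 K3 K4 ↔ z.2 ∈ seedSet K1 K3 K4 z.1 := by
  obtain ⟨ι, k⟩ := z
  cases ι <;> simp [seedIdx, seedSet]

theorem nodup_seedIdx : (seedIdx K1 K3 K4).Nodup := by
  have h : ∀ (ι : QRType) (K : Finset ℕ),
      ((K.sort (· ≤ ·)).map (fun k => (ι, k))).Nodup := fun ι K =>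
    (Finset.sort_nodup K _).map fun k l h => (Prod.mk.inj h).2
  rw [seedIdx, List.nodup_append, List.nodup_append]
  refine ⟨⟨h _ _, h _ _, ?_⟩, h _ _, ?_⟩
  · rintro x hx y hy rfl
    simp only [List.mem_map] at hx hy
    obtain ⟨k, -, rfl⟩ := hx
    obtain ⟨l, -, hl⟩ := hy
    simp at hl
  · rintro x hx y hy rfl
    simp only [List.mem_map, List.mem_append] at hx hy
    obtain ⟨l, -, rfl⟩ := hy
    rcases hx with ⟨k, -, hk⟩ | ⟨k, -, hk⟩ <;> simp at hk

theorem seedIdx_types : (seedIdx K1 K3 K4).map Prod.fst = List.replicate K1.card QRType.one ++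
    List.replicate K3.card QRType.three ++ List.replicate K4.card QRType.four := by
  have h : ∀ (ι : QRType) (K : Finset ℕ),
      ((K.sort (· ≤ ·)).map (fun k => (ι, k))).map Prod.fst = List.replicate K.card ι := by
    intro ι K
    rw [List.map_map, List.eq_replicate_iff]
    simp
  rw [seedIdx, List.map_append, List.map_append, h, h, h]

theorem length_seedIdx : (seedIdx K1 K3 K4).length = K1.card + K3.card + K4.card := by
  simp [seedIdx, add_assoc]

theorem length_seedList (a b : ℝ) :
    (seedList K1 K3 K4 a b).length = K1.card + K3.card + K4.card := by
  rw [seedList, List.length_map, length_seedIdx]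

theorem seedList_types (a b : ℝ) : (seedList K1 K3 K4 a b).map Seed.ty =
    List.replicate K1.card QRType.one ++ List.replicate K3.card QRType.three ++
      List.replicate K4.card QRType.four := by
  rw [← seedIdx_types, seedList, List.map_map]; rfl

theorem sum_seedIdx {M : Type*} [AddCommMonoid M] (f : QRType × ℕ → M) :
    ((seedIdx K1 K3 K4).map f).sum = ∑ k ∈ K1, f (.one, k) + ∑ k ∈ K3, f (.three, k) +
      ∑ k ∈ K4, f (.four, k) := by
  have h : ∀ (ι : QRType) (K : Finset ℕ),
      (((K.sort (· ≤ ·)).map (fun k => (ι, k))).map f).sum = ∑ k ∈ K, f (ι, k) := by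
    intro ι K
    rw [List.map_map, ← List.sum_toFinset _ (Finset.sort_nodup K _), Finset.sort_toFinset]
    rfl
  rw [seedIdx, List.map_append, List.map_append, List.sum_append, List.sum_append, h, h, h]

theorem prod_seedIdx {M : Type*} [CommMonoid M] (f : QRType × ℕ → M) :
    ((seedIdx K1 K3 K4).map f).prod = (∏ k ∈ K1, f (.one, k)) * (∏ k ∈ K3, f (.three, k)) *
      ∏ k ∈ K4, f (.four, k) := by
  have h : ∀ (ι : QRType) (K : Finset ℕ),
      (((K.sort (· ≤ ·)).map (fun k => (ι, k))).map f).prod = ∏ k ∈ K, f (ι, k) := by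
    intro ι K
    rw [List.map_map, ← List.prod_toFinset _ (Finset.sort_nodup K _), Finset.sort_toFinset]
    rfl
  rw [seedIdx, List.map_append, List.map_append, List.prod_append, List.prod_append, h, h, h]

end Seeds

section Params

variable {K1 K3 K4 : Finset ℕ} {a b : ℝ} (hab : ClassG a b ∨ ParamsB K3 K4 a b)
include hab

theorem params_left : ¬ IsInt a := hab.elim (fun h => h.1) fun h => h.1.1

theorem params_right : ¬ IsInt b := hab.elim (fun h => h.2.1) fun h => h.1.2.1

theorem params_sum : ¬ IsInt (a + b) := hab.elim (fun h => h.2.2.1) fun h => h.1.2.2.1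

theorem params_disjoint {k l : ℕ} (hk : k ∈ K3) (hl : l ∈ K4) : (k : ℝ) - a ≠ l - b := by
  intro h
  rcases hab with hG | hB
  · exact hG.2.2.2 (isInt_of_eq (k - l) (by push_cast; linarith))
  · exact disjoint_left.1 hB.2.2.2 ⟨k, hk, rfl⟩ ⟨l, hl, h.symm⟩

/-- In class B the conditions on `K₃` and `K₄` give `k + s ≥ 0` for the parameter sum `s` of types 3
and 4, so all the factors are positive. In the remaining cases `s` is not an integer. -/
theorem params_good {z : QRType × ℕ} (hz : z ∈ seedIdx K1 K3 K4) :
    Good z.2 (parSum z.1 a b) ∧ ∀ j : ℕ, parSum z.1 a b + 2 * z.2 + 2 + j ≠ 0 := by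
  have hni : ∀ {k : ℕ} {s : ℝ}, ¬ IsInt s → Good k s ∧ ∀ j : ℕ, s + 2 * k + 2 + j ≠ 0 :=
    fun {k s} hs => ⟨good_of_not_isInt _ hs, fun j hj =>
      hs (isInt_of_eq (-2 * k - 2 - j) (by push_cast; linarith))⟩
  have hpl : ∀ {k : ℕ} {s : ℝ}, 0 ≤ (k : ℝ) + s → Good k s ∧ ∀ j : ℕ, s + 2 * k + 2 + j ≠ 0 :=
    fun {k s} hs => ⟨good_iff.2 fun j _ => by positivity, fun j hj => by
      have h1 : (0 : ℝ) ≤ k := k.cast_nonneg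
      have h2 : (0 : ℝ) ≤ j := j.cast_nonneg
      linarith⟩
  obtain ⟨ι, k⟩ := z
  have hz := mem_seedIdx.1 hz
  cases ι
  · have e : parSum .one a b = a + b := by simp [parSum, par1, parm, ex1, exm, QRType.sing1,
      QRType.singm]
    rw [e]
    exact hni (params_sum hab)
  · simp [seedSet] at hz
  · have e : parSum .three a b = b - a := by
      simp [parSum, par1, parm, ex1, exm, QRType.sing1, QRType.singm]; ring
    rw [e]
    rcases hab with hG | hB
    · exact hni fun h => hG.2.2.2 (isInt_neg (by rwa [neg_sub]))
    · obtain ⟨-, h⟩ := hB.2.1 ⟨k, hz, rfl⟩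
      refine hpl ?_
      push_cast at h ⊢
      linarith
  · have e : parSum .four a b = a - b := by
      simp [parSum, par1, parm, ex1, exm, QRType.sing1, QRType.singm]; ring
    rw [e]
    rcases hab with hG | hB
    · exact hni hG.2.2.2
    · obtain ⟨-, h⟩ := hB.2.2.1 ⟨k, hz, rfl⟩
      refine hpl ?_
      push_cast at h ⊢
      linarith

/-- Within a type the eigenvalue determines the index. Type 1 never meets types 3 and 4; types 3 and
4 meet only for `k - a = l - b`, which the parameters exclude, or for `k + l + 1 = 0`. -/
theorem seed_lam_inj {z z' : QRType × ℕ} (hz : z ∈ seedIdx K1 K3 K4)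
    (hz' : z' ∈ seedIdx K1 K3 K4) (h : lamFn z.1 z.2 a b = lamFn z'.1 z'.2 a b) : z = z' := by
  have ha := params_left hab
  have hb := params_right hab
  have h1 := (params_good hab hz).1
  have h2 := (params_good hab hz').1
  obtain ⟨ι, k⟩ := z
  obtain ⟨κ, l⟩ := z'
  have m1 := mem_seedIdx.1 hz
  have m2 := mem_seedIdx.1 hz'
  by_cases he : ι = κ
  · subst he
    exact Prod.ext rfl (classical_index_unique ha hb h1 h2 h)
  · exfalso
    have e13 := lamFn_one_three ha hb
    have e14 := lamFn_one_four ha hb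
    have e34 := lamFn_three_four (a := a) (b := b)
    cases ι <;> cases κ <;> simp only [seedSet, Finset.notMem_empty] at m1 m2 <;>
      try exact he rfl
    · exact e13 k l h
    · exact e14 k l h
    · exact e13 l k h.symm
    · rcases (e34 k l).1 h with h' | h'
      · exact params_disjoint hab m1 m2 (by exact_mod_cast h')
      · omega
    · exact e14 l k h.symm
    · rcases (e34 l k).1 h.symm with h' | h'
      · exact params_disjoint hab m2 m1 (by exact_mod_cast h')
      · omega

theorem isChain_seedList : IsChain (classOp a b) (classExpo a b) (seedList K1 K3 K4 a b) := by
  have ha := params_left hab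
  have hb := params_right hab
  refine ⟨?_, ?_, ?_⟩
  · intro s hs
    obtain ⟨z, hz, rfl⟩ := List.mem_map.1 hs
    exact classSeed_jacobiP_isEigen ha hb (params_good hab hz).1
  · intro s hs
    obtain ⟨z, hz, rfl⟩ := List.mem_map.1 hs
    exact classSeed_notExact ha hb (params_good hab hz).1 (params_good hab hz).2
  · rw [seedList, List.pairwise_map]
    exact List.Pairwise.imp_of_mem
      (fun hz hz' hne h => hne (seed_lam_inj hab hz hz' h)) nodup_seedIdx

end Params

section

/-! ### The polynomial `τ` -/

theorem logDeriv_mul {f g : RatFunc ℝ} (hf : f ≠ 0) (hg : g ≠ 0) :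
    ratDeriv (f * g) / (f * g) = ratDeriv f / f + ratDeriv g / g := by
  rw [ratDeriv_mul]; field_simp

theorem C_mul_gam (c e e' : ℝ) : RatFunc.C c * gam e e' = gam (c * e) (c * e') := by
  simp only [gam, map_mul]; ring

theorem natCast_mul_gam (n : ℕ) (e e' : ℝ) : (n : RatFunc ℝ) * gam e e' = gam (n * e) (n * e') := by
  rw [← C_mul_gam, map_natCast]

theorem logDeriv_pow {f : RatFunc ℝ} (hf : f ≠ 0) (n : ℕ) :
    ratDeriv (f ^ n) / f ^ n = n * (ratDeriv f / f) := by
  have := ratDeriv_zpow f hf n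
  rw [zpow_natCast] at this
  rw [this]
  push_cast
  field_simp

/-- The logarithmic derivative of `(1-x)^m (1+x)^n`. -/
theorem logDeriv_one_sub_add (m n : ℕ) :
    ratDeriv ((1 - RatFunc.X) ^ m * (1 + RatFunc.X) ^ n) /
      ((1 - RatFunc.X) ^ m * (1 + RatFunc.X) ^ n) = gam m n := by
  have h1 := one_sub_X_ne_zero
  have h2 := one_add_X_ne_zero
  rw [logDeriv_mul (pow_ne_zero _ h1) (pow_ne_zero _ h2), logDeriv_pow h1, logDeriv_pow h2,
    one_sub_logDeriv, one_add_logDeriv, natCast_mul_gam, natCast_mul_gam, ← gam_add]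
  simp

theorem gam_mem_poleRing (e e' : ℝ) : gam e e' ∈ poleRing := by
  rw [gam, div_eq_mul_inv, div_eq_mul_inv]
  exact add_mem (mul_mem (C_mem_poleRing _) inv_sub_mem_poleRing)
    (mul_mem (C_mem_poleRing _) inv_add_mem_poleRing)

/-- The rational function `τ`. -/
def tauRat (K1 K3 K4 : Finset ℕ) (a b : ℝ) : RatFunc ℝ :=
  (1 - RatFunc.X) ^ (K3.card * (K1.card + K4.card)) *
    (1 + RatFunc.X) ^ (K4.card * (K1.card + K3.card)) *
      twr ((seedList K1 K3 K4 a b).map Seed.y)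

theorem one_sub_pow_mem_poleRing (m n : ℕ) :
    ((1 - RatFunc.X) ^ m * (1 + RatFunc.X) ^ n : RatFunc ℝ) ∈ poleRing :=
  mul_mem (pow_mem (sub_mem (one_mem _) X_mem_poleRing) _)
    (pow_mem (add_mem (one_mem _) X_mem_poleRing) _)

theorem seed_mem_poleRing (a b : ℝ) (z : QRType × ℕ) :
    (seedOf a b z).y.ω ∈ poleRing ∧ (seedOf a b z).y.f ∈ poleRing :=
  ⟨gam_mem_poleRing _ _, toRat_mem_poleRing _⟩

variable {K1 K3 K4 : Finset ℕ} {a b : ℝ}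

theorem tauRat_mem_poleRing : tauRat K1 K3 K4 a b ∈ poleRing := by
  refine mul_mem (one_sub_pow_mem_poleRing _ _) (twr_mem_poleRing fun y hy => ?_)
  obtain ⟨s, hs, rfl⟩ := List.mem_map.1 hy
  obtain ⟨z, -, rfl⟩ := List.mem_map.1 hs
  exact seed_mem_poleRing a b z

theorem sum_degMu_seeds : ((seedList K1 K3 K4 a b).map Seed.deg).sum =
    ∑ k ∈ K1, (k : ℝ) + ∑ k ∈ K3, (k : ℝ) + ∑ k ∈ K4, (k : ℝ) - K3.card * a - K4.card * b := by
  rw [seedList, List.map_map, sum_seedIdx]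
  simp only [Function.comp, seedOf, classSeed, degMu, Finset.sum_add_distrib, Finset.sum_const,
    nsmul_eq_mul]
  ring

theorem sum_ω_seeds : (((seedList K1 K3 K4 a b).map Seed.y).map QF.ω).sum =
    gam (-(K3.card * a)) (-(K4.card * b)) := by
  rw [seedList, List.map_map, List.map_map, sum_seedIdx]
  simp only [Function.comp, seedOf, classSeed, ex1, exm, QRType.sing1, QRType.singm, if_true,
    if_false, Bool.false_eq_true, Finset.sum_const, nsmul_eq_mul, gam_zero, natCast_mul_gam,
    mul_zero, zero_add, ← gam_add, mul_neg, add_zero]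

/-- The type 1 seeds have exponent `0` and lower the singular exponent to `-a - p₁`. Each type 3
seed contributes this value, and together they lower the regular exponent to `-p₃`, the contribution
of each type 4 seed. -/
theorem expSum1_seeds : expSum1 (classExpo a b) ((seedList K1 K3 K4 a b).map Seed.ty) =
    -(K3.card * (a + K1.card + K4.card)) := by
  rw [seedList_types, expSum1_append, expSum1_append, List.foldl_append, foldl_replicate,
    foldl_replicate, expSum1_replicate, expSum1_replicate, expSum1_replicate]
  simp only [Expo.e1, classExpo, QRType.sing1, if_true, if_false, Bool.false_eq_true]
  ring

theorem expSumm_seeds : expSumm (classExpo a b) ((seedList K1 K3 K4 a b).map Seed.ty) =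
    -(K4.card * (b + K1.card + K3.card)) := by
  rw [seedList_types, expSumm_append, expSumm_append, List.foldl_append, foldl_replicate,
    foldl_replicate, expSumm_replicate, expSumm_replicate, expSumm_replicate]
  simp only [Expo.em, classExpo, QRType.singm, if_true, if_false, Bool.false_eq_true]
  ring

theorem expoAfter_seeds : expoAfter (classExpo a b) (seedList K1 K3 K4 a b) =
    ⟨-K3.card, -a - K1.card - K4.card, -K4.card, -b - K1.card - K3.card⟩ := by
  rw [expoAfter_eq, seedList_types, List.foldl_append, List.foldl_append, foldl_replicate,
    foldl_replicate, foldl_replicate]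
  simp only [classExpo, QRType.sing1, QRType.singm, if_true, if_false, Bool.false_eq_true, zero_sub]

theorem choose_two_cast (n : ℕ) : ((n.choose 2 : ℕ) : ℝ) = n * (n - 1) / 2 := by
  rw [Nat.cast_choose_two]

section

variable (hab : ClassG a b ∨ ParamsB K3 K4 a b)
include hab

theorem seeds_nondeg : Nondeg ((seedList K1 K3 K4 a b).map Seed.y) :=
  IsChain.nondeg _ (jacOp_classOp (params_left hab) (params_right hab)) (isChain_seedList hab)

theorem tauRat_ne_zero : tauRat K1 K3 K4 a b ≠ 0 :=
  mul_ne_zero (mul_ne_zero (pow_ne_zero _ one_sub_X_ne_zero) (pow_ne_zero _ one_add_X_ne_zero))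
    (twr_ne_zero _ (seeds_nondeg hab))

/-- The added term is the negative of the exponents in `expSum1_seeds` and `expSumm_seeds`: the
prefactor of `τ` is chosen to give order zero at `±1`. -/
theorem tauRat_logDeriv : ratDeriv (tauRat K1 K3 K4 a b) / tauRat K1 K3 K4 a b =
    lgSum ((seedList K1 K3 K4 a b).map Seed.y) +
      gam (K3.card * (a + K1.card + K4.card)) (K4.card * (b + K1.card + K3.card)) := by
  have hn := seeds_nondeg (K1 := K1) hab
  rw [tauRat, logDeriv_mul (mul_ne_zero (pow_ne_zero _ one_sub_X_ne_zero)
    (pow_ne_zero _ one_add_X_ne_zero)) (twr_ne_zero _ hn), logDeriv_one_sub_add, lgSum_eq _ hn,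
    sum_ω_seeds, add_right_comm, ← gam_add]
  congr 2 <;> push_cast <;> ring

/-- `tauRat` can have poles only at `±1`, and its log-derivative has no residue there, so it is a
polynomial with nonzero values at `±1`. Its degree is the value of `x τ'/τ` at infinity. -/
theorem exists_tau : ∃ τ : ℝ[X], toRat τ = tauRat K1 K3 K4 a b ∧ τ.eval 1 ≠ 0 ∧
    τ.eval (-1) ≠ 0 ∧
    (τ.natDegree : ℤ) = (∑ k ∈ K1, (k : ℤ)) + (∑ k ∈ K3, (k : ℤ)) + (∑ k ∈ K4, (k : ℤ))
        - (K1.card.choose 2 : ℤ) - (K3.card.choose 2 : ℤ) - (K4.card.choose 2 : ℤ)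
        + (K3.card : ℤ) * K4.card := by
  obtain ⟨h1, h2, h3⟩ := lgSum_residues _ (jacOp_classOp (params_left hab) (params_right hab))
    (isChain_seedList (K1 := K1) hab)
  have hl := tauRat_logDeriv (K1 := K1) hab
  have h0 := tauRat_ne_zero (K1 := K1) hab
  rw [expSum1_seeds] at h1
  rw [expSumm_seeds] at h2
  have r1 := (isPlace_valAt 1).add h1
    (gam_valAt_one (K3.card * (a + K1.card + K4.card)) (K4.card * (b + K1.card + K3.card)))
  have r2 := (isPlace_valAt (-1)).add h2
    (gam_valAt_neg_one (K3.card * (a + K1.card + K4.card)) (K4.card * (b + K1.card + K3.card)))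
  have r3 := isPlace_valInf.add h3
    (gam_valInf (K3.card * (a + K1.card + K4.card)) (K4.card * (b + K1.card + K3.card)))
  rw [← mul_add, ← hl, neg_add_cancel] at r1 r2
  rw [← mul_add, ← hl] at r3
  obtain ⟨v1, n1, u1⟩ := exists_valAt_of_logDeriv h0 r1
  obtain ⟨v2, n2, u2⟩ := exists_valAt_of_logDeriv h0 r2
  obtain ⟨τ, hτ⟩ := exists_polynomial_of_mem_poleRing tauRat_mem_poleRing u1.1 u2.1
  rw [hτ] at u1 u2 r3 h0
  have hτ0 : τ ≠ 0 := by rintro rfl; simp at h0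
  refine ⟨τ, hτ.symm, ?_, ?_, ?_⟩
  · rwa [(valAt_toRat 1 τ).unique u1]
  · rwa [(valAt_toRat (-1) τ).unique u2]
  · rw [ratDeriv_toRat] at r3
    have hd := isPlace_valInf.unique (toRat_logDeriv_valInf hτ0) r3
    have : (τ.natDegree : ℝ) = (∑ k ∈ K1, (k : ℝ)) + (∑ k ∈ K3, (k : ℝ)) + (∑ k ∈ K4, (k : ℝ))
        - (K1.card.choose 2 : ℝ) - (K3.card.choose 2 : ℝ) - (K4.card.choose 2 : ℝ)
        + (K3.card : ℝ) * K4.card := by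
      rw [hd, sum_degMu_seeds, length_seedList, choose_two_cast, choose_two_cast,
        choose_two_cast]
      push_cast
      ring
    refine Int.cast_injective (α := ℝ) ?_
    push_cast
    exact this

end

/-! ### Wronskians on `(-1, 1)` -/

/-- The factor `(1-x)^e (1+x)^e'` of a classical eigenfunction. -/
def muFun (a b : ℝ) (ι : QRType) (x : ℝ) : ℝ := (1 - x) ^ ex1 ι a * (1 + x) ^ exm ι b

/-- A seed as a function on `(-1, 1)`. -/
def phiFun (a b : ℝ) (z : QRType × ℕ) (x : ℝ) : ℝ :=
  muFun a b z.1 x * (jacobiP z.2 (par1 z.1 a) (parm z.1 b)).eval x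

theorem phiList_eq : phiList K1 K3 K4 a b = (seedIdx K1 K3 K4).map (phiFun a b) := by
  have h1 : phi1 a b = phiFun a b ∘ fun k => (QRType.one, k) := by
    funext n x
    simp [phi1, phiFun, muFun, ex1, exm, par1, parm, QRType.sing1, QRType.singm]
  have h3 : phi3 a b = phiFun a b ∘ fun k => (QRType.three, k) := by
    funext n x
    simp only [Function.comp, phi3, phiFun, muFun, ex1, exm, par1, parm, QRType.sing1,
      QRType.singm, if_true, if_false, Bool.false_eq_true, Real.rpow_zero, mul_one, mul_zero,
      add_zero]
    rw [show a + 2 * -a = -a by ring]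
  have h4 : phi4 a b = phiFun a b ∘ fun k => (QRType.four, k) := by
    funext n x
    simp only [Function.comp, phi4, phiFun, muFun, ex1, exm, par1, parm, QRType.sing1,
      QRType.singm, if_true, if_false, Bool.false_eq_true, Real.rpow_zero, one_mul, mul_zero,
      add_zero]
    rw [show b + 2 * -b = -b by ring]
  rw [phiList, seedIdx, List.map_append, List.map_append, List.map_map, List.map_map, List.map_map,
    h1, h3, h4]

theorem rval_toRat (P : ℝ[X]) (x : ℝ) : rval (toRat P) x = P.eval x := (valAt_toRat x P).2

theorem gam_valAt {x : ℝ} (h1 : x ≠ 1) (h2 : x ≠ -1) (e e' : ℝ) :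
    ValAt x (e / (x - 1) + e' / (x + 1)) (gam e e') := by
  have P := isPlace_valAt x
  have u1 := P.sub (valAt_X x) P.one
  have u2 := P.add (valAt_X x) P.one
  exact P.add (P.div (P.const e) u1 (sub_ne_zero.2 h1))
    (P.div (P.const e') u2 fun h => h2 (by linarith))

theorem hasDerivAt_weight {x : ℝ} (hx : x ∈ Ioo (-1 : ℝ) 1) (e e' : ℝ) :
    HasDerivAt (fun y => (1 - y) ^ e * (1 + y) ^ e')
      ((e / (x - 1) + e' / (x + 1)) * ((1 - x) ^ e * (1 + x) ^ e')) x := by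
  have p1 : 0 < 1 - x := by linarith [hx.2]
  have p2 : 0 < 1 + x := by linarith [hx.1]
  have h1 := ((hasDerivAt_id x).const_sub 1).rpow_const (p := e) (Or.inl p1.ne')
  have h2 := ((hasDerivAt_id x).const_add 1).rpow_const (p := e') (Or.inl p2.ne')
  convert! h1.mul h2 using 1
  simp only [id]
  rw [Real.rpow_sub_one p1.ne', Real.rpow_sub_one p2.ne', show x - 1 = -(1 - x) by ring,
    add_comm x 1]
  field_simp

theorem realizes_weight (e e' : ℝ) (P : ℝ[X]) :
    Realizes (fun x => (1 - x) ^ e * (1 + x) ^ e' * P.eval x)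
      (fun x => (1 - x) ^ e * (1 + x) ^ e') ⟨gam e e', toRat P⟩ where
  eq x _ := by simp only [rval_toRat]
  deriv x hx := by
    rw [(gam_valAt hx.2.ne hx.1.ne' e e').2]
    exact hasDerivAt_weight hx e e'
  regω x hx := (gam_valAt hx.2.ne hx.1.ne' e e').1
  regf x _ := (valAt_toRat x P).1

theorem prod_muFun {x : ℝ} (hx : x ∈ Ioo (-1 : ℝ) 1) :
    ((seedIdx K1 K3 K4).map fun z => muFun a b z.1 x).prod =
      (1 - x) ^ (-(K3.card * a)) * (1 + x) ^ (-(K4.card * b)) := by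
  have p1 : 0 < 1 - x := by linarith [hx.2]
  have p2 : 0 < 1 + x := by linarith [hx.1]
  rw [prod_seedIdx]
  simp only [muFun, ex1, exm, QRType.sing1, QRType.singm, if_true, if_false, Bool.false_eq_true,
    Real.rpow_zero, mul_one, one_mul, Finset.prod_const, one_pow]
  rw [← Real.rpow_natCast, ← Real.rpow_natCast, ← Real.rpow_mul p1.le, ← Real.rpow_mul p2.le]
  congr 2 <;> ring

theorem wronskian_phiList {x : ℝ} (hx : x ∈ Ioo (-1 : ℝ) 1) :
    RegularAt (twr ((seedList K1 K3 K4 a b).map Seed.y)) x ∧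
      wronskian (phiList K1 K3 K4 a b) x =
        (1 - x) ^ (-(K3.card * a)) * (1 + x) ^ (-(K4.card * b)) *
          rval (twr ((seedList K1 K3 K4 a b).map Seed.y)) x := by
  have h := wronskian_eq (φ := phiFun a b) (μ := fun z => muFun a b z.1)
    (Y := fun z => (seedOf a b z).y) (seedIdx K1 K3 K4)
    (fun z _ => realizes_weight _ _ _) hx
  rw [← phiList_eq, prod_muFun hx] at h
  rwa [seedList, List.map_map]

theorem wronskian_phiList_append (P : ℝ[X]) {x : ℝ} (hx : x ∈ Ioo (-1 : ℝ) 1) :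
    RegularAt (twr ((seedList K1 K3 K4 a b).map Seed.y ++ [⟨0, toRat P⟩])) x ∧
      wronskian (phiList K1 K3 K4 a b ++ [fun y => P.eval y]) x =
        (1 - x) ^ (-(K3.card * a)) * (1 + x) ^ (-(K4.card * b)) *
          rval (twr ((seedList K1 K3 K4 a b).map Seed.y ++ [⟨0, toRat P⟩])) x := by
  -- The appended polynomial need not be a `phiFun`, so the list is indexed by triples of function,
  -- transcendental factor and rational data.
  have h := wronskian_eq (κ := (ℝ → ℝ) × (ℝ → ℝ) × QF) (φ := fun z => z.1) (μ := fun z => z.2.1)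
    (Y := fun z => z.2.2)
    ((seedIdx K1 K3 K4).map (fun z => (phiFun a b z, muFun a b z.1, (seedOf a b z).y)) ++
      [(fun y => P.eval y, fun _ => 1, ⟨0, toRat P⟩)])
    (fun z hz => by
      rcases List.mem_append.1 hz with hz | hz
      · obtain ⟨z, -, rfl⟩ := List.mem_map.1 hz
        exact realizes_weight _ _ _
      · rw [List.mem_singleton.1 hz]
        have := realizes_weight 0 0 P
        simpa only [Real.rpow_zero, one_mul, gam_zero] using this) hx
  simp only [List.map_append, List.map_map, List.map_cons, List.map_nil, List.prod_append,
    List.prod_cons, List.prod_nil, mul_one, Function.comp_def] at h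
  rw [prod_muFun hx, ← phiList_eq] at h
  rwa [seedList, List.map_map]

theorem one_sub_valAt (x : ℝ) : ValAt x (1 - x) (1 - RatFunc.X) :=
  (isPlace_valAt x).sub (isPlace_valAt x).one (valAt_X x)

theorem one_add_valAt (x : ℝ) : ValAt x (1 + x) (1 + RatFunc.X) :=
  (isPlace_valAt x).add (isPlace_valAt x).one (valAt_X x)

theorem eval_tau {τ : ℝ[X]} (h : toRat τ = tauRat K1 K3 K4 a b) {x : ℝ}
    (hx : x ∈ Ioo (-1 : ℝ) 1) : τ.eval x = tauFun K1 K3 K4 a b x := by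
  have p1 : 0 < 1 - x := by linarith [hx.2]
  have p2 : 0 < 1 + x := by linarith [hx.1]
  obtain ⟨h1, h2⟩ := wronskian_phiList (K1 := K1) (K3 := K3) (K4 := K4) (a := a) (b := b) hx
  have P := isPlace_valAt x
  have h3 := P.mul (P.mul (P.pow (one_sub_valAt x) (K3.card * (K1.card + K4.card)))
    (P.pow (one_add_valAt x) (K4.card * (K1.card + K3.card)))) h1.valAt
  rw [← tauRat, ← h] at h3
  rw [(valAt_toRat x τ).unique h3, tauFun, h2, ← Real.rpow_natCast, ← Real.rpow_natCast,
    show (K3.card : ℝ) * (a + K1.card + K4.card) =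
      K3.card * a + ((K3.card * (K1.card + K4.card) : ℕ) : ℝ) by push_cast; ring,
    show (K4.card : ℝ) * (b + K1.card + K3.card) =
      K4.card * b + ((K4.card * (K1.card + K3.card) : ℕ) : ℝ) by push_cast; ring,
    Real.rpow_add p1, Real.rpow_add p2, Real.rpow_neg p1.le, Real.rpow_neg p2.le]
  have := (Real.rpow_pos_of_pos p1 (K3.card * a)).ne'
  have := (Real.rpow_pos_of_pos p2 (K4.card * b)).ne'
  field_simp

end

/-! ### The operator in the rational gauge -/

theorem Trg_q (τ : ℝ[X]) (α β : ℝ) :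
    (Trg τ α β).q = x21 * gam (α + 1) (β + 1) := by
  simp only [Trg, DiffOp.gauge, Tng, ratDeriv_toRat, eta_eq]
  ring

/-- In the rational gauge the terms with `η` cancel, and only the log-derivative of `τ` enters. This
makes the coefficient comparable with `opAfter_r`. -/
theorem Trg_r {τ : ℝ[X]} (hτ : τ ≠ 0) (α β : ℝ) :
    (Trg τ α β).r = 2 * x21 * ratDeriv (ratDeriv (toRat τ) / toRat τ) +
      2 * RatFunc.X * (ratDeriv (toRat τ) / toRat τ) := by
  have h0 := toRat_ne_zero hτ
  rw [ratDeriv_div _ _ h0]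
  simp only [Trg, DiffOp.gauge, Tng, ratDeriv_toRat]
  field_simp
  ring

theorem ratDeriv_x21_mul_gam (e e' : ℝ) : ratDeriv (x21 * gam e e') = RatFunc.C (e + e') := by
  rw [x21_mul_gam, ratDeriv_add, ratDeriv_C_mul, ratDeriv_C_mul, ratDeriv_add, ratDeriv_sub,
    ratDeriv_X, ratDeriv_one, map_add]
  ring

theorem ratDeriv_x21_eq : ratDeriv x21 = 2 * RatFunc.X := by
  rw [x21, ratDeriv_sub, ratDeriv_pow, ratDeriv_X, ratDeriv_one]
  push_cast
  ring

theorem x21_gam_deriv (e e' : ℝ) : 2 * x21 * ratDeriv (gam e e') + 2 * RatFunc.X * gam e e' =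
    RatFunc.C (e + e') - RatFunc.C e * ((RatFunc.X + 1) / (RatFunc.X - 1)) -
      RatFunc.C e' * ((RatFunc.X - 1) / (RatFunc.X + 1)) := by
  have := X_sub_one_ne_zero
  have := X_add_one_ne_zero
  rw [ratDeriv_gam, gam, x21_eq_mul, map_add]
  field_simp
  ring

/-- The shift of the indices of type `ι`. -/
def idxShift (K1 K3 K4 : Finset ℕ) : QRType → ℤ
  | .one => -(K1.card : ℤ)
  | .two => K1.card
  | .three => -(K3.card : ℤ) + K4.card
  | .four => (K3.card : ℤ) - K4.card

section

variable {K1 K3 K4 : Finset ℕ} {a b α β : ℝ} (hα : α = a + K1.card - K3.card + K4.card)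
  (hβ : β = b + K1.card + K3.card - K4.card)
include hα hβ

theorem lamFn_shift (ι : QRType) (n : ℝ) : lamFn ι (n + idxShift K1 K3 K4 ι) α β =
    lamFn ι n a b - K1.card * (K1.card + a + b + 1) := by
  subst hα hβ
  cases ι <;> simp only [lamFn, idxShift] <;> push_cast <;> ring

theorem degMu_shift (ι : QRType) : idxShift K1 K3 K4 ι + degMu ι α β =
    degMu ι a b - K1.card := by
  subst hα hβ
  cases ι <;> simp only [degMu, idxShift] <;> push_cast <;> ring

variable (hab : ClassG a b ∨ ParamsB K3 K4 a b) {τ : ℝ[X]} (hτ : toRat τ = tauRat K1 K3 K4 a b)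
include hab hτ

/-- Gauging by `(x-1)^p₃ (x+1)^p₄` turns the first-order coefficient after the chain into the one
for `α` and `β`. The pole terms created at `±1` cancel against those from the prefactor of `τ`,
because the coefficients agree (`e4`, `e5`); only a constant shift of the eigenvalue is left (`e6`).
-/
theorem mem_ricSet_Trg_iff (w : RatFunc ℝ) (lam : ℝ) :
    w + gam K3.card K4.card ∈ ricSet (Trg τ α β) (lam - K1.card * (K1.card + a + b + 1)) ↔
      w ∈ ricSet (opAfter (classOp a b) (seedList K1 K3 K4 a b)) lam := by
  have hτ0 : τ ≠ 0 := by
    rintro rfl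
    exact tauRat_ne_zero (K1 := K1) hab (by rw [← hτ]; simp)
  have hJ := jacOp_opAfter (seedList K1 K3 K4 a b)
    (jacOp_classOp (params_left hab) (params_right hab))
  obtain ⟨-, hr⟩ := opAfter_r (seedList K1 K3 K4 a b) (classOp a b)
  have hp : (Trg τ α β).p = x21 := rfl
  have hv := tauRat_logDeriv (K1 := K1) hab
  rw [← hτ] at hv
  rw [length_seedList] at hJ hr
  have hp0 : (classOp a b).p = x21 := rfl
  have hq0 : (classOp a b).q = x21 * gam (a + 1) (b + 1) := rfl
  have hr0 : (classOp a b).r = 0 := rfl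
  have h2 : ratDeriv (2 : RatFunc ℝ) = 0 := by
    have := ratDeriv_natCast 2
    exact_mod_cast this
  rw [hp0, hq0, hr0, ratDeriv_x21_mul_gam, ratDeriv_x21_eq, ratDeriv_mul, ratDeriv_X, h2, zero_mul,
    zero_add, zero_add, mul_one] at hr
  change (Trg τ α β).p * (ratDeriv (w + gam K3.card K4.card) + (w + gam K3.card K4.card) ^ 2) +
    (Trg τ α β).q * (w + gam K3.card K4.card) + (Trg τ α β).r = _ ↔ _ * _ + _ * w + _ = _
  have e1 : x21 * gam (a + (K1.card + K3.card + K4.card : ℕ) + 1)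
      (b + (K1.card + K3.card + K4.card : ℕ) + 1) =
      x21 * gam (α + 1) (β + 1) + 2 * x21 * gam K3.card K4.card := by
    rw [mul_comm 2 x21, mul_assoc, ← mul_add, two_mul, ← gam_add, ← gam_add]
    congr 2 <;> subst hα hβ <;> push_cast <;> ring
  have e2 := x21_gam_gauge (α + 1) (β + 1) K3.card K4.card
  have e3 := x21_gam_deriv (K3.card * (a + K1.card + K4.card)) (K4.card * (b + K1.card + K3.card))
  have e4 : (K3.card : ℝ) ^ 2 - K3.card + K3.card * (α + 1) =
      K3.card * (a + K1.card + K4.card) := by subst hα; ring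
  have e5 : (K4.card : ℝ) ^ 2 - K4.card + K4.card * (β + 1) =
      K4.card * (b + K1.card + K3.card) := by subst hβ; ring
  have e6 : RatFunc.C (2 * (K3.card : ℝ) * K4.card + K3.card * (β + 1) + K4.card * (α + 1)) +
      RatFunc.C ((K3.card : ℝ) * (a + K1.card + K4.card) + K4.card * (b + K1.card + K3.card)) =
      ((K1.card + K3.card + K4.card : ℕ) : RatFunc ℝ) * RatFunc.C (a + 1 + (b + 1)) +
        ((K1.card + K3.card + K4.card : ℕ) : RatFunc ℝ) *
          (((K1.card + K3.card + K4.card : ℕ) : RatFunc ℝ) - 1) / 2 * 2 -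
        RatFunc.C (K1.card * (K1.card + a + b + 1)) := by
    have : ((K1.card + K3.card + K4.card : ℕ) : RatFunc ℝ) =
        RatFunc.C ((K1.card + K3.card + K4.card : ℕ) : ℝ) := by rw [map_natCast]
    rw [div_mul_cancel₀ _ two_ne_zero, this, ← map_one RatFunc.C]
    simp only [← map_add, ← map_mul, ← map_sub]
    congr 1
    subst hα hβ
    push_cast
    ring
  rw [e4, e5] at e2
  rw [hJ.p, hJ.q, hp, hr, Trg_q, Trg_r hτ0, hv, e1, ratDeriv_add, ratDeriv_add, map_sub]
  constructor <;> intro h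
  · linear_combination h - e2 - e3 - e6
  · linear_combination h + e2 + e3 + e6


end

/-- The indices of the quasi-rational eigenfunctions of type `ι`, before the shift. -/
def rawIdx (K1 K3 K4 : Finset ℕ) (a b : ℝ) (ι : QRType) : Set ℤ :=
  {n | 0 ≤ n ∧ Good n.toNat (parSum ι a b) ∧
    ∀ z ∈ seedIdx K1 K3 K4, lamFn ι n a b ≠ lamFn z.1 z.2 a b} ∪ bar (seedSet K1 K3 K4 ι.dual)

/-- A description of the quasi-rational eigenfunctions of `T`: those of type `ι` have degrees
`n + deg μ_ι` and eigenvalues `λ_ι(n)`, `n ∈ J ι`, and are determined by type and eigenvalue. -/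
structure Spectrum (T : DiffOp) (α β : ℝ) (J : QRType → Set ℤ) : Prop where
  classify : ∀ {lam w}, w ∈ ricSet T lam → ∃ ι, ∃ n ∈ J ι, lam = lamFn ι (n : ℝ) α β ∧
    Asym (classExpo α β) ι (n + degMu ι α β) w
  exist : ∀ ι, ∀ n ∈ J ι, ∃ w ∈ ricSet T (lamFn ι (n : ℝ) α β),
    Asym (classExpo α β) ι (n + degMu ι α β) w
  unique : ∀ {lam ι d d' w w'}, w ∈ ricSet T lam → w' ∈ ricSet T lam →
    Asym (classExpo α β) ι d w → Asym (classExpo α β) ι d' w' → w = w'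

/-! ### Quasi-rational eigenfunctions after the chain, and in the rational gauge -/

section

variable {K1 K3 K4 : Finset ℕ} {a b α β : ℝ}
  (hab : ClassG a b ∨ ParamsB K3 K4 a b)
include hab

/-- The quasi-rational eigenfunctions of the Darboux transform of the classical operator. -/
theorem opAfter_classify {lam : ℝ} {w : RatFunc ℝ}
    (h : w ∈ ricSet (opAfter (classOp a b) (seedList K1 K3 K4 a b)) lam) :
    ∃ ι, ∃ n ∈ rawIdx K1 K3 K4 a b ι, lam = lamFn ι (n : ℝ) a b ∧
      Asym (expoAfter (classExpo a b) (seedList K1 K3 K4 a b)) ι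
        (n + degMu ι a b - (K1.card + K3.card + K4.card)) w := by
  have ha := params_left hab
  have hb := params_right hab
  have hT := jacOp_classOp ha hb
  have hC := isChain_seedList (K1 := K1) hab
  by_cases hl : ∀ s ∈ seedList K1 K3 K4 a b, lam ≠ s.lam
  · obtain ⟨w₀, hw₀, rfl⟩ := (wtr_bijOn _ hT hC hl).surjOn h
    obtain ⟨ι, n, hn, rfl, rfl⟩ := ricSet_classOp_classify ha hb hw₀
    have hA := wtr_asym _ hT hC hl hw₀ (classSeed_jacobiP_isEigen ha hb hn).asym
    rw [length_seedList] at hA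
    refine ⟨ι, n, Or.inl ⟨by simp, by simpa using hn, fun z hz => ?_⟩, by simp, ?_⟩
    · exact_mod_cast hl _ (List.mem_map_of_mem hz)
    · convert! hA using 1
      simp [classSeed]
  · push Not at hl
    obtain ⟨s, hs, rfl⟩ := hl
    obtain ⟨v, hv, hA⟩ := ricSet_opAfter_seed _ hT hC s hs
    rw [hv] at h
    obtain rfl := mem_singleton_iff.1 h
    obtain ⟨⟨ι, k⟩, hz, rfl⟩ := List.mem_map.1 hs
    have hk := mem_seedIdx.1 hz
    refine ⟨ι.dual, -(k : ℤ) - 1, Or.inr ⟨k, ?_, rfl⟩, ?_, ?_⟩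
    · have : ι.dual.dual = ι := by cases ι <;> rfl
      rwa [this]
    · have := lamFn_dual ι k a b
      push_cast
      rw [this]
      rfl
    · rw [length_seedList] at hA
      convert! hA using 1
      simp only [seedOf, classSeed, degMu_dual]
      push_cast
      ring

theorem opAfter_exist {ι : QRType} {n : ℤ} (h : n ∈ rawIdx K1 K3 K4 a b ι) :
    ∃ w ∈ ricSet (opAfter (classOp a b) (seedList K1 K3 K4 a b)) (lamFn ι (n : ℝ) a b),
      Asym (expoAfter (classExpo a b) (seedList K1 K3 K4 a b)) ι
        (n + degMu ι a b - (K1.card + K3.card + K4.card)) w := by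
  have ha := params_left hab
  have hb := params_right hab
  have hT := jacOp_classOp ha hb
  have hC := isChain_seedList (K1 := K1) hab
  rcases h with ⟨h0, hn, hl⟩ | ⟨k, hk, rfl⟩
  · lift n to ℕ using h0
    rw [Int.toNat_natCast] at hn
    have hE := classSeed_jacobiP_isEigen ha hb hn
    have hl' : ∀ s ∈ seedList K1 K3 K4 a b, lamFn ι n a b ≠ s.lam := by
      intro s hs
      obtain ⟨z, hz, rfl⟩ := List.mem_map.1 hs
      exact_mod_cast hl z hz
    refine ⟨wtr (seedList K1 K3 K4 a b)
      (classSeed ι (jacobiP n (par1 ι a) (parm ι b)) n a b).y.lg, ?_, ?_⟩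
    · have := (wtr_bijOn _ hT hC hl').mapsTo hE.mem
      exact_mod_cast this
    · have := wtr_asym _ hT hC hl' hE.mem hE.asym
      rw [length_seedList] at this
      convert! this using 1
      simp [classSeed]
  · have hz : (ι.dual, k) ∈ seedIdx K1 K3 K4 := mem_seedIdx.2 hk
    obtain ⟨v, hv, hA⟩ := ricSet_opAfter_seed _ hT hC _ (List.mem_map_of_mem hz)
    have hd : ι.dual.dual = ι := by cases ι <;> rfl
    have e := lamFn_dual ι.dual k a b
    rw [hd] at e
    refine ⟨v, ?_, ?_⟩
    · push_cast
      rw [e]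
      exact hv ▸ rfl
    · rw [length_seedList] at hA
      convert! hA using 1
      · exact hd.symm
      · simp only [seedOf, classSeed, degMu_dual]
        push_cast
        ring

/-- At a seed eigenvalue there is a single solution. Elsewhere both solutions are transforms of
classical ones of the same type, since the chain preserves types, and the classical index is unique.
-/
theorem opAfter_unique {lam d d' : ℝ} {ι : QRType} {w w' : RatFunc ℝ}
    (h : w ∈ ricSet (opAfter (classOp a b) (seedList K1 K3 K4 a b)) lam)
    (h' : w' ∈ ricSet (opAfter (classOp a b) (seedList K1 K3 K4 a b)) lam)
    (hA : Asym (expoAfter (classExpo a b) (seedList K1 K3 K4 a b)) ι d w)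
    (hA' : Asym (expoAfter (classExpo a b) (seedList K1 K3 K4 a b)) ι d' w') : w = w' := by
  have ha := params_left hab
  have hb := params_right hab
  have hT := jacOp_classOp ha hb
  have hC := isChain_seedList (K1 := K1) hab
  have hJ := jacOp_opAfter (seedList K1 K3 K4 a b) hT
  by_cases hl : ∀ s ∈ seedList K1 K3 K4 a b, lam ≠ s.lam
  · obtain ⟨w₀, hw₀, rfl⟩ := (wtr_bijOn _ hT hC hl).surjOn h
    obtain ⟨w₁, hw₁, rfl⟩ := (wtr_bijOn _ hT hC hl).surjOn h'
    obtain ⟨κ, n, hn, rfl, rfl⟩ := ricSet_classOp_classify ha hb hw₀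
    obtain ⟨κ', m, hm, hlam, rfl⟩ := ricSet_classOp_classify ha hb hw₁
    have hB := wtr_asym _ hT hC hl hw₀ (classSeed_jacobiP_isEigen ha hb hn).asym
    have hB' := wtr_asym _ hT hC hl hw₁ (classSeed_jacobiP_isEigen ha hb hm).asym
    obtain rfl : κ = ι := hJ.type_unique hB hA
    obtain rfl : κ' = κ := hJ.type_unique hB' hA'
    rw [classical_index_unique ha hb hn hm hlam]
  · push Not at hl
    obtain ⟨s, hs, rfl⟩ := hl
    obtain ⟨v, hv, -⟩ := ricSet_opAfter_seed _ hT hC s hs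
    rw [hv] at h h'
    exact h.trans h'.symm

variable (hα : α = a + K1.card - K3.card + K4.card)
  (hβ : β = b + K1.card + K3.card - K4.card)
include hα hβ

-- The chain leaves regular exponents `-p₃`, `-p₄`. Adding `p₃`, `p₄` brings them back to `0` and
-- the singular ones to `-α`, `-β`; this dictates the values of `α` and `β`.
omit hab in
theorem asym_Trg_iff (ι : QRType) (d : ℝ) (w : RatFunc ℝ) :
    Asym (classExpo α β) ι (d + (K3.card + K4.card)) (w + gam K3.card K4.card) ↔
      Asym (expoAfter (classExpo a b) (seedList K1 K3 K4 a b)) ι d w := by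
  have key : ∀ (E : Expo) (d : ℝ) (w : RatFunc ℝ) (e e' : ℝ), Asym E ι d w →
      Asym ⟨E.r1 + e, E.s1 + e, E.rm + e', E.sm + e'⟩ ι (d + (e + e')) (w + gam e e') := by
    intro E d w e e' h
    have h1 := (isPlace_valAt 1).add h.one (gam_valAt_one e e')
    have h2 := (isPlace_valAt (-1)).add h.neg (gam_valAt_neg_one e e')
    have h3 := isPlace_valInf.add h.inf (gam_valInf e e')
    rw [← mul_add] at h1 h2 h3
    refine ⟨?_, ?_, h3⟩
    · convert! h1 using 1
      simp only [Expo.e1]; split_ifs <;> rfl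
    · convert! h2 using 1
      simp only [Expo.em]; split_ifs <;> rfl
  rw [expoAfter_seeds]
  constructor
  · intro h
    have := key _ _ _ (-K3.card) (-K4.card) h
    have e : gam (K3.card : ℝ) K4.card + gam (-K3.card : ℝ) (-K4.card) = 0 := by
      rw [← gam_add, add_neg_cancel, add_neg_cancel, gam_zero]
    rw [add_assoc w, e, add_zero] at this
    convert! this using 1
    · subst hα hβ
      simp only [classExpo]
      congr 1 <;> ring
    · ring
  · intro h
    have := key _ _ _ (K3.card) (K4.card) h
    convert! this using 1
    subst hα hβ
    simp only [classExpo]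
    congr 1 <;> ring

/-- One and the same shift of the indices absorbs the change of degree by chain and gauge and the
shift of the eigenvalue. -/
theorem spectrum_Trg {τ : ℝ[X]} (hτ : toRat τ = tauRat K1 K3 K4 a b) :
    Spectrum (Trg τ α β) α β fun ι => shift (rawIdx K1 K3 K4 a b ι) (idxShift K1 K3 K4 ι) := by
  have hm := mem_ricSet_Trg_iff hα hβ hab hτ
  have hA := asym_Trg_iff (K1 := K1) hα hβ
  have hd : ∀ (ι : QRType) (n : ℤ), ((n + idxShift K1 K3 K4 ι : ℤ) : ℝ) + degMu ι α β =
      n + degMu ι a b - (K1.card + K3.card + K4.card) + (K3.card + K4.card) := by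
    intro ι n
    have := degMu_shift (K1 := K1) (K3 := K3) (K4 := K4) hα hβ ι
    push_cast
    linarith
  have hlam : ∀ (ι : QRType) (n : ℤ), lamFn ι ((n + idxShift K1 K3 K4 ι : ℤ) : ℝ) α β =
      lamFn ι n a b - K1.card * (K1.card + a + b + 1) := by
    intro ι n
    push_cast
    exact lamFn_shift hα hβ ι n
  have hw : ∀ w : RatFunc ℝ, w - gam K3.card K4.card + gam K3.card K4.card = w := fun w =>
    sub_add_cancel _ _
  have hm' : ∀ {w lam}, w ∈ ricSet (Trg τ α β) lam → w - gam K3.card K4.card ∈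
      ricSet (opAfter (classOp a b) (seedList K1 K3 K4 a b))
        (lam + K1.card * (K1.card + a + b + 1)) := by
    intro w lam h
    rw [← hm, hw, add_sub_cancel_right]
    exact h
  refine ⟨?_, ?_, ?_⟩
  · intro lam w h
    obtain ⟨ι, n, hn, h1, h2⟩ := opAfter_classify hab (hm' h)
    refine ⟨ι, _, ⟨n, hn, rfl⟩, ?_, ?_⟩
    · rw [hlam, ← h1, add_sub_cancel_right]
    · rw [hd, ← hw w]
      exact (hA _ _ _).2 h2
  · rintro ι - ⟨n, hn, rfl⟩
    obtain ⟨w, h1, h2⟩ := opAfter_exist hab hn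
    refine ⟨w + gam K3.card K4.card, ?_, ?_⟩
    · rw [hlam, hm]; exact h1
    · rw [hd]; exact (hA _ _ _).2 h2
  · intro lam ι d d' w w' h h' hA1 hA2
    rw [← hw w, ← sub_add_cancel d ((K3.card : ℝ) + K4.card), hA] at hA1
    rw [← hw w', ← sub_add_cancel d' ((K3.card : ℝ) + K4.card), hA] at hA2
    exact sub_left_injective (opAfter_unique hab (hm' h) (hm' h') hA1 hA2)

end

/-! ### Index sets -/

theorem natCast_mem_castZ {K : Finset ℕ} {k : ℕ} : (k : ℤ) ∈ castZ K ↔ k ∈ K := by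
  simp [castZ]

theorem nonneg_of_mem_castZ {K : Finset ℕ} {n : ℤ} (h : n ∈ castZ K) : 0 ≤ n := by
  obtain ⟨k, -, rfl⟩ := h; simp

theorem mem_bar {K : Finset ℕ} {n : ℤ} : n ∈ bar K ↔ -n - 1 ∈ castZ K := by
  constructor
  · rintro ⟨k, hk, rfl⟩; exact ⟨k, hk, by simp⟩
  · rintro ⟨k, hk, h⟩; exact ⟨k, hk, by simp only at h ⊢; omega⟩

theorem bar_empty : bar ∅ = ∅ := by simp [bar]

theorem forall_seedIdx {K1 K3 K4 : Finset ℕ} {P : QRType → ℤ → Prop} :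
    (∀ z ∈ seedIdx K1 K3 K4, P z.1 z.2) ↔ (∀ m ∈ castZ K1, P .one m) ∧
      (∀ m ∈ castZ K3, P .three m) ∧ ∀ m ∈ castZ K4, P .four m := by
  constructor
  · intro h
    refine ⟨?_, ?_, ?_⟩ <;> rintro - ⟨k, hk, rfl⟩
    · exact h (.one, k) (mem_seedIdx.2 hk)
    · exact h (.three, k) (mem_seedIdx.2 hk)
    · exact h (.four, k) (mem_seedIdx.2 hk)
  · rintro ⟨h1, h3, h4⟩ ⟨ι, k⟩ hz
    have := mem_seedIdx.1 hz
    cases ι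
    · exact h1 _ ⟨k, this, rfl⟩
    · simp [seedSet] at this
    · exact h3 _ ⟨k, this, rfl⟩
    · exact h4 _ ⟨k, this, rfl⟩

theorem mem_rawIdx {K1 K3 K4 : Finset ℕ} {a b : ℝ} {ι : QRType} {n : ℤ} :
    n ∈ rawIdx K1 K3 K4 a b ι ↔ (0 ≤ n ∧ Good n.toNat (parSum ι a b) ∧
      (∀ m ∈ castZ K1, lamFn ι n a b ≠ lamFn .one m a b) ∧
      (∀ m ∈ castZ K3, lamFn ι n a b ≠ lamFn .three m a b) ∧
      ∀ m ∈ castZ K4, lamFn ι n a b ≠ lamFn .four m a b) ∨ n ∈ bar (seedSet K1 K3 K4 ι.dual) := by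
  have h := forall_seedIdx (K1 := K1) (K3 := K3) (K4 := K4)
    (P := fun κ m => lamFn ι n a b ≠ lamFn κ m a b)
  simp only [Int.cast_natCast] at h
  rw [rawIdx, mem_union, mem_ofPred_eq, h]

theorem parSum_one (a b : ℝ) : parSum .one a b = a + b := by
  simp [parSum, par1, parm, ex1, exm, QRType.sing1, QRType.singm]

theorem parSum_two (a b : ℝ) : parSum .two a b = -(a + b) := by
  simp [parSum, par1, parm, ex1, exm, QRType.sing1, QRType.singm]; ring

theorem parSum_three (a b : ℝ) : parSum .three a b = -(a - b) := by
  simp [parSum, par1, parm, ex1, exm, QRType.sing1, QRType.singm]; ring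

theorem parSum_four (a b : ℝ) : parSum .four a b = a - b := by
  simp [parSum, par1, parm, ex1, exm, QRType.sing1, QRType.singm]; ring

section

variable {K1 K3 K4 : Finset ℕ} {a b : ℝ}

section

variable (hab : ClassG a b ∨ ParamsB K3 K4 a b)
include hab

theorem rawIdx_one : rawIdx K1 K3 K4 a b .one = natZ \ castZ K1 := by
  have ha := params_left hab
  have hb := params_right hab
  have hs := params_sum hab
  ext n
  rw [mem_rawIdx]
  simp only [parSum_one, good_of_not_isInt _ hs, lamFn_one_one hs, Ne, QRType.dual, seedSet, bar_empty,
    mem_empty_iff_false, or_false, true_and]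
  constructor
  · exact fun h => ⟨h.1, fun h' => h.2.1 n h' rfl⟩
  · exact fun h => ⟨h.1, fun m hm e => h.2 (e ▸ hm), fun m _ => lamFn_one_three ha hb n m,
      fun m _ => lamFn_one_four ha hb n m⟩

theorem rawIdx_two : rawIdx K1 K3 K4 a b .two = natZ ∪ bar K1 := by
  have ha := params_left hab
  have hb := params_right hab
  have hs := params_sum hab
  have hs' : ¬ IsInt (-(a + b)) := fun h => hs (isInt_neg h)
  ext n
  rw [mem_rawIdx]
  simp only [parSum_two, good_of_not_isInt _ hs', true_and]
  refine or_congr_left ⟨fun h => h.1, fun h => ⟨h, fun m hm e => ?_,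
    fun m _ => lamFn_two_three ha hb n m, fun m _ => lamFn_two_four ha hb n m⟩⟩
  -- `λ₁(m) = λ₂(n)` needs `m = -n - 1`, impossible for nonnegative indices; no type 2 index is
  -- removed.
  have h1 := (lamFn_one_two hs m n).1 e.symm
  have h2 := nonneg_of_mem_castZ hm
  have h3 : 0 ≤ n := h
  omega

end

/-- The only coincidences between eigenvalues of different types come from duality, `n ↦ -n - 1`, so
among nonnegative indices each type loses just its own seeds. -/
theorem rawIdx_classG (hG : ClassG a b) (ι : QRType) : rawIdx K1 K3 K4 a b ι = match ι with
    | .one => natZ \ castZ K1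
    | .two => natZ ∪ bar K1
    | .three => (natZ \ castZ K3) ∪ bar K4
    | .four => (natZ \ castZ K4) ∪ bar K3 := by
  have hab : ClassG a b ∨ ParamsB K3 K4 a b := Or.inl hG
  obtain ⟨ha, hb, hs, hd⟩ := hG
  have hd' : ¬ IsInt (-(a - b)) := fun h => hd (isInt_neg h)
  have e33 : ∀ n m : ℤ, (n : ℝ) + m + 1 ≠ a - b := fun n m h =>
    hd (isInt_of_eq (n + m + 1) (by push_cast; linarith))
  have e44 : ∀ n m : ℤ, (n : ℝ) + m + 1 ≠ b - a := fun n m h =>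
    hd (isInt_of_eq (-(n + m + 1)) (by push_cast; linarith))
  have e34 : ∀ n m : ℤ, (n : ℝ) - a ≠ m - b := fun n m h =>
    hd (isInt_of_eq (n - m) (by push_cast; linarith))
  cases ι
  · exact rawIdx_one hab
  · exact rawIdx_two hab
  · ext n
    rw [mem_rawIdx]
    simp only [parSum_three, good_of_not_isInt _ hd', true_and, lamFn_three_three,
      lamFn_three_four, e33, e34, or_false, false_or, Ne, QRType.dual, seedSet]
    refine or_congr_left ⟨fun ⟨h0, _, h1, _⟩ => ⟨h0, fun h => h1 n h rfl⟩, fun ⟨h0, h1⟩ =>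
      ⟨h0, fun m _ h => lamFn_one_three ha hb m n h.symm, fun m hm h => h1 (h ▸ hm),
        fun m hm h => ?_⟩⟩
    have h2 := nonneg_of_mem_castZ hm
    have h3 : 0 ≤ n := h0
    omega
  · ext n
    rw [mem_rawIdx]
    simp only [parSum_four, good_of_not_isInt _ hd, true_and, lamFn_four_four,
      e44, or_false, Ne, QRType.dual, seedSet]
    refine or_congr_left ⟨fun ⟨h0, _, _, h1⟩ => ⟨h0, fun h => h1 n h rfl⟩, fun ⟨h0, h1⟩ =>
      ⟨h0, fun m _ h => lamFn_one_four ha hb m n h.symm, fun m hm h => ?_,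
        fun m hm h => h1 (h ▸ hm)⟩⟩
    have h2 := nonneg_of_mem_castZ hm
    have h3 : 0 ≤ n := h0
    rcases (lamFn_three_four m n).1 h.symm with h4 | h4
    · exact e34 _ _ h4
    · omega

/-- Integral form of the class B data, `d = a - b`. -/
structure DataB (K3 K4 : Finset ℕ) (a b : ℝ) (d : ℤ) : Prop where
  eq : (d : ℝ) = a - b
  pos3 : ∀ {n}, n ∈ castZ K3 → d ≤ n
  pos4 : ∀ {n}, n ∈ castZ K4 → 0 ≤ n + d
  disj : ∀ {n}, n ∈ castZ K3 → n - d ∉ castZ K4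

theorem ParamsB.exists_data (h : ParamsB K3 K4 a b) : ∃ d, DataB K3 K4 a b d := by
  obtain ⟨d, hd⟩ := h.1.2.2.2
  refine ⟨d, hd, fun {n} hn => ?_, fun {n} hn => ?_, fun {n} hn hn' => ?_⟩
  · have h1 := (h.2.1 hn).2
    have : (d : ℝ) ≤ n := by linarith
    exact_mod_cast this
  · have h1 := (h.2.2.1 hn).2
    have : (0 : ℝ) ≤ n + d := by linarith
    exact_mod_cast this
  · obtain ⟨k, hk, rfl⟩ := hn
    obtain ⟨l, hl, hl'⟩ := hn'
    simp only at hl'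
    have : (l : ℝ) = k - d := by exact_mod_cast hl'
    exact disjoint_left.1 h.2.2.2 ⟨k, hk, rfl⟩ ⟨l, hl, by simp only; rw [this, hd]; ring⟩

section DataB

variable {d : ℤ} (hd : DataB K3 K4 a b d)
include hd

theorem DataB.three_three (n m : ℤ) :
    lamFn .three n a b = lamFn .three m a b ↔ n = m ∨ n + m + 1 = d := by
  rw [lamFn_three_three, ← hd.eq]; norm_cast

theorem DataB.four_four (n m : ℤ) :
    lamFn .four n a b = lamFn .four m a b ↔ n = m ∨ n + m + 1 = -d := by
  rw [lamFn_four_four, show b - a = -(a - b) by ring, ← hd.eq]; norm_cast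

theorem DataB.three_four (n m : ℤ) :
    lamFn .three n a b = lamFn .four m a b ↔ n = m + d ∨ n + m + 1 = 0 := by
  rw [lamFn_three_four]
  refine or_congr_left ?_
  have : (n : ℝ) - a = m - b ↔ (n : ℝ) = m + d := by rw [hd.eq]; constructor <;> intro h <;> linarith
  rw [this]; norm_cast

theorem DataB.mem_minus3 {n : ℤ} : n ∈ classicalMinus a b ↔ 0 ≤ n ∧ 2 * n < d := by
  have : 2 * (n : ℝ) - a + b < 0 ↔ 2 * (n : ℝ) < d := by
    rw [hd.eq]; constructor <;> intro h <;> linarith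
  rw [classicalMinus, mem_ofPred_eq, this]; norm_cast

theorem DataB.mem_minus4 {n : ℤ} : n ∈ classicalMinus b a ↔ 0 ≤ n ∧ 2 * n + d < 0 := by
  have : 2 * (n : ℝ) - b + a < 0 ↔ 2 * (n : ℝ) + d < 0 := by
    rw [hd.eq]; constructor <;> intro h <;> linarith
  rw [classicalMinus, mem_ofPred_eq, this]; norm_cast

theorem DataB.mem_plus3 {n : ℤ} : n ∈ classicalPlus a b ↔ 0 ≤ n ∧ d ≤ n := by
  have : 0 ≤ (n : ℝ) - a + b ↔ (d : ℝ) ≤ n := by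
    rw [hd.eq]; constructor <;> intro h <;> linarith
  rw [classicalPlus, mem_ofPred_eq, this]; norm_cast

theorem DataB.mem_plus4 {n : ℤ} : n ∈ classicalPlus b a ↔ 0 ≤ n ∧ 0 ≤ n + d := by
  have : 0 ≤ (n : ℝ) - b + a ↔ (0 : ℝ) ≤ n + d := by
    rw [hd.eq]; constructor <;> intro h <;> linarith
  rw [classicalPlus, mem_ofPred_eq, this]; norm_cast

theorem DataB.mem_K34_left {n : ℤ} :
    (n : ℝ) - a ∈ K34 K3 K4 a b ↔ n ∈ castZ K3 ∨ n - d ∈ castZ K4 := by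
  refine or_congr (exists_congr fun k => and_congr_right fun _ => ?_)
    (exists_congr fun k => and_congr_right fun _ => ?_)
  · simp only [sub_left_inj]; norm_cast
  · have : (k : ℝ) - b = n - a ↔ (k : ℝ) = n - d := by
      rw [hd.eq]; constructor <;> intro h <;> linarith
    rw [this]; norm_cast

theorem DataB.mem_K34_right {n : ℤ} :
    (n : ℝ) - b ∈ K34 K3 K4 a b ↔ n + d ∈ castZ K3 ∨ n ∈ castZ K4 := by
  refine or_congr (exists_congr fun k => and_congr_right fun _ => ?_)
    (exists_congr fun k => and_congr_right fun _ => ?_)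
  · have : (k : ℝ) - a = n - b ↔ (k : ℝ) = n + d := by
      rw [hd.eq]; constructor <;> intro h <;> linarith
    rw [this]; norm_cast
  · simp only [sub_left_inj]; norm_cast

end DataB

/-- For integer `a - b`, types 3 and 4 share eigenvalues through `n - a = m - b`, so seeds of both
types remove indices. As the seeds lie in the plus ranges, all removals happen there and the minus
range stays intact. -/
theorem rawIdx_three_classB (hB : ParamsB K3 K4 a b) : rawIdx K1 K3 K4 a b .three =
    (classicalMinus a b ∪ bar K4) ∪ (classicalPlus a b \ {n | (n : ℝ) - a ∈ K34 K3 K4 a b}) := by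
  have ha := hB.1.1
  have hb := hB.1.2.1
  obtain ⟨d, hd⟩ := hB.exists_data
  ext n
  have hg : 0 ≤ n → (Good n.toNat (parSum .three a b) ↔ 2 * n < d ∨ d ≤ n) := by
    intro h0
    rw [parSum_three, ← hd.eq, ← Int.cast_neg, good_intCast_iff, Int.toNat_of_nonneg h0]
    exact or_congr ⟨fun h => by omega, fun h => by omega⟩ ⟨fun h => by omega, fun h => by omega⟩
  have h13 : ∀ m ∈ castZ K1, lamFn .three n a b ≠ lamFn .one m a b := fun m _ h =>
    lamFn_one_three ha hb m n h.symm
  simp only [mem_rawIdx, mem_union, mem_sdiff, mem_ofPred_eq, hd.mem_minus3, hd.mem_plus3,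
    hd.mem_K34_left, hd.three_three, hd.three_four, QRType.dual, seedSet, Ne]
  constructor
  · rintro (⟨h0, h1, _, h2, h3⟩ | h)
    · rcases (hg h0).1 h1 with h | h
      · exact Or.inl (Or.inl ⟨h0, h⟩)
      · refine Or.inr ⟨⟨h0, h⟩, ?_⟩
        rintro (h4 | h4)
        · exact h2 n h4 (Or.inl rfl)
        · exact h3 _ h4 (Or.inl (by ring))
    · exact Or.inl (Or.inr h)
  · rintro ((⟨h0, h⟩ | h) | ⟨⟨h0, h⟩, h1⟩)
    · refine Or.inl ⟨h0, (hg h0).2 (Or.inl h), h13, fun m hm => ?_, fun m hm => ?_⟩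
      · have := hd.pos3 hm; omega
      · have := hd.pos4 hm; have := nonneg_of_mem_castZ hm; omega
    · exact Or.inr h
    · refine Or.inl ⟨h0, (hg h0).2 (Or.inr h), h13, fun m hm => ?_, fun m hm => ?_⟩
      · have := nonneg_of_mem_castZ hm
        rintro (rfl | h')
        · exact h1 (Or.inl hm)
        · omega
      · have := nonneg_of_mem_castZ hm
        rintro (rfl | h')
        · exact h1 (Or.inr (by rwa [add_sub_cancel_right]))
        · omega

theorem rawIdx_four_classB (hB : ParamsB K3 K4 a b) : rawIdx K1 K3 K4 a b .four =
    (classicalMinus b a ∪ bar K3) ∪ (classicalPlus b a \ {n | (n : ℝ) - b ∈ K34 K3 K4 a b}) := by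
  have ha := hB.1.1
  have hb := hB.1.2.1
  obtain ⟨d, hd⟩ := hB.exists_data
  ext n
  have hg : 0 ≤ n → (Good n.toNat (parSum .four a b) ↔ 2 * n + d < 0 ∨ 0 ≤ n + d) := by
    intro h0
    rw [parSum_four, ← hd.eq, good_intCast_iff, Int.toNat_of_nonneg h0]
  have h14 : ∀ m ∈ castZ K1, lamFn .four n a b ≠ lamFn .one m a b := fun m _ h =>
    lamFn_one_four ha hb m n h.symm
  simp only [mem_rawIdx, mem_union, mem_sdiff, mem_ofPred_eq, hd.mem_minus4, hd.mem_plus4,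
    hd.mem_K34_right, hd.four_four, eq_comm (a := lamFn .four n a b) (b := lamFn .three _ a b),
    hd.three_four, QRType.dual, seedSet, Ne]
  constructor
  · rintro (⟨h0, h1, _, h2, h3⟩ | h)
    · rcases (hg h0).1 h1 with h | h
      · exact Or.inl (Or.inl ⟨h0, h⟩)
      · refine Or.inr ⟨⟨h0, h⟩, ?_⟩
        rintro (h4 | h4)
        · exact h2 _ h4 (Or.inl rfl)
        · exact h3 _ h4 (Or.inl rfl)
    · exact Or.inl (Or.inr h)
  · rintro ((⟨h0, h⟩ | h) | ⟨⟨h0, h⟩, h1⟩)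
    · refine Or.inl ⟨h0, (hg h0).2 (Or.inl h), h14, fun m hm => ?_, fun m hm => ?_⟩
      · have := hd.pos3 hm; have := nonneg_of_mem_castZ hm; omega
      · have := hd.pos4 hm; omega
    · exact Or.inr h
    · refine Or.inl ⟨h0, (hg h0).2 (Or.inr h), h14, fun m hm => ?_, fun m hm => ?_⟩
      · have := nonneg_of_mem_castZ hm
        rintro (rfl | h')
        · exact h1 (Or.inl hm)
        · omega
      · have := nonneg_of_mem_castZ hm
        rintro (rfl | h')
        · exact h1 (Or.inr hm)
        · omega

/-! ### Eigenvalues -/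

theorem disjoint_lamImage {ι κ : QRType} {I J : Set ℤ}
    (h : ∀ n ∈ I, ∀ m ∈ J, lamFn ι n a b ≠ lamFn κ m a b) :
    Disjoint (lamImage ι I a b) (lamImage κ J a b) := by
  rw [disjoint_left]
  rintro - ⟨n, hn, rfl⟩ ⟨m, hm, h'⟩
  exact h n hn m hm h'.symm

theorem lamImage_union (ι : QRType) (I J : Set ℤ) :
    lamImage ι (I ∪ J) a b = lamImage ι I a b ∪ lamImage ι J a b := image_union _ _ _

theorem lamImage_univ_dual (ι : QRType) : lamImage ι.dual univ a b = lamImage ι univ a b := by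
  ext x
  constructor
  · rintro ⟨n, -, rfl⟩
    refine ⟨-n - 1, trivial, ?_⟩
    have := lamFn_dual ι (-n - 1 : ℝ) a b
    simp only at this ⊢
    push_cast
    rw [← this]; congr 1; ring
  · rintro ⟨n, -, rfl⟩
    refine ⟨-n - 1, trivial, ?_⟩
    have := lamFn_dual ι (n : ℝ) a b
    simp only at this ⊢
    push_cast
    rw [this]

theorem sigmaQ_eq : sigmaQ a b = lamImage .one univ a b ∪ lamImage .three univ a b := by
  rw [sigmaQ, lamImage, lamImage, image_univ, image_univ]
  congr 2
  funext k
  rw [lamFn_eq_one .three]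
  rfl

theorem mem_lamImage_of_eq {ι κ : QRType} {I : Set ℤ} {n m : ℤ} (hm : m ∈ I)
    (h : lamFn ι n a b = lamFn κ m a b) : lamFn ι n a b ∈ lamImage κ I a b := ⟨m, hm, h.symm⟩

/-- `λ₁(n) = λ₂(-n-1)`: an integer missing among the type 1 indices, being negative or a seed,
reappears reflected among those of type 2. -/
theorem lamImage_one_two (hs : ¬ IsInt (a + b)) : lamImage .one univ a b =
    lamImage .one (natZ \ castZ K1) a b ∪ lamImage .two (natZ ∪ bar K1) a b := by
  refine Subset.antisymm ?_ (union_subset (image_mono (subset_univ _)) ?_)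
  · rintro - ⟨n, -, rfl⟩
    by_cases h0 : n ∈ natZ \ castZ K1
    · exact Or.inl ⟨n, h0, rfl⟩
    · refine Or.inr (mem_lamImage_of_eq (m := -n - 1) ?_ ((lamFn_one_two hs _ _).2 (by ring)))
      by_cases h1 : 0 ≤ n
      · refine Or.inr (mem_bar.2 ?_)
        have : n ∈ castZ K1 := by_contra fun h => h0 ⟨h1, h⟩
        convert! this using 1; ring
      · exact Or.inl (by change (0 : ℤ) ≤ _; omega)
  · rw [← lamImage_univ_dual .one]
    exact image_mono (subset_univ _)

theorem disjoint_one_two (hs : ¬ IsInt (a + b)) :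
    Disjoint (lamImage .one (natZ \ castZ K1) a b) (lamImage .two (natZ ∪ bar K1) a b) := by
  refine disjoint_lamImage fun n hn m hm h => ?_
  rw [lamFn_one_two hs] at h
  obtain ⟨h0, h1⟩ := hn
  have h0 : 0 ≤ n := h0
  rcases hm with hm | hm
  · have : 0 ≤ m := hm
    omega
  · rw [mem_bar, show -m - 1 = n by omega] at hm
    exact h1 hm

section ClassG

theorem lamImage_three_four_classG : lamImage .three univ a b =
    lamImage .three ((natZ \ castZ K3) ∪ bar K4) a b ∪
      lamImage .four ((natZ \ castZ K4) ∪ bar K3) a b := by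
  refine Subset.antisymm ?_ (union_subset (image_mono (subset_univ _)) ?_)
  · rintro - ⟨n, -, rfl⟩
    have h4 := (lamFn_three_four (a := a) (b := b) n (-n - 1)).2 (Or.inr (by ring))
    by_cases h0 : 0 ≤ n
    · by_cases h1 : n ∈ castZ K3
      · exact Or.inr (mem_lamImage_of_eq (Or.inr (mem_bar.2 (by convert! h1 using 1; ring))) h4)
      · exact Or.inl ⟨n, Or.inl ⟨h0, h1⟩, rfl⟩
    · by_cases h1 : -n - 1 ∈ castZ K4
      · exact Or.inl ⟨n, Or.inr (mem_bar.2 h1), rfl⟩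
      · exact Or.inr (mem_lamImage_of_eq (Or.inl ⟨by change (0 : ℤ) ≤ _; omega, h1⟩) h4)
  · rw [← lamImage_univ_dual .three]
    exact image_mono (subset_univ _)

theorem disjoint_three_four_classG (hG : ClassG a b) :
    Disjoint (lamImage .three ((natZ \ castZ K3) ∪ bar K4) a b)
      (lamImage .four ((natZ \ castZ K4) ∪ bar K3) a b) := by
  refine disjoint_lamImage fun n hn m hm h => ?_
  rcases (lamFn_three_four n m).1 h with h | h
  · exact hG.2.2.2 (isInt_of_eq (n - m) (by push_cast; linarith))
  · obtain rfl : m = -n - 1 := by omega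
    rcases hn with ⟨h0, h1⟩ | h1 <;> rcases hm with ⟨h2, h3⟩ | h3
    · have : (0 : ℤ) ≤ n := h0
      have : (0 : ℤ) ≤ -n - 1 := h2
      omega
    · rw [mem_bar, show -(-n - 1) - 1 = n by ring] at h3
      exact h1 h3
    · exact h3 (mem_bar.1 h1)
    · have := nonneg_of_mem_castZ (mem_bar.1 h1)
      have := nonneg_of_mem_castZ (mem_bar.1 h3)
      omega

end ClassG

theorem disjoint_of_ne (ha : ¬ IsInt a) (hb : ¬ IsInt b) (I J : Set ℤ) :
    Disjoint (lamImage .one I a b) (lamImage .three J a b) ∧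
    Disjoint (lamImage .one I a b) (lamImage .four J a b) ∧
    Disjoint (lamImage .two I a b) (lamImage .three J a b) ∧
    Disjoint (lamImage .two I a b) (lamImage .four J a b) :=
  ⟨disjoint_lamImage fun n _ m _ => lamFn_one_three ha hb n m,
    disjoint_lamImage fun n _ m _ => lamFn_one_four ha hb n m,
    disjoint_lamImage fun n _ m _ => lamFn_two_three ha hb n m,
    disjoint_lamImage fun n _ m _ => lamFn_two_four ha hb n m⟩

/-! ### Class B: partition of the eigenvalues of types 3 and 4 -/

section ClassB

variable (hB : ParamsB K3 K4 a b)
include hB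

theorem lamImage_plus_classB :
    lamImage .three (classicalPlus a b \ {n | (n : ℝ) - a ∈ K34 K3 K4 a b}) a b =
      lamImage .four (classicalPlus b a \ {n | (n : ℝ) - b ∈ K34 K3 K4 a b}) a b := by
  obtain ⟨d, hd⟩ := hB.exists_data
  refine Subset.antisymm ?_ ?_
  · rintro - ⟨n, ⟨h1, h2⟩, rfl⟩
    rw [hd.mem_plus3] at h1
    rw [mem_ofPred_eq, hd.mem_K34_left] at h2
    refine mem_lamImage_of_eq (m := n - d) ⟨hd.mem_plus4.2 (by omega), ?_⟩
      ((hd.three_four _ _).2 (Or.inl (by ring)))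
    rwa [mem_ofPred_eq, hd.mem_K34_right, sub_add_cancel]
  · rintro - ⟨n, ⟨h1, h2⟩, rfl⟩
    rw [hd.mem_plus4] at h1
    rw [mem_ofPred_eq, hd.mem_K34_right] at h2
    refine mem_lamImage_of_eq (m := n + d) ⟨hd.mem_plus3.2 (by omega), ?_⟩
      ((hd.three_four _ _).2 (Or.inl rfl)).symm
    rwa [mem_ofPred_eq, hd.mem_K34_left, add_sub_cancel_right]

theorem disjoint_minus_classB :
    Disjoint (lamImage .three (classicalMinus a b ∪ bar K4) a b)
      (lamImage .four (classicalMinus b a ∪ bar K3) a b) := by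
  obtain ⟨d, hd⟩ := hB.exists_data
  refine disjoint_lamImage fun n hn m hm h => ?_
  rw [hd.three_four] at h
  rcases hn with hn | hn <;> rcases hm with hm | hm
  · rw [hd.mem_minus3] at hn
    rw [hd.mem_minus4] at hm
    omega
  · rw [hd.mem_minus3] at hn
    rw [mem_bar] at hm
    have := hd.pos3 hm
    omega
  · rw [hd.mem_minus4] at hm
    rw [mem_bar] at hn
    have := hd.pos4 hn
    have := nonneg_of_mem_castZ hn
    omega
  · rw [mem_bar] at hn hm
    have := nonneg_of_mem_castZ hn
    have := nonneg_of_mem_castZ hm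
    rcases h with h | h
    · exact hd.disj hm (by rwa [show -m - 1 - d = -n - 1 by omega])
    · omega

theorem disjoint_minus3_plus_classB :
    Disjoint (lamImage .three (classicalMinus a b ∪ bar K4) a b)
      (lamImage .three (classicalPlus a b \ {n | (n : ℝ) - a ∈ K34 K3 K4 a b}) a b) := by
  obtain ⟨d, hd⟩ := hB.exists_data
  refine disjoint_lamImage fun n hn m hm h => ?_
  obtain ⟨h1, h2⟩ := hm
  rw [hd.mem_plus3] at h1
  rw [mem_ofPred_eq, hd.mem_K34_left] at h2
  rw [hd.three_three] at h
  rcases hn with hn | hn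
  · rw [hd.mem_minus3] at hn
    omega
  · rw [mem_bar] at hn
    have := nonneg_of_mem_castZ hn
    rcases h with h | h
    · omega
    · exact h2 (Or.inr (by rwa [show m - d = -n - 1 by omega]))

theorem disjoint_minus4_plus_classB :
    Disjoint (lamImage .four (classicalMinus b a ∪ bar K3) a b)
      (lamImage .three (classicalPlus a b \ {n | (n : ℝ) - a ∈ K34 K3 K4 a b}) a b) := by
  obtain ⟨d, hd⟩ := hB.exists_data
  refine disjoint_lamImage fun n hn m hm h => ?_
  obtain ⟨h1, h2⟩ := hm
  rw [hd.mem_plus3] at h1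
  rw [mem_ofPred_eq, hd.mem_K34_left] at h2
  have h := (hd.three_four _ _).1 h.symm
  rcases hn with hn | hn
  · rw [hd.mem_minus4] at hn
    omega
  · rw [mem_bar] at hn
    have := nonneg_of_mem_castZ hn
    have := hd.pos3 hn
    rcases h with h | h
    · omega
    · exact h2 (Or.inl (by rwa [show m = -n - 1 by omega]))

theorem lamImage_three_four_classB : lamImage .three univ a b =
    lamImage .three (classicalMinus a b ∪ bar K4) a b ∪
      lamImage .four (classicalMinus b a ∪ bar K3) a b ∪
      lamImage .three (classicalPlus a b \ {n | (n : ℝ) - a ∈ K34 K3 K4 a b}) a b := by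
  obtain ⟨d, hd⟩ := hB.exists_data
  refine Subset.antisymm ?_ (union_subset (union_subset (image_mono (subset_univ _)) ?_)
    (image_mono (subset_univ _)))
  -- `n ↦ d - 1 - n` preserves `λ₃`, while `n ↦ -n - 1` and `n ↦ n - d` turn it into `λ₄`. With
  -- these every integer is brought to the plus range treated here or to one of the two minus
  -- ranges.
  · have key : ∀ n : ℤ, 0 ≤ n → d ≤ n → lamFn .three n a b ∈
        lamImage .three (classicalMinus a b ∪ bar K4) a b ∪
        lamImage .four (classicalMinus b a ∪ bar K3) a b ∪
        lamImage .three (classicalPlus a b \ {n | (n : ℝ) - a ∈ K34 K3 K4 a b}) a b := by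
      intro n h0 h1
      by_cases h3 : n ∈ castZ K3
      · exact Or.inl (Or.inr (mem_lamImage_of_eq (m := -n - 1)
          (Or.inr (mem_bar.2 (by rwa [show -(-n - 1) - 1 = n by ring])))
          ((hd.three_four _ _).2 (Or.inr (by ring)))))
      by_cases h4 : n - d ∈ castZ K4
      · exact Or.inl (Or.inl (mem_lamImage_of_eq (m := d - n - 1)
          (Or.inr (mem_bar.2 (by rwa [show -(d - n - 1) - 1 = n - d by ring])))
          ((hd.three_three _ _).2 (Or.inr (by ring)))))
      · refine Or.inr ⟨n, ⟨hd.mem_plus3.2 ⟨h0, h1⟩, ?_⟩, rfl⟩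
        rw [mem_ofPred_eq, hd.mem_K34_left]
        tauto
    rintro - ⟨n, -, rfl⟩
    change lamFn .three n a b ∈ _
    by_cases h0 : 0 ≤ n
    · by_cases h1 : d ≤ n
      · exact key n h0 h1
      · by_cases h2 : 2 * n < d
        · exact Or.inl (Or.inl ⟨n, Or.inl (hd.mem_minus3.2 ⟨h0, h2⟩), rfl⟩)
        · exact Or.inl (Or.inl (mem_lamImage_of_eq (m := d - n - 1)
            (Or.inl (hd.mem_minus3.2 (by omega))) ((hd.three_three _ _).2 (Or.inr (by ring)))))
    · by_cases h1 : d ≤ -n - 1 + d ∧ 0 ≤ -n - 1 + d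
      · have := key (-n - 1 + d) h1.2 h1.1
        rwa [← (hd.three_three n (-n - 1 + d)).2 (Or.inr (by ring))] at this
      · by_cases h2 : 2 * (-n - 1) + d < 0
        · exact Or.inl (Or.inr (mem_lamImage_of_eq (m := -n - 1)
            (Or.inl (hd.mem_minus4.2 ⟨by omega, h2⟩))
            ((hd.three_four _ _).2 (Or.inr (by ring)))))
        · exact Or.inl (Or.inr (mem_lamImage_of_eq (m := n - d)
            (Or.inl (hd.mem_minus4.2 (by omega)))
            ((hd.three_four _ _).2 (Or.inl (by ring)))))
  · rw [← lamImage_univ_dual .three]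
    exact image_mono (subset_univ _)

end ClassB

end

/-! ### Rational functions on intervals -/

theorem finite_not_regularAt (f : RatFunc ℝ) : {x | ¬ RegularAt f x}.Finite := by
  refine (f.denom.roots.toFinset.finite_toSet).subset fun x hx => ?_
  have : f.denom.eval x = 0 := not_not.1 hx
  simpa [f.denom_ne_zero] using this

theorem eq_zero_of_infinite {f : RatFunc ℝ} (h : {x | ValAt x 0 f}.Infinite) : f = 0 := by
  by_contra hf
  have hn := RatFunc.num_ne_zero hf
  refine h ((f.num.roots.toFinset.finite_toSet).subset fun x hx => ?_)
  obtain ⟨h1, h2⟩ := hx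
  rw [rval_eq, div_eq_zero_iff, or_iff_left h1] at h2
  simpa [hn] using h2

theorem exists_interval {S : Set ℝ} (hS : S.Finite) : ∃ c d, c < d ∧ ∀ x ∈ Ioo c d, x ∉ S := by
  obtain ⟨M, hM⟩ := hS.bddAbove
  exact ⟨M, M + 1, by linarith, fun x hx h => absurd (hM h) (not_le.2 hx.1)⟩

theorem rval_continuousAt {f : RatFunc ℝ} {x : ℝ} (h : RegularAt f x) :
    ContinuousAt (rval f) x := h.hasDerivAt.continuousAt

theorem deriv_deriv_of_logDeriv {c d : ℝ} {w : RatFunc ℝ} {φ : ℝ → ℝ}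
    (h : ∀ x ∈ Ioo c d, RegularAt w x ∧ HasDerivAt φ (rval w x * φ x) x) {x : ℝ}
    (hx : x ∈ Ioo c d) : deriv φ x = rval w x * φ x ∧
      deriv (deriv φ) x = rval (ratDeriv w + w ^ 2) x * φ x := by
  refine ⟨(h x hx).2.deriv, ?_⟩
  have he : deriv φ =ᶠ[nhds x] fun y => rval w y * φ y :=
    Filter.eventually_of_mem (Ioo_mem_nhds hx.1 hx.2) fun y hy => (h y hy).2.deriv
  have P := isPlace_valAt x
  have h2 : HasDerivAt (fun y => rval w y * φ y) _ x := (h x hx).1.hasDerivAt.mul (h x hx).2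
  rw [he.deriv_eq, h2.deriv, (P.add (h x hx).1.ratDeriv.valAt (P.pow (h x hx).1.valAt 2)).2]
  ring

theorem exists_logDeriv_function {c d : ℝ} (hcd : c < d) {w : RatFunc ℝ}
    (h : ∀ x ∈ Ioo c d, RegularAt w x) :
    ∃ φ : ℝ → ℝ, ∀ x ∈ Ioo c d, φ x ≠ 0 ∧ HasDerivAt φ (rval w x * φ x) x := by
  obtain ⟨m, hm⟩ := exists_between hcd
  have hm : m ∈ Ioo c d := hm
  have hcont : ContinuousOn (rval w) (Ioo c d) := fun x hx =>
    (rval_continuousAt (h x hx)).continuousWithinAt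
  refine ⟨fun x => Real.exp (∫ t in m..x, rval w t), fun x hx => ⟨Real.exp_ne_zero _, ?_⟩⟩
  have hsub : uIcc m x ⊆ Ioo c d := ordConnected_Ioo.uIcc_subset hm hx
  have h1 : HasDerivAt (fun u => ∫ t in m..u, rval w t) (rval w x) x :=
    intervalIntegral.integral_hasDerivAt_right (hcont.mono hsub).intervalIntegrable
      (hcont.stronglyMeasurableAtFilter isOpen_Ioo x hx) (rval_continuousAt (h x hx))
  rw [mul_comm]
  exact h1.exp

/-- On an interval without poles the eigenvalue equation divided by `φ` is the Riccati equation, and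
rational functions agreeing on an interval are equal. Conversely `exp ∫ w` is an eigenfunction. -/
theorem exists_qr_iff (T : DiffOp) (lam : ℝ) (w : RatFunc ℝ) :
    (∃ φ, IsQREigenfunction T lam w φ) ↔ w ∈ ricSet T lam := by
  constructor
  · rintro ⟨φ, c, d, hcd, h⟩
    have hw : ∀ x ∈ Ioo c d, RegularAt w x ∧ HasDerivAt φ (rval w x * φ x) x := fun x hx =>
      ⟨(h x hx).1, (h x hx).2.2.2.2.2.1⟩
    refine sub_eq_zero.1 (eq_zero_of_infinite ((Ioo_infinite hcd).mono fun x hx => ?_))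
    obtain ⟨r1, r2, r3, r4, h0, -, he⟩ := h x hx
    obtain ⟨d1, d2⟩ := deriv_deriv_of_logDeriv hw hx
    have P := isPlace_valAt x
    have v0 := P.add r1.ratDeriv.valAt (P.pow r1.valAt 2)
    have v := P.sub (P.add (P.add (P.mul r2.valAt v0) (P.mul r3.valAt r1.valAt)) r4.valAt)
      (P.const lam)
    rw [d1, d2] at he
    have e : rval T.p x * (rval (ratDeriv w) x + rval w x ^ 2) + rval T.q x * rval w x +
        rval T.r x - lam = 0 := by
      refine (mul_eq_zero.1 (?_ : φ x * _ = 0)).resolve_left h0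
      rw [v0.2] at he
      linear_combination he
    rwa [e] at v
  · intro hw
    have hfin : ({x | ¬ RegularAt w x} ∪ ({x | ¬ RegularAt T.p x} ∪ ({x | ¬ RegularAt T.q x} ∪
        {x | ¬ RegularAt T.r x}))).Finite :=
      (finite_not_regularAt _).union ((finite_not_regularAt _).union
        ((finite_not_regularAt _).union (finite_not_regularAt _)))
    obtain ⟨c, d, hcd, h⟩ := exists_interval hfin
    have h : ∀ x ∈ Ioo c d, RegularAt w x ∧ RegularAt T.p x ∧ RegularAt T.q x ∧
        RegularAt T.r x := fun x hx => by
      have := h x hx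
      simp only [mem_union, mem_ofPred_eq, not_or, not_not] at this
      exact this
    obtain ⟨φ, hφ⟩ := exists_logDeriv_function hcd fun x hx => (h x hx).1
    refine ⟨φ, c, d, hcd, fun x hx => ?_⟩
    obtain ⟨r1, r2, r3, r4⟩ := h x hx
    refine ⟨r1, r2, r3, r4, (hφ x hx).1, (hφ x hx).2, ?_⟩
    obtain ⟨d1, d2⟩ := deriv_deriv_of_logDeriv
      (fun x hx => ⟨(h x hx).1, (hφ x hx).2⟩) hx
    have P := isPlace_valAt x
    have v0 := P.add r1.ratDeriv.valAt (P.pow r1.valAt 2)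
    have v := P.add (P.add (P.mul r2.valAt v0) (P.mul r3.valAt r1.valAt)) r4.valAt
    have hw' : T.p * (ratDeriv w + w ^ 2) + T.q * w + T.r = RatFunc.C lam := hw
    rw [hw'] at v
    have e := P.unique v (P.const lam)
    rw [d1, d2, v0.2]
    linear_combination φ x * e

/-- Finiteness of `x w` at infinity makes `w` a proper fraction, so the remainder in `resInfinity`
is the numerator itself. -/
theorem resInfinity_eq {w : RatFunc ℝ} {d : ℝ} (h : ValInf d (RatFunc.X * w)) :
    resInfinity w = d := by
  have hm := w.denom_ne_zero
  have hw : RatFunc.X * w = toRat (X * w.num) / toRat w.denom := by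
    rw [toRat_mul, toRat_X, mul_div_assoc]
    exact congrArg _ (RatFunc.num_div_denom w).symm
  by_cases hn : w.num = 0
  · have h0 : w = 0 := RatFunc.num_eq_zero_iff.1 hn
    rw [h0, mul_zero] at h
    rw [resInfinity, hn, EuclideanDomain.zero_mod, coeff_zero]
    exact isPlace_valInf.unique isPlace_valInf.zero h
  · have hdeg : w.num.natDegree + 1 ≤ w.denom.natDegree := by
      obtain ⟨N, M, hM, hN, he, -⟩ := h
      rw [hw, toRat_div_eq_iff hm hM] at he
      have hN0 : N ≠ 0 := by
        rintro rfl
        rw [zero_mul] at he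
        exact mul_ne_zero (mul_ne_zero X_ne_zero hn) hM he
      have := congrArg natDegree he
      rw [natDegree_mul (mul_ne_zero X_ne_zero hn) hM, natDegree_mul hN0 hm,
        natDegree_mul X_ne_zero hn, natDegree_X] at this
      omega
    have hmod : w.num % w.denom = w.num := by
      rw [mod_eq_self_iff hm]
      exact degree_lt_degree (by omega)
    have hv : ValInf ((X * w.num).coeff w.denom.natDegree / w.denom.leadingCoeff)
        (RatFunc.X * w) := by
      refine ⟨X * w.num, w.denom, hm, ?_, hw, rfl⟩
      rw [natDegree_mul X_ne_zero hn, natDegree_X]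
      omega
    rw [isPlace_valInf.unique h hv, resInfinity, hmod, (RatFunc.monic_denom w).leadingCoeff, div_one]
    obtain ⟨k, hk⟩ : ∃ k, w.denom.natDegree = k + 1 := ⟨w.denom.natDegree - 1, by omega⟩
    rw [hk, coeff_X_mul, Nat.add_sub_cancel]

/-! ### Types and labels -/

theorem hasType_unique {ι κ : QRType} {w : RatFunc ℝ} (h : HasType ι w) (h' : HasType κ w) :
    ι = κ := by
  cases ι <;> cases κ <;> simp only [HasType] at h h' <;> first | rfl | tauto

theorem Asym.hasType {α β d : ℝ} {ι : QRType} {w : RatFunc ℝ} (hα : ¬ IsInt α) (hβ : ¬ IsInt β)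
    (h : Asym (classExpo α β) ι d w) : HasType ι w := by
  have h1 := regularAt_iff_of_residue h.one
  have h2 := regularAt_iff_of_residue h.neg
  have n1 : α ≠ 0 := fun h => hα ⟨0, by push_cast; linarith⟩
  have n2 : β ≠ 0 := fun h => hβ ⟨0, by push_cast; linarith⟩
  cases ι <;> simp [Expo.e1, Expo.em, classExpo, QRType.sing1, QRType.singm] at h1 h2 <;>
    simp [HasType, h1, h2, n1, n2]

/-- The label of an eigenvalue with a single eigenfunction, of type `ι`. -/
def QRType.label : QRType → Label
  | .one => .circ
  | .two => .times
  | .three => .plus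
  | .four => .minus

theorem hasLabel_single {T : DiffOp} {lam : ℝ} {w : RatFunc ℝ} {ι : QRType} {l : Label}
    (h : ricSet T lam = {w}) (ht : HasType ι w) : HasLabel T lam l ↔ l = ι.label := by
  have key : ∀ {κ v}, ricSet T lam = {v} → HasType κ v → κ = ι := by
    intro κ v h1 h2
    rw [h, singleton_eq_singleton_iff] at h1
    exact hasType_unique (h1 ▸ h2) ht
  have key2 : ∀ {κ κ' v v'}, ricSet T lam = {v, v'} → HasType κ v → HasType κ' v' → κ = κ' := by
    intro κ κ' v v' h1 h2 h3
    have m1 : v ∈ ricSet T lam := by rw [h1]; simp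
    have m2 : v' ∈ ricSet T lam := by rw [h1]; simp
    rw [h] at m1 m2
    rw [mem_singleton_iff.1 m1] at h2
    rw [mem_singleton_iff.1 m2] at h3
    exact hasType_unique h2 h3
  constructor
  · intro hl
    cases l
    · obtain ⟨v, h1, h2⟩ := hl; rw [← key h1 h2]; rfl
    · obtain ⟨v, h1, h2⟩ := hl; rw [← key h1 h2]; rfl
    · obtain ⟨v, h1, h2⟩ := hl; rw [← key h1 h2]; rfl
    · obtain ⟨v, h1, h2⟩ := hl; rw [← key h1 h2]; rfl
    · obtain ⟨v, v', h1, h2, h3⟩ := hl; exact absurd (key2 h1 h2 h3) (by simp)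
    · obtain ⟨v, v', h1, h2, h3⟩ := hl; exact absurd (key2 h1 h2 h3) (by simp)
    · obtain ⟨v, v', h1, h2, h3⟩ := hl; exact absurd (key2 h1 h2 h3) (by simp)
    · exact absurd (h ▸ finite_singleton w) hl.1
  · rintro rfl
    cases ι <;> exact ⟨w, h, ht⟩

theorem hasLabel_divide {T : DiffOp} {lam : ℝ} {w v : RatFunc ℝ} {l : Label}
    (h : ricSet T lam = {w, v}) (hw : HasType .three w) (hv : HasType .four v) :
    HasLabel T lam l ↔ l = .divide := by
  have mw : w ∈ ricSet T lam := by rw [h]; simp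
  have mv : v ∈ ricSet T lam := by rw [h]; simp
  have key : ∀ u, ricSet T lam ≠ {u} := by
    intro u h1
    rw [h1] at mw mv
    rw [mem_singleton_iff.1 mw] at hw
    rw [mem_singleton_iff.1 mv] at hv
    exact absurd (hasType_unique hw hv) (by simp)
  have key2 : ∀ {u κ}, u ∈ ricSet T lam → HasType κ u → κ = .three ∨ κ = .four := by
    intro u κ hu ht
    rw [h] at hu
    rcases hu with rfl | rfl
    · exact Or.inl (hasType_unique ht hw)
    · exact Or.inr (hasType_unique ht hv)
  constructor
  · intro hl
    cases l
    · obtain ⟨u, h1, -⟩ := hl; exact absurd h1 (key u)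
    · obtain ⟨u, h1, -⟩ := hl; exact absurd h1 (key u)
    · obtain ⟨u, h1, -⟩ := hl; exact absurd h1 (key u)
    · obtain ⟨u, h1, -⟩ := hl; exact absurd h1 (key u)
    · obtain ⟨u, u', h1, h2, -⟩ := hl
      exact absurd (key2 (h1 ▸ mem_insert _ _) h2) (by simp)
    · rfl
    · obtain ⟨u, u', h1, h2, -⟩ := hl
      exact absurd (key2 (h1 ▸ mem_insert _ _) h2) (by simp)
    · exact absurd (h ▸ toFinite _) hl.1
  · rintro rfl
    exact ⟨w, v, h, hw, hv⟩

namespace Spectrum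

variable {T : DiffOp} {α β : ℝ} {J : QRType → Set ℤ} (h : Spectrum T α β J)
include h

theorem qrSpectrum_eq : qrSpectrum T = ⋃ ι, lamImage ι (J ι) α β := by
  ext lam
  have : lam ∈ qrSpectrum T ↔ ∃ w, w ∈ ricSet T lam :=
    exists_congr fun w => exists_qr_iff T lam w
  rw [this, mem_iUnion]
  constructor
  · rintro ⟨w, hw⟩
    obtain ⟨ι, n, hn, rfl, -⟩ := h.classify hw
    exact ⟨ι, n, hn, rfl⟩
  · rintro ⟨ι, n, hn, rfl⟩
    obtain ⟨w, hw, -⟩ := h.exist ι n hn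
    exact ⟨w, hw⟩

variable (hα : ¬ IsInt α) (hβ : ¬ IsInt β)
include hα hβ

theorem eq_of_types {lam : ℝ} {w v : RatFunc ℝ} {ι : QRType} (hw : w ∈ ricSet T lam)
    (hv : v ∈ ricSet T lam) (tw : HasType ι w) (tv : HasType ι v) : w = v := by
  obtain ⟨κ, n, -, -, h1⟩ := h.classify hw
  obtain ⟨κ', m, -, -, h2⟩ := h.classify hv
  obtain rfl := hasType_unique (h1.hasType hα hβ) tw
  obtain rfl := hasType_unique (h2.hasType hα hβ) tv
  exact h.unique hw hv h1 h2

theorem exists_hasType {lam : ℝ} {ι : QRType} (hl : lam ∈ lamImage ι (J ι) α β) :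
    ∃ w ∈ ricSet T lam, HasType ι w := by
  obtain ⟨n, hn, rfl⟩ := hl
  obtain ⟨w, hw, ha⟩ := h.exist ι n hn
  exact ⟨w, hw, ha.hasType hα hβ⟩

theorem exists_mem_lamImage {lam : ℝ} {w : RatFunc ℝ} (hw : w ∈ ricSet T lam) :
    ∃ ι, lam ∈ lamImage ι (J ι) α β ∧ HasType ι w := by
  obtain ⟨ι, n, hn, rfl, h1⟩ := h.classify hw
  exact ⟨ι, ⟨n, hn, rfl⟩, h1.hasType hα hβ⟩

/-- The type of any solution is one whose index set yields the eigenvalue. If there is only one such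
type, all solutions have it and therefore coincide. -/
theorem hasLabel_of_single {lam : ℝ} {ι : QRType} {l : Label} (hl : lam ∈ lamImage ι (J ι) α β)
    (hs : ∀ κ, κ ≠ ι → lam ∉ lamImage κ (J κ) α β) : HasLabel T lam l ↔ l = ι.label := by
  obtain ⟨w, hw, ht⟩ := h.exists_hasType hα hβ hl
  refine hasLabel_single (eq_singleton_iff_unique_mem.2 ⟨hw, fun v hv => ?_⟩) ht
  obtain ⟨κ, hκ, tv⟩ := h.exists_mem_lamImage hα hβ hv
  obtain rfl : κ = ι := by_contra fun hne => hs κ hne hκ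
  exact h.eq_of_types hα hβ hv hw tv ht

theorem hasLabel_of_three_four {lam : ℝ} {l : Label} (h3 : lam ∈ lamImage .three (J .three) α β)
    (h4 : lam ∈ lamImage .four (J .four) α β) (h1 : lam ∉ lamImage .one (J .one) α β)
    (h2 : lam ∉ lamImage .two (J .two) α β) : HasLabel T lam l ↔ l = .divide := by
  obtain ⟨w, hw, tw⟩ := h.exists_hasType hα hβ h3
  obtain ⟨v, hv, tv⟩ := h.exists_hasType hα hβ h4
  refine hasLabel_divide (Subset.antisymm (fun u hu => ?_) ?_) tw tv
  · obtain ⟨κ, hκ, tu⟩ := h.exists_mem_lamImage hα hβ hu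
    cases κ
    · exact absurd hκ h1
    · exact absurd hκ h2
    · exact Or.inl (h.eq_of_types hα hβ hu hw tu tw)
    · exact Or.inr (h.eq_of_types hα hβ hu hv tu tv)
  · rintro u (rfl | rfl)
    exacts [hw, hv]

theorem indexSet_eq {τ : ℝ[X]} (hT : T = Trg τ α β) (ι : QRType) :
    indexSet ι τ α β = (fun k : ℤ => (k : ℝ)) '' J ι := by
  subst hT
  ext k
  constructor
  · rintro ⟨lam, w, φ, hφ, ht, rfl⟩
    obtain ⟨κ, n, hn, -, ha⟩ := h.classify ((exists_qr_iff _ _ _).1 ⟨φ, hφ⟩)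
    obtain rfl := hasType_unique (ha.hasType hα hβ) ht
    exact ⟨n, hn, by rw [resInfinity_eq ha.inf, add_sub_cancel_right]⟩
  · rintro ⟨n, hn, rfl⟩
    obtain ⟨w, hw, ha⟩ := h.exist ι n hn
    obtain ⟨φ, hφ⟩ := (exists_qr_iff _ _ _).2 hw
    exact ⟨_, w, φ, hφ, ha.hasType hα hβ, by rw [resInfinity_eq ha.inf, add_sub_cancel_right]⟩

end Spectrum

/-! ### Spectral diagrams -/

theorem shift_union (I J : Set ℤ) (s : ℤ) : shift (I ∪ J) s = shift I s ∪ shift J s :=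
  image_union _ _ _

theorem disjoint_shift {I J : Set ℤ} (h : Disjoint I J) (s : ℤ) :
    Disjoint (shift I s) (shift J s) :=
  (disjoint_image_iff (add_left_injective s)).2 h

section

variable {K1 K3 K4 : Finset ℕ} {a b α β : ℝ}

theorem shift_rawIdx_classG (hG : ClassG a b) :
    (fun ι => shift (rawIdx K1 K3 K4 a b ι) (idxShift K1 K3 K4 ι)) = indexG K1 K3 K4 := by
  funext ι
  rw [rawIdx_classG hG]
  cases ι <;> rfl

theorem shift_rawIdx_classB (hB : ParamsB K3 K4 a b) :
    (fun ι => shift (rawIdx K1 K3 K4 a b ι) (idxShift K1 K3 K4 ι)) = indexB K1 K3 K4 a b := by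
  have hab : ClassG a b ∨ ParamsB K3 K4 a b := Or.inr hB
  funext ι
  cases ι
  · rw [rawIdx_one hab]; rfl
  · rw [rawIdx_two hab]; rfl
  · rw [rawIdx_three_classB hB, shift_union]; rfl
  · rw [rawIdx_four_classB hB, shift_union]; rfl

variable (hα : α = a + K1.card - K3.card + K4.card)
  (hβ : β = b + K1.card + K3.card - K4.card)
include hα hβ

theorem lamImage_shift (ι : QRType) (I : Set ℤ) : lamImage ι (shift I (idxShift K1 K3 K4 ι)) α β =
    (fun x => x - K1.card * (K1.card + a + b + 1)) '' lamImage ι I a b := by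
  rw [lamImage, lamImage, shift, image_image, image_image]
  refine image_congr fun n _ => ?_
  push_cast
  exact lamFn_shift hα hβ ι n

theorem sigmaQ_shift : sigmaQ α β =
    (fun x => x - K1.card * (K1.card + a + b + 1)) '' sigmaQ a b := by
  have hu : ∀ s, shift univ s = univ := fun s =>
    image_univ_of_surjective (add_right_surjective s)
  rw [sigmaQ_eq, sigmaQ_eq, image_union, ← lamImage_shift hα hβ, ← lamImage_shift hα hβ, hu, hu]

theorem disjoint_lamImage_shift {ι κ : QRType} {I J : Set ℤ}
    (h : Disjoint (lamImage ι I a b) (lamImage κ J a b)) :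
    Disjoint (lamImage ι (shift I (idxShift K1 K3 K4 ι)) α β)
      (lamImage κ (shift J (idxShift K1 K3 K4 κ)) α β) := by
  rw [lamImage_shift hα hβ, lamImage_shift hα hβ]
  exact (disjoint_image_iff sub_left_injective).2 h

omit hβ in
theorem not_isInt_left (ha : ¬ IsInt a) : ¬ IsInt α := by
  have := not_isInt_add_intCast ha (K1.card - K3.card + K4.card)
  subst hα; push_cast at this; convert! this using 2; ring

omit hα in
theorem not_isInt_right (hb : ¬ IsInt b) : ¬ IsInt β := by
  have := not_isInt_add_intCast hb (K1.card + K3.card - K4.card)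
  subst hβ; push_cast at this; convert! this using 2; ring

theorem not_isInt_sum (hs : ¬ IsInt (a + b)) : ¬ IsInt (α + β) := by
  have := not_isInt_add_intCast hs (2 * K1.card)
  subst hα hβ; push_cast at this; convert! this using 2; ring

theorem isInt_diff_iff : IsInt (α - β) ↔ IsInt (a - b) := by
  subst hα hβ
  constructor
  · rintro ⟨m, hm⟩
    exact ⟨m + 2 * K3.card - 2 * K4.card, by push_cast; linarith⟩
  · rintro ⟨m, hm⟩
    exact ⟨m - 2 * K3.card + 2 * K4.card, by push_cast; linarith⟩

section ClassG

variable (hG : ClassG a b)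
include hG

theorem classG_shift : ClassG α β :=
  ⟨not_isInt_left hα hG.1, not_isInt_right hβ hG.2.1, not_isInt_sum hα hβ hG.2.2.1,
    (isInt_diff_iff hα hβ).not.2 hG.2.2.2⟩

theorem pairwise_disjoint_classG :
    Pairwise fun ι κ : QRType => Disjoint (lamImage ι (indexG K1 K3 K4 ι) α β)
      (lamImage κ (indexG K1 K3 K4 κ) α β) := by
  have e : ∀ ι, indexG K1 K3 K4 ι = shift (rawIdx K1 K3 K4 a b ι) (idxShift K1 K3 K4 ι) :=
    fun ι => (congrFun (shift_rawIdx_classG hG) ι).symm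
  intro ι κ hne
  simp only [e]
  refine disjoint_lamImage_shift hα hβ ?_
  rw [rawIdx_classG hG, rawIdx_classG hG]
  have d12 := disjoint_one_two (K1 := K1) hG.2.2.1
  have d34 := disjoint_three_four_classG (K3 := K3) (K4 := K4) hG
  have d := disjoint_of_ne hG.1 hG.2.1
  cases ι <;> cases κ <;> first | exact absurd rfl hne | skip
  exacts [d12, (d _ _).1, (d _ _).2.1, d12.symm, (d _ _).2.2.1, (d _ _).2.2.2, (d _ _).1.symm,
    (d _ _).2.2.1.symm, d34, (d _ _).2.1.symm, (d _ _).2.2.2.symm, d34.symm]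

theorem sigmaQ_classG : sigmaQ α β = ⋃ ι : QRType, lamImage ι (indexG K1 K3 K4 ι) α β := by
  have e : ∀ ι, indexG K1 K3 K4 ι = shift (rawIdx K1 K3 K4 a b ι) (idxShift K1 K3 K4 ι) :=
    fun ι => (congrFun (shift_rawIdx_classG hG) ι).symm
  simp only [e, lamImage_shift hα hβ]
  rw [sigmaQ_shift hα hβ, ← image_iUnion]
  congr 1
  rw [sigmaQ_eq, lamImage_one_two (K1 := K1) hG.2.2.1,
    lamImage_three_four_classG (K3 := K3) (K4 := K4)]
  ext x
  rw [mem_iUnion]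
  constructor
  · rintro ((h | h) | (h | h))
    exacts [⟨.one, by rwa [rawIdx_classG hG]⟩, ⟨.two, by rwa [rawIdx_classG hG]⟩,
      ⟨.three, by rwa [rawIdx_classG hG]⟩, ⟨.four, by rwa [rawIdx_classG hG]⟩]
  · rintro ⟨ι, h⟩
    rw [rawIdx_classG hG] at h
    cases ι
    exacts [Or.inl (Or.inl h), Or.inl (Or.inr h), Or.inr (Or.inl h), Or.inr (Or.inr h)]

theorem spectralDiagram_classG {T : DiffOp} (h : Spectrum T α β (indexG K1 K3 K4)) :
    spectralDiagram T = diagramG K1 K3 K4 α β := by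
  have hc := classG_shift hα hβ hG
  have hd := pairwise_disjoint_classG hα hβ hG
  have key : ∀ ι lam l, lam ∈ lamImage ι (indexG K1 K3 K4 ι) α β →
      (HasLabel T lam l ↔ l = ι.label) := fun ι lam l hl =>
    h.hasLabel_of_single hc.1 hc.2.1 hl fun κ hne hκ => disjoint_left.1 (hd hne) hκ hl
  have e : ∀ lam l, (lam, l) ∈ diagramG K1 K3 K4 α β ↔
      ∃ ι : QRType, lam ∈ lamImage ι (indexG K1 K3 K4 ι) α β ∧ l = ι.label := by
    intro lam l
    constructor
    · rintro (((⟨h1, h2⟩ | ⟨h1, h2⟩) | ⟨h1, h2⟩) | ⟨h1, h2⟩)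
      exacts [⟨.one, h1, h2⟩, ⟨.two, h1, h2⟩, ⟨.three, h1, h2⟩, ⟨.four, h1, h2⟩]
    · rintro ⟨ι, h1, h2⟩
      cases ι
      exacts [Or.inl (Or.inl (Or.inl ⟨h1, h2⟩)), Or.inl (Or.inl (Or.inr ⟨h1, h2⟩)),
        Or.inl (Or.inr ⟨h1, h2⟩), Or.inr ⟨h1, h2⟩]
  ext ⟨lam, l⟩
  rw [e]
  constructor
  · rintro ⟨h1, h2⟩
    rw [h.qrSpectrum_eq, mem_iUnion] at h1
    obtain ⟨ι, hι⟩ := h1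
    exact ⟨ι, hι, (key ι lam l hι).1 h2⟩
  · rintro ⟨ι, hι, hl⟩
    exact ⟨by rw [h.qrSpectrum_eq]; exact mem_iUnion.2 ⟨ι, hι⟩, (key ι lam l hι).2 hl⟩

end ClassG

section ClassB

variable (hB : ParamsB K3 K4 a b)
include hB

theorem classB_shift : ClassB α β :=
  ⟨not_isInt_left hα hB.1.1, not_isInt_right hβ hB.1.2.1, not_isInt_sum hα hβ hB.1.2.2.1,
    (isInt_diff_iff hα hβ).2 hB.1.2.2.2⟩

theorem lamImage_plus_shift : lamImage .three (indexB3plus K3 K4 a b) α β =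
    lamImage .four (indexB4plus K3 K4 a b) α β := by
  have h3 := lamImage_shift hα hβ .three
    (classicalPlus a b \ {n | (n : ℝ) - a ∈ K34 K3 K4 a b})
  have h4 := lamImage_shift hα hβ .four
    (classicalPlus b a \ {n | (n : ℝ) - b ∈ K34 K3 K4 a b})
  rw [← lamImage_plus_classB hB, ← h3] at h4
  exact h4.symm

theorem pairwise_disjoint_classB : List.Pairwise Disjoint
    [lamImage .one (indexB K1 K3 K4 a b .one) α β,
      lamImage .two (indexB K1 K3 K4 a b .two) α β,
      lamImage .three (indexB3minus K3 K4 a b) α β,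
      lamImage .four (indexB4minus K3 K4 a b) α β,
      lamImage .three (indexB3plus K3 K4 a b) α β] := by
  have hc := classB_shift hα hβ hB
  have d := disjoint_of_ne hc.1 hc.2.1
  have d12 := disjoint_lamImage_shift hα hβ (disjoint_one_two (K1 := K1) hB.1.2.2.1)
  have d1 := disjoint_lamImage_shift hα hβ (disjoint_minus_classB hB)
  have d2 := disjoint_lamImage_shift hα hβ (disjoint_minus3_plus_classB hB)
  have d3 := disjoint_lamImage_shift hα hβ (disjoint_minus4_plus_classB hB)
  simp only [List.pairwise_cons, List.mem_cons, List.not_mem_nil, or_false, forall_eq_or_imp,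
    forall_eq, List.Pairwise.nil, and_true, IsEmpty.forall_iff, implies_true]
  exact ⟨⟨d12, (d _ _).1, (d _ _).2.1, (d _ _).1⟩, ⟨(d _ _).2.2.1, (d _ _).2.2.2, (d _ _).2.2.1⟩,
    ⟨d1, d2⟩, d3⟩

theorem sigmaQ_classB : sigmaQ α β = lamImage .one (indexB K1 K3 K4 a b .one) α β ∪
    lamImage .two (indexB K1 K3 K4 a b .two) α β ∪
    lamImage .three (indexB3minus K3 K4 a b) α β ∪
    lamImage .four (indexB4minus K3 K4 a b) α β ∪
    lamImage .three (indexB3plus K3 K4 a b) α β := by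
  have h1 := lamImage_shift hα hβ .one (natZ \ castZ K1)
  have h2 := lamImage_shift hα hβ .two (natZ ∪ bar K1)
  have h3 := lamImage_shift hα hβ .three (classicalMinus a b ∪ bar K4)
  have h4 := lamImage_shift hα hβ .four (classicalMinus b a ∪ bar K3)
  have h5 := lamImage_shift hα hβ .three
    (classicalPlus a b \ {n | (n : ℝ) - a ∈ K34 K3 K4 a b})
  change lamImage .one (indexB K1 K3 K4 a b .one) α β = _ at h1
  change lamImage .two (indexB K1 K3 K4 a b .two) α β = _ at h2
  change lamImage .three (indexB3minus K3 K4 a b) α β = _ at h3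
  change lamImage .four (indexB4minus K3 K4 a b) α β = _ at h4
  change lamImage .three (indexB3plus K3 K4 a b) α β = _ at h5
  rw [h1, h2, h3, h4, h5, sigmaQ_shift hα hβ, sigmaQ_eq, lamImage_one_two (K1 := K1) hB.1.2.2.1,
    lamImage_three_four_classB hB]
  simp only [image_union, union_assoc]

omit hα hβ in
theorem disjoint_indexB3 : Disjoint (indexB3minus K3 K4 a b) (indexB3plus K3 K4 a b) := by
  obtain ⟨d, hd⟩ := hB.exists_data
  refine disjoint_shift (disjoint_left.2 fun n hn hp => ?_) _
  have hp := hd.mem_plus3.1 hp.1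
  rcases hn with hn | hn
  · have := hd.mem_minus3.1 hn; omega
  · have := nonneg_of_mem_castZ (mem_bar.1 hn); omega

omit hα hβ in
theorem disjoint_indexB4 : Disjoint (indexB4minus K3 K4 a b) (indexB4plus K3 K4 a b) := by
  obtain ⟨d, hd⟩ := hB.exists_data
  refine disjoint_shift (disjoint_left.2 fun n hn hp => ?_) _
  have hp := hd.mem_plus4.1 hp.1
  rcases hn with hn | hn
  · have := hd.mem_minus4.1 hn; omega
  · have := nonneg_of_mem_castZ (mem_bar.1 hn); omega

theorem iUnion_classB : ⋃ ι, lamImage ι (indexB K1 K3 K4 a b ι) α β = sigmaQ α β := by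
  rw [sigmaQ_classB hα hβ hB]
  have h34 := lamImage_plus_shift hα hβ hB
  ext x
  rw [mem_iUnion]
  constructor
  · rintro ⟨ι, h⟩
    cases ι
    · exact Or.inl (Or.inl (Or.inl (Or.inl h)))
    · exact Or.inl (Or.inl (Or.inl (Or.inr h)))
    · rw [indexB, lamImage_union] at h
      exact h.elim (fun h => Or.inl (Or.inl (Or.inr h))) Or.inr
    · rw [indexB, lamImage_union, ← h34] at h
      exact h.elim (fun h => Or.inl (Or.inr h)) Or.inr
  · rintro ((((h | h) | h) | h) | h)
    · exact ⟨.one, h⟩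
    · exact ⟨.two, h⟩
    · exact ⟨.three, by rw [indexB, lamImage_union]; exact Or.inl h⟩
    · exact ⟨.four, by rw [indexB, lamImage_union]; exact Or.inl h⟩
    · exact ⟨.three, by rw [indexB, lamImage_union]; exact Or.inr h⟩

theorem spectralDiagram_classB {T : DiffOp} (h : Spectrum T α β (indexB K1 K3 K4 a b)) :
    spectralDiagram T = diagramB K1 K3 K4 a b α β := by
  have hc := classB_shift hα hβ hB
  have hd := pairwise_disjoint_classB hα hβ hB
  have h34 := lamImage_plus_shift hα hβ hB
  have hq := h.qrSpectrum_eq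
  rw [iUnion_classB hα hβ hB, sigmaQ_classB hα hβ hB] at hq
  simp only [List.pairwise_cons, List.mem_cons, List.not_mem_nil, or_false, forall_eq_or_imp,
    forall_eq, List.Pairwise.nil, and_true, IsEmpty.forall_iff, implies_true] at hd
  obtain ⟨⟨d12, d13, d14, d15⟩, ⟨d23, d24, d25⟩, ⟨d34, d35⟩, d45⟩ := hd
  have u3 : lamImage .three (indexB K1 K3 K4 a b .three) α β =
      lamImage .three (indexB3minus K3 K4 a b) α β ∪ lamImage .three (indexB3plus K3 K4 a b) α β :=
    lamImage_union _ _ _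
  have u4 : lamImage .four (indexB K1 K3 K4 a b .four) α β =
      lamImage .four (indexB4minus K3 K4 a b) α β ∪ lamImage .three (indexB3plus K3 K4 a b) α β := by
    rw [h34]; exact lamImage_union _ _ _
  rw [disjoint_left] at d12 d13 d14 d15 d23 d24 d25 d34 d35 d45
  have k1 : ∀ {lam l}, lam ∈ lamImage .one (indexB K1 K3 K4 a b .one) α β →
      (HasLabel T lam l ↔ l = .circ) := fun {lam l} hl => by
    refine h.hasLabel_of_single hc.1 hc.2.1 (ι := .one) hl fun κ hne hκ => ?_
    cases κ
    · exact hne rfl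
    · exact d12 hl hκ
    · rw [u3] at hκ; exact hκ.elim (d13 hl) (d15 hl)
    · rw [u4] at hκ; exact hκ.elim (d14 hl) (d15 hl)
  have k2 : ∀ {lam l}, lam ∈ lamImage .two (indexB K1 K3 K4 a b .two) α β →
      (HasLabel T lam l ↔ l = .times) := fun {lam l} hl => by
    refine h.hasLabel_of_single hc.1 hc.2.1 (ι := .two) hl fun κ hne hκ => ?_
    cases κ
    · exact d12 hκ hl
    · exact hne rfl
    · rw [u3] at hκ; exact hκ.elim (d23 hl) (d25 hl)
    · rw [u4] at hκ; exact hκ.elim (d24 hl) (d25 hl)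
  have k3 : ∀ {lam l}, lam ∈ lamImage .three (indexB3minus K3 K4 a b) α β →
      (HasLabel T lam l ↔ l = .plus) := fun {lam l} hl => by
    refine h.hasLabel_of_single hc.1 hc.2.1 (ι := .three) (u3 ▸ Or.inl hl) fun κ hne hκ => ?_
    cases κ
    · exact d13 hκ hl
    · exact d23 hκ hl
    · exact hne rfl
    · rw [u4] at hκ; exact hκ.elim (d34 hl) (d35 hl)
  have k4 : ∀ {lam l}, lam ∈ lamImage .four (indexB4minus K3 K4 a b) α β →
      (HasLabel T lam l ↔ l = .minus) := fun {lam l} hl => by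
    refine h.hasLabel_of_single hc.1 hc.2.1 (ι := .four) (u4 ▸ Or.inl hl) fun κ hne hκ => ?_
    cases κ
    · exact d14 hκ hl
    · exact d24 hκ hl
    · rw [u3] at hκ; exact hκ.elim (fun h' => d34 h' hl) (d45 hl)
    · exact hne rfl
  have k5 : ∀ {lam l}, lam ∈ lamImage .three (indexB3plus K3 K4 a b) α β →
      (HasLabel T lam l ↔ l = .divide) := fun {lam l} hl =>
    h.hasLabel_of_three_four hc.1 hc.2.1 (u3 ▸ Or.inr hl) (u4 ▸ Or.inr hl)
      (fun h1 => d15 h1 hl) (fun h2 => d25 h2 hl)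
  ext ⟨lam, l⟩
  constructor
  · rintro ⟨h1, h2⟩
    simp only at h1 h2
    rw [hq] at h1
    rcases h1 with (((h1 | h1) | h1) | h1) | h1
    · exact Or.inl (Or.inl (Or.inl (Or.inl ⟨h1, (k1 h1).1 h2⟩)))
    · exact Or.inl (Or.inl (Or.inl (Or.inr ⟨h1, (k2 h1).1 h2⟩)))
    · exact Or.inl (Or.inr ⟨h1, (k3 h1).1 h2⟩)
    · exact Or.inr ⟨h1, (k4 h1).1 h2⟩
    · exact Or.inl (Or.inl (Or.inr ⟨h1, (k5 h1).1 h2⟩))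
  · rintro ((((⟨h1, h2⟩ | ⟨h1, h2⟩) | ⟨h1, h2⟩) | ⟨h1, h2⟩) | ⟨h1, h2⟩) <;> simp only at h1 h2
    · exact ⟨hq ▸ Or.inl (Or.inl (Or.inl (Or.inl h1))), (k1 h1).2 h2⟩
    · exact ⟨hq ▸ Or.inl (Or.inl (Or.inl (Or.inr h1))), (k2 h1).2 h2⟩
    · exact ⟨hq ▸ Or.inr h1, (k5 h1).2 h2⟩
    · exact ⟨hq ▸ Or.inl (Or.inl (Or.inr h1)), (k3 h1).2 h2⟩
    · exact ⟨hq ▸ Or.inl (Or.inr h1), (k4 h1).2 h2⟩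

end ClassB

end

/-! ### Quasi-polynomial eigenfunctions -/

theorem app_of_logDeriv {T : DiffOp} {lam : ℝ} {f : RatFunc ℝ} (hf : f ≠ 0) :
    T.app f = RatFunc.C lam * f ↔ ratDeriv f / f ∈ ricSet T lam := by
  have h1 : ratDeriv (ratDeriv f / f) + (ratDeriv f / f) ^ 2 = ratDeriv (ratDeriv f) / f := by
    rw [ratDeriv_div _ _ hf]; field_simp; ring
  change T.p * ratDeriv (ratDeriv f) + T.q * ratDeriv f + T.r * f = _ ↔
    T.p * (ratDeriv (ratDeriv f / f) + (ratDeriv f / f) ^ 2) + T.q * (ratDeriv f / f) + T.r = _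
  rw [h1, ← mul_left_inj' hf]
  have h2 : (T.p * (ratDeriv (ratDeriv f) / f) + T.q * (ratDeriv f / f) + T.r) * f =
      T.p * ratDeriv (ratDeriv f) + T.q * ratDeriv f + T.r * f := by field_simp
  rw [mul_left_inj' hf, ← h2, mul_left_inj' hf]

/-- A nonzero rational function has neither zero nor pole at a point exactly when its log-derivative
is regular there. So quasi-polynomial eigenfunctions are the rational ones of type 1. -/
theorem isQuasiPolyEigenfunction_iff {T : DiffOp} {lam : ℝ} {π : RatFunc ℝ} :
    IsQuasiPolyEigenfunction T lam π ↔
      π ≠ 0 ∧ ratDeriv π / π ∈ ricSet T lam ∧ HasType .one (ratDeriv π / π) := by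
  constructor
  · rintro ⟨h1, h2, h3, h4, h5⟩
    have h0 : π ≠ 0 := by rintro rfl; simp at h2
    have hr : ∀ c, π.num.eval c ≠ 0 → RegularAt π c → RegularAt (ratDeriv π / π) c := by
      intro c hc hr
      have hv : rval π c ≠ 0 := by rw [rval_eq]; exact div_ne_zero hc hr
      exact ((isPlace_valAt c).div hr.ratDeriv.valAt hr.valAt hv).1
    exact ⟨h0, (app_of_logDeriv h0).1 h1, hr _ h3 h5, hr _ h2 h4⟩
  · rintro ⟨h0, h1, h2, h3⟩
    have hr : ∀ c, RegularAt (ratDeriv π / π) c → π.num.eval c ≠ 0 ∧ RegularAt π c := by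
      intro c hc
      obtain ⟨v, hv, h⟩ := exists_valAt_of_logDeriv h0 (valAt_zero_of_regularAt hc)
      refine ⟨fun h' => hv ?_, h.1⟩
      rw [← h.2, rval_eq, h', zero_div]
    exact ⟨(app_of_logDeriv h0).2 h1, (hr _ h3).1, (hr _ h2).1, (hr _ h3).2, (hr _ h2).2⟩

/-- `f - f(x)` vanishes at a regular point `x`; if it were not identically zero, its vanishing
log-derivative would make it nonzero at `x`. -/
theorem eq_C_of_ratDeriv_eq_zero {f : RatFunc ℝ} (h : ratDeriv f = 0) : ∃ c, f = RatFunc.C c := by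
  obtain ⟨c, d, hcd, hr⟩ := exists_interval (finite_not_regularAt f)
  obtain ⟨x, hx⟩ := exists_between hcd
  have hx : RegularAt f x := not_not.1 (hr x hx)
  refine ⟨rval f x, sub_eq_zero.1 (by_contra fun hne => ?_)⟩
  have P := isPlace_valAt x
  have h0 : ratDeriv (f - RatFunc.C (rval f x)) = 0 := by rw [ratDeriv_sub, h, ratDeriv_C, sub_zero]
  obtain ⟨v, hv, hv'⟩ := exists_valAt_of_logDeriv (c := x) hne
    (by rw [h0, zero_div, mul_zero]; exact P.zero)
  have := P.sub hx.valAt (P.const (rval f x))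
  rw [sub_self] at this
  exact hv (P.unique hv' this)

theorem eq_C_mul_of_logDeriv_eq {f g : RatFunc ℝ} (hf : f ≠ 0) (hg : g ≠ 0)
    (h : ratDeriv f / f = ratDeriv g / g) : ∃ c : ℝ, c ≠ 0 ∧ f = RatFunc.C c * g := by
  rw [div_eq_div_iff hf hg] at h
  obtain ⟨c, hc⟩ := eq_C_of_ratDeriv_eq_zero (f := f / g)
    (by rw [ratDeriv_div _ _ hg, h, mul_comm f, sub_self, zero_div])
  refine ⟨c, ?_, (div_eq_iff hg).1 hc⟩
  rintro rfl
  rw [map_zero] at hc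
  exact div_ne_zero hf hg hc

theorem X_sub_one_logDeriv : ratDeriv (RatFunc.X - 1) / (RatFunc.X - 1) = gam 1 0 := by
  rw [ratDeriv_sub, gam, ratDeriv_X, ratDeriv_one]; simp

/-- The logarithmic derivative of `(x-1)^m (1+x)^n`. -/
theorem logDeriv_sub_add (m n : ℕ) :
    ratDeriv ((RatFunc.X - 1) ^ m * (1 + RatFunc.X) ^ n) /
      ((RatFunc.X - 1) ^ m * (1 + RatFunc.X) ^ n) = gam m n := by
  have h1 := X_sub_one_ne_zero
  have h2 := one_add_X_ne_zero
  rw [logDeriv_mul (pow_ne_zero _ h1) (pow_ne_zero _ h2), logDeriv_pow h1, logDeriv_pow h2,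
    X_sub_one_logDeriv, one_add_logDeriv, natCast_mul_gam, natCast_mul_gam, ← gam_add]
  simp

theorem valInf_sub_add (m n : ℕ) : ValInf 1 ((RatFunc.X - 1) ^ m * (1 + RatFunc.X) ^ n *
    RatFunc.X ^ (-((m : ℤ) + n))) := by
  have P := isPlace_valInf
  have h1 := P.inv (X_div_valInf 1) one_ne_zero
  have h2 := P.inv (X_div_valInf (-1)) one_ne_zero
  have h := P.mul (P.pow h1 m) (P.pow h2 n)
  rw [inv_one, one_pow, one_pow, one_mul] at h
  convert! h using 1
  rw [inv_div, inv_div, C_neg_one, sub_neg_eq_add, map_one, div_pow, div_pow, neg_add,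
    zpow_add₀ RatFunc.X_ne_zero, zpow_neg, zpow_neg, zpow_natCast, zpow_natCast, add_comm 1]
  ring

theorem DiffOp.gauge_app (T : DiffOp) {f : RatFunc ℝ} (hf : f ≠ 0) (y : RatFunc ℝ) :
    T.app (f * y) = f * (T.gauge f).app y := by
  simp only [DiffOp.app, DiffOp.gauge, ratDeriv_mul, ratDeriv_add]
  field_simp
  ring

theorem jacobiMonic_spec (n : ℕ) {a b : ℝ} (ha : ¬ IsInt a) (hs : ¬ IsInt (a + b)) :
    IsEig a b (n * (n + a + b + 1)) (jacobiMonic n a b) ∧ (jacobiMonic n a b).Monic ∧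
      (jacobiMonic n a b).natDegree = n := by
  have hg : (ascPochhammer ℝ n).eval ((n : ℝ) + (a + b) + 1) ≠ 0 := good_of_not_isInt n hs
  have hc := jacobiP_coeff n a b
  rw [← add_assoc] at hg hc
  have h2 : (2 : ℝ) ^ n * n.factorial ≠ 0 := by positivity
  have hd := (jacobiP_natDegree_iff n b ha).2 (good_of_not_isInt n hs)
  refine ⟨(jacobiP_isEig n a b).C_mul _, ?_, ?_⟩
  · rw [Monic, jacobiMonic, leadingCoeff_mul, leadingCoeff_C, leadingCoeff, hd,
      div_mul_eq_mul_div, hc, div_self hg]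
  · rw [jacobiMonic, natDegree_C_mul (div_ne_zero h2 hg), hd]

section

variable {K1 K3 K4 : Finset ℕ} {a b α β : ℝ}

/-- The monic quasi-polynomial eigenfunctions. -/
def piRat (K1 K3 K4 : Finset ℕ) (a b : ℝ) (i : ℤ) : RatFunc ℝ :=
  RatFunc.C (∏ k ∈ Ktilde K1 K3 K4 a b, ((i : ℝ) + K1.card - k))⁻¹ *
    ((RatFunc.X - 1) ^ K3.card * (1 + RatFunc.X) ^ K4.card) *
    (trans ((seedList K1 K3 K4 a b).map Seed.y)
      ⟨0, toRat (jacobiMonic (i + K1.card).toNat a b)⟩).f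

/-- The classical eigenfunction of index `n`. -/
def monicSeed (n : ℕ) (a b : ℝ) : Seed := classSeed .one (jacobiMonic n a b) n a b

theorem monicSeed_y (n : ℕ) (a b : ℝ) : (monicSeed n a b).y = ⟨0, toRat (jacobiMonic n a b)⟩ := by
  simp [monicSeed, classSeed, ex1, exm, QRType.sing1, QRType.singm, gam_zero]

variable (hab : ClassG a b ∨ ParamsB K3 K4 a b)
include hab

theorem monicSeed_isEigen (n : ℕ) :
    IsEigen (classOp a b) (classExpo a b) (monicSeed n a b) := by
  obtain ⟨h1, h2, h3⟩ := jacobiMonic_spec n (params_left hab) (params_sum hab)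
  refine classSeed_isEigen (params_left hab) (params_right hab) ?_ h2.ne_zero h3
  simpa [par1, parm, ex1, exm, QRType.sing1, QRType.singm] using h1

theorem monicSeed_lam_ne {n : ℕ} (hn : n ∉ K1) :
    ∀ s ∈ seedList K1 K3 K4 a b, (monicSeed n a b).lam ≠ s.lam := by
  intro s hs
  obtain ⟨z, hz, rfl⟩ := List.mem_map.1 hs
  have h : (n : ℤ) ∈ rawIdx K1 K3 K4 a b .one := by
    rw [rawIdx_one hab]
    exact ⟨Int.natCast_nonneg n, fun h => hn (natCast_mem_castZ.1 h)⟩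
  rcases h with h | h
  · exact_mod_cast h.2.2 z hz
  · simp [QRType.dual, seedSet, bar] at h

/-- The parameter conditions make the union defining `Ktilde` disjoint, and its elements are the
degrees of the seeds. Products over it become products along the seed list. -/
theorem prod_Ktilde {M : Type*} [CommMonoid M] (f : ℝ → M) :
    ∏ k ∈ Ktilde K1 K3 K4 a b, f k =
      ((seedIdx K1 K3 K4).map fun z => f (z.2 + degMu z.1 a b)).prod := by
  have ha := params_left hab
  have hb := params_right hab
  have inj : ∀ c : ℝ, Function.Injective fun k : ℕ => (k : ℝ) - c := fun c k l h => by
    simpa using h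
  rw [prod_seedIdx, Ktilde, Finset.prod_union, Finset.prod_union, Finset.prod_image,
    Finset.prod_image, Finset.prod_image]
  · simp only [degMu, add_zero, ← sub_eq_add_neg]
  · exact (inj b).injOn
  · exact (inj a).injOn
  · exact Nat.cast_injective.injOn
  · rw [Finset.disjoint_left]
    intro x h1 h3
    obtain ⟨k, -, rfl⟩ := Finset.mem_image.1 h1
    obtain ⟨l, -, h⟩ := Finset.mem_image.1 h3
    exact ha (isInt_of_eq (l - k) (by push_cast; linarith))
  · rw [Finset.disjoint_left]
    intro x h1 h4
    obtain ⟨l, hl, rfl⟩ := Finset.mem_image.1 h4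
    rcases Finset.mem_union.1 h1 with h1 | h1
    · obtain ⟨k, -, h⟩ := Finset.mem_image.1 h1
      exact hb (isInt_of_eq (l - k) (by push_cast; linarith))
    · obtain ⟨k, hk, h⟩ := Finset.mem_image.1 h1
      exact params_disjoint hab hk hl h

/-- A vanishing factor would be a coincidence of degrees with a seed, hence of eigenvalues. -/
theorem prod_Ktilde_ne_zero {n : ℕ} (hn : n ∉ K1) :
    ∏ k ∈ Ktilde K1 K3 K4 a b, ((n : ℝ) - k) ≠ 0 := by
  rw [prod_Ktilde hab (fun k => (n : ℝ) - k)]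
  refine List.prod_ne_zero fun h0 => ?_
  obtain ⟨z, hz, h⟩ := List.mem_map.1 h0
  refine monicSeed_lam_ne hab hn _ (List.mem_map_of_mem hz) ?_
  change lamFn .one n a b = lamFn z.1 z.2 a b
  rw [lamFn_eq_one z.1, sub_eq_zero.1 h]

omit hab in
theorem mem_indexG_one {i : ℤ} : i ∈ indexG K1 K3 K4 .one ↔
    ∃ n : ℕ, n ∉ K1 ∧ i = n - K1.card := by
  constructor
  · rintro ⟨m, ⟨h0, h1⟩, rfl⟩
    lift m to ℕ using h0
    exact ⟨m, fun h => h1 (natCast_mem_castZ.2 h), rfl⟩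
  · rintro ⟨n, hn, rfl⟩
    exact ⟨n, ⟨Int.natCast_nonneg n, fun h => hn (natCast_mem_castZ.1 h)⟩, rfl⟩

omit hab in
theorem piRat_eq (n : ℕ) : piRat K1 K3 K4 a b (n - K1.card) =
    RatFunc.C (∏ k ∈ Ktilde K1 K3 K4 a b, ((n : ℝ) - k))⁻¹ *
      ((RatFunc.X - 1) ^ K3.card * (1 + RatFunc.X) ^ K4.card) *
      (trans ((seedList K1 K3 K4 a b).map Seed.y) (monicSeed n a b).y).f := by
  rw [monicSeed_y, piRat, sub_add_cancel, Int.toNat_natCast]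
  push_cast
  simp only [sub_add_cancel]

theorem piRat_ne_zero {n : ℕ} (hn : n ∉ K1) : piRat K1 K3 K4 a b (n - K1.card) ≠ 0 := by
  obtain ⟨h0, -⟩ := trans_spec _ (jacOp_classOp (params_left hab) (params_right hab))
    (isChain_seedList hab) (monicSeed_lam_ne (K1 := K1) hab hn) (monicSeed_isEigen hab n)
  rw [piRat_eq]
  exact mul_ne_zero (mul_ne_zero (C_ne_zero (inv_ne_zero (prod_Ktilde_ne_zero hab hn)))
    (mul_ne_zero (pow_ne_zero _ X_sub_one_ne_zero) (pow_ne_zero _ one_add_X_ne_zero))) h0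

theorem piRat_logDeriv {n : ℕ} (hn : n ∉ K1) :
    ratDeriv (piRat K1 K3 K4 a b (n - K1.card)) / piRat K1 K3 K4 a b (n - K1.card) =
      (trans ((seedList K1 K3 K4 a b).map Seed.y) (monicSeed n a b).y).lg +
        gam K3.card K4.card := by
  obtain ⟨h0, -⟩ := trans_spec _ (jacOp_classOp (params_left hab) (params_right hab))
    (isChain_seedList hab) (monicSeed_lam_ne (K1 := K1) hab hn) (monicSeed_isEigen hab n)
  have h1 : (RatFunc.X - 1) ^ K3.card * (1 + RatFunc.X) ^ K4.card ≠ (0 : RatFunc ℝ) :=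
    mul_ne_zero (pow_ne_zero _ X_sub_one_ne_zero) (pow_ne_zero _ one_add_X_ne_zero)
  have hc := C_ne_zero (inv_ne_zero (prod_Ktilde_ne_zero (K1 := K1) hab hn))
  have hω : (trans ((seedList K1 K3 K4 a b).map Seed.y) (monicSeed n a b).y).ω = 0 := by
    rw [trans_ω, monicSeed_y]
  rw [piRat_eq, logDeriv_mul (mul_ne_zero hc h1) h0, logDeriv_mul hc h1, logDeriv_sub_add,
    ratDeriv_C, zero_div, zero_add, QF.lg, hω, zero_add, add_comm]

variable (hα : α = a + K1.card - K3.card + K4.card)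
  (hβ : β = b + K1.card + K3.card - K4.card) {τ : ℝ[X]} (hτ : toRat τ = tauRat K1 K3 K4 a b)
include hα hβ hτ

theorem piRat_mem_ricSet {n : ℕ} (hn : n ∉ K1) :
    ratDeriv (piRat K1 K3 K4 a b (n - K1.card)) / piRat K1 K3 K4 a b (n - K1.card) ∈
        ricSet (Trg τ α β) (lamFn .one ((n - K1.card : ℤ) : ℝ) α β) ∧
      HasType .one
        (ratDeriv (piRat K1 K3 K4 a b (n - K1.card)) / piRat K1 K3 K4 a b (n - K1.card)) := by
  obtain ⟨-, h1, h2, -⟩ := trans_spec _ (jacOp_classOp (params_left hab) (params_right hab))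
    (isChain_seedList hab) (monicSeed_lam_ne (K1 := K1) hab hn) (monicSeed_isEigen hab n)
  rw [piRat_logDeriv hab hn]
  refine ⟨?_, ((asym_Trg_iff hα hβ _ _ _).2 h2).hasType (not_isInt_left hα (params_left hab))
    (not_isInt_right hβ (params_right hab))⟩
  have e := lamFn_shift (K1 := K1) (K3 := K3) (K4 := K4) hα hβ .one n
  have e' : ((n - K1.card : ℤ) : ℝ) = n + idxShift K1 K3 K4 .one := by
    simp only [idxShift]; push_cast; ring
  rw [e', e, mem_ricSet_Trg_iff hα hβ hab hτ]
  exact h1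

theorem piRat_isQuasiPoly {i : ℤ} (hi : i ∈ indexG K1 K3 K4 .one) :
    IsQuasiPolyEigenfunction (Trg τ α β) (lamFn .one (i : ℝ) α β) (piRat K1 K3 K4 a b i) := by
  obtain ⟨n, hn, rfl⟩ := mem_indexG_one.1 hi
  exact isQuasiPolyEigenfunction_iff.2 ⟨piRat_ne_zero hab hn,
    piRat_mem_ricSet hab hα hβ hτ hn⟩

-- The chain multiplies the leading coefficient by the product of the degree differences, which is
-- exactly the normalizing denominator. Of the `p₁ + p₃ + p₄` degrees lost, the polynomial prefactor
-- gives back `p₃ + p₄`.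
omit hα hβ hτ in
theorem piRat_degree {i : ℤ} (hi : i ∈ indexG K1 K3 K4 .one) :
    (piRat K1 K3 K4 a b i).intDegree = i ∧ (piRat K1 K3 K4 a b i).num.leadingCoeff = 1 := by
  obtain ⟨n, hn, rfl⟩ := mem_indexG_one.1 hi
  obtain ⟨-, -, -, h, -⟩ := trans_spec _ (jacOp_classOp (params_left hab) (params_right hab))
    (isChain_seedList hab) (monicSeed_lam_ne (K1 := K1) hab hn) (monicSeed_isEigen hab n)
  obtain ⟨-, h2, h3⟩ := jacobiMonic_spec n (params_left hab) (params_sum hab)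
  have hv : ValInf 1 ((monicSeed n a b).y.f * RatFunc.X ^ (-(n : ℤ))) := by
    refine ⟨jacobiMonic n a b, X ^ n, pow_ne_zero _ X_ne_zero, by simp [h3], ?_, ?_⟩
    · rw [monicSeed_y, toRat_pow, toRat_X, zpow_neg, zpow_natCast, div_eq_mul_inv]
    · have : (jacobiMonic n a b).coeff n = 1 := by
        have := h2.coeff_natDegree
        rwa [h3] at this
      rw [natDegree_X_pow, this, leadingCoeff_X_pow, div_one]
  have h4 := h 1 n hv
  have hprod : ((seedList K1 K3 K4 a b).map fun s' => (monicSeed n a b).deg - s'.deg).prod =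
      ∏ k ∈ Ktilde K1 K3 K4 a b, ((n : ℝ) - k) := by
    rw [prod_Ktilde hab (fun k => (n : ℝ) - k), seedList, List.map_map]
    simp [Function.comp_def, monicSeed, seedOf, classSeed, degMu]
  rw [hprod, one_mul, length_seedList] at h4
  have P := isPlace_valInf
  have h5 := P.mul (P.mul (P.const (∏ k ∈ Ktilde K1 K3 K4 a b, ((n : ℝ) - k))⁻¹)
    (valInf_sub_add K3.card K4.card)) h4
  rw [mul_one, inv_mul_cancel₀ (prod_Ktilde_ne_zero hab hn)] at h5
  refine intDegree_of_valInf one_ne_zero ?_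
  convert! h5 using 1
  rw [piRat_eq, show -((n : ℤ) - K1.card) = -((K3.card : ℤ) + K4.card) +
    -((n : ℤ) - ((K1.card + K3.card + K4.card : ℕ) : ℤ)) by push_cast; ring,
    zpow_add₀ RatFunc.X_ne_zero]
  ring

/-- Eigenvalue and type determine the log-derivative, and the log-derivative determines the function
up to a constant. -/
theorem quasiPoly_classify {ρ : RatFunc ℝ} {lam : ℝ} (h : IsQuasiPolyEigenfunction (Trg τ α β) lam ρ) :
    ∃ i ∈ indexG K1 K3 K4 .one, ∃ c : ℝ, c ≠ 0 ∧ ρ = RatFunc.C c * piRat K1 K3 K4 a b i := by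
  have ha := not_isInt_left hα (params_left hab)
  have hb := not_isInt_right hβ (params_right hab)
  obtain ⟨h0, h1, h2⟩ := isQuasiPolyEigenfunction_iff.1 h
  obtain ⟨ι, i, hi, rfl, hA⟩ := (spectrum_Trg hab hα hβ hτ).classify h1
  obtain rfl := hasType_unique (hA.hasType ha hb) h2
  simp only [rawIdx_one hab] at hi
  have hi : i ∈ indexG K1 K3 K4 .one := hi
  obtain ⟨h0', h1', h2'⟩ := isQuasiPolyEigenfunction_iff.1 (piRat_isQuasiPoly hab hα hβ hτ hi)
  exact ⟨i, hi, eq_C_mul_of_logDeriv_eq h0 h0' ((spectrum_Trg hab hα hβ hτ).eq_of_types ha hb h1 h1' h2 h2')⟩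

theorem quasiPolyIndexSet_eq : quasiPolyIndexSet (Trg τ α β) = indexG K1 K3 K4 .one := by
  ext k
  constructor
  · rintro ⟨ρ, lam, hρ, rfl⟩
    obtain ⟨i, hi, c, hc, rfl⟩ := quasiPoly_classify hab hα hβ hτ hρ
    have h0 := (isQuasiPolyEigenfunction_iff.1 (piRat_isQuasiPoly hab hα hβ hτ hi)).1
    rw [RatFunc.intDegree_mul (C_ne_zero hc) h0, RatFunc.intDegree_C, zero_add,
      (piRat_degree hab hi).1]
    exact hi
  · intro hk
    exact ⟨_, _, piRat_isQuasiPoly hab hα hβ hτ hk, (piRat_degree hab hk).1⟩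

omit hα hβ hτ in
theorem rval_piRat (i : ℤ) {x : ℝ} (hx : x ∈ Ioo (-1 : ℝ) 1)
    (hw : wronskian (phiList K1 K3 K4 a b) x ≠ 0) :
    RegularAt (piRat K1 K3 K4 a b i) x ∧
      rval (piRat K1 K3 K4 a b i) x = piFun K1 K3 K4 a b i x := by
  have hN := seeds_nondeg (K1 := K1) hab
  have h0 := twr_ne_zero _ hN
  obtain ⟨r1, e1⟩ := wronskian_phiList (K1 := K1) (K3 := K3) (K4 := K4) (a := a) (b := b) hx
  obtain ⟨r2, e2⟩ := wronskian_phiList_append (K1 := K1) (K3 := K3) (K4 := K4) (a := a) (b := b)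
    (jacobiMonic (i + K1.card).toNat a b) hx
  have p1 : 0 < 1 - x := by linarith [hx.2]
  have p2 : 0 < 1 + x := by linarith [hx.1]
  rw [e1] at hw
  have hw2 := right_ne_zero_of_mul hw
  have hw1 := left_ne_zero_of_mul hw
  have P := isPlace_valAt x
  have hv := P.div r2.valAt r1.valAt hw2
  rw [twr_append _ _ hN, mul_div_cancel_left₀ _ h0] at hv
  have h := P.mul (P.mul (P.const (∏ k ∈ Ktilde K1 K3 K4 a b, ((i : ℝ) + K1.card - k))⁻¹)
    (P.mul (P.pow (P.sub (valAt_X x) P.one) K3.card) (P.pow (one_add_valAt x) K4.card))) hv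
  refine ⟨h.1, h.2.trans ?_⟩
  rw [piFun, e1, e2, mul_div_mul_left _ _ hw1, twr_append _ _ hN]
  ring

/-- By `twr_append` the product is the extended Wronskian times a constant and powers of `1 ± x`, so
poles are possible only at `±1`, where both factors are regular. -/
theorem tau_mul_piRat {i : ℤ} (hi : i ∈ indexG K1 K3 K4 .one) : ∃ P : ℝ[X], toRat P = toRat τ * piRat K1 K3 K4 a b i := by
  obtain ⟨-, -, -, r1, r2⟩ := piRat_isQuasiPoly hab hα hβ hτ hi
  have hN := seeds_nondeg (K1 := K1) hab
  have hm : toRat τ * piRat K1 K3 K4 a b i ∈ poleRing := by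
    rw [hτ, tauRat, piRat]
    set y : QF := ⟨0, toRat (jacobiMonic (i + K1.card).toNat a b)⟩
    have hy : twr ((seedList K1 K3 K4 a b).map Seed.y ++ [y]) ∈ poleRing := by
      refine twr_mem_poleRing fun z hz => ?_
      rcases List.mem_append.1 hz with hz | hz
      · obtain ⟨s, hs, rfl⟩ := List.mem_map.1 hz
        obtain ⟨z, -, rfl⟩ := List.mem_map.1 hs
        exact seed_mem_poleRing a b z
      · rw [List.mem_singleton.1 hz]
        exact ⟨zero_mem _, toRat_mem_poleRing _⟩
    rw [twr_append _ _ hN] at hy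
    have h3 : ((RatFunc.X - 1) ^ K3.card * (1 + RatFunc.X) ^ K4.card : RatFunc ℝ) ∈ poleRing :=
      mul_mem (pow_mem (sub_mem X_mem_poleRing (one_mem _)) _)
        (pow_mem (add_mem (one_mem _) X_mem_poleRing) _)
    have := mul_mem (mul_mem (one_sub_pow_mem_poleRing (K3.card * (K1.card + K4.card))
      (K4.card * (K1.card + K3.card))) (mul_mem (C_mem_poleRing
      (∏ k ∈ Ktilde K1 K3 K4 a b, ((i : ℝ) + K1.card - k))⁻¹) h3)) hy
    convert! this using 1
    ring
  obtain ⟨P, hP⟩ := exists_polynomial_of_mem_poleRing hm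
    ((isPlace_valAt 1).mul (valAt_toRat 1 τ) r1.valAt).1
    ((isPlace_valAt (-1)).mul (valAt_toRat (-1) τ) r2.valAt).1
  exact ⟨P, hP.symm⟩

/-- The polynomials `τ π_i` are eigenpolynomials in the natural gauge of degree `deg τ + i`, and `i`
runs over all sufficiently large integers. -/
theorem isExceptionalRG_tau (h1 : τ.eval 1 ≠ 0) (h2 : τ.eval (-1) ≠ 0) :
    IsExceptionalRG τ α β := by
  refine ⟨h1, h2, rfl, (finite_Iic (τ.natDegree + K1.sup id)).subset fun m hm => ?_⟩
  by_contra hlt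
  rw [mem_Iic, not_le] at hlt
  refine hm ?_
  have hτ0 : τ ≠ 0 := by rintro rfl; simp at h1
  have hi : (m : ℤ) - τ.natDegree ∈ indexG K1 K3 K4 .one := by
    -- `m` exceeds `deg τ + max K₁`, so this classical index is larger than every element of `K₁`.
    refine mem_indexG_one.2 ⟨m - τ.natDegree + K1.card, fun h => ?_, by push_cast; omega⟩
    have := Finset.le_sup (f := id) h
    simp only [id] at this
    omega
  obtain ⟨P, hP⟩ := tau_mul_piRat hab hα hβ hτ hi
  have hq := piRat_isQuasiPoly hab hα hβ hτ hi
  have h0 := (isQuasiPolyEigenfunction_iff.1 hq).1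
  have hP0 : P ≠ 0 := by
    rintro rfl
    exact mul_ne_zero (toRat_ne_zero hτ0) h0 (hP.symm.trans (map_zero _))
  refine ⟨P, lamFn .one (((m : ℤ) - τ.natDegree : ℤ) : ℝ) α β, hP0, ?_, ?_⟩
  · have h3 := congrArg RatFunc.intDegree hP
    rw [RatFunc.intDegree_mul (toRat_ne_zero hτ0) h0, (piRat_degree hab hi).1,
      RatFunc.intDegree_polynomial, RatFunc.intDegree_polynomial] at h3
    omega
  · change (Tng τ α β).app (toRat P) = _ * toRat P
    rw [hP, DiffOp.gauge_app _ (toRat_ne_zero hτ0)]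
    have := hq.1
    rw [Trg] at this
    rw [this]
    ring

end

/-! ### Norms of the quasi-polynomial eigenfunctions -/

theorem rpow_weight_succ {x : ℝ} (hx : x ∈ Ioo (-1 : ℝ) 1) (α β : ℝ) :
    (1 - x) ^ (α + 1) * (1 + x) ^ (β + 1) = -(x ^ 2 - 1) * ((1 - x) ^ α * (1 + x) ^ β) := by
  have p1 : 0 < 1 - x := by linarith [hx.2]
  have p2 : 0 < 1 + x := by linarith [hx.1]
  rw [Real.rpow_add_one p1.ne', Real.rpow_add_one p2.ne']
  ring

theorem x21_valAt (x : ℝ) : ValAt x (x ^ 2 - 1) x21 :=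
  (isPlace_valAt x).sub ((isPlace_valAt x).pow (valAt_X x) 2) (isPlace_valAt x).one

theorem hasDerivAt_mul_weight {x : ℝ} (hx : x ∈ Ioo (-1 : ℝ) 1) (α β : ℝ) {q : RatFunc ℝ}
    (hq : RegularAt q x) :
    HasDerivAt (fun y => rval q y * ((1 - y) ^ (α + 1) * (1 + y) ^ (β + 1)))
      (rval (-(x21 * (ratDeriv q + gam (α + 1) (β + 1) * q))) x *
        ((1 - x) ^ α * (1 + x) ^ β)) x := by
  have P := isPlace_valAt x
  have hg := gam_valAt (x := x) hx.2.ne hx.1.ne' (α + 1) (β + 1)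
  have hv := (P.neg (P.mul (x21_valAt x) (P.add hq.ratDeriv.valAt (P.mul hg hq.valAt)))).2
  convert! hq.hasDerivAt.mul (hasDerivAt_weight hx (α + 1) (β + 1)) using 1
  rw [hv, rpow_weight_succ hx]
  ring

/-- The two forms of the antiderivative differ by the factor `-(x²-1)` coming from the raised
weight. Regularity at `±1` costs nothing: for non-integer `α`, `β` the antiderivative in `Exact`
vanishes there. -/
theorem exists_antideriv_iff_exact {α β : ℝ} (hα : ¬ IsInt α) (hβ : ¬ IsInt β)
    {f g : RatFunc ℝ} (f1 : RegularAt f 1) (f2 : RegularAt f (-1)) (g1 : RegularAt g 1)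
    (g2 : RegularAt g (-1)) (c : ℝ) :
    (∃ q : RatFunc ℝ, RegularAt q 1 ∧ RegularAt q (-1) ∧
      ∀ x ∈ Ioo (-1 : ℝ) 1, RegularAt q x → RegularAt f x → RegularAt g x →
        HasDerivAt (fun y => rval q y * ((1 - y) ^ (α + 1) * (1 + y) ^ (β + 1)))
          ((rval f x * rval g x - c) * ((1 - x) ^ α * (1 + x) ^ β)) x) ↔
      Exact α β (f * g - RatFunc.C c) := by
  constructor
  · rintro ⟨q, -, -, h⟩
    have key : f * g - RatFunc.C c = -(x21 * (ratDeriv q + gam (α + 1) (β + 1) * q)) := by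
      refine sub_eq_zero.1 (eq_zero_of_infinite ?_)
      have hfin := ((finite_not_regularAt q).union (finite_not_regularAt f)).union
        (finite_not_regularAt g)
      refine ((Ioo_infinite (show (-1 : ℝ) < 1 by norm_num)).sdiff hfin).mono ?_
      rintro x ⟨hx, hr⟩
      simp only [mem_union, mem_ofPred_eq, not_or, not_not] at hr
      obtain ⟨⟨r1, r2⟩, r3⟩ := hr
      have P := isPlace_valAt x
      have e := (h x hx r1 r2 r3).unique (hasDerivAt_mul_weight hx α β r1)
      have p1 : 0 < 1 - x := by linarith [hx.2]
      have p2 : 0 < 1 + x := by linarith [hx.1]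
      have hw : (1 - x) ^ α * (1 + x) ^ β ≠ 0 :=
        (mul_pos (Real.rpow_pos_of_pos p1 _) (Real.rpow_pos_of_pos p2 _)).ne'
      have e := mul_right_cancel₀ hw e
      have v1 := P.sub (P.mul r2.valAt r3.valAt) (P.const c)
      have v2 := P.neg (P.mul (x21_valAt x) (P.add r1.ratDeriv.valAt
        (P.mul (gam_valAt (x := x) hx.2.ne hx.1.ne' (α + 1) (β + 1)) r1.valAt)))
      rw [v2.2] at e
      have v := P.sub v1 v2
      rwa [e, sub_self] at v
    have := ((exact_x21_mul_iff (a := α) (b := β) _).1 ⟨q, rfl⟩).C_mul (-1)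
    rwa [C_neg_one, neg_one_mul, ← key] at this
  · rintro ⟨q, hq⟩
    have reg : ∀ c' e : ℝ, ValAt c' e ((RatFunc.X - RatFunc.C c') * gam α β) → ¬ IsInt e →
        RegularAt f c' → RegularAt g c' → ∃ u, ValAt c' u (q / (RatFunc.X - RatFunc.C c')) :=
      fun c' e h1 h2 h3 h4 => antideriv_div_valAt h1 h2
        ((isPlace_valAt c').sub ((isPlace_valAt c').mul h3.valAt h4.valAt)
          ((isPlace_valAt c').const c)) hq
    obtain ⟨u, hu⟩ := reg 1 α (gam_valAt_one α β) hα f1 g1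
    obtain ⟨v, hv⟩ := reg (-1) β (gam_valAt_neg_one α β) hβ f2 g2
    have hx := x21_ne_zero
    have key : -(x21 * (ratDeriv (-q / x21) + gam (α + 1) (β + 1) * (-q / x21))) =
        f * g - RatFunc.C c := by
      rw [ratDeriv_div _ _ hx, ratDeriv_x21, gam_add, ← hq, ratDeriv_neg]
      field_simp
      ring
    refine ⟨-q / x21, ?_, ?_, fun x hx r1 r2 r3 => ?_⟩
    · have P := isPlace_valAt 1
      have := P.div (P.neg hu) (P.add (valAt_X 1) P.one) (by norm_num)
      convert! this.1 using 1
      rw [map_one, x21_eq_mul]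
      have := X_sub_one_ne_zero
      have := X_add_one_ne_zero
      field_simp
    · have P := isPlace_valAt (-1)
      have := P.div (P.neg hv) (P.sub (valAt_X (-1)) P.one) (by norm_num)
      convert! this.1 using 1
      rw [C_neg_one, sub_neg_eq_add, x21_eq_mul]
      have := X_sub_one_ne_zero
      have := X_add_one_ne_zero
      field_simp
    · have P := isPlace_valAt x
      have h := hasDerivAt_mul_weight hx α β r1
      rwa [key, (P.sub (P.mul r2.valAt r3.valAt) (P.const c)).2] at h

/-- Lagrange's identity: `(x²-1)(f g' - f' g)` is an antiderivative of `(λ' - λ) f g`. -/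
theorem exact_mul_of_eigen {T : DiffOp} {α β lam lam' : ℝ} {f g : RatFunc ℝ}
    (hp : T.p = x21) (hq : T.q = x21 * gam (α + 1) (β + 1)) (hf : T.app f = RatFunc.C lam * f)
    (hg : T.app g = RatFunc.C lam' * g) (hne : lam ≠ lam') : Exact α β (f * g) := by
  have h : Exact α β (RatFunc.C (lam' - lam) * (f * g)) := by
    refine ⟨x21 * (f * ratDeriv g - ratDeriv f * g), ?_⟩
    rw [DiffOp.app, hp, hq] at hf hg
    rw [gam_add] at hf hg
    rw [map_sub, ratDeriv_mul, ratDeriv_x21, ratDeriv_sub, ratDeriv_mul, ratDeriv_mul]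
    linear_combination f * hg - g * hf
  have := h.C_mul (lam' - lam)⁻¹
  rwa [← mul_assoc, ← map_mul, inv_mul_cancel₀ (sub_ne_zero.2 hne.symm), map_one, one_mul] at this

section

variable {K1 K3 K4 : Finset ℕ} {a b α β : ℝ} (hab : ClassG a b ∨ ParamsB K3 K4 a b)
  (hα : α = a + K1.card - K3.card + K4.card)
  (hβ : β = b + K1.card + K3.card - K4.card)
include hab hα hβ

/-- `trans_spec` multiplies the classical norm by the product of the differences `λ(k) - λ(n)`,
which is `±κ d²` with `d` the normalizing denominator of `π_i`; dividing by `d²` leaves `κ`. The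
powers of `x² - 1` are absorbed by the integer shift from `(a, b)` to `(α, β)` and the squared
prefactor, and the signs cancel. -/
theorem hasNorm_piRat {n : ℕ} (hn : n ∉ K1) :
    HasNorm α β (piRat K1 K3 K4 a b (n - K1.card) ^ 2) (kappa K1 K3 K4 a b n * nu n a b) := by
  have ha := params_left hab
  have hb := params_right hab
  have hs := params_sum hab
  obtain ⟨-, -, -, -, h⟩ := trans_spec _ (jacOp_classOp ha hb)
    (isChain_seedList hab) (monicSeed_lam_ne (K1 := K1) hab hn) (monicSeed_isEigen hab n)
  have h := h (by rw [monicSeed_y])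
  obtain ⟨h1, h2, h3⟩ := jacobiMonic_spec n ha hs
  have hN := ((h1.hasNorm n ha hb hs h2 h3).C_mul
    ((seedList K1 K3 K4 a b).map fun s' => s'.lam - (monicSeed n a b).lam).prod).add_exact h
  rw [monicSeed_y, add_sub_cancel] at hN
  set F := (trans ((seedList K1 K3 K4 a b).map Seed.y) (⟨0, toRat (jacobiMonic n a b)⟩ : QF)).f
    with hF
  set d := ∏ k ∈ Ktilde K1 K3 K4 a b, ((n : ℝ) - k) with hd
  have hd0 : d ≠ 0 := prod_Ktilde_ne_zero hab hn
  -- Each factor is `λ(k) - λ(n) = -(n - k)(n - k*)`, and `κ d²` is the product of the `(n - k)(n -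
  -- k*)`.
  have hprod : ((seedList K1 K3 K4 a b).map fun s' => s'.lam - (monicSeed n a b).lam).prod =
      (-1) ^ (K1.card + K3.card + K4.card) * (kappa K1 K3 K4 a b n * d ^ 2) := by
    have e1 : kappa K1 K3 K4 a b n * d ^ 2 =
        ∏ k ∈ Ktilde K1 K3 K4 a b, -(k * (k + a + b + 1) - n * (n + a + b + 1)) := by
      rw [kappa, hd, ← Finset.prod_pow, ← Finset.prod_mul_distrib]
      refine Finset.prod_congr rfl fun k hk => ?_
      have : (n : ℝ) - k ≠ 0 := Finset.prod_ne_zero_iff.1 hd0 k hk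
      field_simp
      ring
    rw [e1, prod_Ktilde hab (fun k => -(k * (k + a + b + 1) - n * (n + a + b + 1))),
      ← length_seedList a b, seedList, List.map_map, List.length_map,
      ← List.length_map (f := fun z : QRType × ℕ => -(((z.2 : ℝ) + degMu z.1 a b) *
        (z.2 + degMu z.1 a b + a + b + 1) - n * (n + a + b + 1))), ← List.prod_map_neg,
      List.map_map]
    refine congrArg List.prod (List.map_congr_left fun z _ => ?_)
    change lamFn z.1 z.2 a b - lamFn .one n a b = - -_
    rw [neg_neg, lamFn_eq_one z.1]
    rfl
  rw [hprod, length_seedList] at hN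
  have hN := hN.C_mul ((-1) ^ (K1.card + K3.card + K4.card) * (d⁻¹) ^ 2)
  have eα : α = a + ((K1.card - K3.card + K4.card : ℤ) : ℝ) := by rw [hα]; push_cast; ring
  have eβ : β = b + ((K1.card + K3.card - K4.card : ℤ) : ℝ) := by rw [hβ]; push_cast; ring
  rw [eα, eβ, hasNorm_one_sub_zpow ha (not_isInt_add_intCast hb _)
    (by rw [← add_assoc]; exact not_isInt_add_intCast hs _), hasNorm_one_add_zpow ha hb hs, piRat_eq,
    monicSeed_y, ← hd, ← hF]
  have hu := one_sub_X_ne_zero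
  have hv := one_add_X_ne_zero
  convert! hN using 1
  · have ex : x21 = -1 * ((1 - RatFunc.X) * (1 + RatFunc.X)) := by rw [x21]; ring
    have es : (RatFunc.X - 1 : RatFunc ℝ) = -1 * (1 - RatFunc.X) := by ring
    have hC : RatFunc.C ((-1 : ℝ) ^ (K1.card + K3.card + K4.card)) =
        (-1) ^ (K1.card + K3.card + K4.card) := by rw [map_pow, C_neg_one]
    have hsq : ((-1 : RatFunc ℝ) ^ (K1.card + K3.card + K4.card)) ^ 2 = 1 := by
      rw [← pow_mul, mul_comm, pow_mul, neg_one_sq, one_pow]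
    have hsq3 : ((-1 : RatFunc ℝ) ^ K3.card) ^ 2 = 1 := by
      rw [← pow_mul, mul_comm, pow_mul, neg_one_sq, one_pow]
    -- The exponent `p₁ + p₃ + p₄` exceeds the shift of the weight by `2p₃` at `1` (and by `2p₄` at
    -- `-1`); the surplus is the square of the prefactor of `π_i`.
    have z1 : (1 - RatFunc.X : RatFunc ℝ) ^ (K1.card + K3.card + K4.card) =
        (1 - RatFunc.X) ^ (K1.card - K3.card + K4.card : ℤ) * ((1 - RatFunc.X) ^ K3.card) ^ 2 := by
      rw [← zpow_natCast, ← zpow_natCast, ← zpow_natCast, ← zpow_mul, ← zpow_add₀ hu]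
      congr 1; push_cast; ring
    have z2 : (1 + RatFunc.X : RatFunc ℝ) ^ (K1.card + K3.card + K4.card) =
        (1 + RatFunc.X) ^ (K1.card + K3.card - K4.card : ℤ) * ((1 + RatFunc.X) ^ K4.card) ^ 2 := by
      rw [← zpow_natCast, ← zpow_natCast, ← zpow_natCast, ← zpow_mul, ← zpow_add₀ hv]
      congr 1; push_cast; ring
    rw [ex, es, mul_pow (-1 : RatFunc ℝ) _ K3.card, mul_pow (-1 : RatFunc ℝ), mul_pow (1 - RatFunc.X),
      z1, z2, map_mul, hC, map_pow]
    generalize (-1 : RatFunc ℝ) ^ K3.card = s at hsq3 ⊢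
    generalize (-1 : RatFunc ℝ) ^ (K1.card + K3.card + K4.card) = t at hsq ⊢
    generalize (1 - RatFunc.X : RatFunc ℝ) ^ (K1.card - K3.card + K4.card : ℤ) = u
    generalize (1 + RatFunc.X : RatFunc ℝ) ^ (K1.card + K3.card - K4.card : ℤ) = v
    linear_combination u * v * RatFunc.C d⁻¹ ^ 2 * ((1 - RatFunc.X) ^ K3.card) ^ 2 *
      ((1 + RatFunc.X) ^ K4.card) ^ 2 * F ^ 2 * (hsq3 - hsq)
  · have hsq : ((-1 : ℝ) ^ (K1.card + K3.card + K4.card)) ^ 2 = 1 := by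
      rw [← pow_mul, mul_comm, pow_mul, neg_one_sq, one_pow]
    field_simp
    linear_combination -(kappa K1 K3 K4 a b n * nu n a b) * hsq

/-- Off the diagonal exactness is automatic, because distinct indices have distinct eigenvalues. On
the diagonal the uniqueness of formal norms makes the stated value the only possible one. -/
theorem areFormalNorms_piRat_iff {τ : ℝ[X]} (hτ : toRat τ = tauRat K1 K3 K4 a b) (ν : ℤ → ℝ) :
    AreFormalNorms α β (indexG K1 K3 K4 .one) (piRat K1 K3 K4 a b) ν ↔
      ∀ i ∈ indexG K1 K3 K4 .one,
        ν i = kappa K1 K3 K4 a b ((i : ℝ) + K1.card) * nu ((i : ℝ) + K1.card) a b := by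
  have hα' := not_isInt_left hα (params_left hab)
  have hβ' := not_isInt_right hβ (params_right hab)
  have hs' := not_isInt_sum hα hβ (params_sum hab)
  have hE := fun {i : ℤ} (hi : i ∈ indexG K1 K3 K4 .one) => piRat_isQuasiPoly hab hα hβ hτ hi
  have hN : ∀ i ∈ indexG K1 K3 K4 .one, HasNorm α β
      (piRat K1 K3 K4 a b i * piRat K1 K3 K4 a b i)
      (kappa K1 K3 K4 a b ((i : ℝ) + K1.card) * nu ((i : ℝ) + K1.card) a b) := by
    intro i hi
    obtain ⟨n, hn, rfl⟩ := mem_indexG_one.1 hi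
    have := hasNorm_piRat hab hα hβ hn
    rw [← sq]
    push_cast
    rwa [sub_add_cancel]
  have hiff : ∀ i ∈ indexG K1 K3 K4 .one, ∀ j ∈ indexG K1 K3 K4 .one, ∀ c : ℝ, _ :=
    fun i hi j hj c => exists_antideriv_iff_exact hα' hβ' (hE hi).2.2.2.1 (hE hi).2.2.2.2
      (hE hj).2.2.2.1 (hE hj).2.2.2.2 c
  constructor
  · intro h i hi
    have := (hiff i hi i hi _).1 (h i hi i hi)
    rw [if_pos rfl] at this
    exact hasNorm_unique hα' hβ' hs' this (hN i hi)
  · intro h i hi j hj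
    refine (hiff i hi j hj _).2 ?_
    split_ifs with hij
    · subst hij
      rw [h i hi]
      exact hN i hi
    · rw [zero_div, map_zero, sub_zero]
      exact exact_mul_of_eigen rfl (Trg_q τ α β) (hE hi).1 (hE hj).1
        fun he => hij ((lamFn_one_one hs' i j).1 he)

end

end ExJacobi

end

theorem mainTheorem9 (K1 K3 K4 : Finset ℕ) (a b α β : ℝ)
    (hα : α = a + K1.card - K3.card + K4.card)
    (hβ : β = b + K1.card + K3.card - K4.card)
    (hab : ClassG a b ∨ ParamsB K3 K4 a b) :
    ∃ τ : ℝ[X],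
      -- `τ` is a polynomial of the stated degree
      (∀ x ∈ Ioo (-1 : ℝ) 1, τ.eval x = tauFun K1 K3 K4 a b x) ∧
      (τ.natDegree : ℤ) = (∑ k ∈ K1, (k : ℤ)) + (∑ k ∈ K3, (k : ℤ)) + (∑ k ∈ K4, (k : ℤ))
        - (K1.card.choose 2 : ℤ) - (K3.card.choose 2 : ℤ) - (K4.card.choose 2 : ℤ)
        + (K3.card : ℤ) * K4.card ∧
      -- the operator is exceptional
      IsExceptionalRG τ α β ∧
      qrSpectrum (Trg τ α β) = sigmaQ α β ∧
      -- class, spectral diagram and index sets for class G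
      (ClassG a b →
        ClassG α β ∧
        (Pairwise fun ι κ : QRType => Disjoint (lamImage ι (indexG K1 K3 K4 ι) α β)
          (lamImage κ (indexG K1 K3 K4 κ) α β)) ∧
        sigmaQ α β = (⋃ ι : QRType, lamImage ι (indexG K1 K3 K4 ι) α β) ∧
        spectralDiagram (Trg τ α β) = diagramG K1 K3 K4 α β ∧
        (∀ ι : QRType, indexSet ι τ α β = (fun k : ℤ => (k : ℝ)) '' indexG K1 K3 K4 ι)) ∧
      -- class, spectral diagram and index sets for class B
      (ParamsB K3 K4 a b →
        ClassB α β ∧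
        lamImage .three (indexB3plus K3 K4 a b) α β =
          lamImage .four (indexB4plus K3 K4 a b) α β ∧
        List.Pairwise Disjoint
          [lamImage .one (indexB K1 K3 K4 a b .one) α β,
            lamImage .two (indexB K1 K3 K4 a b .two) α β,
            lamImage .three (indexB3minus K3 K4 a b) α β,
            lamImage .four (indexB4minus K3 K4 a b) α β,
            lamImage .three (indexB3plus K3 K4 a b) α β] ∧
        sigmaQ α β = lamImage .one (indexB K1 K3 K4 a b .one) α β ∪
          lamImage .two (indexB K1 K3 K4 a b .two) α β ∪
          lamImage .three (indexB3minus K3 K4 a b) α β ∪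
          lamImage .four (indexB4minus K3 K4 a b) α β ∪
          lamImage .three (indexB3plus K3 K4 a b) α β ∧
        spectralDiagram (Trg τ α β) = diagramB K1 K3 K4 a b α β ∧
        Disjoint (indexB3minus K3 K4 a b) (indexB3plus K3 K4 a b) ∧
        Disjoint (indexB4minus K3 K4 a b) (indexB4plus K3 K4 a b) ∧
        (∀ ι : QRType, indexSet ι τ α β = (fun k : ℤ => (k : ℝ)) '' indexB K1 K3 K4 a b ι)) ∧
      -- `I₁` (the same for both classes) is the set of degrees of the quasi-polynomials
      quasiPolyIndexSet (Trg τ α β) = indexG K1 K3 K4 .one ∧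
      -- the monic quasi-polynomial eigenfunctions and their norms
      ∃ π : ℤ → RatFunc ℝ,
        (∀ i ∈ indexG K1 K3 K4 .one,
          (∀ x ∈ Ioo (-1 : ℝ) 1, wronskian (phiList K1 K3 K4 a b) x ≠ 0 →
            RegularAt (π i) x ∧ rval (π i) x = piFun K1 K3 K4 a b i x) ∧
          IsQuasiPolyEigenfunction (Trg τ α β) (lamFn .one (i : ℝ) α β) (π i) ∧
          (π i).intDegree = i ∧ (π i).num.leadingCoeff = 1) ∧
        (∀ (ρ : RatFunc ℝ) (lam : ℝ), IsQuasiPolyEigenfunction (Trg τ α β) lam ρ →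
          ∃ i ∈ indexG K1 K3 K4 .one, ∃ c : ℝ, c ≠ 0 ∧ ρ = RatFunc.C c * π i) ∧
        (∀ ν : ℤ → ℝ, AreFormalNorms α β (indexG K1 K3 K4 .one) π ν ↔
          ∀ i ∈ indexG K1 K3 K4 .one,
            ν i = kappa K1 K3 K4 a b ((i : ℝ) + K1.card) *
              nu ((i : ℝ) + K1.card) a b) := by
  obtain ⟨τ, hτ, h1, h2, hdeg⟩ := exists_tau hab
  have ha := not_isInt_left hα (params_left hab)
  have hb := not_isInt_right hβ (params_right hab)
  have hS := spectrum_Trg hab hα hβ hτ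
  refine ⟨τ, fun x hx => eval_tau hτ hx, hdeg, isExceptionalRG_tau hab hα hβ hτ h1 h2, ?_, ?_, ?_,
    quasiPolyIndexSet_eq hab hα hβ hτ, piRat K1 K3 K4 a b, fun i hi =>
      ⟨fun x hx hw => rval_piRat hab i hx hw, piRat_isQuasiPoly hab hα hβ hτ hi,
        piRat_degree hab hi⟩,
    fun ρ lam hρ => quasiPoly_classify hab hα hβ hτ hρ,
    areFormalNorms_piRat_iff hab hα hβ hτ⟩
  · rw [hS.qrSpectrum_eq]
    rcases hab with hG | hB
    · rw [sigmaQ_classG hα hβ hG, ← shift_rawIdx_classG hG]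
    · rw [← iUnion_classB hα hβ hB, ← shift_rawIdx_classB hB]
  · intro hG
    rw [shift_rawIdx_classG hG] at hS
    exact ⟨classG_shift hα hβ hG, pairwise_disjoint_classG hα hβ hG, sigmaQ_classG hα hβ hG,
      spectralDiagram_classG hα hβ hG hS, hS.indexSet_eq ha hb rfl⟩
  · intro hB
    rw [shift_rawIdx_classB hB] at hS
    exact ⟨classB_shift hα hβ hB, lamImage_plus_shift hα hβ hB, pairwise_disjoint_classB hα hβ hB,
      sigmaQ_classB hα hβ hB, spectralDiagram_classB hα hβ hB hS, disjoint_indexB3 hB,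
      disjoint_indexB4 hB, hS.indexSet_eq ha hb rfl⟩
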